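/- **Setting.** Let $T\in\{1,2,\dots\}$, $\mathbb T=\{0,\dots,T\}$, $\mathbb T_t=\{t,\dots,T\}$, and let $(\Omega,\mathcal F,(\mathcal F_t)_{t\in\mathbb T},\mathbb P)$ be a filtered probability space with $\mathcal F=\mathcal F_T$ and $\mathcal F_0$ complete and trivial (it consists exactly of the sets of probability $0$ or $1$). Write $L^p_t(\mathbb R^d)=L^p(\Omega,\mathcal F_t,\mathbb P;\mathbb R^d)$, $\mathbb E_t=\mathbb E[\,\cdot\,|\mathcal F_t]$; all (in)equalities are a.s. and componentwise. Let $1\le m\le d$, $M=\mathbb R^m\times\{0\}^{d-m}$, $M_t=L^\infty_t(M)$, $M_{t,+}=\{u\in M_t: u\ge0\}$, $M_{t,+}^*=\{w\in L^1_t(\mathbb R^d):\mathbb E[w^\top u]\ge0\ \forall u\in M_{t,+}\}$, $M_t^\perp=\{w\in L_t^1(\mathbb R^d):\mathbb E[w^\top u]=0\ \forall u\in M_t\}$, $\Gamma_t(w)=\{u\in L_t^\infty(\mathbb R^d): w^\top u\ge0\}$. $L_t^\infty(\mathbb R^d)$ carries the topology $\sigma(L_t^\infty,L_t^1)$ and $M_t$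 the subspace topology; $\mathcal G(M_t;M_{t,+})=\{D\subseteq M_t: D=\mathrm{cl\,co}(D+M_{t,+})\}$, and $A-^{\bullet}B=\{u\in M_t: B+\{u\}\subseteq A\}$. $\mathcal R^{\infty,d}_t$ is the space of bounded adapted $\mathbb R^d$-valued processes that vanish before $t$, with the topology $\sigma(\mathcal R^{\infty,d}_t,\mathcal A^{1,d}_t)$ given by the pairing $\mathbb E[\sum_{s\ge t}\Delta a_s^\top X_s]$ with the adapted processes $a$ of integrable variation that vanish before $t$. For a probability measure $\mathbb Q\ll\mathbb P$ put $\xi_{t,s}(\mathbb Q)=\mathbb E_s[\frac{d\mathbb Q}{d\mathbb P}]/\mathbb E_t[\frac{d\mathbb Q}{d\mathbb P}]$ where the denominator is positive and $1$ elsewhere, $\mathbb E_t^{\mathbb Q}[X]=\mathbb E_t[\xi_{t,T}(\mathbb Q)X]$ (componentwise for vectors of measures), and $w_t^s(\mathbb Q,w)=\operatorname{diag}(w)\xi_{t,s}(\mathbb Q)$. $\mathcal M(\mathbb P)$ is the set of probability measures $\mathbb Q\ll\mathbb P$, and $\mathcal M_t(\mathbb P)$ the subset of those equal to $\mathbb P$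 on $\mathcal F_t$. *Optional filtration.* Let $\bar\Omega=\Omega\times\mathbb T$, $\bar{\mathcal F}=\sigma(A_s\times\{s\}: A_s\in\mathcal F_s)$, $\bar{\mathcal F}_t=\sigma(D_r\times\{r\},\,D_t\times\mathbb T_t: r<t,\ D_r\in\mathcal F_r,\ D_t\in\mathcal F_t)$, and $\bar{\mathbb P}=\mathbb P\otimes\mu$, where $\mu$ is adapted, $\sum_s\mu_s=1$ and $\min_s\mu_s>\varepsilon$ a.s. for some $\varepsilon>0$; here $\mathbb Q\otimes\psi$ is the measure on $\bar{\mathcal F}$ under which $X$ has the expectation $\mathbb E^{\mathbb Q}[\sum_s\psi_sX_s]$. Objects with a bar are the same objects for $(\bar\Omega,\bar{\mathcal F},(\bar{\mathcal F}_t),\bar{\mathbb P})$. $\Psi(\mathbb P)$ is the set of adapted $\psi\ge0$ with $\sum_s\psi_s=1$ a.s. For sets, $\sum_{s<t}D_s1_{\{s\}}+D'1_{\mathbb T_t}$ is formed elementwise, and $D_s=\{u_s:u\in D\}$. *Risk measures.* A conditional risk measure for processes is a map $\rho_t$ from $\mathcal R_t^{\infty,d}$ to the sets $D\subseteq M_t$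 with $D=D+M_{t,+}$, such that $\rho_t(X+u1_{\mathbb T_t})=\rho_t(X)-u$ for $u\in M_t$; $X\le Y$ implies $\rho_t(X)\subseteq\rho_t(Y)$; and $\rho_t(0)$ is nonempty, closed, $\mathcal F_t$-decomposable and the set of bounded $\mathcal F_t$-measurable selectors of an $\mathcal F_t$-measurable random closed subset of $M$ that is a.s. different from $M$. It is conditionally convex if $\rho_t(\lambda X+(1-\lambda)Y)\supseteq\lambda\rho_t(X)+(1-\lambda)\rho_t(Y)$ for all $\mathcal F_t$-measurable $\lambda$ with values in $[0,1]$, and closed if its graph in $\mathcal R_t^{\infty,d}\times M_t$ is closed. Risk measures for vectors $\bar R_t$ on $\bar L^\infty(\mathbb R^d)$ (values in $\bar M_t$) and $R_s$ on $L_s^\infty(\mathbb R^d)$ (values in $M_s$) are defined in the same way, with cash invariance $R(X+u)=R(X)-u$. The acceptance sets are $A_t=\{X:0\in\rho_t(X)\}$, $\bar A_t=\{X:0\in\bar R_t(X)\}$, $A_{R_s}=\{Z:0\in R_s(Z)\}$. *Dual variables, penalties, dual representations.* - $\bar{\mathcal W}_t=\{(\bar{\mathbb Q},\bar w)\in\bar{\mathcal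 M}_t(\bar{\mathbb P})^d\times(\bar M_{t,+}^*\setminus\bar M_t^\perp):\bar w_t^T(\bar{\mathbb Q},\bar w)\in\bar L^1(\mathbb R^d_+)\}$, $\ \bar\alpha_t(\bar{\mathbb Q},\bar w)=\bigcap_{Y\in\bar A_t}(\bar{\mathbb E}_t^{\bar{\mathbb Q}}[-Y]+\bar\Gamma_t(\bar w))\cap\bar M_t$. $\bar R_t$ has its dual representation if for all $X\in\bar L^\infty(\mathbb R^d)$ $$\bar R_t(X)=\bigcap_{(\bar{\mathbb Q},\bar w)\in\bar{\mathcal W}_t}\big((\bar{\mathbb E}_t^{\bar{\mathbb Q}}[-X]+\bar\Gamma_t(\bar w))\cap\bar M_t\big)-^{\bullet}\bar\alpha_t(\bar{\mathbb Q},\bar w).$$ - $\alpha_{R_s}(w)=\bigcap_{Z\in A_{R_s}}(-Z+\Gamma_s(w))\cap M_s$. $R_s$ has its dual representation if $R_s(X)=\bigcap_{w}\big((-X+\Gamma_s(w))\cap M_s\big)-^{\bullet}\alpha_{R_s}(w)$ for all $X\in L^\infty_s(\mathbb R^d)$, the intersection being over $w\in L^1_s(\mathbb R^d_+)\setminus M_s^\perp$.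 - $\mathcal W^0_t$ is the set of $(\mathbb Q,w)=(\mathbb Q_s,w_s)_{s\in\mathbb T_t}$ with $\mathbb Q_s\in\mathcal M_t(\mathbb P)^d$, $w_s\in M_{t,+}^*$ and $w_t^s(\mathbb Q_s,w_s)\in L^1_s(\mathbb R^d_+)$ for all $s\in\mathbb T_t$; $\mathcal W_t$ is the set of those with $\sum_{s\in\mathbb T_t}w_s\notin M_t^\perp$. Put $H_t(\mathbb Q,w;X)=\{u\in M_t:\sum_{s\in\mathbb T_t}w_s^\top u\ge\sum_{s\in\mathbb T_t}w_s^\top\mathbb E_t^{\mathbb Q_s}[-X_s]\}$ and $\alpha_t(\mathbb Q,w)=\bigcap_{Y\in A_t}H_t(\mathbb Q,w;Y)$. $\rho_t$ has its dual representation if $\rho_t(X)=\bigcap_{(\mathbb Q,w)\in\mathcal W_t}H_t(\mathbb Q,w;X)-^{\bullet}\alpha_t(\mathbb Q,w)$ for all $X\in\mathcal R_t^{\infty,d}$. **Lemma.** Fix $t\in\mathbb T$. 1. Let $\rho_t:\mathcal R_t^{\infty,d}\to\mathcal G(M_t;M_{t,+})$ and $R_s:L_s^\infty(\mathbb R^d)\to\mathcal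 G(M_s;M_{s,+})$, $s<t$, be closed conditionally convex risk measures. Then $\bar R_t(X)=\sum_{s<t}R_s(X_s)1_{\{s\}}+\rho_t(X1_{\mathbb T_t})1_{\mathbb T_t}$ is a closed conditionally convex risk measure $\bar L^\infty(\mathbb R^d)\to\mathcal G(\bar M_t;\bar M_{t,+})$, and it has its dual representation. Every $(\bar{\mathbb Q},\bar w)\in\bar{\mathcal W}_t$ has a decomposition $\bar{\mathbb Q}_i=\mathbb Q_i\otimes\psi_i$ with $\mathbb Q_i\in\mathcal M(\mathbb P)$ and $\psi_i\in\Psi(\mathbb P)$, $i=1,\dots,d$, and for every such decomposition $$\bar\alpha_t(\bar{\mathbb Q},\bar w)=\sum_{s<t}\alpha_{R_s}(\bar w_s)1_{\{s\}}+\alpha_t(W_t(\mathbb Q\otimes\psi,\bar w))1_{\mathbb T_t},$$ where $W_t(\mathbb Q\otimes\psi,\bar w)=(\hat{\mathbb Q},w)\in\mathcal W_t^0$ is given, for $s\in\mathbb T_t$, by $$\frac{d\hat{\mathbb Q}_{s,i}}{d\mathbb P}=\frac{\psi_{s,i}}{\mathbb E_t^{\mathbb Q_i}[\psi_{s,i}]}\xi_{t,s}(\mathbb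 Q_i)1_{\{\mathbb E_t^{\mathbb Q_i}[\psi_{s,i}]>0\}}+\frac{\mu_s}{\mathbb E_t[\mu_s]}1_{\{\mathbb E_t^{\mathbb Q_i}[\psi_{s,i}]=0\}},\qquad w_{s,i}=\frac{\mathbb E_t^{\mathbb Q_i}[\psi_{s,i}]}{1-\sum_{r<t}\mu_r}\bar w_{t,i},$$ and $W_t(\mathbb Q\otimes\psi,\bar w)\in\mathcal W_t$ whenever $\bar w_t\notin M_t^\perp$. 2. Let $\bar R_t:\bar L^\infty(\mathbb R^d)\to\mathcal G(\bar M_t;\bar M_{t,+})$ be a closed conditionally convex risk measure. Then $\rho_t(X)=\bar R_t(X1_{\mathbb T_t})_t$ and $R_s(Z)=\bar R_t(Z1_{\{s\}})_s$, $s<t$, are closed conditionally convex risk measures with values in $\mathcal G(M_t;M_{t,+})$ and $\mathcal G(M_s;M_{s,+})$; they have their dual representations; $$\alpha_{R_s}(w_s)=\bar\alpha_t(\bar{\mathbb P},w_s1_{\{s\}})_s\quad\text{with }(\bar{\mathbb P},w_s1_{\{s\}})\in\bar{\mathcal W}_t,\qquad w_s\in L^1_s(\mathbb R^d_+)\setminus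 M_s^\perp,\ s<t;$$ $$\alpha_t(\mathbb Q,w)=\bar\alpha_t(\bar W_t(\mathbb Q,w))_t,\qquad(\mathbb Q,w)\in\mathcal W_t,$$ where $\bar W_t(\mathbb Q,w)=(\bar{\mathbb Q},\bar w)\in\bar{\mathcal W}_t$ is given by $\bar w=\sum_{s\in\mathbb T_t}\operatorname{diag}(1_{\{w_s>0\}})w_s1_{\mathbb T_t}$, $\ (d\bar{\mathbb Q}_i/d\bar{\mathbb P})_s=1$ for $s<t$, and for $s\in\mathbb T_t$ $$\Big(\frac{d\bar{\mathbb Q}_i}{d\bar{\mathbb P}}\Big)_s=\frac{1-\sum_{r<t}\mu_r}{\mu_s}\Big(\frac{w_{s,i}}{\bar w_{t,i}}1_{\{\bar w_{t,i}>0\}}+\frac{1}{T-t+1}1_{\{\bar w_{t,i}=0\}}\Big)\xi_{t,s}(\mathbb Q_{s,i}).$$ -/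

import Mathlib

open MeasureTheory Set
open scoped Pointwise ENNReal

namespace SetRisk

/-! Random vectors are represented by functions; all (in)equalities between them are almost sure.
Risk measures are monotone for the a.s. order and their values are upper sets for the a.s. order,
so they do not distinguish functions which agree almost surely.
The first part is generic: `P` is a probability measure on a space `S`, `mt` is the
sigma-algebra of the information at the time of evaluation. It is used both on the original
space and on the optional one. -/

section Generic

variable {S : Type*} {d : ℕ}

/-- The space `L^∞(S, mt, P; ℝ^d)`. -/
def LInf (mt : MeasurableSpace S) {mS : MeasurableSpace S} (P : Measure S) : Set (S → Fin d → ℝ) :=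
  {X | Measurable[mt] X ∧ MemLp X ∞ P}

/-- The space `L^1(S, mt, P; ℝ^d)`. -/
def LOne (mt : MeasurableSpace S) {mS : MeasurableSpace S} (P : Measure S) : Set (S → Fin d → ℝ) :=
  {X | Measurable[mt] X ∧ Integrable X P}

/-- The a.s. componentwise nonnegative elements of `L^1(S, mt, P; ℝ^d)`. -/
def LOnePos (mt : MeasurableSpace S) {mS : MeasurableSpace S} (P : Measure S) :
    Set (S → Fin d → ℝ) :=
  {X | X ∈ LOne mt P ∧ ∀ᵐ ω ∂P, ∀ i, 0 ≤ X ω i}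

/-- The subspace `M = ℝ^m × {0}^(d-m)` of eligible assets. -/
def eligible (m d : ℕ) : Set (Fin d → ℝ) := {x | ∀ i : Fin d, m ≤ (i : ℕ) → x i = 0}

/-- The eligible portfolios `M_t`. -/
def Elig (mt : MeasurableSpace S) {mS : MeasurableSpace S} (P : Measure S) (m : ℕ) :
    Set (S → Fin d → ℝ) :=
  {u | u ∈ LInf mt P ∧ ∀ᵐ ω ∂P, u ω ∈ eligible m d}

/-- The nonnegative eligible portfolios `M_{t,+}`. -/
def EligPos (mt : MeasurableSpace S) {mS : MeasurableSpace S} (P : Measure S) (m : ℕ) :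
    Set (S → Fin d → ℝ) :=
  {u | u ∈ Elig mt P m ∧ ∀ᵐ ω ∂P, ∀ i, 0 ≤ u ω i}

/-- The positive dual cone `M_{t,+}^*`. -/
def EligPosDual (mt : MeasurableSpace S) {mS : MeasurableSpace S} (P : Measure S) (m : ℕ) :
    Set (S → Fin d → ℝ) :=
  {w | w ∈ LOne mt P ∧ ∀ u ∈ EligPos mt P m, 0 ≤ ∫ ω, w ω ⬝ᵥ u ω ∂P}

/-- The annihilator `M_t^⊥`. -/
def EligPerp (mt : MeasurableSpace S) {mS : MeasurableSpace S} (P : Measure S) (m : ℕ) :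
    Set (S → Fin d → ℝ) :=
  {w | w ∈ LOne mt P ∧ ∀ u ∈ Elig mt P m, ∫ ω, w ω ⬝ᵥ u ω ∂P = 0}

/-- The topology on a set `C` of `mt`-measurable bounded random vectors which is induced by the
weak* topology `σ(L_t^∞, L_t^1)`. -/
@[reducible] noncomputable def weakTop (mt : MeasurableSpace S) {mS : MeasurableSpace S}
    (P : Measure S) (C : Set (S → Fin d → ℝ)) :
    TopologicalSpace C :=
  ⨅ Z : (LOne mt P : Set (S → Fin d → ℝ)),
    TopologicalSpace.induced (fun X : C => ∫ ω, Z.1 ω ⬝ᵥ X.1 ω ∂P) inferInstance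

/-- Closure of `D ⊆ M_t` relative to `M_t`. -/
def clElig (mt : MeasurableSpace S) {mS : MeasurableSpace S} (P : Measure S)
    (m : ℕ) (D : Set (S → Fin d → ℝ)) :
    Set (S → Fin d → ℝ) :=
  Subtype.val '' (@closure _ (weakTop mt P (Elig mt P m))
    (Subtype.val ⁻¹' D : Set (Elig mt P m : Set (S → Fin d → ℝ))))

/-- The upper sets `U(M_t; M_{t,+})`. -/
def UpperSets (mt : MeasurableSpace S) {mS : MeasurableSpace S} (P : Measure S) (m : ℕ) :
    Set (Set (S → Fin d → ℝ)) :=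
  {D | D ⊆ Elig mt P m ∧ D = D + EligPos mt P m}

/-- The closed convex upper sets `G(M_t; M_{t,+})`. -/
def ClosedConvexUpperSets (mt : MeasurableSpace S) {mS : MeasurableSpace S} (P : Measure S)
    (m : ℕ) :
    Set (Set (S → Fin d → ℝ)) :=
  {D | D ⊆ Elig mt P m ∧ D = clElig mt P m (convexHull ℝ (D + EligPos mt P m))}

/-- The properties of the value at zero of a risk measure: it is nonempty, closed, decomposable,
and it is the set of bounded selectors of a measurable random closed subset of `M`
(with graph `G`) which a.s. differs from `M`. -/
def FiniteAtZero (mt : MeasurableSpace S) {mS : MeasurableSpace S} (P : Measure S) (m : ℕ)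
    (D : Set (S → Fin d → ℝ)) : Prop :=
  D.Nonempty ∧ D = clElig mt P m D ∧
  (∀ u ∈ D, ∀ v ∈ D, ∀ A : Set S, MeasurableSet[mt] A →
    A.indicator u + Aᶜ.indicator v ∈ D) ∧
  ∃ G : Set (S × (Fin d → ℝ)), MeasurableSet[mt.prod MeasurableSpace.pi] G ∧
    D = {u | u ∈ LInf mt P ∧ ∀ᵐ ω ∂P, (ω, u ω) ∈ G} ∧
    ∀ᵐ ω ∂P, IsClosed {x | (ω, x) ∈ G} ∧ {x | (ω, x) ∈ G} ⊆ eligible m d ∧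
      {x | (ω, x) ∈ G} ≠ eligible m d

/-- Set-valued conditional risk measures for vectors, for claims in `L^∞(S, mX, P; ℝ^d)`. -/
structure IsVectorRM (mX mt : MeasurableSpace S) {mS : MeasurableSpace S} (P : Measure S) (m : ℕ)
    (R : (S → Fin d → ℝ) → Set (S → Fin d → ℝ)) : Prop where
  upper : ∀ X ∈ LInf mX P, R X ∈ UpperSets mt P m
  cash : ∀ X ∈ LInf mX P, ∀ c ∈ Elig mt P m, R (X + c) = (fun u => u - c) '' R X
  mono : ∀ X ∈ LInf mX P, ∀ Y ∈ LInf mX P, (∀ᵐ ω ∂P, X ω ≤ Y ω) → R X ⊆ R Y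
  zero : FiniteAtZero mt P m (R 0)

/-- Closed conditionally convex risk measures for vectors with values in `G(M_t; M_{t,+})`. -/
structure IsClosedConvexVectorRM (mX mt : MeasurableSpace S) {mS : MeasurableSpace S} (P : Measure S) (m : ℕ)
    (R : (S → Fin d → ℝ) → Set (S → Fin d → ℝ)) : Prop extends IsVectorRM mX mt P m R where
  values : ∀ X ∈ LInf mX P, R X ∈ ClosedConvexUpperSets mt P m
  convex : ∀ X ∈ LInf mX P, ∀ Y ∈ LInf mX P, ∀ l : S → ℝ, Measurable[mt] l →
    (∀ᵐ ω ∂P, 0 ≤ l ω ∧ l ω ≤ 1) → ∀ u ∈ R X, ∀ v ∈ R Y,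
    (fun ω => l ω • u ω + (1 - l ω) • v ω) ∈ R (fun ω => l ω • X ω + (1 - l ω) • Y ω)
  closed : @IsClosed _ (@instTopologicalSpaceProd _ _ (weakTop mX P (LInf mX P))
      (weakTop mt P (Elig mt P m)))
    {p : ↥(LInf (d := d) mX P) × ↥(Elig (d := d) mt P m) | p.2.1 ∈ R p.1.1}

/-- The acceptance set of a risk measure for vectors. -/
def accVec (mX : MeasurableSpace S) {mS : MeasurableSpace S} (P : Measure S)
    (R : (S → Fin d → ℝ) → Set (S → Fin d → ℝ)) : Set (S → Fin d → ℝ) :=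
  {X | X ∈ LInf mX P ∧ 0 ∈ R X}

/-- Probability measures which are absolutely continuous with respect to `P`. -/
def ProbAC {mS : MeasurableSpace S} (P : Measure S) :
    Set (Measure S) := {Q | IsProbabilityMeasure Q ∧ Q ≪ P}

/-- Those which agree with `P` on `mt`. -/
def ProbACAt (mt : MeasurableSpace S) {mS : MeasurableSpace S} (P : Measure S) : Set (Measure S) :=
  {Q | Q ∈ ProbAC P ∧ ∀ A, MeasurableSet[mt] A → Q A = P A}

open Classical in
/-- The conditional density `ξ_{t,s}(Q) = E_s[dQ/dP] / E_t[dQ/dP]`, and `1` where the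
denominator vanishes. -/
noncomputable def xi (mt ms : MeasurableSpace S) {mS : MeasurableSpace S} (P : Measure S)
    (Q : Measure S) (ω : S) : ℝ :=
  if 0 < condExp mt P (fun η => (Q.rnDeriv P η).toReal) ω then
    condExp ms P (fun η => (Q.rnDeriv P η).toReal) ω /
      condExp mt P (fun η => (Q.rnDeriv P η).toReal) ω
  else 1

/-- The `P`-a.s. version `E_t^Q[X] = E_t[ξ_{t,T}(Q) X]` of the conditional expectation of a
random variable; `mS` is the sigma-algebra at the terminal time. -/
noncomputable def condQ (mt : MeasurableSpace S) {mS : MeasurableSpace S} (P : Measure S)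
    (Q : Measure S) (X : S → ℝ) :
    S → ℝ :=
  condExp mt P (fun ω => xi mt mS P Q ω * X ω)

/-- Its componentwise version for random vectors and vectors of probability measures. -/
noncomputable def condQVec (mt : MeasurableSpace S) {mS : MeasurableSpace S} (P : Measure S)
    (Q : Fin d → Measure S)
    (X : S → Fin d → ℝ) : S → Fin d → ℝ :=
  fun ω i => condQ mt P (Q i) (fun η => X η i) ω

/-- `w_t^s(Q, w) = diag(w) ξ_{t,s}(Q)`. -/
noncomputable def wts (mt ms : MeasurableSpace S) {mS : MeasurableSpace S} (P : Measure S)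
    (Q : Fin d → Measure S)
    (w : S → Fin d → ℝ) : S → Fin d → ℝ :=
  fun ω i => w ω i * xi mt ms P (Q i) ω

/-- `Γ_t(w)`. -/
def Gam (mt : MeasurableSpace S) {mS : MeasurableSpace S} (P : Measure S) (w : S → Fin d → ℝ) :
    Set (S → Fin d → ℝ) :=
  {u | u ∈ LInf mt P ∧ ∀ᵐ ω ∂P, 0 ≤ w ω ⬝ᵥ u ω}

/-- `(c + Γ_t(w)) ∩ M_t`. -/
def halfSp (mt : MeasurableSpace S) {mS : MeasurableSpace S} (P : Measure S)
    (m : ℕ) (w c : S → Fin d → ℝ) :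
    Set (S → Fin d → ℝ) :=
  ({c} + Gam mt P w) ∩ Elig mt P m

/-- Minkowski subtraction of subsets of `M_t`. -/
def minkSub (mt : MeasurableSpace S) {mS : MeasurableSpace S} (P : Measure S)
    (m : ℕ) (A B : Set (S → Fin d → ℝ)) :
    Set (S → Fin d → ℝ) :=
  {u | u ∈ Elig mt P m ∧ B + {u} ⊆ A}

/-- The dual variables for risk measures for vectors on `L^∞(S, mS, P; ℝ^d)`. -/
def dualVec (mt : MeasurableSpace S) {mS : MeasurableSpace S} (P : Measure S) (m : ℕ) :
    Set ((Fin d → Measure S) × (S → Fin d → ℝ)) :=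
  {p | (∀ i, p.1 i ∈ ProbACAt mt P) ∧ p.2 ∈ EligPosDual mt P m \ EligPerp mt P m ∧
    wts mt mS P p.1 p.2 ∈ LOnePos mS P}

/-- The minimal penalty function of a risk measure on `L^∞(S, mS, P; ℝ^d)`. -/
def penVec (mt : MeasurableSpace S) {mS : MeasurableSpace S} (P : Measure S) (m : ℕ)
    (R : (S → Fin d → ℝ) → Set (S → Fin d → ℝ))
    (p : (Fin d → Measure S) × (S → Fin d → ℝ)) : Set (S → Fin d → ℝ) :=
  ⋂ Y ∈ accVec mS P R, halfSp mt P m p.2 (condQVec mt P p.1 (-Y))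

/-- The dual representation of a risk measure on `L^∞(S, mS, P; ℝ^d)` with respect to its
minimal penalty function. -/
def HasDualVec (mt : MeasurableSpace S) {mS : MeasurableSpace S} (P : Measure S) (m : ℕ)
    (R : (S → Fin d → ℝ) → Set (S → Fin d → ℝ)) : Prop :=
  ∀ X ∈ LInf mS P, R X = ⋂ p ∈ (dualVec mt P m : Set ((Fin d → Measure S) × (S → Fin d → ℝ))),
    minkSub mt P m (halfSp mt P m p.2 (condQVec mt P p.1 (-X))) (penVec mt P m R p)

/-- The dual variables for risk measures for vectors restricted to `L^∞(S, mt, P; ℝ^d)`. -/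
def dualRes (mt : MeasurableSpace S) {mS : MeasurableSpace S} (P : Measure S) (m : ℕ) :
    Set (S → Fin d → ℝ) :=
  LOnePos mt P \ EligPerp mt P m

/-- The minimal penalty function of a risk measure restricted to `L^∞(S, mt, P; ℝ^d)`. -/
def penRes (mt : MeasurableSpace S) {mS : MeasurableSpace S} (P : Measure S) (m : ℕ)
    (R : (S → Fin d → ℝ) → Set (S → Fin d → ℝ)) (w : S → Fin d → ℝ) : Set (S → Fin d → ℝ) :=
  ⋂ Z ∈ accVec mt P R, halfSp mt P m w (-Z)

/-- The dual representation of a risk measure restricted to `L^∞(S, mt, P; ℝ^d)` with respect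
to its minimal penalty function. -/
def HasDualRes (mt : MeasurableSpace S) {mS : MeasurableSpace S} (P : Measure S) (m : ℕ)
    (R : (S → Fin d → ℝ) → Set (S → Fin d → ℝ)) : Prop :=
  ∀ X ∈ LInf mt P, R X = ⋂ w ∈ dualRes mt P m,
    minkSub mt P m (halfSp mt P m w (-X)) (penRes mt P m R w)

end Generic

section Processes

variable {Ω : Type*} {m0 : MeasurableSpace Ω} {T d : ℕ}

/-- The space `R_t^{∞,d}` of bounded adapted processes which vanish before `t`. -/
def RInf (P : Measure Ω) (F : Filtration (Fin (T + 1)) m0) (t : Fin (T + 1)) :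
    Set (Fin (T + 1) → Ω → Fin d → ℝ) :=
  {X | (∀ s, X s ∈ LInf (F s) P) ∧ ∀ s < t, X s = 0}

/-- The increments of a process, with value `0` before time `0`. -/
def incr (a : Fin (T + 1) → Ω → Fin d → ℝ) (s : Fin (T + 1)) : Ω → Fin d → ℝ :=
  if s = 0 then a s else a s - a ⟨(s : ℕ) - 1, lt_of_le_of_lt (Nat.sub_le _ _) s.isLt⟩

/-- The space `A_t^{1,d}` of adapted processes with integrable variation which vanish
before `t`. -/
def AOne (P : Measure Ω) (F : Filtration (Fin (T + 1)) m0) (t : Fin (T + 1)) :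
    Set (Fin (T + 1) → Ω → Fin d → ℝ) :=
  {a | (∀ s, Measurable[F s] (a s)) ∧ (∀ s, Integrable (incr a s) P) ∧ ∀ s < t, a s = 0}

/-- The topology `σ(R_t^{∞,d}, A_t^{1,d})`. -/
@[reducible] noncomputable def weakTopProc
    (P : Measure Ω) (F : Filtration (Fin (T + 1)) m0) (t : Fin (T + 1)) :
    TopologicalSpace (RInf P F t : Set (Fin (T + 1) → Ω → Fin d → ℝ)) :=
  ⨅ a : (AOne P F t : Set (Fin (T + 1) → Ω → Fin d → ℝ)),
    TopologicalSpace.induced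
      (fun X : (RInf P F t : Set (Fin (T + 1) → Ω → Fin d → ℝ)) =>
        ∫ ω, ∑ s ∈ Finset.Ici t, incr a.1 s ω ⬝ᵥ X.1 s ω ∂P) inferInstance

/-- The process `c 1_{T_t}`. -/
def constFrom (t : Fin (T + 1)) (c : Ω → Fin d → ℝ) : Fin (T + 1) → Ω → Fin d → ℝ :=
  fun s => if t ≤ s then c else 0

/-- Set-valued conditional risk measures for processes at time `t`. -/
structure IsProcessRM (P : Measure Ω) (F : Filtration (Fin (T + 1)) m0) (m : ℕ)
    (t : Fin (T + 1)) (ρ : (Fin (T + 1) → Ω → Fin d → ℝ) → Set (Ω → Fin d → ℝ)) : Prop where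
  upper : ∀ X ∈ RInf P F t, ρ X ∈ UpperSets (F t) P m
  cash : ∀ X ∈ RInf P F t, ∀ c ∈ Elig (F t) P m,
    ρ (X + constFrom t c) = (fun u => u - c) '' ρ X
  mono : ∀ X ∈ RInf P F t, ∀ Y ∈ RInf P F t,
    (∀ s, ∀ᵐ ω ∂P, X s ω ≤ Y s ω) → ρ X ⊆ ρ Y
  zero : FiniteAtZero (F t) P m (ρ 0)

/-- Closed conditionally convex risk measures for processes with values in `G(M_t; M_{t,+})`. -/
structure IsClosedConvexProcessRM (P : Measure Ω) (F : Filtration (Fin (T + 1)) m0) (m : ℕ)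
    (t : Fin (T + 1)) (ρ : (Fin (T + 1) → Ω → Fin d → ℝ) → Set (Ω → Fin d → ℝ)) : Prop
    extends IsProcessRM P F m t ρ where
  values : ∀ X ∈ RInf P F t, ρ X ∈ ClosedConvexUpperSets (F t) P m
  convex : ∀ X ∈ RInf P F t, ∀ Y ∈ RInf P F t, ∀ l : Ω → ℝ, Measurable[F t] l →
    (∀ᵐ ω ∂P, 0 ≤ l ω ∧ l ω ≤ 1) → ∀ u ∈ ρ X, ∀ v ∈ ρ Y,
    (fun ω => l ω • u ω + (1 - l ω) • v ω) ∈
      ρ (fun s ω => l ω • X s ω + (1 - l ω) • Y s ω)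
  closed : @IsClosed _ (@instTopologicalSpaceProd _ _ (weakTopProc P F t)
      (weakTop (F t) P (Elig (F t) P m)))
    {p : ↥(RInf (d := d) P F t) × ↥(Elig (d := d) (F t) P m) | p.2.1 ∈ ρ p.1.1}

/-- The acceptance set of a risk measure for processes. -/
def accProc (P : Measure Ω) (F : Filtration (Fin (T + 1)) m0) (t : Fin (T + 1))
    (ρ : (Fin (T + 1) → Ω → Fin d → ℝ) → Set (Ω → Fin d → ℝ)) :
    Set (Fin (T + 1) → Ω → Fin d → ℝ) :=
  {X | X ∈ RInf P F t ∧ 0 ∈ ρ X}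

/-- Pairs `(Q, w)` with `Q_s ∈ M_t(P)^d`, `w_s ∈ M_{t,+}^*` and `w_t^s(Q_s, w_s) ≥ 0` for all
`s ≥ t`. Only the components with `s ≥ t` are used. -/
def dualProcCone (P : Measure Ω) (F : Filtration (Fin (T + 1)) m0) (m : ℕ) (t : Fin (T + 1)) :
    Set ((Fin (T + 1) → Fin d → Measure Ω) × (Fin (T + 1) → Ω → Fin d → ℝ)) :=
  {p | ∀ s, t ≤ s → (∀ i, p.1 s i ∈ ProbACAt (F t) P) ∧ p.2 s ∈ EligPosDual (F t) P m ∧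
    wts (F t) (F s) P (p.1 s) (p.2 s) ∈ LOnePos (F s) P}

/-- The dual variables `W_t` for risk measures for processes: the pairs above for which
`∑_{s ≥ t} w_s` is not in `M_t^⊥`. -/
def dualProc (P : Measure Ω) (F : Filtration (Fin (T + 1)) m0) (m : ℕ) (t : Fin (T + 1)) :
    Set ((Fin (T + 1) → Fin d → Measure Ω) × (Fin (T + 1) → Ω → Fin d → ℝ)) :=
  {p | p ∈ dualProcCone P F m t ∧ ∑ s ∈ Finset.Ici t, p.2 s ∉ EligPerp (F t) P m}

/-- The set of `u ∈ M_t` with `∑_{s ≥ t} w_s^⊤ u ≥ ∑_{s ≥ t} w_s^⊤ E_t^{Q_s}[-X_s]`. -/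
def halfProc (P : Measure Ω) (F : Filtration (Fin (T + 1)) m0) (m : ℕ) (t : Fin (T + 1))
    (p : (Fin (T + 1) → Fin d → Measure Ω) × (Fin (T + 1) → Ω → Fin d → ℝ))
    (X : Fin (T + 1) → Ω → Fin d → ℝ) : Set (Ω → Fin d → ℝ) :=
  {u | u ∈ Elig (F t) P m ∧ ∀ᵐ ω ∂P,
    ∑ s ∈ Finset.Ici t, p.2 s ω ⬝ᵥ condQVec (F t) P (p.1 s) (-(X s)) ω ≤
      ∑ s ∈ Finset.Ici t, p.2 s ω ⬝ᵥ u ω}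

/-- The minimal penalty function of a risk measure for processes. -/
def penProc (P : Measure Ω) (F : Filtration (Fin (T + 1)) m0) (m : ℕ) (t : Fin (T + 1))
    (ρ : (Fin (T + 1) → Ω → Fin d → ℝ) → Set (Ω → Fin d → ℝ))
    (p : (Fin (T + 1) → Fin d → Measure Ω) × (Fin (T + 1) → Ω → Fin d → ℝ)) :
    Set (Ω → Fin d → ℝ) :=
  ⋂ Y ∈ accProc P F t ρ, halfProc P F m t p Y

/-- The dual representation of a risk measure for processes with respect to its minimal
penalty function. -/
def HasDualProc (P : Measure Ω) (F : Filtration (Fin (T + 1)) m0) (m : ℕ) (t : Fin (T + 1))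
    (ρ : (Fin (T + 1) → Ω → Fin d → ℝ) → Set (Ω → Fin d → ℝ)) : Prop :=
  ∀ X ∈ RInf P F t, ρ X = ⋂ p ∈ dualProc P F m t,
    minkSub (F t) P m (halfProc P F m t p X) (penProc P F m t ρ p)

end Processes

section OptionalSpace

variable {Ω : Type*} {m0 : MeasurableSpace Ω} {T d : ℕ}

/-- The optional sigma-algebra on `Ω × {0, …, T}`. -/
@[reducible] def optSigma (F : Filtration (Fin (T + 1)) m0) : MeasurableSpace (Ω × Fin (T + 1)) :=
  MeasurableSpace.generateFrom
    {B | ∃ (s : Fin (T + 1)) (A : Set Ω), MeasurableSet[F s] A ∧ B = A ×ˢ {s}}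

/-- The sigma-algebra at time `t` of the optional filtration. -/
@[reducible] def optFilt (F : Filtration (Fin (T + 1)) m0) (t : Fin (T + 1)) :
    MeasurableSpace (Ω × Fin (T + 1)) :=
  MeasurableSpace.generateFrom
    ({B | ∃ (r : Fin (T + 1)) (D : Set Ω), r < t ∧ MeasurableSet[F r] D ∧ B = D ×ˢ {r}} ∪
      {B | ∃ D : Set Ω, MeasurableSet[F t] D ∧ B = D ×ˢ Set.Ici t})

/-- The measure `Q ⊗ ψ` on the optional sigma-algebra: the integral of `X` with respect to it
is `E^Q[∑_s ψ_s X_s]`. -/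
noncomputable def tensor (F : Filtration (Fin (T + 1)) m0) (Q : Measure Ω)
    (ψ : Fin (T + 1) → Ω → ℝ) : @Measure (Ω × Fin (T + 1)) (optSigma F) :=
  ∑ s, @Measure.map Ω (Ω × Fin (T + 1)) m0 (optSigma F) (fun ω => (ω, s))
    (Q.withDensity fun ω => ENNReal.ofReal (ψ s ω))

/-- The optional random measures `Ψ(P)` (boundedness is automatic). -/
def OptRandomMeas (P : Measure Ω) (F : Filtration (Fin (T + 1)) m0) :
    Set (Fin (T + 1) → Ω → ℝ) :=
  {ψ | (∀ s, Measurable[F s] (ψ s)) ∧ ∀ᵐ ω ∂P, (∀ s, 0 ≤ ψ s ω) ∧ ∑ s, ψ s ω = 1}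

/-- Adapted reference processes `μ`, with `∑_s μ_s = 1` and `min_s μ_s > ε` a.s. for
some `ε > 0`. -/
def IsReference (P : Measure Ω) (F : Filtration (Fin (T + 1)) m0)
    (μ : Fin (T + 1) → Ω → ℝ) : Prop :=
  (∀ s, Measurable[F s] (μ s)) ∧ (∀ᵐ ω ∂P, ∑ s, μ s ω = 1) ∧
    ∃ ε : ℝ, 0 < ε ∧ ∀ᵐ ω ∂P, ∀ s, ε < μ s ω

/-- The component `X_s` of a random vector on the optional space. -/
def slice (s : Fin (T + 1)) (X : Ω × Fin (T + 1) → Fin d → ℝ) : Ω → Fin d → ℝ :=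
  fun ω => X (ω, s)

/-- The random vector `∑_{s < t} u_s 1_{{s}} + v 1_{T_t}` on the optional space. -/
def paste (t : Fin (T + 1)) (u : Fin (T + 1) → Ω → Fin d → ℝ) (v : Ω → Fin d → ℝ) :
    Ω × Fin (T + 1) → Fin d → ℝ :=
  fun p => if p.2 < t then u p.2 p.1 else v p.1

/-- The set `∑_{s < t} D_s 1_{{s}} + D' 1_{T_t}`. -/
def pasteSets (t : Fin (T + 1)) (D : Fin (T + 1) → Set (Ω → Fin d → ℝ))
    (D' : Set (Ω → Fin d → ℝ)) : Set (Ω × Fin (T + 1) → Fin d → ℝ) :=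
  {x | ∃ (u : Fin (T + 1) → Ω → Fin d → ℝ) (v : Ω → Fin d → ℝ),
    (∀ s < t, u s ∈ D s) ∧ v ∈ D' ∧ x = paste t u v}

/-- The projection `π_{t,T}(X)` of a random vector on the optional space. -/
def projFrom (t : Fin (T + 1)) (X : Ω × Fin (T + 1) → Fin d → ℝ) :
    Fin (T + 1) → Ω → Fin d → ℝ :=
  fun s => if t ≤ s then slice s X else 0

/-- The random vector `Z 1_{{s}}` on the optional space. -/
def single (s : Fin (T + 1)) (Z : Ω → Fin d → ℝ) : Ω × Fin (T + 1) → Fin d → ℝ :=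
  fun p => if p.2 = s then Z p.1 else 0

/-- The random vector `X 1_{T_t}` on the optional space, for a process `X`. -/
def procFrom (t : Fin (T + 1)) (X : Fin (T + 1) → Ω → Fin d → ℝ) :
    Ω × Fin (T + 1) → Fin d → ℝ :=
  fun p => if t ≤ p.2 then X p.2 p.1 else 0

/-- The risk measure `∑_{s < t} R_s(X_s) 1_{{s}} + ρ_t(π_{t,T}(X)) 1_{T_t}`. -/
def toOptional (t : Fin (T + 1)) (ρ : (Fin (T + 1) → Ω → Fin d → ℝ) → Set (Ω → Fin d → ℝ))
    (R : Fin (T + 1) → (Ω → Fin d → ℝ) → Set (Ω → Fin d → ℝ))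
    (X : Ω × Fin (T + 1) → Fin d → ℝ) : Set (Ω × Fin (T + 1) → Fin d → ℝ) :=
  pasteSets t (fun s => R s (slice s X)) (ρ (projFrom t X))

/-- The risk measure for processes `X ↦ (R(X 1_{T_t}))_t`. -/
def toProcess (t : Fin (T + 1))
    (R : (Ω × Fin (T + 1) → Fin d → ℝ) → Set (Ω × Fin (T + 1) → Fin d → ℝ))
    (X : Fin (T + 1) → Ω → Fin d → ℝ) : Set (Ω → Fin d → ℝ) :=
  slice t '' R (procFrom t X)

/-- The restricted risk measure for vectors `Z ↦ (R(Z 1_{{s}}))_s`. -/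
def toRestricted (s : Fin (T + 1))
    (R : (Ω × Fin (T + 1) → Fin d → ℝ) → Set (Ω × Fin (T + 1) → Fin d → ℝ))
    (Z : Ω → Fin d → ℝ) : Set (Ω → Fin d → ℝ) :=
  slice s '' R (single s Z)

open Classical in
/-- The map `W_t(Q ⊗ ψ, w̄) = (Q̂, w)`. -/
noncomputable def mapW (P : Measure Ω) (F : Filtration (Fin (T + 1)) m0)
    (μ : Fin (T + 1) → Ω → ℝ) (t : Fin (T + 1)) (Q : Fin d → Measure Ω)
    (ψ : Fin d → Fin (T + 1) → Ω → ℝ) (wbar : Ω × Fin (T + 1) → Fin d → ℝ) :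
    (Fin (T + 1) → Fin d → Measure Ω) × (Fin (T + 1) → Ω → Fin d → ℝ) :=
  (fun s i => P.withDensity fun ω => ENNReal.ofReal
      (if 0 < condQ (F t) P (Q i) (ψ i s) ω then
        ψ i s ω / condQ (F t) P (Q i) (ψ i s) ω * xi (F t) (F s) P (Q i) ω
      else μ s ω / condExp (F t) P (μ s) ω),
    fun s ω i => condQ (F t) P (Q i) (ψ i s) ω / (1 - ∑ r ∈ Finset.Iio t, μ r ω) * wbar (ω, t) i)

open Classical in
/-- The component at time `t` of the weight of `W̄_t(Q, w)`:
`∑_{s ≥ t} diag(1_{w_s > 0}) w_s`. -/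
noncomputable def sumPos (t : Fin (T + 1)) (w : Fin (T + 1) → Ω → Fin d → ℝ) :
    Ω → Fin d → ℝ :=
  fun ω i => ∑ s ∈ Finset.Ici t, if 0 < w s ω i then w s ω i else 0

open Classical in
/-- The map `W̄_t(Q, w) = (Q̄, w̄)`. -/
noncomputable def mapWbar (P : Measure Ω) (F : Filtration (Fin (T + 1)) m0)
    (μ : Fin (T + 1) → Ω → ℝ) (t : Fin (T + 1))
    (p : (Fin (T + 1) → Fin d → Measure Ω) × (Fin (T + 1) → Ω → Fin d → ℝ)) :
    (Fin d → @Measure (Ω × Fin (T + 1)) (optSigma F)) × (Ω × Fin (T + 1) → Fin d → ℝ) :=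
  (fun i => (tensor F P μ).withDensity fun x => ENNReal.ofReal
      (if x.2 < t then 1
      else (1 - ∑ r ∈ Finset.Iio t, μ r x.1) / μ x.2 x.1 *
        (if 0 < sumPos t p.2 x.1 i then p.2 x.2 x.1 i / sumPos t p.2 x.1 i
          else 1 / ((T : ℝ) - ((t : ℕ) : ℝ) + 1)) *
        xi (F t) (F x.2) P (p.1 x.2 i) x.1),
    paste t 0 (sumPos t p.2))

end OptionalSpace

end SetRisk

open SetRisk

namespace SetRisk

theorem exists_mem_span_separation {E ι : Type*} [AddCommGroup E] [Module ℝ E]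
    (f : ι → E →ₗ[ℝ] ℝ) {C : Set E} (hC : Convex ℝ C)
    (hcl : @IsClosed _ (⨅ i, TopologicalSpace.induced (f i) inferInstance) C) {x : E} (hx : x ∉ C) :
    ∃ φ ∈ Submodule.span ℝ (Set.range f), ∃ c, φ x < c ∧ ∀ y ∈ C, c < φ y := by
  let t₁ : TopologicalSpace E := ⨅ i, TopologicalSpace.induced (f i) inferInstance
  have : IsTopologicalAddGroup E :=
    topologicalAddGroup_iInf fun _ => topologicalAddGroup_induced _
  have : ContinuousSMul ℝ E := continuousSMul_iInf fun _ => continuousSMul_induced _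
  have : LocallyConvexSpace ℝ E := LocallyConvexSpace.iInf fun _ => LocallyConvexSpace.induced _
  obtain ⟨φ, c, h1, h2⟩ := geometric_hahn_banach_point_closed hC hcl hx
  exact ⟨φ.toLinearMap, (LinearMap.mem_span_iff_continuous _).2 φ.continuous, c, h1, h2⟩

section Measurability

variable {S : Type*} {d : ℕ} {m : MeasurableSpace S}

theorem measurable_apply {X : S → Fin d → ℝ} (hX : Measurable[m] X) (i : Fin d) :
    Measurable[m] (fun ω => X ω i) := measurable_pi_iff.1 hX i

theorem measurable_of_apply {X : S → Fin d → ℝ} (hX : ∀ i, Measurable[m] (fun ω => X ω i)) :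
    Measurable[m] X := measurable_pi_iff.2 hX

theorem measurableSet_le_fun {f g : S → ℝ} (hf : Measurable[m] f) (hg : Measurable[m] g) :
    MeasurableSet[m] {ω | f ω ≤ g ω} := measurableSet_le hf hg

theorem measurableSet_lt_fun {f g : S → ℝ} (hf : Measurable[m] f) (hg : Measurable[m] g) :
    MeasurableSet[m] {ω | f ω < g ω} := measurableSet_lt hf hg

end Measurability

section Spaces

variable {S : Type*} {d : ℕ} {mt mS : MeasurableSpace S} {P : Measure S}

theorem mem_LInf_iff (hm : mt ≤ mS) {X : S → Fin d → ℝ} :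
    X ∈ LInf mt P ↔ Measurable[mt] X ∧ ∃ C, ∀ᵐ ω ∂P, ∀ i, |X ω i| ≤ C := by
  refine and_congr_right fun hX => ?_
  constructor
  · intro h
    refine ⟨(eLpNormEssSup X P).toReal, ?_⟩
    have h2 : eLpNormEssSup X P < ∞ := by simpa [eLpNorm_exponent_top] using h.2
    filter_upwards [ae_le_eLpNormEssSup (f := X) (μ := P)] with ω hω i
    have h3 : ‖X ω‖ ≤ (eLpNormEssSup X P).toReal := by
      rw [← ENNReal.ofReal_le_iff_le_toReal h2.ne, ofReal_norm]
      exact hω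
    exact (norm_le_pi_norm (X ω) i).trans h3
  · rintro ⟨C, hC⟩
    refine memLp_top_of_bound (hX.mono hm le_rfl).aestronglyMeasurable |C| ?_
    filter_upwards [hC] with ω hω
    exact (pi_norm_le_iff_of_nonneg (abs_nonneg C)).2 fun i => (hω i).trans (le_abs_self C)

theorem mem_LOne_iff {Z : S → Fin d → ℝ} :
    Z ∈ LOne mt P ↔ Measurable[mt] Z ∧ ∀ i, Integrable (fun ω => Z ω i) P := by
  refine and_congr_right fun _ => ?_
  exact ⟨fun h i => h.eval i, fun h => Integrable.of_eval h⟩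


/-- `LInf` as a linear subspace. -/
def LInfSub (d : ℕ) (mt : MeasurableSpace S) {mS : MeasurableSpace S} (P : Measure S) :
    Submodule ℝ (S → Fin d → ℝ) where
  carrier := LInf mt P
  add_mem' := fun ha hb => ⟨ha.1.add hb.1, ha.2.add hb.2⟩
  zero_mem' := ⟨measurable_const, MemLp.zero⟩
  smul_mem' := fun c _ ha => ⟨ha.1.const_smul c, ha.2.const_smul c⟩

theorem LInf_add {X Y : S → Fin d → ℝ} (hX : X ∈ LInf mt P) (hY : Y ∈ LInf mt P) :
    X + Y ∈ LInf mt P := (LInfSub d mt P).add_mem hX hY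
theorem LInf_sub {X Y : S → Fin d → ℝ} (hX : X ∈ LInf mt P) (hY : Y ∈ LInf mt P) :
    X - Y ∈ LInf mt P := (LInfSub d mt P).sub_mem hX hY
theorem LInf_neg {X : S → Fin d → ℝ} (hX : X ∈ LInf mt P) : -X ∈ LInf mt P :=
  (LInfSub d mt P).neg_mem hX
theorem LInf_smul {X : S → Fin d → ℝ} (c : ℝ) (hX : X ∈ LInf mt P) : c • X ∈ LInf mt P :=
  (LInfSub d mt P).smul_mem c hX
theorem LInf_zero : (0 : S → Fin d → ℝ) ∈ LInf mt P := (LInfSub d mt P).zero_mem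

theorem LInf_mono {mX : MeasurableSpace S} (h : mt ≤ mX) {X : S → Fin d → ℝ}
    (hX : X ∈ LInf mt P) : X ∈ LInf mX P := ⟨hX.1.mono h le_rfl, hX.2⟩

theorem LOne_mono {mX : MeasurableSpace S} (h : mt ≤ mX) {X : S → Fin d → ℝ}
    (hX : X ∈ LOne mt P) : X ∈ LOne mX P := ⟨hX.1.mono h le_rfl, hX.2⟩

theorem LOne_add {X Y : S → Fin d → ℝ} (hX : X ∈ LOne mt P) (hY : Y ∈ LOne mt P) :
    X + Y ∈ LOne mt P := ⟨hX.1.add hY.1, hX.2.add hY.2⟩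
theorem LOne_smul {X : S → Fin d → ℝ} (c : ℝ) (hX : X ∈ LOne mt P) : c • X ∈ LOne mt P :=
  ⟨hX.1.const_smul c, hX.2.smul c⟩

theorem LInf_lcomb (hm : mt ≤ mS) {X Y : S → Fin d → ℝ} (hX : X ∈ LInf mt P) (hY : Y ∈ LInf mt P)
    {l : S → ℝ} (hl : Measurable[mt] l) (hl1 : ∀ᵐ ω ∂P, 0 ≤ l ω ∧ l ω ≤ 1) :
    (fun ω => l ω • X ω + (1 - l ω) • Y ω) ∈ LInf mt P := by
  rw [mem_LInf_iff hm] at *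
  obtain ⟨hX, C, hC⟩ := hX
  obtain ⟨hY, D, hD⟩ := hY
  refine ⟨(hl.smul hX).add ((measurable_const.sub hl).smul hY), C + D, ?_⟩
  filter_upwards [hC, hD, hl1] with ω h1 h2 h3 i
  have := h1 i
  have := h2 i
  simp only [Pi.add_apply, Pi.smul_apply, smul_eq_mul]
  refine (abs_add_le _ _).trans (add_le_add ?_ ?_)
  · rw [abs_mul, abs_of_nonneg h3.1]
    nlinarith [abs_nonneg (X ω i)]
  · rw [abs_mul, abs_of_nonneg (sub_nonneg.2 h3.2)]
    nlinarith [abs_nonneg (Y ω i)]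

theorem integrable_dot (hm : mt ≤ mS) {Z X : S → Fin d → ℝ} (hZ : Z ∈ LOne mS P)
    (hX : X ∈ LInf mt P) : Integrable (fun ω => Z ω ⬝ᵥ X ω) P := by
  obtain ⟨hX, C, hC⟩ := (mem_LInf_iff hm).1 hX
  refine integrable_finsetSum _ fun i _ => ?_
  refine Integrable.mul_bdd (c := C) ((mem_LOne_iff.1 hZ).2 i)
    ((measurable_pi_iff.1 (hX.mono hm le_rfl)) i).aestronglyMeasurable ?_
  filter_upwards [hC] with ω h using h i

theorem dotProduct_measurable {Z X : S → Fin d → ℝ} (hZ : Measurable[mt] Z)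
    (hX : Measurable[mt] X) : Measurable[mt] (fun ω => Z ω ⬝ᵥ X ω) :=
  Finset.measurable_fun_sum _ fun i _ => (measurable_pi_iff.1 hZ i).mul (measurable_pi_iff.1 hX i)

/-- Separation of a point from a weak* closed convex subset of `LInf`. -/
theorem exists_LOne_separation (hm : mt ≤ mS) {C : Set (S → Fin d → ℝ)} (hC : Convex ℝ C)
    (hCs : C ⊆ LInf mt P)
    (hcl : @IsClosed _ (weakTop mt P (LInf mt P)) (Subtype.val ⁻¹' C : Set (LInf (d := d) mt P)))
    {X : S → Fin d → ℝ} (hX : X ∈ LInf mt P) (hXC : X ∉ C) :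
    ∃ Z ∈ LOne (d := d) mt P, ∃ c : ℝ, ∫ ω, Z ω ⬝ᵥ X ω ∂P < c ∧
      ∀ Y ∈ C, c ≤ ∫ ω, Z ω ⬝ᵥ Y ω ∂P := by
  let f : ↥(LOne (d := d) mt P) → (LInfSub d mt P) →ₗ[ℝ] ℝ := fun Z =>
    { toFun := fun X => ∫ ω, Z.1 ω ⬝ᵥ X.1 ω ∂P
      map_add' := fun X Y => by
        rw [← integral_add (integrable_dot hm (LOne_mono hm Z.2) X.2)
          (integrable_dot hm (LOne_mono hm Z.2) Y.2)]
        simp [dotProduct_add]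
      map_smul' := fun c X => by
        simp [dotProduct_smul, integral_const_mul] }
  have hconv : Convex ℝ ((LInfSub d mt P).subtype ⁻¹' C) := hC.linear_preimage _
  obtain ⟨φ, hφ, c, h1, h2⟩ := exists_mem_span_separation f hconv hcl (x := ⟨X, hX⟩) hXC
  have key : ∀ φ ∈ Submodule.span ℝ (Set.range f), ∃ Z ∈ LOne (d := d) mt P,
      ∀ Y : LInfSub d mt P, φ Y = ∫ ω, Z ω ⬝ᵥ Y.1 ω ∂P := by
    intro φ hφ
    induction hφ using Submodule.span_induction with
    | mem x h => obtain ⟨Z, rfl⟩ := h; exact ⟨Z.1, Z.2, fun _ => rfl⟩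
    | zero => exact ⟨0, ⟨measurable_const, integrable_zero _ _ _⟩, fun Y => by simp⟩
    | add x y _ _ hx hy =>
      obtain ⟨Z, hZ, h⟩ := hx
      obtain ⟨Z', hZ', h'⟩ := hy
      refine ⟨Z + Z', LOne_add hZ hZ', fun Y => ?_⟩
      rw [LinearMap.add_apply, h, h', ← integral_add (integrable_dot hm (LOne_mono hm hZ) Y.2)
          (integrable_dot hm (LOne_mono hm hZ') Y.2)]
      simp [add_dotProduct]
    | smul a x _ hx =>
      obtain ⟨Z, hZ, h⟩ := hx
      refine ⟨a • Z, LOne_smul a hZ, fun Y => ?_⟩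
      rw [LinearMap.smul_apply, h]
      simp [smul_dotProduct, integral_const_mul]
  obtain ⟨Z, hZ, h⟩ := key φ hφ
  refine ⟨Z, hZ, c, (h ⟨X, hX⟩) ▸ h1, fun Y hY => ?_⟩
  have := h2 ⟨Y, hCs hY⟩ hY
  rw [h] at this
  exact this.le

end Spaces

end SetRisk

namespace SetRisk

section EssInf

variable {S : Type*} {mS : MeasurableSpace S} {P : Measure S}

/-- A family of integrable functions which is directed downwards and has integrals bounded below
has an integrable lower bound whose integral is the infimum of the integrals. -/
theorem exists_integrable_lowerBound {G : Set (S → ℝ)} (hne : G.Nonempty)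
    (hG : ∀ f ∈ G, Integrable f P) (hmin : ∀ f ∈ G, ∀ g ∈ G, ∃ h ∈ G, h =ᵐ[P] fun ω => min (f ω) (g ω))
    {c : ℝ} (hc : ∀ f ∈ G, c ≤ ∫ ω, f ω ∂P) :
    ∃ σ : S → ℝ, Integrable σ P ∧ (∀ f ∈ G, σ ≤ᵐ[P] f) ∧ c ≤ ∫ ω, σ ω ∂P := by
  set V : Set ℝ := (fun f : S → ℝ => ∫ ω, f ω ∂P) '' G with hV
  have hVb : BddBelow V := ⟨c, by rintro _ ⟨f, hf, rfl⟩; exact hc f hf⟩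
  have hVn : V.Nonempty := hne.image _
  have hI : ∀ f ∈ G, sInf V ≤ ∫ ω, f ω ∂P := fun f hf => csInf_le hVb ⟨f, hf, rfl⟩
  have hex : ∀ n : ℕ, ∃ f ∈ G, ∫ ω, f ω ∂P < sInf V + (1 / 2) ^ n := by
    intro n
    obtain ⟨_, ⟨f, hf, rfl⟩, h⟩ := exists_lt_of_csInf_lt hVn
      (lt_add_of_pos_right (sInf V) (by positivity : (0 : ℝ) < (1 / 2) ^ n))
    exact ⟨f, hf, h⟩
  choose g hgG hg using hex
  have hpos : ∀ n, ∀ f ∈ G, ∫ ω, max (g n ω - f ω) 0 ∂P ≤ (1 / 2) ^ n := by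
    intro n f hf
    obtain ⟨h, hhG, hh⟩ := hmin (g n) (hgG n) f hf
    have h1 : ∫ ω, max (g n ω - f ω) 0 ∂P = ∫ ω, g n ω ∂P - ∫ ω, h ω ∂P := by
      rw [← integral_sub (hG _ (hgG n)) (hG _ hhG)]
      refine integral_congr_ae ?_
      filter_upwards [hh] with ω hω
      rw [hω]
      rcases le_total (g n ω) (f ω) with h | h
      · simp [h]
      · simp [h]
    have := hI h hhG
    have := hg n
    linarith
  have hdist : ∀ n, dist ((hG _ (hgG n)).toL1 (g n)) ((hG _ (hgG (n + 1))).toL1 (g (n + 1)))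
      ≤ 2 * (1 / 2) ^ n := by
    intro n
    rw [dist_eq_norm, ← Integrable.toL1_sub, L1.norm_of_fun_eq_integral_norm]
    have h1 : ∫ ω, ‖(g n - g (n + 1)) ω‖ ∂P =
        ∫ ω, max (g n ω - g (n + 1) ω) 0 ∂P + ∫ ω, max (g (n + 1) ω - g n ω) 0 ∂P := by
      refine Eq.trans ?_ (integral_add ((hG _ (hgG n)).sub (hG _ (hgG (n + 1)))).pos_part
        ((hG _ (hgG (n + 1))).sub (hG _ (hgG n))).pos_part)
      refine integral_congr_ae (Filter.Eventually.of_forall fun ω => ?_)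
      simp only [Pi.sub_apply, Real.norm_eq_abs]
      rcases le_total (g n ω) (g (n + 1) ω) with h | h
      · rw [abs_of_nonpos (by linarith), max_eq_right (by linarith), max_eq_left (by linarith)]
        ring
      · rw [abs_of_nonneg (by linarith), max_eq_left (by linarith), max_eq_right (by linarith)]
        ring
    rw [h1]
    have h2 := hpos n _ (hgG (n + 1))
    have h3 := hpos (n + 1) _ (hgG n)
    have h4 : ((1 : ℝ) / 2) ^ (n + 1) ≤ (1 / 2) ^ n :=
      pow_le_pow_of_le_one (by norm_num) (by norm_num) (Nat.le_succ n)
    linarith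
  obtain ⟨L, hL⟩ := cauchySeq_tendsto_of_complete
    (cauchySeq_of_le_geometric (1 / 2) 2 (by norm_num) hdist)
  have hLint : Integrable (L : S → ℝ) P := L1.integrable_coeFn L
  have hnorm : Filter.Tendsto (fun n => ∫ ω, |L ω - g n ω| ∂P) Filter.atTop (nhds 0) := by
    have h1 := (tendsto_iff_norm_sub_tendsto_zero.1 hL)
    refine h1.congr fun n => ?_
    rw [norm_sub_rev, L1.norm_eq_integral_norm]
    refine integral_congr_ae ?_
    filter_upwards [Lp.coeFn_sub L ((hG _ (hgG n)).toL1 (g n)), (hG _ (hgG n)).coeFn_toL1]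
      with ω h2 h3
    rw [h2, Pi.sub_apply, h3, Real.norm_eq_abs]
  refine ⟨L, hLint, fun f hf => ?_, ?_⟩
  · have h1 : ∀ n, ∫ ω, max (L ω - f ω) 0 ∂P ≤ ∫ ω, |L ω - g n ω| ∂P + (1 / 2) ^ n := by
      intro n
      refine le_trans ?_ (add_le_add le_rfl (hpos n f hf))
      refine le_trans ?_ (integral_add (hLint.sub (hG _ (hgG n))).abs
        ((hG _ (hgG n)).sub (hG _ hf)).pos_part).le
      refine integral_mono (hLint.sub (hG _ hf)).pos_part
        ((hLint.sub (hG _ (hgG n))).abs.add ((hG _ (hgG n)).sub (hG _ hf)).pos_part) fun ω => ?_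
      simp only [Pi.add_apply, Pi.sub_apply]
      refine max_le ?_ (by positivity)
      have := le_abs_self (L ω - g n ω)
      have := le_max_left (g n ω - f ω) 0
      linarith
    have h2 : ∫ ω, max (L ω - f ω) 0 ∂P ≤ 0 := by
      have := hnorm.add (tendsto_pow_atTop_nhds_zero_of_lt_one
        (by norm_num : (0 : ℝ) ≤ 1 / 2) (by norm_num))
      rw [add_zero] at this
      exact ge_of_tendsto' this h1
    have h3 : (fun ω => max (L ω - f ω) 0) =ᵐ[P] 0 :=
      (integral_eq_zero_iff_of_nonneg (fun ω => le_max_right _ _)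
        (hLint.sub (hG _ hf)).pos_part).1
        (le_antisymm h2 (integral_nonneg fun ω => le_max_right _ _))
    filter_upwards [h3] with ω hω
    have := le_max_left (L ω - f ω) 0
    simp only [Pi.zero_apply] at hω
    linarith
  · refine ge_of_tendsto' (f := fun n => ∫ ω, g n ω ∂P) (x := Filter.atTop) ?_
      fun n => hc _ (hgG n)
    refine tendsto_iff_norm_sub_tendsto_zero.2 (squeeze_zero (fun _ => norm_nonneg _) (fun n => ?_)
      hnorm)
    rw [← integral_sub (hG _ (hgG n)) hLint]
    refine (norm_integral_le_integral_norm _).trans (le_of_eq ?_)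
    simp [abs_sub_comm]

end EssInf

section CondExp

variable {S : Type*} {d : ℕ} {mt mS : MeasurableSpace S} {P : Measure S} 

/-- The componentwise conditional expectation. -/
noncomputable def condVec (mt : MeasurableSpace S) {mS : MeasurableSpace S} (P : Measure S)
    (Z : S → Fin d → ℝ) : S → Fin d → ℝ := fun ω i => condExp mt P (fun η => Z η i) ω

theorem condVec_mem_LOne (Z : S → Fin d → ℝ) : condVec mt P Z ∈ LOne mt P :=
  mem_LOne_iff.2 ⟨measurable_of_apply fun _ => stronglyMeasurable_condExp.measurable,
    fun _ => integrable_condExp⟩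

theorem condExp_dot_indicator {Z Y : S → Fin d → ℝ} (hZ : Z ∈ LOne mS P)
    (hY : Y ∈ LInf mS P) {B : Set S} (hB : MeasurableSet[mt] B) :
    condExp mt P (fun ω => B.indicator Z ω ⬝ᵥ Y ω) =ᵐ[P]
      B.indicator (condExp mt P (fun ω => Z ω ⬝ᵥ Y ω)) := by
  have h : (fun ω => B.indicator Z ω ⬝ᵥ Y ω) = B.indicator (fun ω => Z ω ⬝ᵥ Y ω) := by
    ext ω; by_cases h : ω ∈ B <;> simp [h]
  rw [h]
  exact condExp_indicator (integrable_dot le_rfl hZ hY) hB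

theorem condExp_dot_right (hm : mt ≤ mS) [IsFiniteMeasure P] {Z v : S → Fin d → ℝ}
    (hZ : Z ∈ LOne mS P) (hv : v ∈ LInf mt P) :
    condExp mt P (fun ω => Z ω ⬝ᵥ v ω) =ᵐ[P] fun ω => condVec mt P Z ω ⬝ᵥ v ω := by
  obtain ⟨hv, C, hC⟩ := (mem_LInf_iff hm).1 hv
  have hint : ∀ i, Integrable ((fun ω => Z ω i) * (fun ω => v ω i)) P := fun i =>
    Integrable.mul_bdd (c := C) ((mem_LOne_iff.1 hZ).2 i)
      ((measurable_pi_iff.1 (hv.mono hm le_rfl)) i).aestronglyMeasurable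
      (by filter_upwards [hC] with ω h using h i)
  have h1 : (fun ω => Z ω ⬝ᵥ v ω) = ∑ i, (fun ω => Z ω i) * (fun ω => v ω i) := by
    ext ω; simp [dotProduct]
  rw [h1]
  refine (condExp_finsetSum (fun i _ => hint i) mt).trans ?_
  have h2 : ∀ i, condExp mt P ((fun ω => Z ω i) * (fun ω => v ω i)) =ᵐ[P]
      condExp mt P (fun ω => Z ω i) * fun ω => v ω i := fun i =>
    condExp_mul_of_stronglyMeasurable_right (measurable_apply hv i).stronglyMeasurable (hint i)
      ((mem_LOne_iff.1 hZ).2 i)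
  filter_upwards [ae_all_iff.2 h2] with ω hω
  simp [dotProduct, hω, condVec]

theorem exists_condExp_lowerBound (hm : mt ≤ mS) [IsFiniteMeasure P] {A : Set (S → Fin d → ℝ)}
    (hAs : A ⊆ LInf mS P) (hne : A.Nonempty)
    (hA : ∀ X ∈ A, ∀ Y ∈ A, ∀ l : S → ℝ, Measurable[mt] l → (∀ᵐ ω ∂P, 0 ≤ l ω ∧ l ω ≤ 1) →
      (fun ω => l ω • X ω + (1 - l ω) • Y ω) ∈ A)
    {Z : S → Fin d → ℝ} (hZ : Z ∈ LOne mS P) {c : ℝ} (hc : ∀ Y ∈ A, c ≤ ∫ ω, Z ω ⬝ᵥ Y ω ∂P) :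
    ∃ σ : S → ℝ, Measurable[mt] σ ∧ Integrable σ P ∧
      (∀ Y ∈ A, σ ≤ᵐ[P] condExp mt P (fun ω => Z ω ⬝ᵥ Y ω)) ∧ c ≤ ∫ ω, σ ω ∂P := by
  set G : Set (S → ℝ) := (fun Y => condExp mt P (fun ω => Z ω ⬝ᵥ Y ω)) '' A with hG
  obtain ⟨σ, h1, h2, h3⟩ := exists_integrable_lowerBound (P := P) (G := G) (hne.image _)
    (by rintro _ ⟨Y, hY, rfl⟩; exact integrable_condExp)
    (by
      rintro _ ⟨X, hX, rfl⟩ _ ⟨Y, hY, rfl⟩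
      set f := condExp mt P (fun ω => Z ω ⬝ᵥ X ω)
      set g := condExp mt P (fun ω => Z ω ⬝ᵥ Y ω)
      have hf : StronglyMeasurable[mt] f := stronglyMeasurable_condExp
      have hg : StronglyMeasurable[mt] g := stronglyMeasurable_condExp
      set B : Set S := {ω | f ω ≤ g ω}
      have hB : MeasurableSet[mt] B := measurableSet_le_fun hf.measurable hg.measurable
      refine ⟨_, ⟨_, hA X hX Y hY (B.indicator 1) (measurable_const.indicator hB)
        (Filter.Eventually.of_forall fun ω => by by_cases h : ω ∈ B <;> simp [h]), rfl⟩, ?_⟩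
      have e : (fun ω => Z ω ⬝ᵥ (B.indicator (1 : S → ℝ) ω • X ω +
          (1 - B.indicator (1 : S → ℝ) ω) • Y ω)) =
          B.indicator (fun ω => Z ω ⬝ᵥ X ω) + Bᶜ.indicator (fun ω => Z ω ⬝ᵥ Y ω) := by
        ext ω; by_cases h : ω ∈ B <;> simp [h]
      simp only [e]
      refine (condExp_add ((integrable_dot le_rfl hZ (hAs hX)).indicator (hm _ hB))
        ((integrable_dot le_rfl hZ (hAs hY)).indicator (hm _ hB.compl)) mt).trans ?_
      filter_upwards [condExp_indicator (integrable_dot le_rfl hZ (hAs hX)) hB,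
        condExp_indicator (integrable_dot le_rfl hZ (hAs hY)) hB.compl] with ω h1 h2
      rw [Pi.add_apply, h1, h2]
      by_cases h : ω ∈ B
      · simp only [h, indicator_of_mem, mem_compl_iff, not_true_eq_false, not_false_eq_true,
          indicator_of_notMem, add_zero]
        exact (min_eq_left h).symm
      · simp only [h, indicator_of_mem, mem_compl_iff, not_false_eq_true,
          indicator_of_notMem, zero_add]
        exact (min_eq_right (not_le.1 h).le).symm)
    (c := c)
    (by rintro _ ⟨Y, hY, rfl⟩; simp only [integral_condExp hm]; exact hc Y hY)
  refine ⟨condExp mt P σ, stronglyMeasurable_condExp.measurable, integrable_condExp,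
    fun Y hY => ?_, by rwa [integral_condExp hm]⟩
  have h4 := condExp_mono (m := mt) h1 integrable_condExp (h2 _ ⟨Y, hY, rfl⟩)
  rwa [condExp_of_stronglyMeasurable hm stronglyMeasurable_condExp integrable_condExp] at h4

end CondExp

end SetRisk

namespace SetRisk

section Elig

variable {S : Type*} {d m : ℕ} {mt mS : MeasurableSpace S} {P : Measure S}

theorem Elig_add {u v : S → Fin d → ℝ} (hu : u ∈ Elig mt P m) (hv : v ∈ Elig mt P m) :
    u + v ∈ Elig mt P m := by
  refine ⟨LInf_add hu.1 hv.1, ?_⟩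
  filter_upwards [hu.2, hv.2] with ω h1 h2 i hi
  simp [h1 i hi, h2 i hi]

theorem Elig_sub {u v : S → Fin d → ℝ} (hu : u ∈ Elig mt P m) (hv : v ∈ Elig mt P m) :
    u - v ∈ Elig mt P m := by
  refine ⟨LInf_sub hu.1 hv.1, ?_⟩
  filter_upwards [hu.2, hv.2] with ω h1 h2 i hi
  simp [h1 i hi, h2 i hi]

theorem Elig_zero : (0 : S → Fin d → ℝ) ∈ Elig mt P m :=
  ⟨LInf_zero, Filter.Eventually.of_forall fun _ _ _ => rfl⟩

theorem Elig_lcomb (hm : mt ≤ mS) {X Y : S → Fin d → ℝ} (hX : X ∈ Elig mt P m)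
    (hY : Y ∈ Elig mt P m) {l : S → ℝ} (hl : Measurable[mt] l)
    (hl1 : ∀ᵐ ω ∂P, 0 ≤ l ω ∧ l ω ≤ 1) :
    (fun ω => l ω • X ω + (1 - l ω) • Y ω) ∈ Elig mt P m := by
  refine ⟨LInf_lcomb hm hX.1 hY.1 hl hl1, ?_⟩
  filter_upwards [hX.2, hY.2] with ω h1 h2 i hi
  simp [h1 i hi, h2 i hi]

theorem indicator_add_compl_eq (A : Set S) (u v : S → Fin d → ℝ) :
    A.indicator u + Aᶜ.indicator v =
      fun ω => A.indicator (1 : S → ℝ) ω • u ω + (1 - A.indicator (1 : S → ℝ) ω) • v ω := by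
  ext ω i; by_cases h : ω ∈ A <;> simp [h]

theorem indicator_one_bounds (A : Set S) (P : Measure S) :
    ∀ᵐ ω ∂P, 0 ≤ A.indicator (1 : S → ℝ) ω ∧ A.indicator (1 : S → ℝ) ω ≤ 1 :=
  Filter.Eventually.of_forall fun ω => by by_cases h : ω ∈ A <;> simp [h]

theorem Elig_paste (hm : mt ≤ mS) {u v : S → Fin d → ℝ} (hu : u ∈ Elig mt P m)
    (hv : v ∈ Elig mt P m) {A : Set S} (hA : MeasurableSet[mt] A) :
    A.indicator u + Aᶜ.indicator v ∈ Elig mt P m := by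
  rw [indicator_add_compl_eq]
  exact Elig_lcomb hm hu hv (measurable_const.indicator hA) (indicator_one_bounds A P)

theorem const_mem_Elig [IsFiniteMeasure P] {c : Fin d → ℝ} (hc : c ∈ eligible m d) :
    (fun _ => c) ∈ Elig mt P m :=
  ⟨⟨measurable_const, memLp_const c⟩, Filter.Eventually.of_forall fun _ => hc⟩

end Elig

section Acceptance

variable {S : Type*} {d m : ℕ} {mt mX mS : MeasurableSpace S} {P : Measure S}
  {R : (S → Fin d → ℝ) → Set (S → Fin d → ℝ)}

theorem IsVectorRM.mem_iff_add_mem_accVec (h : IsVectorRM mX mt P m R) (hm : mt ≤ mX)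
    {X u : S → Fin d → ℝ} (hX : X ∈ LInf mX P) (hu : u ∈ Elig mt P m) :
    u ∈ R X ↔ X + u ∈ accVec mX P R := by
  have h1 := h.cash X hX u hu
  constructor
  · intro h2
    refine ⟨LInf_add hX (LInf_mono hm hu.1), ?_⟩
    rw [h1]
    exact ⟨u, h2, sub_self u⟩
  · rintro ⟨_, h2⟩
    rw [h1] at h2
    obtain ⟨v, hv, h3⟩ := h2
    rwa [← sub_eq_zero.1 h3]

theorem IsVectorRM.mem_zero_iff (h : IsVectorRM mX mt P m R) (hm : mt ≤ mX)
    {u : S → Fin d → ℝ} (hu : u ∈ Elig mt P m) : u ∈ R 0 ↔ u ∈ accVec mX P R := by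
  rw [h.mem_iff_add_mem_accVec hm LInf_zero hu, zero_add]

theorem IsVectorRM.subset_Elig (h : IsVectorRM mX mt P m R) {X : S → Fin d → ℝ}
    (hX : X ∈ LInf mX P) : R X ⊆ Elig mt P m := (h.upper X hX).1

theorem IsVectorRM.accVec_mono (h : IsVectorRM mX mt P m R) {X Y : S → Fin d → ℝ}
    (hX : X ∈ accVec mX P R) (hY : Y ∈ LInf mX P) (hXY : ∀ᵐ ω ∂P, X ω ≤ Y ω) :
    Y ∈ accVec mX P R := ⟨hY, h.mono X hX.1 Y hY hXY hX.2⟩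

theorem IsVectorRM.exists_accVec_Elig (h : IsVectorRM mX mt P m R) (hm : mt ≤ mX) :
    ∃ u ∈ Elig mt P m, u ∈ R 0 ∧ u ∈ accVec mX P R := by
  obtain ⟨u, hu⟩ := h.zero.1
  have := h.subset_Elig LInf_zero hu
  exact ⟨u, this, hu, (h.mem_zero_iff hm this).1 hu⟩

theorem IsClosedConvexVectorRM.accVec_lcomb (h : IsClosedConvexVectorRM mX mt P m R)
    (hm : mt ≤ mX) (hX : mX ≤ mS)
    {X Y : S → Fin d → ℝ} (hXA : X ∈ accVec mX P R) (hYA : Y ∈ accVec mX P R)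
    {l : S → ℝ} (hl : Measurable[mt] l) (hl1 : ∀ᵐ ω ∂P, 0 ≤ l ω ∧ l ω ≤ 1) :
    (fun ω => l ω • X ω + (1 - l ω) • Y ω) ∈ accVec mX P R := by
  refine ⟨LInf_lcomb hX hXA.1 hYA.1 (hl.mono hm le_rfl) hl1, ?_⟩
  have := h.convex X hXA.1 Y hYA.1 l hl hl1 0 hXA.2 0 hYA.2
  simpa using! this

theorem IsClosedConvexVectorRM.accVec_convex (h : IsClosedConvexVectorRM mX mt P m R)
    (hm : mt ≤ mX) (hX : mX ≤ mS) : Convex ℝ (accVec mX P R) := by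
  intro X hXA Y hYA a b ha hb hab
  have := h.accVec_lcomb hm hX hXA hYA (l := fun _ => a) measurable_const
    (Filter.Eventually.of_forall fun _ => ⟨ha, by linarith⟩)
  have e : b = 1 - a := by linarith
  rw [e]
  exact this

theorem IsClosedConvexVectorRM.accVec_closed (h : IsClosedConvexVectorRM mX mt P m R) :
    @IsClosed _ (weakTop mX P (LInf mX P))
      (Subtype.val ⁻¹' accVec mX P R : Set (LInf (d := d) mX P)) := by
  let := weakTop mX P (LInf (d := d) mX P)
  let := weakTop mt P (Elig (d := d) mt P m)
  have h1 : Continuous fun X : LInf (d := d) mX P =>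
      (X, (⟨0, Elig_zero⟩ : Elig (d := d) mt P m)) := by fun_prop
  convert! h.closed.preimage h1
  ext X
  exact ⟨fun hX => hX.2, fun hX => ⟨X.2, hX⟩⟩

/-- Separation of a claim which is not acceptable, with a conditional bound. -/
theorem IsClosedConvexVectorRM.exists_separation [IsFiniteMeasure P]
    (h : IsClosedConvexVectorRM mX mt P m R) (hm : mt ≤ mX) (hX : mX ≤ mS)
    {X : S → Fin d → ℝ} (hXL : X ∈ LInf mX P) (hXA : X ∉ accVec mX P R) :
    ∃ Z ∈ LOnePos (d := d) mX P, ∃ σ : S → ℝ, Measurable[mt] σ ∧ Integrable σ P ∧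
      (∀ Y ∈ accVec mX P R, σ ≤ᵐ[P] condExp mt P (fun ω => Z ω ⬝ᵥ Y ω)) ∧
      ∫ ω, Z ω ⬝ᵥ X ω ∂P < ∫ ω, σ ω ∂P := by
  obtain ⟨Z, hZ, c, h1, h2⟩ := exists_LOne_separation hX (h.accVec_convex hm hX) (fun _ h => h.1)
    h.accVec_closed hXL hXA
  obtain ⟨u, huE, -, hu⟩ := h.exists_accVec_Elig hm
  refine ⟨Z, ⟨hZ, ?_⟩, ?_⟩
  · rw [ae_all_iff]
    intro i
    have hZi : Measurable[mX] (fun ω => Z ω i) := measurable_apply hZ.1 i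
    set B : Set S := {ω | Z ω i < 0} with hB
    have hBm : MeasurableSet[mX] B := measurableSet_lt_fun hZi measurable_const
    set H : S → Fin d → ℝ := B.indicator fun _ => Pi.single i 1 with hH
    have hHL : H ∈ LInf mX P := by
      rw [mem_LInf_iff hX]
      refine ⟨measurable_const.indicator hBm, 1, Filter.Eventually.of_forall fun ω j => ?_⟩
      by_cases hω : ω ∈ B
      · simp only [hH, hω, indicator_of_mem]
        by_cases hj : j = i
        · subst hj; simp
        · simp [hj]
      · simp [hH, hω]
    have hdot : ∀ ω, Z ω ⬝ᵥ H ω = min (Z ω i) 0 := by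
      intro ω
      by_cases hω : ω ∈ B
      · simp only [hH, hω, indicator_of_mem, dotProduct_single, mul_one]
        exact (min_eq_left (le_of_lt hω)).symm
      · simp only [hH, hω, not_false_eq_true, indicator_of_notMem, dotProduct_zero]
        exact (min_eq_right (not_lt.1 hω)).symm
    have hint : Integrable (fun ω => Z ω ⬝ᵥ H ω) P := integrable_dot hX (LOne_mono hX hZ) hHL
    have hle : ∀ n : ℕ, c ≤ ∫ ω, Z ω ⬝ᵥ u ω ∂P + n * ∫ ω, Z ω ⬝ᵥ H ω ∂P := by
      intro n
      have hA : u + (n : ℝ) • H ∈ accVec mX P R := by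
        refine h.accVec_mono hu (LInf_add hu.1 (LInf_smul _ hHL))
          (Filter.Eventually.of_forall fun ω j => ?_)
        have : 0 ≤ (n : ℝ) * H ω j := by
          refine mul_nonneg n.cast_nonneg ?_
          by_cases hω : ω ∈ B
          · simp only [hH, hω, indicator_of_mem]
            by_cases hj : j = i
            · subst hj; simp
            · simp [hj]
          · simp [hH, hω]
        simpa using this
      have := h2 _ hA
      rw [← integral_const_mul, ← integral_add (integrable_dot hX (LOne_mono hX hZ) hu.1)
        (hint.const_mul _)]
      simpa [dotProduct_add, dotProduct_smul] using this
    have hnn : 0 ≤ ∫ ω, Z ω ⬝ᵥ H ω ∂P := by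
      by_contra! hneg
      obtain ⟨n, hn⟩ := exists_nat_gt ((∫ ω, Z ω ⬝ᵥ u ω ∂P - c) / (-∫ ω, Z ω ⬝ᵥ H ω ∂P))
      rw [div_lt_iff₀ (by linarith)] at hn
      have := hle n
      linarith
    have hle0 : (fun ω => -(Z ω ⬝ᵥ H ω)) =ᵐ[P] 0 := by
      refine (integral_eq_zero_iff_of_nonneg (fun ω => ?_) hint.neg).1 ?_
      · simp [hdot]
      · change ∫ ω, -(Z ω ⬝ᵥ H ω) ∂P = 0
        rw [integral_neg]
        refine neg_eq_zero.2 (le_antisymm (integral_nonpos fun ω => ?_) hnn)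
        simp [hdot]
    filter_upwards [hle0] with ω hω
    simp only [hdot, Pi.zero_apply, neg_eq_zero] at hω
    rw [← hω]
    exact min_le_left _ _
  · obtain ⟨σ, a1, a2, a3, a4⟩ := exists_condExp_lowerBound (hm.trans hX)
      (A := accVec mX P R) (fun Y hY => LInf_mono hX hY.1) ⟨u, hu⟩
      (fun X hX1 Y hY l hl hl1 => h.accVec_lcomb hm hX hX1 hY hl hl1) (LOne_mono hX hZ) h2
    exact ⟨σ, a1, a2, a3, h1.trans_le a4⟩

end Acceptance

end SetRisk

namespace SetRisk

section Linear

variable {S : Type*} {d m : ℕ} {mt mS : MeasurableSpace S} {P : Measure S}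

theorem condExp_dot_add_smul_left {Z Z' Y : S → Fin d → ℝ} (hZ : Z ∈ LOne mS P)
    (hZ' : Z' ∈ LOne mS P) (hY : Y ∈ LInf mS P) (ε : ℝ) :
    condExp mt P (fun ω => (Z + ε • Z') ω ⬝ᵥ Y ω) =ᵐ[P]
      fun ω => condExp mt P (fun ω => Z ω ⬝ᵥ Y ω) ω + ε * condExp mt P (fun ω => Z' ω ⬝ᵥ Y ω) ω := by
  have e : (fun ω => (Z + ε • Z') ω ⬝ᵥ Y ω) =
      (fun ω => Z ω ⬝ᵥ Y ω) + ε • (fun ω => Z' ω ⬝ᵥ Y ω) := by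
    ext ω; simp [add_dotProduct, smul_dotProduct]
  rw [e]
  refine (condExp_add (integrable_dot le_rfl hZ hY)
    ((integrable_dot le_rfl hZ' hY).smul ε) mt).trans ?_
  filter_upwards [condExp_smul (μ := P) ε (fun ω => Z' ω ⬝ᵥ Y ω) mt] with ω h
  simp [h]

theorem condVec_add_smul {Z Z' : S → Fin d → ℝ} (hZ : Z ∈ LOne mS P)
    (hZ' : Z' ∈ LOne mS P) (ε : ℝ) :
    ∀ᵐ ω ∂P, ∀ i, condVec mt P (Z + ε • Z') ω i = condVec mt P Z ω i + ε * condVec mt P Z' ω i := by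
  rw [ae_all_iff]
  intro i
  have e : (fun ω => (Z + ε • Z') ω i) = (fun ω => Z ω i) + ε • (fun ω => Z' ω i) := rfl
  unfold condVec
  rw [e]
  filter_upwards [condExp_add ((mem_LOne_iff.1 hZ).2 i) (((mem_LOne_iff.1 hZ').2 i).smul ε) mt,
    condExp_smul (μ := P) ε (fun ω => Z' ω i) mt] with ω h1 h2
  rw [h1]; simp [h2]

theorem condVec_indicator {Z : S → Fin d → ℝ} (hZ : Z ∈ LOne mS P) {B : Set S}
    (hB : MeasurableSet[mt] B) :
    condVec mt P (B.indicator Z) =ᵐ[P] B.indicator (condVec mt P Z) := by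
  have : ∀ᵐ ω ∂P, ∀ i, condVec mt P (B.indicator Z) ω i = B.indicator (condVec mt P Z) ω i := by
    rw [ae_all_iff]
    intro i
    have e : (fun ω => B.indicator Z ω i) = B.indicator (fun ω => Z ω i) := by
      ext ω; by_cases h : ω ∈ B <;> simp [h]
    unfold condVec
    rw [e]
    filter_upwards [condExp_indicator ((mem_LOne_iff.1 hZ).2 i) hB] with ω h
    rw [h]
    by_cases h : ω ∈ B <;> simp [h]
  filter_upwards [this] with ω h
  exact funext h

theorem condVec_nonneg {Z : S → Fin d → ℝ} (hZ : ∀ᵐ ω ∂P, ∀ i, 0 ≤ Z ω i) :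
    ∀ᵐ ω ∂P, ∀ i, 0 ≤ condVec mt P Z ω i := by
  rw [ae_all_iff] at hZ ⊢
  exact fun i => condExp_nonneg (hZ i)

theorem condExp_dot_add_right (hm : mt ≤ mS) [IsFiniteMeasure P] {Z Y v : S → Fin d → ℝ}
    (hZ : Z ∈ LOne mS P) (hY : Y ∈ LInf mS P) (hv : v ∈ LInf mt P) :
    condExp mt P (fun ω => Z ω ⬝ᵥ (Y + v) ω) =ᵐ[P]
      fun ω => condExp mt P (fun ω => Z ω ⬝ᵥ Y ω) ω + condVec mt P Z ω ⬝ᵥ v ω := by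
  have e : (fun ω => Z ω ⬝ᵥ (Y + v) ω) = (fun ω => Z ω ⬝ᵥ Y ω) + (fun ω => Z ω ⬝ᵥ v ω) := by
    ext ω; simp [dotProduct_add]
  rw [e]
  refine (condExp_add (integrable_dot le_rfl hZ hY) (integrable_dot hm hZ hv) mt).trans ?_
  filter_upwards [condExp_dot_right hm hZ hv] with ω h
  simp [h]

/-- The truncation of a vector to the eligible assets. -/
def truncElig (m : ℕ) (x : Fin d → ℝ) : Fin d → ℝ := fun i => if (i : ℕ) < m then x i else 0

theorem truncElig_mem (x : Fin d → ℝ) : truncElig m x ∈ eligible m d := fun i hi => by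
  simp [truncElig, not_lt.2 hi]

theorem truncElig_eq {x : Fin d → ℝ} (hx : x ∈ eligible m d) : truncElig m x = x := by
  ext i
  by_cases h : (i : ℕ) < m
  · simp [truncElig, h]
  · simp [truncElig, h, hx i (not_lt.1 h)]

theorem continuous_truncElig : Continuous (truncElig m : (Fin d → ℝ) → Fin d → ℝ) := by
  refine continuous_pi fun i => ?_
  by_cases h : (i : ℕ) < m
  · simpa [truncElig, h] using! continuous_apply i
  · simpa [truncElig, h] using! continuous_const

theorem measurable_truncElig {X : S → Fin d → ℝ} (hX : Measurable[mt] X) :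
    Measurable[mt] (fun ω => truncElig m (X ω)) := continuous_truncElig.measurable.comp hX

theorem subset_of_rat_mem {G : Set (Fin d → ℝ)} (hG : IsClosed G)
    (h : ∀ q : Fin d → ℚ, truncElig m (fun i => (q i : ℝ)) ∈ G) : eligible m d ⊆ G := by
  have hd : DenseRange (fun (q : Fin d → ℚ) (i : Fin d) => (q i : ℝ)) :=
    DenseRange.piMap (f := fun _ : Fin d => ((↑) : ℚ → ℝ)) fun _ => Rat.denseRange_cast
  have h2 : truncElig m ⁻¹' G = univ := by
    refine (hG.preimage continuous_truncElig).closure_eq ▸ ?_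
    exact (hd.mono (s₂ := truncElig m ⁻¹' G) (by rintro _ ⟨q, rfl⟩; exact h q)).closure_eq
  intro x hx
  have : x ∈ truncElig m ⁻¹' G := h2 ▸ mem_univ x
  rwa [mem_preimage, truncElig_eq hx] at this

theorem measurableSet_section {E : Type*} [MeasurableSpace E] {G : Set (S × E)}
    (hG : MeasurableSet[mt.prod inferInstance] G) (c : E) :
    MeasurableSet[mt] {ω | (ω, c) ∈ G} :=
  @measurable_prodMk_right S E mt _ c G hG

end Linear

end SetRisk

namespace SetRisk

section Core

variable {S : Type*} {d m : ℕ} {mt mX mS : MeasurableSpace S} {P : Measure S}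
  {R : (S → Fin d → ℝ) → Set (S → Fin d → ℝ)}

/-- The total conditional weight of the eligible assets. -/
noncomputable def eligWeight (m : ℕ) (mt : MeasurableSpace S) {mS : MeasurableSpace S}
    (P : Measure S) (Z : S → Fin d → ℝ) (ω : S) : ℝ :=
  ∑ i, truncElig m (condVec mt P Z ω) i

theorem measurable_eligWeight (Z : S → Fin d → ℝ) : Measurable[mt] (eligWeight m mt P Z) :=
  Finset.measurable_fun_sum _ fun i _ =>
    measurable_apply (measurable_truncElig (condVec_mem_LOne (mt := mt) (P := P) Z).1) i

theorem truncElig_nonneg {x : Fin d → ℝ} (hx : ∀ i, 0 ≤ x i) (i : Fin d) :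
    0 ≤ truncElig m x i := by
  unfold truncElig
  split_ifs
  exacts [hx i, le_rfl]

/-- A value of a risk measure at zero which is a.s. different from `M` yields dual elements with
positive weight of the eligible assets on a part of every nonnull event. -/
theorem IsClosedConvexVectorRM.exists_eligWeight_pos [IsProbabilityMeasure P]
    (h : IsClosedConvexVectorRM mX mt P m R) (hm : mt ≤ mX) (hX : mX ≤ mS)
    {B : Set S} (hB : MeasurableSet[mt] B) (hPB : P B ≠ 0) :
    ∃ Z ∈ LOnePos (d := d) mX P, ∃ σ : S → ℝ, Measurable[mt] σ ∧ Integrable σ P ∧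
      (∀ Y ∈ accVec mX P R, σ ≤ᵐ[P] condExp mt P (fun ω => Z ω ⬝ᵥ Y ω)) ∧
      P (B ∩ {ω | 0 < eligWeight m mt P Z ω}) ≠ 0 := by
  have hmS := hm.trans hX
  obtain ⟨-, -, -, G, hGm, hG0, hGae⟩ := h.zero
  have hsec : ∀ c : Fin d → ℝ, MeasurableSet[mt] {ω | (ω, c) ∈ G} :=
    fun c => measurableSet_section hGm c
  obtain ⟨c, hcM, hc⟩ : ∃ c ∈ eligible m d, P (B ∩ {ω | (ω, c) ∈ G}ᶜ) ≠ 0 := by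
    by_contra! hcon
    refine hPB ?_
    have h1 : ∀ᵐ ω ∂P, ∀ q : Fin d → ℚ, ω ∈ B → (ω, truncElig m fun i => (q i : ℝ)) ∈ G := by
      rw [ae_all_iff]
      intro q
      have := measure_eq_zero_iff_ae_notMem.1 (hcon _ (truncElig_mem (fun i => (q i : ℝ))))
      filter_upwards [this] with ω hω hωB
      by_contra hωG
      exact hω ⟨hωB, hωG⟩
    rw [measure_eq_zero_iff_ae_notMem]
    filter_upwards [h1, hGae] with ω h1 h2 hωB
    exact h2.2.2 (h2.2.1.antisymm (subset_of_rat_mem h2.1 fun q => h1 q hωB))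
  set B1 := B ∩ {ω | (ω, c) ∈ G}ᶜ with hB1
  have hB1m : MeasurableSet[mt] B1 := hB.inter (hsec c).compl
  obtain ⟨u0, hu0E, hu0, hu0A⟩ := h.exists_accVec_Elig hm
  set u1 : S → Fin d → ℝ := B1.indicator (fun _ => c) + B1ᶜ.indicator u0 with hu1
  have hu1E : u1 ∈ Elig mt P m := Elig_paste hmS (const_mem_Elig hcM) hu0E hB1m
  have hu1A : u1 ∉ accVec mX P R := by
    intro hA
    have h2 := (h.mem_zero_iff hm hu1E).2 hA
    rw [hG0] at h2
    refine hc (measure_eq_zero_iff_ae_notMem.2 ?_)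
    filter_upwards [h2.2] with ω hω hωB
    have : u1 ω = c := by simp [hu1, hωB]
    rw [this] at hω
    exact hωB.2 hω
  obtain ⟨Z, hZ, σ, hσm, hσi, hσA, hσ⟩ := h.exists_separation hm hX (LInf_mono hm hu1E.1) hu1A
  refine ⟨Z, hZ, σ, hσm, hσi, hσA, fun hnull => ?_⟩
  have hZL := LOne_mono hX hZ.1
  have hdE : u0 - u1 ∈ Elig mt P m := Elig_sub hu0E hu1E
  have h3 : ∫ ω, Z ω ⬝ᵥ (u0 - u1) ω ∂P = 0 := by
    rw [← integral_condExp hmS]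
    refine integral_eq_zero_of_ae ?_
    filter_upwards [condExp_dot_right hmS hZL hdE.1, measure_eq_zero_iff_ae_notMem.1 hnull,
      condVec_nonneg (mt := mt) hZ.2, hdE.2] with ω h4 h5 h6 h7
    rw [h4]
    refine Finset.sum_eq_zero fun i _ => ?_
    by_cases hω : ω ∈ B1
    · by_cases hi : (i : ℕ) < m
      · have h8 : eligWeight m mt P Z ω ≤ 0 := by
          by_contra! h8
          exact h5 ⟨hω.1, h8⟩
        have h9 := (Finset.sum_eq_zero_iff_of_nonneg fun i _ => truncElig_nonneg (m := m) h6 i).1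
          (le_antisymm h8 (Finset.sum_nonneg fun i _ => truncElig_nonneg (m := m) h6 i)) i
          (Finset.mem_univ i)
        simp only [truncElig, hi, if_true] at h9
        rw [h9, zero_mul]
      · rw [h7 i (not_lt.1 hi), mul_zero]
    · simp [hu1, hω]
  have h4 : ∫ ω, Z ω ⬝ᵥ (u0 - u1) ω ∂P = ∫ ω, Z ω ⬝ᵥ u0 ω ∂P - ∫ ω, Z ω ⬝ᵥ u1 ω ∂P := by
    rw [← integral_sub (integrable_dot hmS hZL hu0E.1) (integrable_dot hmS hZL hu1E.1)]
    simp [dotProduct_sub]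
  have h5 : ∫ ω, σ ω ∂P ≤ ∫ ω, Z ω ⬝ᵥ u0 ω ∂P := by
    rw [← integral_condExp hmS (f := fun ω => Z ω ⬝ᵥ u0 ω)]
    exact integral_mono_ae hσi integrable_condExp (hσA u0 hu0A)
  linarith

/-- Conditional separation of a portfolio which does not compensate the risk of a claim. -/
theorem IsClosedConvexVectorRM.exists_dual [IsProbabilityMeasure P]
    (h : IsClosedConvexVectorRM mX mt P m R) (hm : mt ≤ mX) (hX : mX ≤ mS)
    {X u : S → Fin d → ℝ} (hXL : X ∈ LInf mX P) (hu : u ∈ Elig mt P m) (huX : u ∉ R X) :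
    ∃ Z ∈ LOnePos (d := d) mX P, ∃ v ∈ Elig (d := d) mt P m, ∃ B, MeasurableSet[mt] B ∧ P B ≠ 0 ∧
      (∀ᵐ ω ∂P, ω ∈ B → ∃ i : Fin d, (i : ℕ) < m ∧ 0 < condVec mt P Z ω i) ∧
      (∀ Y ∈ accVec mX P R, 0 ≤ᵐ[P] condExp mt P (fun ω => Z ω ⬝ᵥ (Y + v) ω)) ∧
      ∀ᵐ ω ∂P, ω ∈ B → condExp mt P (fun ω => Z ω ⬝ᵥ (X + u + v) ω) ω < 0 := by
  have hmS := hm.trans hX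
  rw [h.toIsVectorRM.mem_iff_add_mem_accVec hm hXL hu] at huX
  set X0 := X + u with hX0
  have hX0L : X0 ∈ LInf mX P := LInf_add hXL (LInf_mono hm hu.1)
  have hX0S : X0 ∈ LInf mS P := LInf_mono hX hX0L
  obtain ⟨Z, hZ, σ, hσm, hσi, hσA, hσ⟩ := h.exists_separation hm hX hX0L huX
  have hZL := LOne_mono hX hZ.1
  set f := condExp mt P (fun ω => Z ω ⬝ᵥ X0 ω) with hf
  have hfm : Measurable[mt] f := stronglyMeasurable_condExp.measurable
  set B0 : Set S := {ω | f ω < σ ω} with hB0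
  have hB0m : MeasurableSet[mt] B0 := measurableSet_lt_fun hfm hσm
  have hPB0 : P B0 ≠ 0 := by
    intro h0
    have h1 : σ ≤ᵐ[P] f := by
      filter_upwards [measure_eq_zero_iff_ae_notMem.1 h0] with ω hω
      exact not_lt.1 hω
    have h2 := integral_mono_ae hσi integrable_condExp h1
    rw [integral_condExp hmS] at h2
    linarith
  obtain ⟨Z', hZ', σ', hσm', hσi', hσA', hP⟩ := h.exists_eligWeight_pos hm hX hB0m hPB0
  have hZL' := LOne_mono hX hZ'.1
  set f' := condExp mt P (fun ω => Z' ω ⬝ᵥ X0 ω) with hf'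
  have hfm' : Measurable[mt] f' := stronglyMeasurable_condExp.measurable
  set e' := eligWeight m mt P Z' with he'
  have hem' : Measurable[mt] e' := measurable_eligWeight Z'
  let ε : ℕ → ℝ := fun n => 1 / ((n : ℝ) + 1)
  have hε : ∀ n, 0 < ε n := fun n => Nat.one_div_pos_of_nat
  let Bn : ℕ × ℕ → Set S := fun p => ((B0 ∩ {ω | 0 < e' ω}) ∩
    {ω | f ω + ε p.1 * f' ω < σ ω + ε p.1 * σ' ω}) ∩
    {ω | |σ ω + ε p.1 * σ' ω| ≤ p.2 * (ε p.1 * e' ω)}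
  obtain ⟨⟨n, k⟩, hnk⟩ : ∃ p, P (Bn p) ≠ 0 := by
    by_contra! hcon
    refine hP (measure_mono_null ?_ (measure_iUnion_null hcon))
    intro ω hω
    have h1 : Filter.Tendsto (fun n => f ω - σ ω + ε n * (f' ω - σ' ω)) Filter.atTop
        (nhds (f ω - σ ω + 0 * (f' ω - σ' ω))) :=
      (tendsto_one_div_add_atTop_nhds_zero_nat.mul_const _).const_add _
    rw [zero_mul, add_zero] at h1
    obtain ⟨n, hn⟩ := (h1.eventually_lt_const (sub_neg.2 hω.1)).exists
    obtain ⟨k, hk⟩ := exists_nat_ge (|σ ω + ε n * σ' ω| / (ε n * e' ω))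
    rw [div_le_iff₀ (mul_pos (hε n) hω.2)] at hk
    refine mem_iUnion.2 ⟨(n, k), ⟨hω, ?_⟩, hk⟩
    simp only [mem_ofPred_eq]
    linarith
  set B := Bn (n, k) with hB
  set η := ε n with hη
  have hη0 : 0 < η := hε n
  have hBm : MeasurableSet[mt] B :=
    ((hB0m.inter (measurableSet_lt_fun measurable_const hem')).inter
      (measurableSet_lt_fun (hfm.add (measurable_const.mul hfm'))
        (hσm.add (measurable_const.mul hσm')))).inter
      (measurableSet_le_fun (continuous_abs.measurable.comp (hσm.add (measurable_const.mul hσm')))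
        (measurable_const.mul (measurable_const.mul hem')))
  set Z2 := Z + η • Z' with hZ2
  have hZ2L : Z2 ∈ LOne mX P := LOne_add hZ.1 (LOne_smul η hZ'.1)
  have hZ2S := LOne_mono hX hZ2L
  set W := eligWeight m mt P Z2 with hW
  have hWm : Measurable[mt] W := measurable_eligWeight Z2
  have hWe : ∀ᵐ ω ∂P, η * e' ω ≤ W ω := by
    filter_upwards [condVec_add_smul (mt := mt) hZL hZL' η, condVec_nonneg (mt := mt) hZ.2]
      with ω h1 h2
    rw [hW, he', eligWeight, eligWeight, Finset.mul_sum]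
    refine Finset.sum_le_sum fun i _ => ?_
    unfold truncElig
    split_ifs
    · rw [h1]
      have := h2 i
      linarith
    · simp
  set s : S → ℝ := fun ω => σ ω + η * σ' ω with hs
  set v : S → Fin d → ℝ := fun ω => truncElig m (fun _ => -(B.indicator (fun ω => s ω / W ω) ω))
    with hv
  have hvE : v ∈ Elig mt P m := by
    refine ⟨(mem_LInf_iff hmS).2 ⟨measurable_truncElig (measurable_of_apply fun i =>
      (((hσm.add (measurable_const.mul hσm')).div hWm).indicator hBm).neg), k, ?_⟩,
      Filter.Eventually.of_forall fun ω => truncElig_mem _⟩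
    filter_upwards [hWe] with ω h1 i
    by_cases hi : (i : ℕ) < m
    · simp only [hv, truncElig, hi, if_true, abs_neg]
      by_cases hω : ω ∈ B
      · have h2 : 0 < η * e' ω := mul_pos hη0 hω.1.1.2
        rw [indicator_of_mem hω, abs_div, abs_of_pos (h2.trans_le h1), div_le_iff₀ (h2.trans_le h1)]
        exact (hω.2 : |s ω| ≤ k * (η * e' ω)).trans
          (mul_le_mul_of_nonneg_left h1 k.cast_nonneg)
      · rw [indicator_of_notMem hω]; simp
    · simp [hv, truncElig, hi]
  have hdot : ∀ᵐ ω ∂P, ω ∈ B → condVec mt P Z2 ω ⬝ᵥ v ω = -s ω := by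
    filter_upwards [hWe] with ω h1 hω
    have h2 : 0 < W ω := (mul_pos hη0 hω.1.1.2).trans_le h1
    have h3 : condVec mt P Z2 ω ⬝ᵥ v ω = ∑ i, truncElig m (condVec mt P Z2 ω) i * -(s ω / W ω) := by
      refine Finset.sum_congr rfl fun i _ => ?_
      by_cases hi : (i : ℕ) < m
      · simp [hv, truncElig, hi, indicator_of_mem hω]
      · simp [hv, truncElig, hi]
    rw [h3, ← Finset.sum_mul]
    change W ω * _ = _
    field_simp
  have hexp : ∀ Y ∈ LInf mX P, ∀ᵐ ω ∂P, condExp mt P (fun ω => B.indicator Z2 ω ⬝ᵥ (Y + v) ω) ω =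
      B.indicator (fun ω => condExp mt P (fun ω => Z ω ⬝ᵥ Y ω) ω +
        η * condExp mt P (fun ω => Z' ω ⬝ᵥ Y ω) ω - s ω) ω := by
    intro Y hY
    have hYS := LInf_mono hX hY
    filter_upwards [condExp_dot_indicator hZ2S (LInf_add hYS (LInf_mono hmS hvE.1)) hBm,
      condExp_dot_add_right hmS hZ2S hYS hvE.1, condExp_dot_add_smul_left (mt := mt) hZL hZL' hYS η,
      hdot] with ω h1 h2 h3 h4
    rw [h1]
    by_cases hω : ω ∈ B
    · simp only [indicator_of_mem hω]
      rw [h2, h3, h4 hω]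
      ring
    · simp only [indicator_of_notMem hω]
  refine ⟨B.indicator Z2, ⟨⟨hZ2L.1.indicator (hm _ hBm), hZ2L.2.indicator (hmS _ hBm)⟩, ?_⟩,
    v, hvE, B, hBm, hnk, ?_, ?_, ?_⟩
  · filter_upwards [hZ.2, hZ'.2] with ω h1 h2 i
    by_cases hω : ω ∈ B
    · simp only [indicator_of_mem hω, hZ2, Pi.add_apply, Pi.smul_apply, smul_eq_mul]
      exact add_nonneg (h1 i) (mul_nonneg hη0.le (h2 i))
    · simp [indicator_of_notMem hω]
  · filter_upwards [condVec_indicator hZ2S hBm, hWe] with ω h1 h2 hω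
    have h3 : 0 < W ω := (mul_pos hη0 hω.1.1.2).trans_le h2
    obtain ⟨i, -, hi⟩ := Finset.exists_lt_of_sum_lt (s := Finset.univ) (f := fun _ : Fin d => (0 : ℝ))
      (g := fun i => truncElig m (condVec mt P Z2 ω) i) (by rw [Finset.sum_const_zero]; exact h3)
    by_cases him : (i : ℕ) < m
    · refine ⟨i, him, ?_⟩
      rw [h1, indicator_of_mem hω]
      simpa [truncElig, him] using hi
    · simp [truncElig, him] at hi
  · intro Y hY
    filter_upwards [hexp Y hY.1, hσA Y hY, hσA' Y hY] with ω h1 h2 h3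
    rw [h1]
    by_cases hω : ω ∈ B
    · simp only [indicator_of_mem hω, Pi.zero_apply, hs]
      have := mul_le_mul_of_nonneg_left h3 hη0.le
      linarith
    · simp [indicator_of_notMem hω]
  · filter_upwards [hexp X0 hX0L] with ω h1 hω
    rw [h1, indicator_of_mem hω]
    have : f ω + η * f' ω < s ω := hω.1.2
    simp only [← hf, ← hf']
    linarith

end Core

end SetRisk

namespace SetRisk

section NonnegPullOut

variable {S : Type*} {mt ms mS : MeasurableSpace S} {P : Measure S}

theorem lintegral_mul_ofReal_condExp (hm : mt ≤ mS) [IsFiniteMeasure P] {k : S → ℝ≥0∞}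
    (hk : Measurable[mt] k) {f : S → ℝ} (hf : Integrable f P) (hf0 : 0 ≤ᵐ[P] f) :
    ∫⁻ ω, ENNReal.ofReal (f ω) * k ω ∂P = ∫⁻ ω, ENNReal.ofReal (condExp mt P f ω) * k ω ∂P := by
  have key : ∀ g : S → ℝ, Integrable g P → ∫⁻ ω, ENNReal.ofReal (g ω) * k ω ∂P =
      ∫⁻ ω, k ω ∂((P.withDensity fun ω => ENNReal.ofReal (g ω)).trim hm) := by
    intro g hg
    rw [lintegral_trim hm hk]
    exact (lintegral_withDensity_eq_lintegral_mul₀ hg.aestronglyMeasurable.aemeasurable.ennreal_ofReal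
      (hk.mono hm le_rfl).aemeasurable).symm
  rw [key f hf, key _ integrable_condExp]
  congr 1
  refine @Measure.ext _ mt _ _ fun A hA => ?_
  rw [trim_measurableSet_eq hm hA, trim_measurableSet_eq hm hA, withDensity_apply _ (hm _ hA),
    withDensity_apply _ (hm _ hA),
    ← ofReal_integral_eq_lintegral_ofReal hf.integrableOn (ae_restrict_of_ae hf0),
    ← ofReal_integral_eq_lintegral_ofReal integrable_condExp.integrableOn
      (ae_restrict_of_ae (condExp_nonneg hf0)), setIntegral_condExp hm hf hA]

/-- Pull-out property for nonnegative factors, with integrability as a conclusion. -/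
theorem condExp_mul_of_nonneg (hm : mt ≤ mS) [IsFiniteMeasure P] {k f : S → ℝ}
    (hk : Measurable[mt] k) (hk0 : 0 ≤ᵐ[P] k) (hf : Integrable f P) (hf0 : 0 ≤ᵐ[P] f)
    (hint : Integrable (fun ω => k ω * condExp mt P f ω) P) :
    Integrable (fun ω => k ω * f ω) P ∧
      condExp mt P (fun ω => k ω * f ω) =ᵐ[P] fun ω => k ω * condExp mt P f ω := by
  have hkS : Measurable k := hk.mono hm le_rfl
  have h1 : Integrable (fun ω => k ω * f ω) P := by
    refine ⟨hkS.aestronglyMeasurable.mul hf.aestronglyMeasurable, ?_⟩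
    rw [hasFiniteIntegral_iff_ofReal (by
      filter_upwards [hk0, hf0] with ω h1 h2 using mul_nonneg h1 h2)]
    have h2 := hint.2
    rw [hasFiniteIntegral_iff_ofReal (by
      filter_upwards [hk0, condExp_nonneg hf0] with ω h1 h2 using mul_nonneg h1 h2)] at h2
    refine lt_of_le_of_lt (le_of_eq ?_) h2
    have h3 : ∀ g : S → ℝ, ∫⁻ ω, ENNReal.ofReal (k ω * g ω) ∂P =
        ∫⁻ ω, ENNReal.ofReal (g ω) * ENNReal.ofReal (k ω) ∂P := by
      intro g
      refine lintegral_congr_ae ?_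
      filter_upwards [hk0] with ω h
      rw [ENNReal.ofReal_mul h, mul_comm]
    rw [h3, h3]
    exact lintegral_mul_ofReal_condExp hm (ENNReal.measurable_ofReal.comp hk) hf hf0
  exact ⟨h1, condExp_mul_of_stronglyMeasurable_left hk.stronglyMeasurable h1 hf⟩

theorem ae_eq_zero_of_condExp_eq_zero (hm : mt ≤ mS) [IsFiniteMeasure P] {f : S → ℝ}
    (hf : Integrable f P) (hf0 : 0 ≤ᵐ[P] f) :
    ∀ᵐ ω ∂P, condExp mt P f ω ≤ 0 → f ω = 0 := by
  set A : Set S := {ω | condExp mt P f ω ≤ 0}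
  have hA : MeasurableSet[mt] A :=
    measurableSet_le_fun stronglyMeasurable_condExp.measurable measurable_const
  have h1 : ∫ ω in A, f ω ∂P = 0 := by
    refine le_antisymm ?_ (setIntegral_nonneg_of_ae hf0)
    rw [← setIntegral_condExp hm hf hA]
    exact setIntegral_nonpos (hm _ hA) fun ω hω => hω
  have h2 := (setIntegral_eq_zero_iff_of_nonneg_ae (ae_restrict_of_ae hf0) hf.integrableOn).1 h1
  exact (ae_restrict_iff' (hm _ hA)).1 h2

open Classical in
/-- The quotient of `f` by its conditional expectation, and `r` where this vanishes. -/
noncomputable def normalize (mt : MeasurableSpace S) {mS : MeasurableSpace S} (P : Measure S)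
    (f r : S → ℝ) (ω : S) : ℝ :=
  if 0 < condExp mt P f ω then f ω / condExp mt P f ω else r ω

theorem measurable_normalize (h : mt ≤ ms) {f r : S → ℝ} (hf : Measurable[ms] f)
    (hr : Measurable[ms] r) : Measurable[ms] (normalize mt P f r) := by
  have hc : Measurable[ms] (condExp mt P f) := stronglyMeasurable_condExp.measurable.mono h le_rfl
  exact Measurable.ite (measurableSet_lt_fun measurable_const hc) (hf.div hc) hr

theorem normalize_nonneg {f r : S → ℝ} (hf : 0 ≤ᵐ[P] f) (hr : 0 ≤ᵐ[P] r) :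
    0 ≤ᵐ[P] normalize mt P f r := by
  filter_upwards [hf, hr] with ω h1 h2
  simp only [normalize, Pi.zero_apply]
  split_ifs with h
  exacts [div_nonneg h1 h.le, h2]

theorem condExp_normalize (hm : mt ≤ mS) [IsFiniteMeasure P] {f r : S → ℝ}
    (hf : Integrable f P) (hf0 : 0 ≤ᵐ[P] f) (hr : Integrable r P)
    (hr1 : condExp mt P r =ᵐ[P] fun _ => 1) :
    Integrable (normalize mt P f r) P ∧ condExp mt P (normalize mt P f r) =ᵐ[P] fun _ => 1 := by
  set g := condExp mt P f with hg
  have hgm : Measurable[mt] g := stronglyMeasurable_condExp.measurable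
  set B : Set S := {ω | 0 < g ω}
  have hB : MeasurableSet[mt] B := measurableSet_lt_fun measurable_const hgm
  have hgi : Measurable[mt] (fun ω => (g ω)⁻¹) := @Measurable.inv _ _ _ _ _ mt _ hgm
  have h1 : (fun ω => B.indicator (fun ω => (g ω)⁻¹) ω * g ω) = B.indicator fun _ => (1 : ℝ) := by
    ext ω
    by_cases hω : ω ∈ B
    · simp only [indicator_of_mem hω]
      exact inv_mul_cancel₀ (ne_of_gt hω)
    · simp [indicator_of_notMem hω]
  obtain ⟨h2, h3⟩ := condExp_mul_of_nonneg (P := P) hm (k := B.indicator fun ω => (g ω)⁻¹) (f := f)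
    (hgi.indicator hB)
    (Filter.Eventually.of_forall fun ω =>
      indicator_nonneg (s := B) (f := fun ω => (g ω)⁻¹) (fun _ hω => (inv_pos.2 hω).le) ω) hf hf0
    (by rw [h1]; exact (integrable_const _).indicator (hm _ hB))
  rw [h1] at h3
  have h4 : normalize mt P f r =
      (fun ω => B.indicator (fun ω => (g ω)⁻¹) ω * f ω) + Bᶜ.indicator r := by
    ext ω
    by_cases hω : ω ∈ B
    · have hω' : 0 < condExp mt P f ω := hω
      simp [normalize, hω, hω', div_eq_inv_mul, hg]
    · have hω' : ¬ 0 < condExp mt P f ω := hω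
      simp [normalize, hω, hω']
  rw [h4]
  refine ⟨h2.add (hr.indicator (hm _ hB.compl)), ?_⟩
  refine (condExp_add h2 (hr.indicator (hm _ hB.compl)) mt).trans ?_
  filter_upwards [h3, condExp_indicator hr hB.compl, hr1] with ω h5 h6 h7
  rw [Pi.add_apply, h5, h6]
  by_cases hω : ω ∈ B
  · simp [hω]
  · simp [hω, h7]

end NonnegPullOut

section Density

variable {S : Type*} {d : ℕ} {mt ms mS : MeasurableSpace S} {P : Measure S}

/-- The real-valued density of `Q` with respect to `P`. -/
noncomputable def dens {mS : MeasurableSpace S} (P Q : Measure S) (ω : S) : ℝ :=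
  (Q.rnDeriv P ω).toReal

theorem dens_nonneg (Q : Measure S) (ω : S) : 0 ≤ dens P Q ω := ENNReal.toReal_nonneg

theorem integrable_dens {Q : Measure S} [IsFiniteMeasure Q] : Integrable (dens P Q) P :=
  Measure.integrable_toReal_rnDeriv

theorem measurable_dens {Q : Measure S} : Measurable (dens P Q) :=
  (Measure.measurable_rnDeriv Q P).ennreal_toReal

theorem withDensity_dens {Q : Measure S} [IsFiniteMeasure Q] [SigmaFinite P] (h : Q ≪ P) :
    P.withDensity (fun ω => ENNReal.ofReal (dens P Q ω)) = Q := by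
  conv_rhs => rw [← Measure.withDensity_rnDeriv_eq Q P h]
  refine withDensity_congr_ae ?_
  filter_upwards [Measure.rnDeriv_lt_top Q P] with ω hω
  rw [dens, ENNReal.ofReal_toReal hω.ne]

theorem dens_withDensity [IsFiniteMeasure P] {q : S → ℝ} (hq : Integrable q P)
    (hq0 : 0 ≤ᵐ[P] q) : dens P (P.withDensity fun ω => ENNReal.ofReal (q ω)) =ᵐ[P] q := by
  filter_upwards [Measure.rnDeriv_withDensity₀ P
    (hq.aestronglyMeasurable.aemeasurable.ennreal_ofReal), hq0] with ω h1 h2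
  rw [dens, h1, ENNReal.toReal_ofReal h2]

theorem condExp_dens (hm : mt ≤ mS) [IsFiniteMeasure P] {Q : Measure S} (hQ : Q ∈ ProbACAt mt P) :
    condExp mt P (dens P Q) =ᵐ[P] fun _ => 1 := by
  have := hQ.1.1
  refine (ae_eq_condExp_of_forall_setIntegral_eq hm integrable_dens
    (fun _ _ _ => (integrable_const _).integrableOn) (fun A hA _ => ?_)
    aestronglyMeasurable_const).symm
  have h1 := Measure.setIntegral_toReal_rnDeriv hQ.1.2 A
  rw [show ∫ ω in A, dens P Q ω ∂P = _ from h1, measureReal_def, hQ.2 A hA]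
  simp [measureReal_def]

theorem withDensity_mem_ProbACAt (hm : mt ≤ mS) [IsProbabilityMeasure P] {q : S → ℝ}
    (hq : Integrable q P) (hq0 : 0 ≤ᵐ[P] q) (hq1 : condExp mt P q =ᵐ[P] fun _ => 1) :
    (P.withDensity fun ω => ENNReal.ofReal (q ω)) ∈ ProbACAt mt P := by
  have h1 : ∀ A, MeasurableSet[mt] A → (P.withDensity fun ω => ENNReal.ofReal (q ω)) A = P A := by
    intro A hA
    rw [withDensity_apply _ (hm _ hA),
      ← ofReal_integral_eq_lintegral_ofReal hq.integrableOn (ae_restrict_of_ae hq0),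
      ← setIntegral_condExp hm hq hA, integral_congr_ae (ae_restrict_of_ae hq1)]
    simp
  exact ⟨⟨⟨by rw [h1 univ MeasurableSet.univ, measure_univ]⟩, withDensity_absolutelyContinuous _ _⟩,
    h1⟩

theorem xi_ae_eq (hm : mt ≤ mS) [IsFiniteMeasure P] {Q : Measure S} (hQ : Q ∈ ProbACAt mt P) :
    xi mt ms P Q =ᵐ[P] condExp ms P (dens P Q) := by
  filter_upwards [condExp_dens hm hQ] with ω h
  unfold xi
  change condExp mt P (fun η => (Q.rnDeriv P η).toReal) ω = 1 at h
  rw [h, if_pos one_pos, div_one]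
  rfl

theorem xi_nonneg (Q : Measure S) : 0 ≤ᵐ[P] xi mt ms P Q := by
  filter_upwards [condExp_nonneg (m := ms) (Filter.Eventually.of_forall (dens_nonneg (P := P) Q))]
    with ω h
  unfold xi
  split_ifs with h1
  · exact div_nonneg h h1.le
  · exact zero_le_one

theorem xi_withDensity (hm : mt ≤ ms) (hs : ms ≤ mS) [IsProbabilityMeasure P] {q : S → ℝ}
    (hqm : Measurable[ms] q) (hq : Integrable q P) (hq0 : 0 ≤ᵐ[P] q)
    (hq1 : condExp mt P q =ᵐ[P] fun _ => 1) :
    xi mt ms P (P.withDensity fun ω => ENNReal.ofReal (q ω)) =ᵐ[P] q := by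
  refine (xi_ae_eq (hm.trans hs) (withDensity_mem_ProbACAt (hm.trans hs) hq hq0 hq1)).trans ?_
  refine (condExp_congr_ae (dens_withDensity hq hq0)).trans ?_
  rw [condExp_of_stronglyMeasurable hs hqm.stronglyMeasurable hq]

theorem xi_self (hm : mt ≤ mS) [IsFiniteMeasure P] {Q : Measure S} (hQ : Q ∈ ProbACAt mt P) :
    xi mt mS P Q =ᵐ[P] dens P Q := by
  have := hQ.1.1
  refine (xi_ae_eq hm hQ).trans ?_
  rw [condExp_of_stronglyMeasurable le_rfl measurable_dens.stronglyMeasurable integrable_dens]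

theorem measurable_xi (hm : mt ≤ ms) (Q : Measure S) : Measurable[ms] (xi mt ms P Q) := by
  have h1 : Measurable[ms] (condExp mt P fun η => (Q.rnDeriv P η).toReal) :=
    stronglyMeasurable_condExp.measurable.mono hm le_rfl
  have h2 : Measurable[ms] (condExp ms P fun η => (Q.rnDeriv P η).toReal) :=
    stronglyMeasurable_condExp.measurable
  exact Measurable.ite (measurableSet_lt_fun measurable_const h1) (h2.div h1) measurable_const

theorem integrable_mul_of_bounded {f g : S → ℝ} (hf : Integrable f P) (hg : Measurable g) {C : ℝ}
    (hC : ∀ᵐ ω ∂P, |g ω| ≤ C) : Integrable (fun ω => f ω * g ω) P :=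
  hf.mul_bdd hg.aestronglyMeasurable hC

/-- The conditional expectation under `Q` of an `ms`-measurable random variable. -/
theorem condQ_ae_eq (hm : mt ≤ ms) (hs : ms ≤ mS) [IsFiniteMeasure P] {Q : Measure S}
    (hQ : Q ∈ ProbACAt mt P) {Y : S → ℝ} (hY : Measurable[ms] Y) {C : ℝ}
    (hC : ∀ᵐ ω ∂P, |Y ω| ≤ C) :
    condQ mt P Q Y =ᵐ[P] condExp mt P (fun ω => xi mt ms P Q ω * Y ω) := by
  have := hQ.1.1
  have hint : Integrable (fun ω => dens P Q ω * Y ω) P :=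
    integrable_mul_of_bounded integrable_dens (hY.mono hs le_rfl) hC
  have h1 : condQ mt P Q Y =ᵐ[P] condExp mt P (fun ω => dens P Q ω * Y ω) := by
    refine condExp_congr_ae ?_
    filter_upwards [xi_self (hm.trans hs) hQ] with ω h
    rw [h]
  refine h1.trans ((condExp_condExp_of_le hm hs).symm.trans (condExp_congr_ae ?_))
  refine (condExp_mul_of_stronglyMeasurable_right hY.stronglyMeasurable hint integrable_dens).trans ?_
  filter_upwards [xi_ae_eq (ms := ms) (hm.trans hs) hQ] with ω h
  rw [Pi.mul_apply, h]

theorem integrable_xi (hm : mt ≤ mS) [IsFiniteMeasure P] {Q : Measure S}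
    (hQ : Q ∈ ProbACAt mt P) : Integrable (xi mt ms P Q) P :=
  integrable_condExp.congr (xi_ae_eq hm hQ).symm

theorem condExp_xi (hm : mt ≤ ms) (hs : ms ≤ mS) [IsFiniteMeasure P] {Q : Measure S}
    (hQ : Q ∈ ProbACAt mt P) : condExp mt P (xi mt ms P Q) =ᵐ[P] fun _ => 1 :=
  (condExp_congr_ae (xi_ae_eq (hm.trans hs) hQ)).trans
    ((condExp_condExp_of_le hm hs).trans (condExp_dens (hm.trans hs) hQ))

theorem abs_condExp_mul_le {f Y : S → ℝ} (hf : Integrable f P) (hf0 : 0 ≤ᵐ[P] f)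
    (hint : Integrable (fun ω => f ω * Y ω) P) {C : ℝ} (hC : ∀ᵐ ω ∂P, |Y ω| ≤ C) :
    ∀ᵐ ω ∂P, |condExp mt P (fun ω => f ω * Y ω) ω| ≤ C * condExp mt P f ω := by
  have h1 := condExp_mono (m := mt) hint (hf.smul C) (by
    filter_upwards [hf0, hC] with ω h1 h2
    rw [Pi.smul_apply, smul_eq_mul, mul_comm C]
    exact mul_le_mul_of_nonneg_left ((le_abs_self _).trans h2) h1)
  have h2 := condExp_mono (m := mt) (hf.smul (-C)) hint (by
    filter_upwards [hf0, hC] with ω h1 h2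
    rw [Pi.smul_apply, smul_eq_mul, mul_comm (-C)]
    exact mul_le_mul_of_nonneg_left (neg_le_of_abs_le h2) h1)
  filter_upwards [h1, h2, condExp_smul (μ := P) C f mt, condExp_smul (μ := P) (-C) f mt]
    with ω h1 h2 h3 h4
  rw [h3] at h1
  rw [h4] at h2
  simp only [Pi.smul_apply, smul_eq_mul] at h1 h2
  exact abs_le.2 ⟨by linarith, h1⟩

theorem condQVec_mem_LInf (hm : mt ≤ mS) [IsFiniteMeasure P] {Q : Fin d → Measure S}
    (hQ : ∀ i, Q i ∈ ProbACAt mt P) {Y : S → Fin d → ℝ} (hY : Y ∈ LInf mS P) :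
    condQVec mt P Q Y ∈ LInf mt P := by
  obtain ⟨hYm, C, hC⟩ := (mem_LInf_iff le_rfl).1 hY
  refine (mem_LInf_iff hm).2 ⟨measurable_of_apply fun i => stronglyMeasurable_condExp.measurable,
    C, ae_all_iff.2 fun i => ?_⟩
  have hCi : ∀ᵐ ω ∂P, |Y ω i| ≤ C := hC.mono fun ω h => h i
  filter_upwards [abs_condExp_mul_le (mt := mt) (integrable_xi (ms := mS) hm (hQ i))
    (xi_nonneg (Q i)) (integrable_mul_of_bounded (integrable_xi hm (hQ i)) (measurable_apply hYm i)
      hCi) hCi, condExp_xi hm le_rfl (hQ i)] with ω h1 h2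
  rw [h2, mul_one] at h1
  exact h1

theorem condVec_wts (hm : mt ≤ ms) (hs : ms ≤ mS) [IsFiniteMeasure P] {Q : Fin d → Measure S}
    (hQ : ∀ i, Q i ∈ ProbACAt mt P) {w : S → Fin d → ℝ} (hw : Measurable[mt] w)
    (hwts : wts mt ms P Q w ∈ LOne ms P) : condVec mt P (wts mt ms P Q w) =ᵐ[P] w := by
  have h1 : ∀ᵐ ω ∂P, ∀ i, condVec mt P (wts mt ms P Q w) ω i = w ω i := by
    rw [ae_all_iff]
    intro i
    have h2 := condExp_mul_of_stronglyMeasurable_left (m := mt)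
      (measurable_apply hw i).stronglyMeasurable ((mem_LOne_iff.1 hwts).2 i)
      (integrable_xi (ms := ms) (hm.trans hs) (hQ i))
    filter_upwards [h2, condExp_xi hm hs (hQ i)] with ω h3 h4
    refine h3.trans ?_
    rw [Pi.mul_apply, h4, mul_one]
  filter_upwards [h1] with ω h using funext h

theorem nonneg_of_wts_nonneg (hm : mt ≤ ms) (hs : ms ≤ mS) [IsFiniteMeasure P]
    {Q : Fin d → Measure S} (hQ : ∀ i, Q i ∈ ProbACAt mt P) {w : S → Fin d → ℝ}
    (hw : Measurable[mt] w) (hwts : wts mt ms P Q w ∈ LOnePos ms P) :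
    ∀ᵐ ω ∂P, ∀ i, 0 ≤ w ω i := by
  filter_upwards [condVec_wts hm hs hQ hw hwts.1, condVec_nonneg (mt := mt) hwts.2] with ω h1 h2
  rwa [h1] at h2

theorem dot_condQVec (hm : mt ≤ ms) (hs : ms ≤ mS) [IsFiniteMeasure P] {Q : Fin d → Measure S}
    (hQ : ∀ i, Q i ∈ ProbACAt mt P) {w : S → Fin d → ℝ} (hw : Measurable[mt] w)
    (hwts : wts mt ms P Q w ∈ LOne ms P) {Y : S → Fin d → ℝ} (hY : Y ∈ LInf ms P) :
    (fun ω => w ω ⬝ᵥ condQVec mt P Q Y ω) =ᵐ[P]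
      condExp mt P (fun ω => wts mt ms P Q w ω ⬝ᵥ Y ω) := by
  obtain ⟨hYm, C, hC⟩ := (mem_LInf_iff hs).1 hY
  have hCi : ∀ i, ∀ᵐ ω ∂P, |Y ω i| ≤ C := fun i => hC.mono fun ω h => h i
  have hYS : ∀ i, Measurable (fun ω => Y ω i) := fun i => (measurable_apply hYm i).mono hs le_rfl
  have h1 : ∀ i, Integrable (fun ω => wts mt ms P Q w ω i * Y ω i) P := fun i =>
    integrable_mul_of_bounded ((mem_LOne_iff.1 hwts).2 i) (hYS i) (hCi i)
  have h2 : ∀ i, condExp mt P (fun ω => wts mt ms P Q w ω i * Y ω i) =ᵐ[P]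
      fun ω => w ω i * condQVec mt P Q Y ω i := by
    intro i
    have e : (fun ω => wts mt ms P Q w ω i * Y ω i) =
        (fun ω => w ω i) * (fun ω => xi mt ms P (Q i) ω * Y ω i) := by
      ext ω; simp [wts, mul_assoc]
    have h3 := h1 i
    rw [e] at h3 ⊢
    refine (condExp_mul_of_stronglyMeasurable_left (measurable_apply hw i).stronglyMeasurable h3
      (integrable_mul_of_bounded (integrable_xi (hm.trans hs) (hQ i)) (hYS i) (hCi i))).trans ?_
    filter_upwards [condQ_ae_eq hm hs (hQ i) (measurable_apply hYm i) (hCi i)] with ω h4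
    rw [Pi.mul_apply, ← h4]
    rfl
  have h3 : (fun ω => wts mt ms P Q w ω ⬝ᵥ Y ω) = ∑ i, fun ω => wts mt ms P Q w ω i * Y ω i := by
    ext ω; simp [dotProduct]
  rw [h3]
  refine Filter.EventuallyEq.symm ((condExp_finsetSum (fun i _ => h1 i) mt).trans ?_)
  filter_upwards [ae_all_iff.2 h2] with ω h4
  simp [dotProduct, h4]

end Density

end SetRisk

namespace SetRisk

section DualElements

variable {S : Type*} {d m : ℕ} {mt ms mX mS : MeasurableSpace S} {P : Measure S}

theorem mem_EligPosDual_of_nonneg {w : S → Fin d → ℝ} (hw : w ∈ LOne mt P)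
    (hw0 : ∀ᵐ ω ∂P, ∀ i, 0 ≤ w ω i) : w ∈ EligPosDual mt P m := by
  refine ⟨hw, fun u hu => integral_nonneg_of_ae ?_⟩
  filter_upwards [hw0, hu.2] with ω h1 h2
  exact Finset.sum_nonneg fun i _ => mul_nonneg (h1 i) (h2 i)

theorem mem_EligPerp_iff (hm : mt ≤ mS) [IsFiniteMeasure P] {w : S → Fin d → ℝ}
    (hw : w ∈ LOne mt P) (hw0 : ∀ᵐ ω ∂P, ∀ i, 0 ≤ w ω i) :
    w ∈ EligPerp mt P m ↔ ∀ᵐ ω ∂P, ∀ i : Fin d, (i : ℕ) < m → w ω i = 0 := by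
  constructor
  · intro h
    have h1 := h.2 _ (const_mem_Elig (c := truncElig m fun _ => 1) (truncElig_mem _))
    have hu := const_mem_Elig (mt := mt) (P := P) (m := m) (d := d)
      (c := truncElig m fun _ => 1) (truncElig_mem _)
    have h2 := (integral_eq_zero_iff_of_nonneg_ae (by
      filter_upwards [hw0] with ω h1
      exact Finset.sum_nonneg fun i _ =>
        mul_nonneg (h1 i) (truncElig_nonneg (fun _ => zero_le_one) i))
      (integrable_dot hm (LOne_mono hm hw) hu.1)).1 h1
    filter_upwards [h2, hw0] with ω h3 h4 i hi
    have h5 := (Finset.sum_eq_zero_iff_of_nonneg fun i _ =>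
      mul_nonneg (h4 i) (truncElig_nonneg (m := m) (fun _ => zero_le_one) i)).1 h3 i
      (Finset.mem_univ i)
    simpa [truncElig, hi] using h5
  · intro h
    refine ⟨hw, fun u hu => integral_eq_zero_of_ae ?_⟩
    filter_upwards [h, hu.2] with ω h1 h2
    refine Finset.sum_eq_zero fun i _ => ?_
    by_cases hi : (i : ℕ) < m
    · rw [h1 i hi, zero_mul]
    · rw [h2 i (not_lt.1 hi), mul_zero]

theorem notMem_EligPerp (hm : mt ≤ mS) [IsFiniteMeasure P] {w : S → Fin d → ℝ}
    (hw : w ∈ LOne mt P) (hw0 : ∀ᵐ ω ∂P, ∀ i, 0 ≤ w ω i) {B : Set S} (hB : P B ≠ 0)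
    (h : ∀ᵐ ω ∂P, ω ∈ B → ∃ i : Fin d, (i : ℕ) < m ∧ 0 < w ω i) : w ∉ EligPerp mt P m := by
  rw [mem_EligPerp_iff hm hw hw0]
  intro h0
  refine hB (measure_eq_zero_iff_ae_notMem.2 ?_)
  filter_upwards [h, h0] with ω h1 h2 hω
  obtain ⟨i, hi, h3⟩ := h1 hω
  exact h3.ne' (h2 i hi)

theorem mem_halfSp_iff {w c u : S → Fin d → ℝ} (hc : c ∈ LInf mt P) :
    u ∈ halfSp mt P m w c ↔ u ∈ Elig mt P m ∧ ∀ᵐ ω ∂P, 0 ≤ w ω ⬝ᵥ (u ω - c ω) := by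
  constructor
  · rintro ⟨⟨a, ha, g, hg, rfl⟩, hu⟩
    rw [mem_singleton_iff] at ha
    subst ha
    refine ⟨hu, ?_⟩
    filter_upwards [hg.2] with ω h
    simpa using h
  · rintro ⟨hu, h⟩
    exact ⟨⟨c, rfl, u - c, ⟨LInf_sub hu.1 hc, h⟩, add_sub_cancel c u⟩, hu⟩

theorem mem_halfSp_neg_iff {w Z u : S → Fin d → ℝ} (hZ : Z ∈ LInf mt P) :
    u ∈ halfSp mt P m w (-Z) ↔ u ∈ Elig mt P m ∧ ∀ᵐ ω ∂P, 0 ≤ w ω ⬝ᵥ (Z + u) ω := by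
  rw [mem_halfSp_iff (LInf_neg hZ)]
  simp [add_comm]

theorem mem_halfSp_condQVec_iff (hm : mt ≤ mS) [IsFiniteMeasure P] {Q : Fin d → Measure S}
    (hQ : ∀ i, Q i ∈ ProbACAt mt P) {w : S → Fin d → ℝ} (hw : Measurable[mt] w)
    (hwts : wts mt mS P Q w ∈ LOne mS P) {Y u : S → Fin d → ℝ} (hY : Y ∈ LInf mS P) :
    u ∈ halfSp mt P m w (condQVec mt P Q (-Y)) ↔ u ∈ Elig mt P m ∧
      0 ≤ᵐ[P] condExp mt P (fun ω => wts mt mS P Q w ω ⬝ᵥ (Y + u) ω) := by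
  rw [mem_halfSp_iff (condQVec_mem_LInf hm hQ (LInf_neg hY))]
  refine and_congr_right fun hu => ?_
  have h1 := dot_condQVec hm le_rfl hQ hw hwts (LInf_neg hY)
  have h2 := condExp_dot_add_right hm hwts hY hu.1
  have h3 := condVec_wts hm le_rfl hQ hw hwts
  have h4 : condExp mt P (fun ω => wts mt mS P Q w ω ⬝ᵥ (-Y) ω) =ᵐ[P]
      -condExp mt P (fun ω => wts mt mS P Q w ω ⬝ᵥ Y ω) := by
    have e : (fun ω => wts mt mS P Q w ω ⬝ᵥ (-Y) ω) = -fun ω => wts mt mS P Q w ω ⬝ᵥ Y ω := by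
      ext ω; simp
    rw [e]
    exact condExp_neg _ _
  have h5 : ∀ᵐ ω ∂P, w ω ⬝ᵥ (u ω - condQVec mt P Q (-Y) ω) =
      condExp mt P (fun ω => wts mt mS P Q w ω ⬝ᵥ (Y + u) ω) ω := by
    filter_upwards [h1, h2, h3, h4] with ω h1 h2 h3 h4
    rw [h2, h3, dotProduct_sub, h1, h4, Pi.neg_apply]
    ring
  constructor
  · intro h
    filter_upwards [h, h5] with ω h6 h7
    rwa [h7] at h6
  · intro h
    filter_upwards [h, h5] with ω h6 h7
    rwa [h7]

/-- The vector of measures with densities `Z_i / E_t[Z_i]`. -/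
noncomputable def normMeas (mt : MeasurableSpace S) {mS : MeasurableSpace S} (P : Measure S)
    (Z : S → Fin d → ℝ) (i : Fin d) : Measure S :=
  P.withDensity fun ω => ENNReal.ofReal (normalize mt P (fun η => Z η i) (fun _ => 1) ω)

theorem condExp_one (hm : mt ≤ mS) [IsFiniteMeasure P] :
    condExp mt P (fun _ : S => (1 : ℝ)) =ᵐ[P] fun _ => 1 := by
  rw [condExp_const hm]

theorem normMeas_mem (hm : mt ≤ ms) (hs : ms ≤ mS) [IsProbabilityMeasure P] {Z : S → Fin d → ℝ}
    (hZ : Z ∈ LOnePos ms P) (i : Fin d) : normMeas mt P Z i ∈ ProbACAt mt P := by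
  have hZ0 : 0 ≤ᵐ[P] fun ω => Z ω i := hZ.2.mono fun ω h => h i
  obtain ⟨h1, h2⟩ := condExp_normalize (hm.trans hs) ((mem_LOne_iff.1 hZ.1).2 i) hZ0
    (integrable_const 1) (condExp_one (hm.trans hs))
  exact withDensity_mem_ProbACAt (hm.trans hs) h1
    (normalize_nonneg hZ0 (Filter.Eventually.of_forall fun _ => zero_le_one)) h2

theorem wts_normMeas (hm : mt ≤ ms) (hs : ms ≤ mS) [IsProbabilityMeasure P] {Z : S → Fin d → ℝ}
    (hZ : Z ∈ LOnePos ms P) : wts mt ms P (normMeas mt P Z) (condVec mt P Z) =ᵐ[P] Z := by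
  have h : ∀ᵐ ω ∂P, ∀ i, wts mt ms P (normMeas mt P Z) (condVec mt P Z) ω i = Z ω i := by
    rw [ae_all_iff]
    intro i
    have hZi := (mem_LOne_iff.1 hZ.1).2 i
    have hZ0 : 0 ≤ᵐ[P] fun ω => Z ω i := hZ.2.mono fun ω h => h i
    obtain ⟨h1, h2⟩ := condExp_normalize (hm.trans hs) hZi hZ0
      (integrable_const 1) (condExp_one (hm.trans hs))
    filter_upwards [xi_withDensity hm hs
      (measurable_normalize hm (measurable_apply hZ.1.1 i) measurable_const) h1
      (normalize_nonneg hZ0 (Filter.Eventually.of_forall fun _ => zero_le_one)) h2,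
      ae_eq_zero_of_condExp_eq_zero (hm.trans hs) hZi hZ0, condVec_nonneg (mt := mt) hZ.2]
      with ω h3 h4 h5
    change condExp mt P (fun η => Z η i) ω * xi mt ms P _ ω = Z ω i
    rw [normMeas, h3, normalize]
    split_ifs with h6
    · field_simp
    · have h7 := le_antisymm (not_lt.1 h6) (h5 i)
      rw [h4 (not_lt.1 h6), h7, zero_mul]
  filter_upwards [h] with ω h using funext h

theorem measurable_wts (hm : mt ≤ ms) {Q : Fin d → Measure S} {w : S → Fin d → ℝ}
    (hw : Measurable[mt] w) : Measurable[ms] (wts mt ms P Q w) :=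
  measurable_of_apply fun i => ((measurable_apply hw i).mono hm le_rfl).mul (measurable_xi hm (Q i))

theorem wts_normMeas_mem (hm : mt ≤ ms) (hs : ms ≤ mS) [IsProbabilityMeasure P]
    {Z : S → Fin d → ℝ} (hZ : Z ∈ LOnePos ms P) :
    wts mt ms P (normMeas mt P Z) (condVec mt P Z) ∈ LOnePos ms P := by
  have h := wts_normMeas hm hs hZ
  refine ⟨⟨measurable_wts hm (condVec_mem_LOne Z).1, hZ.1.2.congr h.symm⟩, ?_⟩
  filter_upwards [h, hZ.2] with ω h1 h2
  rwa [h1]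

theorem normMeas_mem_dualVec (hm : mt ≤ mS) [IsProbabilityMeasure P] {Z : S → Fin d → ℝ}
    (hZ : Z ∈ LOnePos mS P) {B : Set S} (hB : P B ≠ 0)
    (h : ∀ᵐ ω ∂P, ω ∈ B → ∃ i : Fin d, (i : ℕ) < m ∧ 0 < condVec mt P Z ω i) :
    (normMeas mt P Z, condVec mt P Z) ∈ dualVec mt P m :=
  ⟨normMeas_mem hm le_rfl hZ, ⟨mem_EligPosDual_of_nonneg (condVec_mem_LOne Z) (condVec_nonneg hZ.2),
    notMem_EligPerp hm (condVec_mem_LOne Z) (condVec_nonneg hZ.2) hB h⟩,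
    wts_normMeas_mem hm le_rfl hZ⟩

theorem condExp_wts_normMeas_dot (hm : mt ≤ ms) (hs : ms ≤ mS) [IsProbabilityMeasure P]
    {Z : S → Fin d → ℝ} (hZ : Z ∈ LOnePos ms P) (Y : S → Fin d → ℝ) :
    condExp mt P (fun ω => wts mt ms P (normMeas mt P Z) (condVec mt P Z) ω ⬝ᵥ Y ω) =ᵐ[P]
      condExp mt P (fun ω => Z ω ⬝ᵥ Y ω) := by
  refine condExp_congr_ae ?_
  filter_upwards [wts_normMeas hm hs hZ] with ω h
  rw [h]

theorem exists_lt_of_eligWeight_pos {Z : S → Fin d → ℝ} {ω : S} (h : 0 < eligWeight m mt P Z ω) :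
    ∃ i : Fin d, (i : ℕ) < m ∧ 0 < condVec mt P Z ω i := by
  obtain ⟨i, -, hi⟩ := Finset.exists_lt_of_sum_lt (s := Finset.univ) (f := fun _ : Fin d => (0 : ℝ))
    (g := fun i => truncElig m (condVec mt P Z ω) i) (by rw [Finset.sum_const_zero]; exact h)
  by_cases him : (i : ℕ) < m
  · exact ⟨i, him, by simpa [truncElig, him] using hi⟩
  · simp [truncElig, him] at hi

variable {R : (S → Fin d → ℝ) → Set (S → Fin d → ℝ)}

theorem mem_minkSub_iff {A B : Set (S → Fin d → ℝ)} {u : S → Fin d → ℝ} :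
    u ∈ minkSub mt P m A B ↔ u ∈ Elig mt P m ∧ ∀ v ∈ B, v + u ∈ A := by
  refine and_congr_right fun _ => ⟨fun h v hv => h (add_mem_add hv rfl), ?_⟩
  rintro h _ ⟨v, hv, _, rfl, rfl⟩
  exact h v hv

/-- Dual representation of closed conditionally convex risk measures for vectors. -/
theorem IsClosedConvexVectorRM.hasDualVec [IsProbabilityMeasure P]
    (h : IsClosedConvexVectorRM mS mt P m R) (hm : mt ≤ mS) : HasDualVec mt P m R := by
  intro X hX
  obtain ⟨u0, hu0E, -, hu0A⟩ := h.exists_accVec_Elig hm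
  refine Subset.antisymm (fun u hu => mem_iInter₂.2 fun p hp => ?_) fun u hu => ?_
  · have huE := h.subset_Elig hX hu
    have hXu := (h.mem_iff_add_mem_accVec hm hX huE).1 hu
    refine mem_minkSub_iff.2 ⟨huE, fun v hv => ?_⟩
    have hv1 := (mem_halfSp_condQVec_iff hm hp.1 hp.2.1.1.1.1 hp.2.2.1 hXu.1).1
      (mem_iInter₂.1 hv _ hXu)
    refine (mem_halfSp_condQVec_iff hm hp.1 hp.2.1.1.1.1 hp.2.2.1 hX).2
      ⟨Elig_add hv1.1 huE, ?_⟩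
    rw [add_comm v u, ← add_assoc]
    exact hv1.2
  · have hE : u ∈ Elig mt P m := by
      obtain ⟨Z, hZ, -, -, -, -, hP⟩ := h.exists_eligWeight_pos hm le_rfl MeasurableSet.univ
        (by rw [measure_univ]; exact one_ne_zero)
      exact (mem_iInter₂.1 hu _ (normMeas_mem_dualVec hm hZ hP (Filter.Eventually.of_forall
        fun ω hω => exists_lt_of_eligWeight_pos hω.2))).1
    by_contra hu'
    obtain ⟨Z, hZ, v, hv, B, hBm, hB, h1, h2, h3⟩ := h.exists_dual hm le_rfl hX hE hu'
    have hp := normMeas_mem_dualVec hm hZ hB h1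
    have h4 := (mem_minkSub_iff.1 (mem_iInter₂.1 hu _ hp)).2 v (mem_iInter₂.2 fun Y hY => by
      refine (mem_halfSp_condQVec_iff hm hp.1 hp.2.1.1.1.1 hp.2.2.1 hY.1).2 ⟨hv, ?_⟩
      filter_upwards [h2 Y hY, condExp_wts_normMeas_dot hm le_rfl hZ (Y + v)] with ω h5 h6
      rwa [h6])
    have h5 := ((mem_halfSp_condQVec_iff hm hp.1 hp.2.1.1.1.1 hp.2.2.1 hX).1 h4).2
    refine hB (measure_eq_zero_iff_ae_notMem.2 ?_)
    filter_upwards [h5, h3, condExp_wts_normMeas_dot hm le_rfl hZ (X + (v + u))] with ω h6 h7 h8 hω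
    rw [h8] at h6
    have := h7 hω
    rw [add_assoc, add_comm u v] at this
    exact absurd h6 (not_le.2 this)

theorem condExp_dot_self (hm : mt ≤ mS) [IsFiniteMeasure P] {Z Y : S → Fin d → ℝ}
    (hZ : Z ∈ LOne mt P) (hY : Y ∈ LInf mt P) :
    condExp mt P (fun ω => Z ω ⬝ᵥ Y ω) = fun ω => Z ω ⬝ᵥ Y ω :=
  condExp_of_stronglyMeasurable hm (dotProduct_measurable hZ.1 hY.1).stronglyMeasurable
    (integrable_dot hm (LOne_mono hm hZ) hY)

theorem condVec_self (hm : mt ≤ mS) [IsFiniteMeasure P] {Z : S → Fin d → ℝ}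
    (hZ : Z ∈ LOne mt P) : condVec mt P Z = Z := by
  ext ω i
  exact congrFun (condExp_of_stronglyMeasurable hm (measurable_apply hZ.1 i).stronglyMeasurable
    ((mem_LOne_iff.1 hZ).2 i)) ω

/-- Dual representation of closed conditionally convex risk measures for vectors, restricted to
claims which are known at the time of evaluation. -/
theorem IsClosedConvexVectorRM.hasDualRes [IsProbabilityMeasure P]
    (h : IsClosedConvexVectorRM mt mt P m R) (hm : mt ≤ mS) : HasDualRes mt P m R := by
  intro X hX
  obtain ⟨u0, hu0E, -, hu0A⟩ := h.exists_accVec_Elig le_rfl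
  refine Subset.antisymm (fun u hu => mem_iInter₂.2 fun w hw => ?_) fun u hu => ?_
  · have huE := h.subset_Elig hX hu
    have hXu := (h.mem_iff_add_mem_accVec le_rfl hX huE).1 hu
    refine mem_minkSub_iff.2 ⟨huE, fun v hv => ?_⟩
    have hv1 := (mem_halfSp_neg_iff hXu.1).1 (mem_iInter₂.1 hv _ hXu)
    refine (mem_halfSp_neg_iff hX).2 ⟨Elig_add hv1.1 huE, ?_⟩
    rw [add_comm v u, ← add_assoc]
    exact hv1.2
  · have hE : u ∈ Elig mt P m := by
      obtain ⟨Z, hZ, -, -, -, -, hP⟩ := h.exists_eligWeight_pos le_rfl hm MeasurableSet.univ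
        (by rw [measure_univ]; exact one_ne_zero)
      refine (mem_iInter₂.1 hu Z ⟨hZ, notMem_EligPerp hm hZ.1 hZ.2 hP
        (Filter.Eventually.of_forall fun ω hω => ?_)⟩).1
      rw [← condVec_self hm hZ.1]
      exact exists_lt_of_eligWeight_pos hω.2
    by_contra hu'
    obtain ⟨Z, hZ, v, hv, B, hBm, hB, h1, h2, h3⟩ := h.exists_dual le_rfl hm hX hE hu'
    rw [condVec_self hm hZ.1] at h1
    have h4 := (mem_minkSub_iff.1 (mem_iInter₂.1 hu Z ⟨hZ, notMem_EligPerp hm hZ.1 hZ.2 hB h1⟩)).2 v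
      (mem_iInter₂.2 fun Y hY => by
        refine (mem_halfSp_neg_iff hY.1).2 ⟨hv, ?_⟩
        have := h2 Y hY
        rwa [condExp_dot_self hm hZ.1 (LInf_add hY.1 hv.1)] at this)
    have h5 := ((mem_halfSp_neg_iff hX).1 h4).2
    rw [condExp_dot_self hm hZ.1 (LInf_add (LInf_add hX hE.1) hv.1)] at h3
    refine hB (measure_eq_zero_iff_ae_notMem.2 ?_)
    filter_upwards [h5, h3] with ω h6 h7 hω
    have := h7 hω
    rw [add_assoc, add_comm u v] at this
    exact absurd h6 (not_le.2 this)

end DualElements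

end SetRisk

namespace SetRisk

section OptionalMeasurability

variable {Ω : Type*} {m0 : MeasurableSpace Ω} {T : ℕ} {F : Filtration (Fin (T + 1)) m0}
  {t : Fin (T + 1)}

theorem eq_iUnion_sections (B : Set (Ω × Fin (T + 1))) :
    B = ⋃ s, {ω | (ω, s) ∈ B} ×ˢ {s} := by
  ext ⟨ω, s⟩; simp

theorem measurableSet_optSigma_iff {B : Set (Ω × Fin (T + 1))} :
    MeasurableSet[optSigma F] B ↔ ∀ s, MeasurableSet[F s] {ω | (ω, s) ∈ B} := by
  constructor
  · intro hB s
    have h : Measurable[F s, optSigma F] (fun ω : Ω => (ω, s)) := by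
      refine @measurable_generateFrom _ _ (F s) _ _ ?_
      rintro _ ⟨r, A, hA, rfl⟩
      by_cases hr : s = r
      · subst hr
        convert hA using 1
        ext ω; simp
      · convert @MeasurableSet.empty _ (F s) using 1
        ext ω; simp [hr]
    exact h hB
  · intro h
    rw [eq_iUnion_sections B]
    exact MeasurableSet.iUnion fun s => MeasurableSpace.measurableSet_generateFrom ⟨s, _, h s, rfl⟩

theorem measurableSet_optFilt_iff {B : Set (Ω × Fin (T + 1))} :
    MeasurableSet[optFilt F t] B ↔ (∀ s ≤ t, MeasurableSet[F s] {ω | (ω, s) ∈ B}) ∧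
      ∀ s, t ≤ s → ∀ ω, (ω, s) ∈ B ↔ (ω, t) ∈ B := by
  constructor
  · intro hB
    induction B, hB using MeasurableSpace.generateFrom_induction with
    | hC B hB _ =>
      rcases hB with ⟨r, D, hr, hD, rfl⟩ | ⟨D, hD, rfl⟩
      · refine ⟨fun s hs => ?_, fun s hs ω => ?_⟩
        · by_cases h : s = r
          · subst h
            convert hD using 1
            ext ω; simp
          · convert @MeasurableSet.empty _ (F s) using 1
            ext ω; simp [h]
        · simp [(hr.trans_le hs).ne', hr.ne']
      · refine ⟨fun s hs => ?_, fun s hs ω => ?_⟩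
        · rcases hs.eq_or_lt with h | h
          · subst h
            convert hD using 1
            ext ω; simp
          · convert @MeasurableSet.empty _ (F s) using 1
            ext ω; simp [h]
        · simp [hs]
    | empty => simp
    | compl B _ ih =>
      exact ⟨fun s hs => (ih.1 s hs).compl, fun s hs ω => not_congr (ih.2 s hs ω)⟩
    | iUnion f _ ih =>
      refine ⟨fun s hs => ?_, fun s hs ω => ?_⟩
      · convert MeasurableSet.iUnion fun n => (ih n).1 s hs using 1
        ext ω; simp
      · simp only [mem_iUnion]
        exact exists_congr fun n => (ih n).2 s hs ω
  · rintro ⟨h1, h2⟩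
    have e : B = (⋃ s : {s // s < t}, {ω | (ω, s.1) ∈ B} ×ˢ {s.1}) ∪
        {ω | (ω, t) ∈ B} ×ˢ Set.Ici t := by
      ext ⟨ω, s⟩
      rcases lt_or_ge s t with hs | hs
      · simp [hs, not_le.2 hs]
      · simp [hs, not_lt.2 hs, h2 s hs ω]
    rw [e]
    refine MeasurableSet.union (MeasurableSet.iUnion fun s => ?_) ?_
    · exact MeasurableSpace.measurableSet_generateFrom (Or.inl ⟨s.1, _, s.2, h1 _ s.2.le, rfl⟩)
    · exact MeasurableSpace.measurableSet_generateFrom (Or.inr ⟨_, h1 t le_rfl, rfl⟩)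

theorem measurable_optSigma_iff {β : Type*} [MeasurableSpace β] {f : Ω × Fin (T + 1) → β} :
    Measurable[optSigma F] f ↔ ∀ s, Measurable[F s] fun ω => f (ω, s) :=
  ⟨fun h s _ hA => measurableSet_optSigma_iff.1 (h hA) s,
    fun h _ hA => measurableSet_optSigma_iff.2 fun s => h s hA⟩

theorem measurable_optFilt_iff {β : Type*} [MeasurableSpace β] [MeasurableSingletonClass β]
    {f : Ω × Fin (T + 1) → β} :
    Measurable[optFilt F t] f ↔ (∀ s ≤ t, Measurable[F s] fun ω => f (ω, s)) ∧
      ∀ s, t ≤ s → ∀ ω, f (ω, s) = f (ω, t) := by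
  constructor
  · intro h
    refine ⟨fun s hs _ hA => (measurableSet_optFilt_iff.1 (h hA)).1 s hs, fun s hs ω => ?_⟩
    exact ((measurableSet_optFilt_iff.1 (h (measurableSet_singleton (f (ω, t))))).2 s hs ω).2 rfl
  · rintro ⟨h1, h2⟩ A hA
    refine measurableSet_optFilt_iff.2 ⟨fun s hs => h1 s hs hA, fun s hs ω => ?_⟩
    simp only [mem_preimage, h2 s hs ω]

theorem optFilt_le : optFilt F t ≤ optSigma F := by
  intro B hB
  obtain ⟨h1, h2⟩ := measurableSet_optFilt_iff.1 hB
  refine measurableSet_optSigma_iff.2 fun s => ?_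
  rcases le_total s t with hs | hs
  · exact h1 s hs
  · have : {ω | (ω, s) ∈ B} = {ω | (ω, t) ∈ B} := by
      ext ω; exact h2 s hs ω
    rw [this]
    exact F.mono hs _ (h1 t le_rfl)

end OptionalMeasurability

section WeightedMap

variable {Ω S : Type*} {m0 : MeasurableSpace Ω} {mS : MeasurableSpace S} {Q : Measure Ω}
  {j : Ω → S} {g : Ω → ℝ}

theorem lintegral_map_withDensity (hj : Measurable j) (hg : Measurable g) {f : S → ℝ≥0∞}
    (hf : Measurable f) :
    ∫⁻ x, f x ∂(Measure.map j (Q.withDensity fun ω => ENNReal.ofReal (g ω))) =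
      ∫⁻ ω, ENNReal.ofReal (g ω) * f (j ω) ∂Q := by
  rw [lintegral_map hf hj]
  exact lintegral_withDensity_eq_lintegral_mul _ hg.ennreal_ofReal (hf.comp hj)

theorem integrable_map_withDensity_iff (hj : Measurable j) (hg : Measurable g) (hg0 : 0 ≤ᵐ[Q] g)
    {f : S → ℝ} (hf : Measurable f) :
    Integrable f (Measure.map j (Q.withDensity fun ω => ENNReal.ofReal (g ω))) ↔
      Integrable (fun ω => g ω * f (j ω)) Q := by
  rw [integrable_map_measure hf.aestronglyMeasurable hj.aemeasurable,
    integrable_withDensity_iff_integrable_smul' hg.ennreal_ofReal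
    (Filter.Eventually.of_forall fun _ => ENNReal.ofReal_lt_top)]
  refine integrable_congr ?_
  filter_upwards [hg0] with ω h
  rw [ENNReal.toReal_ofReal h]
  rfl

theorem integral_map_withDensity (hj : Measurable j) (hg : Measurable g) (hg0 : 0 ≤ᵐ[Q] g)
    {f : S → ℝ} (hf : Measurable f) :
    ∫ x, f x ∂(Measure.map j (Q.withDensity fun ω => ENNReal.ofReal (g ω))) =
      ∫ ω, g ω * f (j ω) ∂Q := by
  rw [integral_map hj.aemeasurable hf.aestronglyMeasurable,
    integral_withDensity_eq_integral_toReal_smul hg.ennreal_ofReal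
    (Filter.Eventually.of_forall fun _ => ENNReal.ofReal_lt_top)]
  refine integral_congr_ae ?_
  filter_upwards [hg0] with ω h
  rw [ENNReal.toReal_ofReal h, smul_eq_mul]

theorem measure_eq_lintegral_indicator {B : Set S} (hB : MeasurableSet B) (ν : Measure S) :
    ν B = ∫⁻ x, B.indicator 1 x ∂ν := (lintegral_indicator_one hB).symm

theorem measurable_indicator_one {B : Set S} (hB : MeasurableSet B) :
    Measurable (B.indicator (1 : S → ℝ≥0∞)) := measurable_one.indicator hB

theorem exists_measurableSet_superset_null {ν : Measure S} {B : Set S} (h : ν B = 0) :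
    ∃ C, B ⊆ C ∧ MeasurableSet C ∧ ν C = 0 := exists_measurable_superset_of_null h

end WeightedMap

section Tensor

variable {Ω : Type*} {m0 : MeasurableSpace Ω} {P : Measure Ω} {T : ℕ}
  {F : Filtration (Fin (T + 1)) m0} {t : Fin (T + 1)} {μ : Fin (T + 1) → Ω → ℝ}

theorem measurable_pair (s : Fin (T + 1)) : Measurable[m0, optSigma F] (fun ω : Ω => (ω, s)) :=
  fun _ hA => F.le s _ (measurableSet_optSigma_iff.1 hA s)

theorem lintegral_tensor {Q : Measure Ω} {ψ : Fin (T + 1) → Ω → ℝ} (hψ : ∀ s, Measurable (ψ s))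
    {f : Ω × Fin (T + 1) → ℝ≥0∞} (hf : Measurable[optSigma F] f) :
    ∫⁻ x, f x ∂(tensor F Q ψ) = ∑ s, ∫⁻ ω, ENNReal.ofReal (ψ s ω) * f (ω, s) ∂Q := by
  rw [tensor, lintegral_finsetSum_measure]
  refine Finset.sum_congr rfl fun s _ => ?_
  exact lintegral_map_withDensity (measurable_pair s) (hψ s) hf

theorem tensor_apply {Q : Measure Ω} {ψ : Fin (T + 1) → Ω → ℝ} (hψ : ∀ s, Measurable (ψ s))
    {B : Set (Ω × Fin (T + 1))} (hB : MeasurableSet[optSigma F] B) :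
    tensor F Q ψ B = ∑ s, ∫⁻ ω in {ω | (ω, s) ∈ B}, ENNReal.ofReal (ψ s ω) ∂Q := by
  rw [measure_eq_lintegral_indicator hB, lintegral_tensor hψ (measurable_indicator_one hB)]
  refine Finset.sum_congr rfl fun s _ => ?_
  rw [← lintegral_indicator (F.le s _ (measurableSet_optSigma_iff.1 hB s))]
  refine lintegral_congr fun ω => ?_
  by_cases h : (ω, s) ∈ B <;> simp [h]

theorem IsReference.measurable (hμ : IsReference P F μ) (s : Fin (T + 1)) : Measurable (μ s) :=
  (hμ.1 s).mono (F.le s) le_rfl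

theorem IsReference.pos (hμ : IsReference P F μ) : ∀ᵐ ω ∂P, ∀ s, 0 < μ s ω := by
  obtain ⟨-, -, ε, hε, h⟩ := hμ
  filter_upwards [h] with ω h s using hε.trans (h s)

theorem IsReference.le_one (hμ : IsReference P F μ) : ∀ᵐ ω ∂P, ∀ s, μ s ω ≤ 1 := by
  filter_upwards [hμ.pos, hμ.2.1] with ω h1 h2 s
  rw [← h2]
  exact Finset.single_le_sum (fun r _ => (h1 r).le) (Finset.mem_univ s)

theorem ae_tensor_iff (hF0 : ∀ A : Set Ω, MeasurableSet[F 0] A ↔ P A = 0 ∨ P Aᶜ = 0)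
    (hμ : IsReference P F μ) {p : Ω × Fin (T + 1) → Prop} :
    (∀ᵐ x ∂(tensor F P μ), p x) ↔ ∀ s, ∀ᵐ ω ∂P, p (ω, s) := by
  have hmeas : ∀ B : Set (Ω × Fin (T + 1)), MeasurableSet[optSigma F] B →
      (tensor F P μ B = 0 ↔ ∀ s, P {ω | (ω, s) ∈ B} = 0) := by
    intro B hB
    rw [tensor_apply hμ.measurable hB, Finset.sum_eq_zero_iff]
    refine forall_congr' fun s => ?_
    have hBs := F.le s _ (measurableSet_optSigma_iff.1 hB s)
    simp only [Finset.mem_univ, true_imp_iff]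
    rw [setLIntegral_eq_zero_iff hBs (hμ.measurable s).ennreal_ofReal,
      measure_eq_zero_iff_ae_notMem]
    constructor
    · intro h
      filter_upwards [h, hμ.pos] with ω h1 h2 h3
      have := h1 h3
      rw [ENNReal.ofReal_eq_zero] at this
      exact absurd (h2 s) (not_lt.2 this)
    · intro h
      filter_upwards [h] with ω h1 h2
      exact absurd h2 h1
  constructor
  · intro h s
    obtain ⟨B, hB1, hB2, hB3⟩ := exists_measurableSet_superset_null (ae_iff.1 h)
    exact ae_iff.2 (measure_mono_null (fun ω hω => hB1 hω) ((hmeas B hB2).1 hB3 s))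
  · intro h
    refine ae_iff.2 ((hmeas _ ?_).2 fun s => ae_iff.1 (h s))
    exact measurableSet_optSigma_iff.2 fun s => F.mono (Fin.zero_le s) _
      ((hF0 _).2 (Or.inl (ae_iff.1 (h s))))

theorem integrable_tensor_iff (hμ : IsReference P F μ) {f : Ω × Fin (T + 1) → ℝ}
    (hf : Measurable[optSigma F] f) :
    Integrable f (tensor F P μ) ↔ ∀ s, Integrable (fun ω => f (ω, s)) P := by
  rw [tensor, integrable_finsetSum_measure]
  simp only [Finset.mem_univ, true_imp_iff]
  refine forall_congr' fun s => ?_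
  have hfs : Measurable fun ω => f (ω, s) := (measurable_optSigma_iff.1 hf s).mono (F.le s) le_rfl
  have h0 : 0 ≤ᵐ[P] μ s := by filter_upwards [hμ.pos] with ω h using (h s).le
  rw [integrable_map_withDensity_iff (measurable_pair s) (hμ.measurable s) h0 hf]
  constructor
  · intro h
    obtain ⟨hm, -, ε, hε, hμε⟩ := hμ
    refine (h.bdd_mul (f := fun ω => (μ s ω)⁻¹) (c := ε⁻¹)
      ((hm s).mono (F.le s) le_rfl).inv.aestronglyMeasurable ?_).congr ?_
    · filter_upwards [hμε] with ω h1
      rw [norm_inv, Real.norm_of_nonneg (hε.trans (h1 s)).le]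
      exact inv_anti₀ hε (h1 s).le
    · filter_upwards [hμε] with ω h1
      have := (hε.trans (h1 s)).ne'
      field_simp
  · intro h
    refine h.bdd_mul (c := 1) (hμ.measurable s).aestronglyMeasurable ?_
    filter_upwards [hμ.pos, hμ.le_one] with ω h1 h2
    rw [Real.norm_of_nonneg (h1 s).le]
    exact h2 s

theorem integral_tensor (hμ : IsReference P F μ) {f : Ω × Fin (T + 1) → ℝ}
    (hf : Measurable[optSigma F] f) (hint : ∀ s, Integrable (fun ω => f (ω, s)) P) :
    ∫ x, f x ∂(tensor F P μ) = ∑ s, ∫ ω, μ s ω * f (ω, s) ∂P := by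
  have h := (integrable_tensor_iff hμ hf).2 hint
  rw [tensor, integrable_finsetSum_measure] at h
  rw [tensor, integral_finsetSum_measure h]
  refine Finset.sum_congr rfl fun s _ => ?_
  exact integral_map_withDensity (measurable_pair s) (hμ.measurable s)
    (by filter_upwards [hμ.pos] with ω h using (h s).le) hf

theorem isProbabilityMeasure_tensor [IsProbabilityMeasure P] (hμ : IsReference P F μ) :
    IsProbabilityMeasure (tensor F P μ) := by
  constructor
  rw [tensor_apply hμ.measurable MeasurableSet.univ]
  simp only [mem_univ, ofPred_true, Measure.restrict_univ]
  rw [← lintegral_finsetSum _ fun s _ => (hμ.measurable s).ennreal_ofReal]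
  rw [← measure_univ (μ := P), ← lintegral_one]
  refine lintegral_congr_ae ?_
  filter_upwards [hμ.pos, hμ.2.1] with ω h1 h2
  rw [← ENNReal.ofReal_sum_of_nonneg fun s _ => (h1 s).le, h2, ENNReal.ofReal_one]

end Tensor

end SetRisk

namespace SetRisk

section OptionalSpaces

variable {Ω : Type*} {m0 : MeasurableSpace Ω} {P : Measure Ω} {T : ℕ}
  {F : Filtration (Fin (T + 1)) m0} {t : Fin (T + 1)} {μ : Fin (T + 1) → Ω → ℝ} {d m : ℕ}

theorem slice_paste (t s : Fin (T + 1)) (u : Fin (T + 1) → Ω → Fin d → ℝ) (v : Ω → Fin d → ℝ) :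
    slice s (paste t u v) = if s < t then u s else v := by
  ext ω i; by_cases h : s < t <;> simp [slice, paste, h]

theorem slice_single (s r : Fin (T + 1)) (Z : Ω → Fin d → ℝ) :
    slice r (single s Z) = if r = s then Z else 0 := by
  ext ω i; by_cases h : r = s <;> simp [slice, single, h]

theorem slice_procFrom (t s : Fin (T + 1)) (X : Fin (T + 1) → Ω → Fin d → ℝ) :
    slice s (procFrom t X) = if t ≤ s then X s else 0 := by
  ext ω i; by_cases h : t ≤ s <;> simp [slice, procFrom, h]

theorem ext_slice {X Y : Ω × Fin (T + 1) → Fin d → ℝ} (h : ∀ s, slice s X = slice s Y) : X = Y := by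
  ext ⟨ω, s⟩ i
  exact congrFun (congrFun (h s) ω) i

theorem paste_slice {X : Ω × Fin (T + 1) → Fin d → ℝ} (h : ∀ s, t ≤ s → slice s X = slice t X) :
    paste t (fun s => slice s X) (slice t X) = X := by
  refine ext_slice fun s => ?_
  rw [slice_paste]
  split_ifs with hs
  · rfl
  · exact (h s (not_lt.1 hs)).symm

theorem measurable_optSigma_slice {X : Ω × Fin (T + 1) → Fin d → ℝ} :
    Measurable[optSigma F] X ↔ ∀ s, Measurable[F s] (slice s X) := measurable_optSigma_iff

theorem measurable_optFilt_slice {X : Ω × Fin (T + 1) → Fin d → ℝ} :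
    Measurable[optFilt F t] X ↔ (∀ s ≤ t, Measurable[F s] (slice s X)) ∧
      ∀ s, t ≤ s → slice s X = slice t X := by
  rw [measurable_optFilt_iff]
  refine and_congr_right fun _ => forall₂_congr fun s hs => ?_
  exact ⟨fun h => funext h, fun h ω => congrFun h ω⟩

theorem mem_LInf_optSigma (hF0 : ∀ A : Set Ω, MeasurableSet[F 0] A ↔ P A = 0 ∨ P Aᶜ = 0)
    (hμ : IsReference P F μ) {X : Ω × Fin (T + 1) → Fin d → ℝ} :
    X ∈ LInf (optSigma F) (tensor F P μ) ↔ ∀ s, slice s X ∈ LInf (F s) P := by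
  rw [mem_LInf_iff le_rfl, measurable_optSigma_slice]
  constructor
  · rintro ⟨h1, C, hC⟩ s
    exact (mem_LInf_iff (F.le s)).2 ⟨h1 s, C, (ae_tensor_iff hF0 hμ).1 hC s⟩
  · intro h
    have h2 := fun s => ((mem_LInf_iff (F.le s)).1 (h s)).2
    choose C hC using h2
    refine ⟨fun s => (h s).1, ∑ s, |C s|, (ae_tensor_iff hF0 hμ).2 fun s => ?_⟩
    filter_upwards [hC s] with ω hω i
    exact (hω i).trans ((le_abs_self _).trans
      (Finset.single_le_sum (f := fun s => |C s|) (fun r _ => abs_nonneg (C r)) (Finset.mem_univ s)))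

theorem mem_LInf_optFilt (hF0 : ∀ A : Set Ω, MeasurableSet[F 0] A ↔ P A = 0 ∨ P Aᶜ = 0)
    (hμ : IsReference P F μ) {X : Ω × Fin (T + 1) → Fin d → ℝ} :
    X ∈ LInf (optFilt F t) (tensor F P μ) ↔ (∀ s ≤ t, slice s X ∈ LInf (F s) P) ∧
      ∀ s, t ≤ s → slice s X = slice t X := by
  constructor
  · intro h
    have h1 := measurable_optFilt_slice.1 h.1
    have h2 := (mem_LInf_optSigma hF0 hμ).1 (LInf_mono optFilt_le h)
    exact ⟨fun s _ => h2 s, h1.2⟩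
  · rintro ⟨h1, h2⟩
    refine ⟨measurable_optFilt_slice.2 ⟨fun s hs => (h1 s hs).1, h2⟩,
      ((mem_LInf_optSigma hF0 hμ).2 fun s => ?_).2⟩
    rcases le_total s t with hs | hs
    · exact h1 s hs
    · rw [h2 s hs]
      exact LInf_mono (F.mono hs) (h1 t le_rfl)

theorem mem_LOne_optSigma (hμ : IsReference P F μ) {X : Ω × Fin (T + 1) → Fin d → ℝ} :
    X ∈ LOne (optSigma F) (tensor F P μ) ↔ ∀ s, slice s X ∈ LOne (F s) P := by
  simp only [mem_LOne_iff]
  rw [measurable_optSigma_slice, forall_and]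
  refine and_congr_right fun h => ?_
  rw [forall_comm]
  refine forall_congr' fun i => ?_
  exact integrable_tensor_iff hμ
    (measurable_apply (m := optSigma F) (measurable_optSigma_slice.2 h) i)

theorem mem_LOne_optFilt (hμ : IsReference P F μ) {X : Ω × Fin (T + 1) → Fin d → ℝ} :
    X ∈ LOne (optFilt F t) (tensor F P μ) ↔ (∀ s ≤ t, slice s X ∈ LOne (F s) P) ∧
      ∀ s, t ≤ s → slice s X = slice t X := by
  constructor
  · intro h
    have h1 := measurable_optFilt_slice.1 h.1
    have h2 := (mem_LOne_optSigma hμ).1 (LOne_mono optFilt_le h)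
    exact ⟨fun s _ => h2 s, h1.2⟩
  · rintro ⟨h1, h2⟩
    refine ⟨measurable_optFilt_slice.2 ⟨fun s hs => (h1 s hs).1, h2⟩,
      ((mem_LOne_optSigma hμ).2 fun s => ?_).2⟩
    rcases le_total s t with hs | hs
    · exact h1 s hs
    · rw [h2 s hs]
      exact LOne_mono (F.mono hs) (h1 t le_rfl)

theorem mem_Elig_optFilt (hF0 : ∀ A : Set Ω, MeasurableSet[F 0] A ↔ P A = 0 ∨ P Aᶜ = 0)
    (hμ : IsReference P F μ) {X : Ω × Fin (T + 1) → Fin d → ℝ} :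
    X ∈ Elig (optFilt F t) (tensor F P μ) m ↔ (∀ s ≤ t, slice s X ∈ Elig (F s) P m) ∧
      ∀ s, t ≤ s → slice s X = slice t X := by
  unfold Elig
  rw [mem_ofPred_eq, mem_LInf_optFilt hF0 hμ, ae_tensor_iff hF0 hμ]
  constructor
  · rintro ⟨⟨h1, h2⟩, h3⟩
    exact ⟨fun s hs => ⟨h1 s hs, h3 s⟩, h2⟩
  · rintro ⟨h1, h2⟩
    refine ⟨⟨fun s hs => (h1 s hs).1, h2⟩, fun s => ?_⟩
    rcases le_total s t with hs | hs
    · exact (h1 s hs).2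
    · filter_upwards [(h1 t le_rfl).2] with ω hω
      have := congrFun (h2 s hs) ω
      simp only [slice] at this hω
      rwa [this]

theorem mem_EligPos_optFilt (hF0 : ∀ A : Set Ω, MeasurableSet[F 0] A ↔ P A = 0 ∨ P Aᶜ = 0)
    (hμ : IsReference P F μ) {X : Ω × Fin (T + 1) → Fin d → ℝ} :
    X ∈ EligPos (optFilt F t) (tensor F P μ) m ↔ (∀ s ≤ t, slice s X ∈ EligPos (F s) P m) ∧
      ∀ s, t ≤ s → slice s X = slice t X := by
  unfold EligPos
  rw [mem_ofPred_eq, mem_Elig_optFilt hF0 hμ, ae_tensor_iff hF0 hμ]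
  constructor
  · rintro ⟨⟨h1, h2⟩, h3⟩
    exact ⟨fun s hs => ⟨h1 s hs, h3 s⟩, h2⟩
  · rintro ⟨h1, h2⟩
    refine ⟨⟨fun s hs => (h1 s hs).1, h2⟩, fun s => ?_⟩
    rcases le_total s t with hs | hs
    · exact (h1 s hs).2
    · filter_upwards [(h1 t le_rfl).2] with ω hω
      have := congrFun (h2 s hs) ω
      simp only [slice] at this hω
      rwa [this]

/-- A property which holds for the slices before `t` and at `t` holds for pasted vectors. -/
theorem forall_slice_paste {p : (s : Fin (T + 1)) → (Ω → Fin d → ℝ) → Prop}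
    {u : Fin (T + 1) → Ω → Fin d → ℝ} {v : Ω → Fin d → ℝ} :
    ((∀ s ≤ t, p s (slice s (paste t u v))) ∧
      ∀ s, t ≤ s → slice s (paste t u v) = slice t (paste t u v)) ↔
      (∀ s < t, p s (u s)) ∧ p t v := by
  constructor
  · rintro ⟨h1, -⟩
    refine ⟨fun s hs => ?_, ?_⟩
    · have := h1 s hs.le
      rwa [slice_paste, if_pos hs] at this
    · have := h1 t le_rfl
      rwa [slice_paste, if_neg (lt_irrefl t)] at this
  · rintro ⟨h1, h2⟩
    refine ⟨fun s hs => ?_, fun s hs => ?_⟩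
    · rw [slice_paste]
      rcases hs.eq_or_lt with rfl | hs
      · rwa [if_neg (lt_irrefl s)]
      · rw [if_pos hs]
        exact h1 s hs
    · rw [slice_paste, slice_paste, if_neg (not_lt.2 hs), if_neg (lt_irrefl t)]

end OptionalSpaces

section Remainder

variable {Ω : Type*} {m0 : MeasurableSpace Ω} {P : Measure Ω} {T : ℕ}
  {F : Filtration (Fin (T + 1)) m0} {t : Fin (T + 1)} {μ : Fin (T + 1) → Ω → ℝ} {d m : ℕ}

/-- The mass `1 - ∑_{r < t} μ_r` which is left at time `t`. -/
def remMass (μ : Fin (T + 1) → Ω → ℝ) (t : Fin (T + 1)) (ω : Ω) : ℝ :=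
  1 - ∑ r ∈ Finset.Iio t, μ r ω

theorem sum_Iio_add_sum_Ici (f : Fin (T + 1) → ℝ) (t : Fin (T + 1)) :
    ∑ s ∈ Finset.Iio t, f s + ∑ s ∈ Finset.Ici t, f s = ∑ s, f s := by
  rw [← Finset.sum_union]
  · congr 1
    ext s; simp [lt_or_ge]
  · rw [Finset.disjoint_left]
    intro s h1 h2
    exact absurd (Finset.mem_Iio.1 h1) (not_lt.2 (Finset.mem_Ici.1 h2))

theorem measurable_sum_Iio (h : ∀ s, Measurable[F s] (μ s)) (t : Fin (T + 1)) :
    Measurable[F t] (fun ω => ∑ r ∈ Finset.Iio t, μ r ω) :=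
  Finset.measurable_fun_sum _ fun r hr => (h r).mono (F.mono (Finset.mem_Iio.1 hr).le) le_rfl

theorem IsReference.measurable_remMass (hμ : IsReference P F μ) :
    Measurable[F t] (remMass μ t) := measurable_const.sub (measurable_sum_Iio hμ.1 t)

theorem IsReference.remMass_eq (hμ : IsReference P F μ) (t : Fin (T + 1)) :
    ∀ᵐ ω ∂P, remMass μ t ω = ∑ s ∈ Finset.Ici t, μ s ω := by
  filter_upwards [hμ.2.1] with ω h
  rw [remMass, ← h, ← sum_Iio_add_sum_Ici (fun s => μ s ω) t]
  ring

theorem IsReference.exists_le_remMass (hμ : IsReference P F μ) (t : Fin (T + 1)) :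
    ∃ ε : ℝ, 0 < ε ∧ ∀ᵐ ω ∂P, ε ≤ remMass μ t ω ∧ remMass μ t ω ≤ 1 := by
  have h1 := hμ.remMass_eq t
  have h2 := hμ.pos
  obtain ⟨-, -, ε, hε, h⟩ := hμ
  refine ⟨ε, hε, ?_⟩
  filter_upwards [h, h1, h2] with ω h3 h4 h5
  refine ⟨?_, ?_⟩
  · rw [h4]
    exact (h3 t).le.trans (Finset.single_le_sum (f := fun s => μ s ω) (fun s _ => (h5 s).le)
      (Finset.mem_Ici.2 le_rfl))
  · rw [remMass]
    have := Finset.sum_nonneg fun s (_ : s ∈ Finset.Iio t) => (h5 s).le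
    linarith

theorem IsReference.remMass_pos (hμ : IsReference P F μ) (t : Fin (T + 1)) :
    ∀ᵐ ω ∂P, 0 < remMass μ t ω := by
  obtain ⟨ε, hε, h⟩ := hμ.exists_le_remMass t
  filter_upwards [h] with ω h using hε.trans_le h.1

theorem IsReference.integrable_div_remMass (hμ : IsReference P F μ) {f : Ω → ℝ}
    (hf : Integrable f P) : Integrable (fun ω => f ω / remMass μ t ω) P := by
  obtain ⟨ε, hε, h⟩ := hμ.exists_le_remMass t
  simp only [div_eq_mul_inv]
  refine integrable_mul_of_bounded (C := ε⁻¹) hf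
    (hμ.measurable_remMass.mono (F.le t) le_rfl).inv ?_
  filter_upwards [h] with ω h
  rw [abs_inv, abs_of_pos (hε.trans_le h.1)]
  exact inv_anti₀ hε h.1

theorem IsReference.integrable_mul (hμ : IsReference P F μ) {f : Ω → ℝ}
    (hf : Integrable f P) (s : Fin (T + 1)) : Integrable (fun ω => μ s ω * f ω) P := by
  simp only [mul_comm (μ s _)]
  refine integrable_mul_of_bounded (C := 1) hf (hμ.measurable s) ?_
  filter_upwards [hμ.pos, hμ.le_one] with ω h1 h2
  rw [abs_of_pos (h1 s)]
  exact h2 s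

theorem IsReference.integrable_div (hμ : IsReference P F μ) {f : Ω → ℝ}
    (hf : Integrable f P) (s : Fin (T + 1)) : Integrable (fun ω => f ω / μ s ω) P := by
  have hm := hμ.measurable s
  obtain ⟨-, -, ε, hε, h⟩ := hμ
  simp only [div_eq_mul_inv]
  refine integrable_mul_of_bounded (C := ε⁻¹) hf hm.inv ?_
  filter_upwards [h] with ω h
  rw [abs_inv, abs_of_pos (hε.trans (h s))]
  exact inv_anti₀ hε (h s).le

theorem IsReference.integrable_remMass_mul (hμ : IsReference P F μ) {f : Ω → ℝ}
    (hf : Integrable f P) : Integrable (fun ω => remMass μ t ω * f ω) P := by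
  obtain ⟨ε, hε, h⟩ := hμ.exists_le_remMass t
  simp only [mul_comm (remMass μ t _)]
  refine integrable_mul_of_bounded (C := 1) hf (hμ.measurable_remMass.mono (F.le t) le_rfl) ?_
  filter_upwards [h] with ω h
  rw [abs_of_pos (hε.trans_le h.1)]
  exact h.2

/-- The integral of a random variable which is known at time `t` on the optional space. -/
theorem integral_tensor_optFilt (hμ : IsReference P F μ) {f : Ω × Fin (T + 1) → ℝ}
    (hf : Measurable[optFilt F t] f) (hint : ∀ s, Integrable (fun ω => f (ω, s)) P) :
    ∫ x, f x ∂(tensor F P μ) =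
      ∑ s ∈ Finset.Iio t, ∫ ω, μ s ω * f (ω, s) ∂P + ∫ ω, remMass μ t ω * f (ω, t) ∂P := by
  rw [integral_tensor hμ (hf.mono optFilt_le le_rfl) hint, ← sum_Iio_add_sum_Ici _ t]
  congr 1
  have h1 : ∀ s ∈ Finset.Ici t, ∫ ω, μ s ω * f (ω, s) ∂P = ∫ ω, μ s ω * f (ω, t) ∂P := by
    intro s hs
    simp only [(measurable_optFilt_iff.1 hf).2 s (Finset.mem_Ici.1 hs)]
  rw [Finset.sum_congr rfl h1, ← integral_finsetSum _ fun s _ => hμ.integrable_mul (hint t) s]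
  refine integral_congr_ae ?_
  filter_upwards [hμ.remMass_eq t] with ω h
  rw [h, Finset.sum_mul]

/-- The conditional expectation on the optional space. -/
theorem condExp_tensor [IsProbabilityMeasure P]
    (hF0 : ∀ A : Set Ω, MeasurableSet[F 0] A ↔ P A = 0 ∨ P Aᶜ = 0)
    (hμ : IsReference P F μ) {f : Ω × Fin (T + 1) → ℝ}
    (hf : Measurable[optSigma F] f) (hint : ∀ s, Integrable (fun ω => f (ω, s)) P)
    (s : Fin (T + 1)) :
    ∀ᵐ ω ∂P, condExp (optFilt F t) (tensor F P μ) f (ω, s) =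
      if s < t then f (ω, s)
      else condExp (F t) P (fun ω => ∑ r ∈ Finset.Ici t, μ r ω * f (ω, r)) ω / remMass μ t ω := by
  have := isProbabilityMeasure_tensor hμ
  set h : Ω → ℝ := condExp (F t) P (fun ω => ∑ r ∈ Finset.Ici t, μ r ω * f (ω, r)) with hh
  set g : Ω × Fin (T + 1) → ℝ := fun x => if x.2 < t then f x else h x.1 / remMass μ t x.1 with hg
  have hhm : Measurable[F t] h := stronglyMeasurable_condExp.measurable
  have hfs := measurable_optSigma_iff.1 hf
  have hgm : Measurable[optFilt F t] g := by
    refine measurable_optFilt_iff.2 ⟨fun r hr => ?_, fun r hr ω => ?_⟩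
    · rcases hr.eq_or_lt with rfl | hr
      · simp only [hg, lt_irrefl, if_false]
        exact hhm.div hμ.measurable_remMass
      · simp only [hg, hr, if_true]
        exact hfs r
    · simp [hg, not_lt.2 hr]
  have hgi : ∀ r, Integrable (fun ω => g (ω, r)) P := by
    intro r
    by_cases hr : r < t
    · simp only [hg, hr, if_true]
      exact hint r
    · simp only [hg, hr, if_false]
      exact hμ.integrable_div_remMass integrable_condExp
  have hsumi : ∀ r ∈ Finset.Ici t, Integrable (fun ω => μ r ω * f (ω, r)) P := fun r _ =>
    hμ.integrable_mul (hint r) r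
  have key : g =ᵐ[tensor F P μ] condExp (optFilt F t) (tensor F P μ) f := by
    refine ae_eq_condExp_of_forall_setIntegral_eq optFilt_le ((integrable_tensor_iff hμ hf).2 hint)
      (fun B _ _ => ((integrable_tensor_iff hμ (hgm.mono optFilt_le le_rfl)).2 hgi).integrableOn)
      (fun B hB _ => ?_) hgm.stronglyMeasurable.aestronglyMeasurable
    have hBs := measurableSet_optSigma_iff.1 (optFilt_le _ hB)
    have hBS : ∀ r, MeasurableSet {ω | (ω, r) ∈ B} := fun r => F.le r _ (hBs r)
    have hBt := (measurableSet_optFilt_iff.1 hB).2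
    have hind : ∀ (k : Ω × Fin (T + 1) → ℝ) (r : Fin (T + 1)), (fun ω => B.indicator k (ω, r)) =
        {ω | (ω, r) ∈ B}.indicator (fun ω => k (ω, r)) := by
      intro k r
      ext ω; by_cases hω : (ω, r) ∈ B <;> simp [hω]
    have hset : ∀ k : Ω × Fin (T + 1) → ℝ, ∀ r, ∫ ω, μ r ω * B.indicator k (ω, r) ∂P =
        ∫ ω in {ω | (ω, r) ∈ B}, μ r ω * k (ω, r) ∂P := by
      intro k r
      rw [← integral_indicator (hBS r)]
      refine integral_congr_ae (Filter.Eventually.of_forall fun ω => ?_)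
      by_cases hω : (ω, r) ∈ B <;> simp [hω]
    rw [← integral_indicator (optFilt_le _ hB), ← integral_indicator (optFilt_le _ hB),
      integral_tensor_optFilt hμ (hgm.indicator hB)
        (fun r => by rw [hind]; exact (hgi r).indicator (hBS r)),
      integral_tensor hμ (hf.indicator (optFilt_le _ hB))
        (fun r => by rw [hind]; exact (hint r).indicator (hBS r)), ← sum_Iio_add_sum_Ici _ t]
    congr 1
    · refine Finset.sum_congr rfl fun r hr => ?_
      rw [hset, hset]
      simp [hg, Finset.mem_Iio.1 hr]
    · have h1 : ∀ r ∈ Finset.Ici t, ∫ ω, μ r ω * B.indicator f (ω, r) ∂P =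
          ∫ ω in {ω | (ω, t) ∈ B}, μ r ω * f (ω, r) ∂P := by
        intro r hr
        rw [hset]
        congr 2
        ext ω
        exact hBt r (Finset.mem_Ici.1 hr) ω
      rw [Finset.sum_congr rfl h1,
        ← integral_finsetSum _ fun r hr => (hsumi r hr).integrableOn,
        ← setIntegral_condExp (F.le t) (integrable_finsetSum _ hsumi)
          ((measurableSet_optFilt_iff.1 hB).1 t le_rfl), ← integral_indicator (hBS t)]
      refine integral_congr_ae ?_
      filter_upwards [hμ.remMass_pos t] with ω hω
      by_cases hωB : (ω, t) ∈ B
      · simp only [indicator_of_mem hωB, indicator_of_mem (s := {ω | (ω, t) ∈ B}) hωB, hg, lt_irrefl,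
          if_false]
        field_simp
        rfl
      · simp [hωB]
  filter_upwards [(ae_tensor_iff hF0 hμ).1 key s] with ω hω
  rw [← hω]

theorem condExp_tensor_nonneg_iff [IsProbabilityMeasure P]
    (hF0 : ∀ A : Set Ω, MeasurableSet[F 0] A ↔ P A = 0 ∨ P Aᶜ = 0)
    (hμ : IsReference P F μ) {f : Ω × Fin (T + 1) → ℝ}
    (hf : Measurable[optSigma F] f) (hint : ∀ s, Integrable (fun ω => f (ω, s)) P) :
    0 ≤ᵐ[tensor F P μ] condExp (optFilt F t) (tensor F P μ) f ↔
      (∀ s < t, ∀ᵐ ω ∂P, 0 ≤ f (ω, s)) ∧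
        0 ≤ᵐ[P] condExp (F t) P (fun ω => ∑ r ∈ Finset.Ici t, μ r ω * f (ω, r)) := by
  have h1 : ∀ s, ¬ s < t → ((∀ᵐ ω ∂P, 0 ≤ condExp (optFilt F t) (tensor F P μ) f (ω, s)) ↔
      0 ≤ᵐ[P] condExp (F t) P (fun ω => ∑ r ∈ Finset.Ici t, μ r ω * f (ω, r))) := by
    intro s hs
    have h2 := condExp_tensor hF0 hμ hf hint (t := t) s
    simp only [hs, if_false] at h2
    refine Filter.eventually_congr ?_
    filter_upwards [h2, hμ.remMass_pos t] with ω h3 h4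
    rw [h3]
    exact ⟨fun h => by
        have := mul_nonneg h h4.le
        rwa [div_mul_cancel₀ _ h4.ne'] at this, fun h => div_nonneg h h4.le⟩
  have h2 : ∀ s < t, ((∀ᵐ ω ∂P, 0 ≤ condExp (optFilt F t) (tensor F P μ) f (ω, s)) ↔
      ∀ᵐ ω ∂P, 0 ≤ f (ω, s)) := by
    intro s hs
    have h2 := condExp_tensor hF0 hμ hf hint (t := t) s
    simp only [hs, if_true] at h2
    refine Filter.eventually_congr ?_
    filter_upwards [h2] with ω h3
    rw [h3]
  change (∀ᵐ x ∂(tensor F P μ), 0 ≤ condExp (optFilt F t) (tensor F P μ) f x) ↔ _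
  rw [ae_tensor_iff hF0 hμ]
  constructor
  · intro h
    exact ⟨fun s hs => (h2 s hs).1 (h s), (h1 t (lt_irrefl t)).1 (h t)⟩
  · rintro ⟨h3, h4⟩ s
    by_cases hs : s < t
    · exact (h2 s hs).2 (h3 s hs)
    · exact (h1 s hs).2 h4

end Remainder

end SetRisk

namespace SetRisk

section WeakTopology

variable {S : Type*} {d m : ℕ} {mt mX mS : MeasurableSpace S} {P : Measure S}

theorem continuous_weakTop_rng {Y : Type*} [tY : TopologicalSpace Y] {C : Set (S → Fin d → ℝ)}
    {φ : Y → C} (h : ∀ Z ∈ LOne (d := d) mt P, Continuous fun y => ∫ ω, Z ω ⬝ᵥ (φ y).1 ω ∂P) :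
    @Continuous _ _ tY (weakTop mt P C) φ :=
  continuous_iInf_rng.2 fun Z => continuous_induced_rng.2 (h Z.1 Z.2)

theorem continuous_weakTop_dom {C : Set (S → Fin d → ℝ)} {Z : S → Fin d → ℝ}
    (hZ : Z ∈ LOne mt P) :
    @Continuous _ _ (weakTop mt P C) _ fun X : C => ∫ ω, Z ω ⬝ᵥ X.1 ω ∂P :=
  continuous_iInf_dom (i := ⟨Z, hZ⟩) continuous_induced_dom

theorem clElig_eq_self {D : Set (S → Fin d → ℝ)} (hD : D ⊆ Elig mt P m)
    (hcl : @IsClosed _ (weakTop mt P (Elig mt P m))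
      (Subtype.val ⁻¹' D : Set (Elig (d := d) mt P m))) : D = clElig mt P m D := by
  let _ := weakTop mt P (Elig (d := d) mt P m)
  rw [clElig, hcl.closure_eq, Subtype.image_preimage_coe, inter_eq_self_of_subset_right hD]

theorem mem_closedConvexUpperSets {D : Set (S → Fin d → ℝ)} (hD : D ∈ UpperSets mt P m)
    (hconv : Convex ℝ D) (hcl : @IsClosed _ (weakTop mt P (Elig mt P m))
      (Subtype.val ⁻¹' D : Set (Elig (d := d) mt P m))) : D ∈ ClosedConvexUpperSets mt P m := by
  refine ⟨hD.1, ?_⟩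
  rw [← hD.2, hconv.convexHull_eq]
  exact clElig_eq_self hD.1 hcl

theorem isClosedConvexVectorRM_of {R : (S → Fin d → ℝ) → Set (S → Fin d → ℝ)}
    (upper : ∀ X ∈ LInf mX P, R X ∈ UpperSets mt P m)
    (cash : ∀ X ∈ LInf mX P, ∀ c ∈ Elig mt P m, R (X + c) = (fun u => u - c) '' R X)
    (mono : ∀ X ∈ LInf mX P, ∀ Y ∈ LInf mX P, (∀ᵐ ω ∂P, X ω ≤ Y ω) → R X ⊆ R Y)
    (nonempty : (R 0).Nonempty)
    (randomSet : ∃ G : Set (S × (Fin d → ℝ)), MeasurableSet[mt.prod MeasurableSpace.pi] G ∧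
      R 0 = {u | u ∈ LInf mt P ∧ ∀ᵐ ω ∂P, (ω, u ω) ∈ G} ∧
      ∀ᵐ ω ∂P, IsClosed {x | (ω, x) ∈ G} ∧ {x | (ω, x) ∈ G} ⊆ eligible m d ∧
        {x | (ω, x) ∈ G} ≠ eligible m d)
    (convex : ∀ X ∈ LInf mX P, ∀ Y ∈ LInf mX P, ∀ l : S → ℝ, Measurable[mt] l →
      (∀ᵐ ω ∂P, 0 ≤ l ω ∧ l ω ≤ 1) → ∀ u ∈ R X, ∀ v ∈ R Y,
      (fun ω => l ω • u ω + (1 - l ω) • v ω) ∈ R (fun ω => l ω • X ω + (1 - l ω) • Y ω))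
    (closed : @IsClosed _ (@instTopologicalSpaceProd _ _ (weakTop mX P (LInf mX P))
        (weakTop mt P (Elig mt P m)))
      {p : ↥(LInf (d := d) mX P) × ↥(Elig (d := d) mt P m) | p.2.1 ∈ R p.1.1}) :
    IsClosedConvexVectorRM mX mt P m R := by
  have hcl : ∀ X ∈ LInf mX P, @IsClosed _ (weakTop mt P (Elig mt P m))
      (Subtype.val ⁻¹' R X : Set (Elig (d := d) mt P m)) := by
    intro X hX
    let _ := weakTop mX P (LInf (d := d) mX P)
    let _ := weakTop mt P (Elig (d := d) mt P m)
    have h1 : Continuous fun u : Elig (d := d) mt P m => ((⟨X, hX⟩ : LInf (d := d) mX P), u) := by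
      fun_prop
    exact closed.preimage h1
  have hconv : ∀ X ∈ LInf mX P, ∀ u ∈ R X, ∀ v ∈ R X, ∀ l : S → ℝ, Measurable[mt] l →
      (∀ᵐ ω ∂P, 0 ≤ l ω ∧ l ω ≤ 1) → (fun ω => l ω • u ω + (1 - l ω) • v ω) ∈ R X := by
    intro X hX u hu v hv l hl hl1
    have := convex X hX X hX l hl hl1 u hu v hv
    rwa [show (fun ω => l ω • X ω + (1 - l ω) • X ω) = X by
      ext ω i; simp only [Pi.add_apply, Pi.smul_apply, smul_eq_mul]; ring] at this
  refine { upper := upper, cash := cash, mono := mono, convex := convex, closed := closed,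
           zero := ⟨nonempty, clElig_eq_self (upper 0 LInf_zero).1 (hcl 0 LInf_zero), ?_, randomSet⟩,
           values := fun X hX => mem_closedConvexUpperSets (upper X hX) ?_ (hcl X hX) }
  · intro u hu v hv A hA
    rw [indicator_add_compl_eq]
    exact hconv 0 LInf_zero u hu v hv _ (measurable_const.indicator hA) (indicator_one_bounds A P)
  · intro u hu v hv a b ha hb hab
    have := hconv X hX u hu v hv (fun _ => a) measurable_const
      (Filter.Eventually.of_forall fun _ => ⟨ha, by linarith⟩)
    rw [show b = 1 - a by linarith]
    exact this

end WeakTopology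

section ProcessTopology

variable {Ω : Type*} {m0 : MeasurableSpace Ω} {P : Measure Ω} {T d m : ℕ}
  {F : Filtration (Fin (T + 1)) m0} {t : Fin (T + 1)}

theorem RInf_zero : (0 : Fin (T + 1) → Ω → Fin d → ℝ) ∈ RInf P F t :=
  ⟨fun _ => LInf_zero, fun _ _ => rfl⟩

theorem continuous_weakTopProc_rng {Y : Type*} [tY : TopologicalSpace Y]
    {φ : Y → RInf (d := d) P F t} (h : ∀ a ∈ AOne (d := d) P F t, Continuous fun y =>
      ∫ ω, ∑ s ∈ Finset.Ici t, incr a s ω ⬝ᵥ (φ y).1 s ω ∂P) :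
    @Continuous _ _ tY (weakTopProc P F t) φ :=
  continuous_iInf_rng.2 fun Z => continuous_induced_rng.2 (h Z.1 Z.2)

theorem continuous_weakTopProc_dom {a : Fin (T + 1) → Ω → Fin d → ℝ} (ha : a ∈ AOne P F t) :
    @Continuous _ _ (weakTopProc P F t) _ fun X : RInf (d := d) P F t =>
      ∫ ω, ∑ s ∈ Finset.Ici t, incr a s ω ⬝ᵥ X.1 s ω ∂P :=
  continuous_iInf_dom (i := ⟨a, ha⟩) continuous_induced_dom

theorem isClosedConvexProcessRM_of {ρ : (Fin (T + 1) → Ω → Fin d → ℝ) → Set (Ω → Fin d → ℝ)}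
    (upper : ∀ X ∈ RInf P F t, ρ X ∈ UpperSets (F t) P m)
    (cash : ∀ X ∈ RInf P F t, ∀ c ∈ Elig (F t) P m,
      ρ (X + constFrom t c) = (fun u => u - c) '' ρ X)
    (mono : ∀ X ∈ RInf P F t, ∀ Y ∈ RInf P F t,
      (∀ s, ∀ᵐ ω ∂P, X s ω ≤ Y s ω) → ρ X ⊆ ρ Y)
    (nonempty : (ρ 0).Nonempty)
    (randomSet : ∃ G : Set (Ω × (Fin d → ℝ)), MeasurableSet[(F t).prod MeasurableSpace.pi] G ∧
      ρ 0 = {u | u ∈ LInf (F t) P ∧ ∀ᵐ ω ∂P, (ω, u ω) ∈ G} ∧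
      ∀ᵐ ω ∂P, IsClosed {x | (ω, x) ∈ G} ∧ {x | (ω, x) ∈ G} ⊆ eligible m d ∧
        {x | (ω, x) ∈ G} ≠ eligible m d)
    (convex : ∀ X ∈ RInf P F t, ∀ Y ∈ RInf P F t, ∀ l : Ω → ℝ, Measurable[F t] l →
      (∀ᵐ ω ∂P, 0 ≤ l ω ∧ l ω ≤ 1) → ∀ u ∈ ρ X, ∀ v ∈ ρ Y,
      (fun ω => l ω • u ω + (1 - l ω) • v ω) ∈
        ρ (fun s ω => l ω • X s ω + (1 - l ω) • Y s ω))
    (closed : @IsClosed _ (@instTopologicalSpaceProd _ _ (weakTopProc P F t)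
        (weakTop (F t) P (Elig (F t) P m)))
      {p : ↥(RInf (d := d) P F t) × ↥(Elig (d := d) (F t) P m) | p.2.1 ∈ ρ p.1.1}) :
    IsClosedConvexProcessRM P F m t ρ := by
  have hcl : ∀ X ∈ RInf P F t, @IsClosed _ (weakTop (F t) P (Elig (F t) P m))
      (Subtype.val ⁻¹' ρ X : Set (Elig (d := d) (F t) P m)) := by
    intro X hX
    let _ := weakTopProc (d := d) P F t
    let _ := weakTop (F t) P (Elig (d := d) (F t) P m)
    have h1 : Continuous fun u : Elig (d := d) (F t) P m =>
        ((⟨X, hX⟩ : RInf (d := d) P F t), u) := by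
      fun_prop
    exact closed.preimage h1
  have hconv : ∀ X ∈ RInf P F t, ∀ u ∈ ρ X, ∀ v ∈ ρ X, ∀ l : Ω → ℝ, Measurable[F t] l →
      (∀ᵐ ω ∂P, 0 ≤ l ω ∧ l ω ≤ 1) → (fun ω => l ω • u ω + (1 - l ω) • v ω) ∈ ρ X := by
    intro X hX u hu v hv l hl hl1
    have := convex X hX X hX l hl hl1 u hu v hv
    rwa [show (fun s ω => l ω • X s ω + (1 - l ω) • X s ω) = X by
      ext s ω i; simp only [Pi.add_apply, Pi.smul_apply, smul_eq_mul]; ring] at this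
  refine { upper := upper, cash := cash, mono := mono, convex := convex, closed := closed,
           zero := ⟨nonempty, clElig_eq_self (upper 0 RInf_zero).1 (hcl 0 RInf_zero), ?_, randomSet⟩,
           values := fun X hX => mem_closedConvexUpperSets (upper X hX) ?_ (hcl X hX) }
  · intro u hu v hv A hA
    rw [indicator_add_compl_eq]
    exact hconv 0 RInf_zero u hu v hv _ (measurable_const.indicator hA) (indicator_one_bounds A P)
  · intro u hu v hv a b ha hb hab
    have := hconv X hX u hu v hv (fun _ => a) measurable_const
      (Filter.Eventually.of_forall fun _ => ⟨ha, by linarith⟩)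
    rw [show b = 1 - a by linarith]
    exact this

theorem measurable_incr {a : Fin (T + 1) → Ω → Fin d → ℝ} (ha : ∀ s, Measurable[F s] (a s))
    (s : Fin (T + 1)) : Measurable[F s] (incr a s) := by
  unfold incr
  split_ifs with h
  · exact ha s
  · exact (ha s).sub ((ha _).mono (F.mono (Fin.mk_le_of_le_val (Nat.sub_le _ _))) le_rfl)

/-- The increments of a process which is given by its increments from time `t` on. -/
theorem incr_sum_Icc (b : Fin (T + 1) → Ω → Fin d → ℝ) (t s : Fin (T + 1)) :
    incr (fun s => ∑ r ∈ Finset.Icc t s, b r) s = if t ≤ s then b s else 0 := by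
  unfold incr
  by_cases hs : s = 0
  · subst hs
    by_cases ht : t = 0
    · simp [ht]
    · have : ¬ t ≤ 0 := fun h => ht (Fin.le_zero_iff.1 h)
      simp [this, Finset.Icc_eq_empty this]
  · rw [if_neg hs]
    have hs' : 0 < (s : ℕ) := Nat.pos_of_ne_zero fun h => hs (Fin.ext h)
    by_cases ht : t ≤ s
    · have e : Finset.Icc t s =
          insert s (Finset.Icc t ⟨(s : ℕ) - 1, lt_of_le_of_lt (Nat.sub_le _ _) s.isLt⟩) := by
        ext r
        simp only [Finset.mem_Icc, Finset.mem_insert, Fin.le_def, Fin.ext_iff] at ht ⊢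
        omega
      dsimp only
      rw [e, Finset.sum_insert, if_pos ht, add_sub_cancel_right]
      simp only [Finset.mem_Icc, Fin.le_def]
      omega
    · have h2 : ¬ t ≤ ⟨(s : ℕ) - 1, lt_of_le_of_lt (Nat.sub_le _ _) s.isLt⟩ := by
        simp only [Fin.le_def] at ht ⊢
        omega
      dsimp only
      rw [if_neg ht, Finset.Icc_eq_empty ht, Finset.Icc_eq_empty h2]
      simp

end ProcessTopology

section OptionalTopology

variable {Ω : Type*} {m0 : MeasurableSpace Ω} {P : Measure Ω} {T d m : ℕ}
  {F : Filtration (Fin (T + 1)) m0} {t : Fin (T + 1)} {μ : Fin (T + 1) → Ω → ℝ}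

theorem integrable_dot_slice (hF0 : ∀ A : Set Ω, MeasurableSet[F 0] A ↔ P A = 0 ∨ P Aᶜ = 0)
    (hμ : IsReference P F μ) {Z X : Ω × Fin (T + 1) → Fin d → ℝ}
    (hZ : Z ∈ LOne (optSigma F) (tensor F P μ)) (hX : X ∈ LInf (optSigma F) (tensor F P μ))
    (s : Fin (T + 1)) : Integrable (fun ω => slice s Z ω ⬝ᵥ slice s X ω) P :=
  integrable_dot (F.le s) (LOne_mono (F.le s) ((mem_LOne_optSigma hμ).1 hZ s))
    ((mem_LInf_optSigma hF0 hμ).1 hX s)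

theorem integral_dot_tensor (hF0 : ∀ A : Set Ω, MeasurableSet[F 0] A ↔ P A = 0 ∨ P Aᶜ = 0)
    (hμ : IsReference P F μ) {Z X : Ω × Fin (T + 1) → Fin d → ℝ}
    (hZ : Z ∈ LOne (optSigma F) (tensor F P μ)) (hX : X ∈ LInf (optSigma F) (tensor F P μ)) :
    ∫ x, Z x ⬝ᵥ X x ∂(tensor F P μ) = ∑ s, ∫ ω, μ s ω * (slice s Z ω ⬝ᵥ slice s X ω) ∂P :=
  integral_tensor hμ (dotProduct_measurable hZ.1 hX.1) (integrable_dot_slice hF0 hμ hZ hX)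

theorem integral_dot_tensor_optFilt
    (hF0 : ∀ A : Set Ω, MeasurableSet[F 0] A ↔ P A = 0 ∨ P Aᶜ = 0)
    (hμ : IsReference P F μ) {Z X : Ω × Fin (T + 1) → Fin d → ℝ}
    (hZ : Z ∈ LOne (optFilt F t) (tensor F P μ)) (hX : X ∈ LInf (optFilt F t) (tensor F P μ)) :
    ∫ x, Z x ⬝ᵥ X x ∂(tensor F P μ) =
      ∑ s ∈ Finset.Iio t, ∫ ω, μ s ω * (slice s Z ω ⬝ᵥ slice s X ω) ∂P +
        ∫ ω, remMass μ t ω * (slice t Z ω ⬝ᵥ slice t X ω) ∂P :=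
  integral_tensor_optFilt hμ (dotProduct_measurable hZ.1 hX.1)
    (integrable_dot_slice hF0 hμ (LOne_mono optFilt_le hZ) (LInf_mono optFilt_le hX))

theorem IsReference.div_mem_LOne (hμ : IsReference P F μ) {s : Fin (T + 1)} {Z : Ω → Fin d → ℝ}
    (hZ : Z ∈ LOne (F s) P) : (fun ω i => Z ω i / μ s ω) ∈ LOne (F s) P :=
  mem_LOne_iff.2 ⟨measurable_of_apply fun i => (measurable_apply hZ.1 i).div (hμ.1 s),
    fun i => hμ.integrable_div ((mem_LOne_iff.1 hZ).2 i) s⟩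

theorem IsReference.mul_mem_LOne (hμ : IsReference P F μ) {s : Fin (T + 1)} {Z : Ω → Fin d → ℝ}
    (hZ : Z ∈ LOne (F s) P) : (fun ω i => μ s ω * Z ω i) ∈ LOne (F s) P :=
  mem_LOne_iff.2 ⟨measurable_of_apply fun i => (hμ.1 s).mul (measurable_apply hZ.1 i),
    fun i => hμ.integrable_mul ((mem_LOne_iff.1 hZ).2 i) s⟩

theorem IsReference.div_remMass_mem_LOne (hμ : IsReference P F μ) {Z : Ω → Fin d → ℝ}
    (hZ : Z ∈ LOne (F t) P) : (fun ω i => Z ω i / remMass μ t ω) ∈ LOne (F t) P :=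
  mem_LOne_iff.2 ⟨measurable_of_apply fun i => (measurable_apply hZ.1 i).div hμ.measurable_remMass,
    fun i => hμ.integrable_div_remMass ((mem_LOne_iff.1 hZ).2 i)⟩

theorem IsReference.remMass_mul_mem_LOne (hμ : IsReference P F μ) {Z : Ω → Fin d → ℝ}
    (hZ : Z ∈ LOne (F t) P) : (fun ω i => remMass μ t ω * Z ω i) ∈ LOne (F t) P :=
  mem_LOne_iff.2 ⟨measurable_of_apply fun i => hμ.measurable_remMass.mul (measurable_apply hZ.1 i),
    fun i => hμ.integrable_remMass_mul ((mem_LOne_iff.1 hZ).2 i)⟩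

theorem LOne_zero {S : Type*} {mt mS : MeasurableSpace S} {P : Measure S} :
    (0 : S → Fin d → ℝ) ∈ LOne mt P :=
  ⟨measurable_const, integrable_zero _ _ _⟩

theorem single_mem_LOne (hμ : IsReference P F μ) {s : Fin (T + 1)} {Z : Ω → Fin d → ℝ}
    (hZ : Z ∈ LOne (F s) P) : single s Z ∈ LOne (optSigma F) (tensor F P μ) :=
  (mem_LOne_optSigma hμ).2 fun r => by
    rw [slice_single]
    split_ifs with h
    · exact h ▸ hZ
    · exact LOne_zero

theorem single_mem_LOne_optFilt (hμ : IsReference P F μ) {s : Fin (T + 1)} (hs : s < t)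
    {Z : Ω → Fin d → ℝ} (hZ : Z ∈ LOne (F s) P) :
    single s Z ∈ LOne (optFilt F t) (tensor F P μ) :=
  (mem_LOne_optFilt hμ).2 ⟨fun r _ => (mem_LOne_optSigma hμ).1 (single_mem_LOne hμ hZ) r,
    fun r hr => by
      rw [slice_single, slice_single, if_neg (hs.trans_le hr).ne', if_neg hs.ne']⟩

theorem paste_mem_LOne_optFilt (hμ : IsReference P F μ) {u : Fin (T + 1) → Ω → Fin d → ℝ}
    {v : Ω → Fin d → ℝ} (hu : ∀ s < t, u s ∈ LOne (F s) P) (hv : v ∈ LOne (F t) P) :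
    paste t u v ∈ LOne (optFilt F t) (tensor F P μ) :=
  (mem_LOne_optFilt hμ).2 ((forall_slice_paste (p := fun s x => x ∈ LOne (F s) P)).2 ⟨hu, hv⟩)

theorem paste_mem_Elig (hF0 : ∀ A : Set Ω, MeasurableSet[F 0] A ↔ P A = 0 ∨ P Aᶜ = 0)
    (hμ : IsReference P F μ) {u : Fin (T + 1) → Ω → Fin d → ℝ}
    {v : Ω → Fin d → ℝ} (hu : ∀ s < t, u s ∈ Elig (F s) P m) (hv : v ∈ Elig (F t) P m) :
    paste t u v ∈ Elig (optFilt F t) (tensor F P μ) m :=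
  (mem_Elig_optFilt hF0 hμ).2
    ((forall_slice_paste (p := fun s x => x ∈ Elig (F s) P m)).2 ⟨hu, hv⟩)

theorem single_mem_LInf (hF0 : ∀ A : Set Ω, MeasurableSet[F 0] A ↔ P A = 0 ∨ P Aᶜ = 0)
    (hμ : IsReference P F μ) {s : Fin (T + 1)} {Z : Ω → Fin d → ℝ}
    (hZ : Z ∈ LInf (F s) P) : single s Z ∈ LInf (optSigma F) (tensor F P μ) :=
  (mem_LInf_optSigma hF0 hμ).2 fun r => by
    rw [slice_single]
    split_ifs with h
    · exact h ▸ hZ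
    · exact LInf_zero

theorem procFrom_mem_LInf (hF0 : ∀ A : Set Ω, MeasurableSet[F 0] A ↔ P A = 0 ∨ P Aᶜ = 0)
    (hμ : IsReference P F μ) {X : Fin (T + 1) → Ω → Fin d → ℝ} (hX : X ∈ RInf P F t) :
    procFrom t X ∈ LInf (optSigma F) (tensor F P μ) :=
  (mem_LInf_optSigma hF0 hμ).2 fun r => by
    rw [slice_procFrom]
    split_ifs with h
    · exact hX.1 r
    · exact LInf_zero

theorem projFrom_mem_RInf (hF0 : ∀ A : Set Ω, MeasurableSet[F 0] A ↔ P A = 0 ∨ P Aᶜ = 0)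
    (hμ : IsReference P F μ) {X : Ω × Fin (T + 1) → Fin d → ℝ}
    (hX : X ∈ LInf (optSigma F) (tensor F P μ)) : projFrom t X ∈ RInf P F t := by
  refine ⟨fun s => ?_, fun s hs => if_neg (not_le.2 hs)⟩
  unfold projFrom
  split_ifs
  · exact (mem_LInf_optSigma hF0 hμ).1 hX s
  · exact LInf_zero

theorem mul_div_dot {ι : Type*} [Fintype ι] {a : ℝ} (ha : a ≠ 0) (x y : ι → ℝ) :
    a * ((fun i => x i / a) ⬝ᵥ y) = x ⬝ᵥ y := by
  rw [dotProduct, dotProduct, Finset.mul_sum]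
  exact Finset.sum_congr rfl fun i _ => by field_simp

theorem mul_dot {ι : Type*} [Fintype ι] (a : ℝ) (x y : ι → ℝ) :
    (fun i => a * x i) ⬝ᵥ y = a * (x ⬝ᵥ y) := by
  rw [dotProduct, dotProduct, Finset.mul_sum]
  exact Finset.sum_congr rfl fun i _ => by ring

theorem integral_single_dot (hF0 : ∀ A : Set Ω, MeasurableSet[F 0] A ↔ P A = 0 ∨ P Aᶜ = 0)
    (hμ : IsReference P F μ) {s : Fin (T + 1)} {Z : Ω → Fin d → ℝ} (hZ : Z ∈ LOne (F s) P)
    {X : Ω × Fin (T + 1) → Fin d → ℝ} (hX : X ∈ LInf (optSigma F) (tensor F P μ)) :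
    ∫ x, single s (fun ω i => Z ω i / μ s ω) x ⬝ᵥ X x ∂(tensor F P μ) =
      ∫ ω, Z ω ⬝ᵥ slice s X ω ∂P := by
  rw [integral_dot_tensor hF0 hμ (single_mem_LOne hμ (hμ.div_mem_LOne hZ)) hX,
    Finset.sum_eq_single s]
  · rw [slice_single, if_pos rfl]
    refine integral_congr_ae ?_
    filter_upwards [hμ.pos] with ω h
    exact mul_div_dot (h s).ne' _ _
  · intro r _ hr
    rw [slice_single, if_neg hr]
    simp
  · simp

theorem continuous_slice_LInf (hF0 : ∀ A : Set Ω, MeasurableSet[F 0] A ↔ P A = 0 ∨ P Aᶜ = 0)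
    (hμ : IsReference P F μ) (s : Fin (T + 1)) :
    @Continuous _ _ (weakTop (optSigma F) (tensor F P μ) (LInf (d := d) (optSigma F) (tensor F P μ)))
      (weakTop (F s) P (LInf (d := d) (F s) P))
      (fun X => ⟨slice s X.1, (mem_LInf_optSigma hF0 hμ).1 X.2 s⟩) := by
  refine @continuous_weakTop_rng _ _ _ _ _ _ (weakTop _ _ _) _ _ fun Z hZ => ?_
  refine (@continuous_congr _ _ (weakTop _ _ _) _ _ _ fun X => ?_).1
    (continuous_weakTop_dom (single_mem_LOne hμ (hμ.div_mem_LOne hZ)))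
  exact integral_single_dot hF0 hμ hZ X.2

theorem continuous_slice_Elig (hF0 : ∀ A : Set Ω, MeasurableSet[F 0] A ↔ P A = 0 ∨ P Aᶜ = 0)
    (hμ : IsReference P F μ) {s : Fin (T + 1)} (hs : s ≤ t) :
    @Continuous _ _
      (weakTop (optFilt F t) (tensor F P μ) (Elig (d := d) (optFilt F t) (tensor F P μ) m))
      (weakTop (F s) P (Elig (d := d) (F s) P m))
      (fun X => ⟨slice s X.1, ((mem_Elig_optFilt hF0 hμ).1 X.2).1 s hs⟩) := by
  refine @continuous_weakTop_rng _ _ _ _ _ _ (weakTop _ _ _) _ _ fun Z hZ => ?_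
  rcases hs.eq_or_lt with rfl | hs
  · have hZ' := paste_mem_LOne_optFilt hμ (u := fun _ => (0 : Ω → Fin d → ℝ))
      (fun r _ => LOne_zero) (hμ.div_remMass_mem_LOne hZ)
    refine (@continuous_congr _ _ (weakTop _ _ _) _ _ _ fun X => ?_).1 (continuous_weakTop_dom hZ')
    rw [integral_dot_tensor_optFilt hF0 hμ hZ' X.2.1, Finset.sum_eq_zero, zero_add]
    · rw [slice_paste, if_neg (lt_irrefl s)]
      refine integral_congr_ae ?_
      filter_upwards [hμ.remMass_pos s] with ω h
      exact mul_div_dot h.ne' _ _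
    · intro r hr
      rw [slice_paste, if_pos (Finset.mem_Iio.1 hr)]
      simp
  · refine (@continuous_congr _ _ (weakTop _ _ _) _ _ _ fun X => ?_).1
      (continuous_weakTop_dom (single_mem_LOne_optFilt hμ hs (hμ.div_mem_LOne hZ)))
    exact integral_single_dot hF0 hμ hZ (LInf_mono optFilt_le X.2.1)

theorem continuous_projFrom (hF0 : ∀ A : Set Ω, MeasurableSet[F 0] A ↔ P A = 0 ∨ P Aᶜ = 0)
    (hμ : IsReference P F μ) :
    @Continuous _ _ (weakTop (optSigma F) (tensor F P μ) (LInf (d := d) (optSigma F) (tensor F P μ)))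
      (weakTopProc P F t)
      (fun X => (⟨projFrom t X.1, projFrom_mem_RInf hF0 hμ X.2⟩ : RInf (d := d) P F t)) := by
  refine @continuous_weakTopProc_rng _ _ _ _ _ _ _ _ (weakTop _ _ _) _ fun a ha => ?_
  have hb : ∀ s, incr a s ∈ LOne (F s) P := fun s => ⟨measurable_incr ha.1 s, ha.2.1 s⟩
  have hZ : procFrom t (fun s ω i => incr a s ω i / μ s ω) ∈ LOne (optSigma F) (tensor F P μ) :=
    (mem_LOne_optSigma hμ).2 fun r => by
      rw [slice_procFrom]
      split_ifs with h
      · exact hμ.div_mem_LOne (hb r)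
      · exact LOne_zero
  refine (@continuous_congr _ _ (weakTop _ _ _) _ _ _ fun X => ?_).1 (continuous_weakTop_dom hZ)
  rw [integral_dot_tensor hF0 hμ hZ X.2, ← sum_Iio_add_sum_Ici _ t, Finset.sum_eq_zero, zero_add,
    integral_finsetSum]
  · refine Finset.sum_congr rfl fun s hs => ?_
    have hs := Finset.mem_Ici.1 hs
    have e : projFrom t X.1 s = slice s X.1 := if_pos hs
    rw [slice_procFrom, if_pos hs]
    dsimp only
    rw [e]
    refine integral_congr_ae ?_
    filter_upwards [hμ.pos] with ω h
    exact mul_div_dot (h s).ne' _ _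
  · exact fun s _ => integrable_dot (F.le s) (LOne_mono (F.le s) (hb s))
      ((projFrom_mem_RInf hF0 hμ X.2).1 s)
  · intro r hr
    rw [slice_procFrom, if_neg (not_le.2 (Finset.mem_Iio.1 hr))]
    simp

theorem continuous_procFrom (hF0 : ∀ A : Set Ω, MeasurableSet[F 0] A ↔ P A = 0 ∨ P Aᶜ = 0)
    (hμ : IsReference P F μ) :
    @Continuous _ _ (weakTopProc P F t)
      (weakTop (optSigma F) (tensor F P μ) (LInf (d := d) (optSigma F) (tensor F P μ)))
      (fun X : RInf (d := d) P F t => ⟨procFrom t X.1, procFrom_mem_LInf hF0 hμ X.2⟩) := by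
  refine @continuous_weakTop_rng _ _ _ _ _ _ (weakTopProc _ _ _) _ _ fun Z hZ => ?_
  have hb : ∀ s, (fun ω i => μ s ω * slice s Z ω i) ∈ LOne (F s) P := fun s =>
    hμ.mul_mem_LOne ((mem_LOne_optSigma hμ).1 hZ s)
  set a : Fin (T + 1) → Ω → Fin d → ℝ :=
    fun s => ∑ r ∈ Finset.Icc t s, fun ω i => μ r ω * slice r Z ω i with ha
  have hincr : ∀ s, incr a s = if t ≤ s then (fun ω i => μ s ω * slice s Z ω i) else 0 :=
    fun s => incr_sum_Icc _ t s
  have haA : a ∈ AOne P F t := by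
    refine ⟨fun s => ?_, fun s => ?_, fun s hs => ?_⟩
    · have e : a s = fun ω => ∑ r ∈ Finset.Icc t s, fun i => μ r ω * slice r Z ω i := by
        ext ω i; simp [ha]
      rw [e]
      refine Finset.measurable_fun_sum _ fun r hr => ?_
      exact (hb r).1.mono (F.mono (Finset.mem_Icc.1 hr).2) le_rfl
    · rw [hincr]
      split_ifs
      · exact (hb s).2
      · exact integrable_zero _ _ _
    · simp only [ha, Finset.Icc_eq_empty (not_le.2 hs), Finset.sum_empty]
  refine (@continuous_congr _ _ (weakTopProc _ _ _) _ _ _ fun X => ?_).1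
    (continuous_weakTopProc_dom haA)
  rw [integral_dot_tensor hF0 hμ hZ (procFrom_mem_LInf hF0 hμ X.2), ← sum_Iio_add_sum_Ici _ t,
    Finset.sum_eq_zero, zero_add, integral_finsetSum]
  · refine Finset.sum_congr rfl fun s hs => ?_
    have hs := Finset.mem_Ici.1 hs
    rw [slice_procFrom, if_pos hs, hincr, if_pos hs]
    simp only [mul_dot]
  · intro s hs
    have hs := Finset.mem_Ici.1 hs
    rw [hincr, if_pos hs]
    exact integrable_dot (F.le s) (LOne_mono (F.le s) (hb s)) (X.2.1 s)
  · intro r hr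
    rw [slice_procFrom, if_neg (not_le.2 (Finset.mem_Iio.1 hr))]
    simp

theorem continuous_single (hF0 : ∀ A : Set Ω, MeasurableSet[F 0] A ↔ P A = 0 ∨ P Aᶜ = 0)
    (hμ : IsReference P F μ) (s : Fin (T + 1)) :
    @Continuous _ _ (weakTop (F s) P (LInf (d := d) (F s) P))
      (weakTop (optSigma F) (tensor F P μ) (LInf (d := d) (optSigma F) (tensor F P μ)))
      (fun X => ⟨single s X.1, single_mem_LInf hF0 hμ X.2⟩) := by
  refine @continuous_weakTop_rng _ _ _ _ _ _ (weakTop _ _ _) _ _ fun Z hZ => ?_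
  refine (@continuous_congr _ _ (weakTop _ _ _) _ _ _ fun X => ?_).1
    (continuous_weakTop_dom (hμ.mul_mem_LOne ((mem_LOne_optSigma hμ).1 hZ s)))
  rw [integral_dot_tensor hF0 hμ hZ (single_mem_LInf hF0 hμ X.2), Finset.sum_eq_single s]
  · rw [slice_single, if_pos rfl]
    simp only [mul_dot]
  · intro r _ hr
    rw [slice_single, if_neg hr]
    simp
  · simp

theorem continuous_paste (hF0 : ∀ A : Set Ω, MeasurableSet[F 0] A ↔ P A = 0 ∨ P Aᶜ = 0)
    (hμ : IsReference P F μ) {u : Fin (T + 1) → Ω → Fin d → ℝ} (hu : ∀ s < t, u s ∈ Elig (F s) P m) :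
    @Continuous _ _ (weakTop (F t) P (Elig (d := d) (F t) P m))
      (weakTop (optFilt F t) (tensor F P μ) (Elig (d := d) (optFilt F t) (tensor F P μ) m))
      (fun v => ⟨paste t u v.1, paste_mem_Elig hF0 hμ hu v.2⟩) := by
  refine @continuous_weakTop_rng _ _ _ _ _ _ (weakTop _ _ _) _ _ fun Z hZ => ?_
  refine (@continuous_congr _ _ (weakTop _ _ _) _ _ _ fun v => ?_).1
    (@Continuous.add _ _ _ _ _ (weakTop _ _ _) _ _ (@continuous_const _ _ (weakTop _ _ _) _
      (∑ s ∈ Finset.Iio t, ∫ ω, μ s ω * (slice s Z ω ⬝ᵥ u s ω) ∂P))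
    (continuous_weakTop_dom (hμ.remMass_mul_mem_LOne (((mem_LOne_optFilt hμ).1 hZ).1 t le_rfl))))
  rw [integral_dot_tensor_optFilt hF0 hμ hZ (paste_mem_Elig hF0 hμ hu v.2).1]
  rw [Pi.add_apply]
  congr 1
  · refine Finset.sum_congr rfl fun s hs => ?_
    rw [slice_paste, if_pos (Finset.mem_Iio.1 hs)]
  · rw [slice_paste, if_neg (lt_irrefl t)]
    simp only [mul_dot]

theorem continuous_paste_update
    (hF0 : ∀ A : Set Ω, MeasurableSet[F 0] A ↔ P A = 0 ∨ P Aᶜ = 0)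
    (hμ : IsReference P F μ) {u : Fin (T + 1) → Ω → Fin d → ℝ} {v : Ω → Fin d → ℝ} {r : Fin (T + 1)}
    (hr : r < t) (hu : ∀ x ∈ Elig (F r) P m,
      paste t (Function.update u r x) v ∈ Elig (optFilt F t) (tensor F P μ) m) :
    @Continuous _ _ (weakTop (F r) P (Elig (d := d) (F r) P m))
      (weakTop (optFilt F t) (tensor F P μ) (Elig (d := d) (optFilt F t) (tensor F P μ) m))
      (fun x => ⟨paste t (Function.update u r x.1) v, hu x.1 x.2⟩) := by
  refine @continuous_weakTop_rng _ _ _ _ _ _ (weakTop _ _ _) _ _ fun Z hZ => ?_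
  refine (@continuous_congr _ _ (weakTop _ _ _) _ _ _ fun x => ?_).1
    (@Continuous.add _ _ _ _ _ (weakTop _ _ _) _ _
      (continuous_weakTop_dom (hμ.mul_mem_LOne (((mem_LOne_optFilt hμ).1 hZ).1 r hr.le)))
      (@continuous_const _ _ (weakTop _ _ _) _
      (∑ s ∈ (Finset.Iio t).erase r, ∫ ω, μ s ω * (slice s Z ω ⬝ᵥ u s ω) ∂P +
        ∫ ω, remMass μ t ω * (slice t Z ω ⬝ᵥ v ω) ∂P)))
  rw [integral_dot_tensor_optFilt hF0 hμ hZ (hu x.1 x.2).1,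
    ← Finset.add_sum_erase _ _ (Finset.mem_Iio.2 hr), Pi.add_apply, ← add_assoc]
  congr 1
  · congr 1
    · rw [slice_paste, if_pos hr, Function.update_self]
      simp only [mul_dot]
    · refine Finset.sum_congr rfl fun s hs => ?_
      rw [slice_paste, if_pos (Finset.mem_Iio.1 (Finset.mem_of_mem_erase hs)),
        Function.update_of_ne (Finset.ne_of_mem_erase hs)]
  · rw [slice_paste, if_neg (lt_irrefl t)]

end OptionalTopology

end SetRisk

namespace SetRisk

section Sets

variable {S E : Type*} {d m : ℕ} {mt mX mS : MeasurableSpace S} {P : Measure S}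

theorem mem_UpperSets_iff {D : Set (S → Fin d → ℝ)} :
    D ∈ UpperSets mt P m ↔ D ⊆ Elig mt P m ∧ ∀ u ∈ D, ∀ e ∈ EligPos mt P m, u + e ∈ D := by
  refine and_congr_right fun _ => ⟨fun h u hu e he => ?_, fun h => ?_⟩
  · rw [h]
    exact add_mem_add hu he
  · refine Subset.antisymm (fun u hu => ?_) ?_
    · exact ⟨u, hu, 0, ⟨Elig_zero, Filter.Eventually.of_forall fun _ _ => le_rfl⟩, add_zero u⟩
    · rintro _ ⟨u, hu, e, he, rfl⟩
      exact h u hu e he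

theorem mem_image_sub_iff {G : Type*} [AddGroup G] {D : Set G} {c u : G} :
    u ∈ (fun v => v - c) '' D ↔ u + c ∈ D := by
  constructor
  · rintro ⟨v, hv, rfl⟩
    simpa using hv
  · exact fun h => ⟨u + c, h, add_sub_cancel_right u c⟩

theorem measurableSet_prod_preimage {Ω : Type*} [mE : MeasurableSpace E] {mΩ : MeasurableSpace Ω}
    {a : S → Ω} (ha : Measurable[mt, mΩ] a) {G : Set (Ω × E)} (hG : MeasurableSet[mΩ.prod mE] G) :
    MeasurableSet[mt.prod mE] {p : S × E | (a p.1, p.2) ∈ G} :=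
  ((ha.comp measurable_fst).prodMk measurable_snd) hG

theorem measurableSet_prod_imp {Ω : Type*} [mE : MeasurableSpace E] {mΩ : MeasurableSpace Ω}
    {a : S → Ω} (ha : Measurable[mt, mΩ] a) {G : Set (Ω × E)} (hG : MeasurableSet[mΩ.prod mE] G)
    {A : Set S} (hA : MeasurableSet[mt] A) :
    MeasurableSet[mt.prod mE] {p : S × E | p.1 ∈ A → (a p.1, p.2) ∈ G} := by
  have h1 : MeasurableSet[mt.prod mE] {p : S × E | p.1 ∈ A} := @measurable_fst S E mt mE A hA
  have h2 := h1.compl.union (measurableSet_prod_preimage ha hG)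
  convert h2 using 1
  ext p
  simp [imp_iff_not_or]

end Sets

section ToOptional

variable {Ω : Type*} {m0 : MeasurableSpace Ω} {P : Measure Ω} {T d m : ℕ}
  {F : Filtration (Fin (T + 1)) m0} {t : Fin (T + 1)} {μ : Fin (T + 1) → Ω → ℝ}

theorem mem_pasteSets_iff {D : Fin (T + 1) → Set (Ω → Fin d → ℝ)} {D' : Set (Ω → Fin d → ℝ)}
    {x : Ω × Fin (T + 1) → Fin d → ℝ} :
    x ∈ pasteSets t D D' ↔ (∀ s < t, slice s x ∈ D s) ∧ slice t x ∈ D' ∧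
      ∀ s, t ≤ s → slice s x = slice t x := by
  constructor
  · rintro ⟨u, v, hu, hv, rfl⟩
    refine ⟨fun s hs => ?_, ?_, fun s hs => ?_⟩
    · rw [slice_paste, if_pos hs]
      exact hu s hs
    · rwa [slice_paste, if_neg (lt_irrefl t)]
    · rw [slice_paste, slice_paste, if_neg (not_lt.2 hs), if_neg (lt_irrefl t)]
  · rintro ⟨h1, h2, h3⟩
    exact ⟨_, _, h1, h2, (paste_slice h3).symm⟩

theorem projFrom_zero : projFrom t (0 : Ω × Fin (T + 1) → Fin d → ℝ) = 0 := by
  ext s ω i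
  by_cases h : t ≤ s <;> simp [projFrom, h, slice]

theorem projFrom_add {X c : Ω × Fin (T + 1) → Fin d → ℝ}
    (hc : ∀ s, t ≤ s → slice s c = slice t c) :
    projFrom t (X + c) = projFrom t X + constFrom t (slice t c) := by
  ext s ω i
  by_cases h : t ≤ s
  · rw [← hc s h]
    simp [projFrom, constFrom, h, slice]
  · simp [projFrom, constFrom, h]

theorem measurable_optFilt_section {ω₀ : Ω} {s : Fin (T + 1)} (hs : s < t) :
    Measurable[optFilt F t, F s] (fun x : Ω × Fin (T + 1) => if x.2 = s then x.1 else ω₀) := by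
  intro A hA
  refine measurableSet_optFilt_iff.2 ⟨fun r hr => ?_, fun r hr ω => ?_⟩
  · by_cases h : r = s
    · subst h; simpa using hA
    · simp [h]
  · simp [(hs.trans_le hr).ne', hs.ne']

theorem measurable_optFilt_section_ge {ω₀ : Ω} :
    Measurable[optFilt F t, F t] (fun x : Ω × Fin (T + 1) => if t ≤ x.2 then x.1 else ω₀) := by
  intro A hA
  refine measurableSet_optFilt_iff.2 ⟨fun r hr => ?_, fun r hr ω => ?_⟩
  · by_cases h : t ≤ r
    · obtain rfl := le_antisymm hr h
      simpa using hA
    · simp [h]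
  · simp [hr]

theorem measurableSet_optFilt_eq {s : Fin (T + 1)} (hs : s < t) :
    MeasurableSet[optFilt F t] {x : Ω × Fin (T + 1) | x.2 = s} := by
  refine measurableSet_optFilt_iff.2 ⟨fun r hr => ?_, fun r hr ω => ?_⟩
  · by_cases h : r = s <;> simp [h]
  · simp [(hs.trans_le hr).ne', hs.ne']

theorem measurableSet_optFilt_ge : MeasurableSet[optFilt F t] {x : Ω × Fin (T + 1) | t ≤ x.2} := by
  refine measurableSet_optFilt_iff.2 ⟨fun r hr => ?_, fun r hr ω => ?_⟩
  · by_cases h : t ≤ r <;> simp [h]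
  · simp [hr]

variable {ρ : (Fin (T + 1) → Ω → Fin d → ℝ) → Set (Ω → Fin d → ℝ)}
  {R : Fin (T + 1) → (Ω → Fin d → ℝ) → Set (Ω → Fin d → ℝ)}

theorem toOptional_randomSet [IsProbabilityMeasure P]
    (hF0 : ∀ A : Set Ω, MeasurableSet[F 0] A ↔ P A = 0 ∨ P Aᶜ = 0)
    (hμ : IsReference P F μ) (hρ : IsClosedConvexProcessRM P F m t ρ)
    (hR : ∀ s < t, IsClosedConvexVectorRM (F s) (F s) P m (R s)) :
    ∃ G : Set ((Ω × Fin (T + 1)) × (Fin d → ℝ)),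
      MeasurableSet[(optFilt F t).prod MeasurableSpace.pi] G ∧
      toOptional t ρ R 0 =
        {u | u ∈ LInf (optFilt F t) (tensor F P μ) ∧ ∀ᵐ x ∂(tensor F P μ), (x, u x) ∈ G} ∧
      ∀ᵐ x ∂(tensor F P μ), IsClosed {y | (x, y) ∈ G} ∧ {y | (x, y) ∈ G} ⊆ eligible m d ∧
        {y | (x, y) ∈ G} ≠ eligible m d := by
  obtain ⟨ω₀⟩ : Nonempty Ω := nonempty_of_isProbabilityMeasure P
  obtain ⟨-, -, -, Gt, hGtm, hGt0, hGtae⟩ := hρ.zero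
  have hex : ∀ s, ∃ G : Set (Ω × (Fin d → ℝ)), s < t →
      MeasurableSet[(F s).prod MeasurableSpace.pi] G ∧
      R s 0 = {u | u ∈ LInf (F s) P ∧ ∀ᵐ ω ∂P, (ω, u ω) ∈ G} ∧
      ∀ᵐ ω ∂P, IsClosed {x | (ω, x) ∈ G} ∧ {x | (ω, x) ∈ G} ⊆ eligible m d ∧
        {x | (ω, x) ∈ G} ≠ eligible m d := by
    intro s
    by_cases hs : s < t
    · obtain ⟨-, -, -, G, h1, h2, h3⟩ := (hR s hs).zero
      exact ⟨G, fun _ => ⟨h1, h2, h3⟩⟩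
    · exact ⟨∅, fun h => absurd h hs⟩
  choose G hG using hex
  set GG : Set ((Ω × Fin (T + 1)) × (Fin d → ℝ)) :=
    (⋂ s : {s // s < t}, {p | p.1 ∈ {x : Ω × Fin (T + 1) | x.2 = s.1} →
      ((if p.1.2 = s.1 then p.1.1 else ω₀), p.2) ∈ G s.1}) ∩
    {p | p.1 ∈ {x : Ω × Fin (T + 1) | t ≤ x.2} →
      ((if t ≤ p.1.2 then p.1.1 else ω₀), p.2) ∈ Gt} with hGG
  have hlt : ∀ (ω : Ω) (s : Fin (T + 1)) (y : Fin d → ℝ), s < t →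
      (((ω, s), y) ∈ GG ↔ (ω, y) ∈ G s) := by
    intro ω s y hs
    simp only [hGG, mem_inter_iff, mem_iInter, mem_ofPred_eq, not_le.2 hs, IsEmpty.forall_iff,
      and_true, Subtype.forall]
    constructor
    · intro h
      simpa using h s hs rfl
    · intro h r _ hsr
      subst hsr
      simpa using h
  have hge : ∀ (ω : Ω) (s : Fin (T + 1)) (y : Fin d → ℝ), t ≤ s →
      (((ω, s), y) ∈ GG ↔ (ω, y) ∈ Gt) := by
    intro ω s y hs
    simp only [hGG, mem_inter_iff, mem_iInter, mem_ofPred_eq, hs, if_true, true_imp_iff,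
      Subtype.forall]
    exact ⟨fun h => h.2, fun h => ⟨fun r hr hsr => absurd (hsr ▸ hr) (not_lt.2 hs), h⟩⟩
  refine ⟨GG, ?_, ?_, ?_⟩
  · refine MeasurableSet.inter (MeasurableSet.iInter fun s => ?_) ?_
    · exact measurableSet_prod_imp (measurable_optFilt_section s.2) (hG s.1 s.2).1
        (measurableSet_optFilt_eq s.2)
    · exact measurableSet_prod_imp measurable_optFilt_section_ge hGtm measurableSet_optFilt_ge
  · ext u
    rw [toOptional, mem_pasteSets_iff, mem_ofPred_eq, mem_LInf_optFilt hF0 hμ, ae_tensor_iff hF0 hμ,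
      projFrom_zero, hGt0]
    have h0 : ∀ s, slice s (0 : Ω × Fin (T + 1) → Fin d → ℝ) = 0 := fun s => rfl
    simp only [h0]
    constructor
    · rintro ⟨h1, h2, h3⟩
      refine ⟨⟨fun s hs => ?_, h3⟩, fun s => ?_⟩
      · rcases hs.eq_or_lt with rfl | hs
        · exact h2.1
        · have := h1 s hs
          rw [(hG s hs).2.1] at this
          exact this.1
      · rcases lt_or_ge s t with hs | hs
        · have := h1 s hs
          rw [(hG s hs).2.1] at this
          filter_upwards [this.2] with ω hω
          exact (hlt _ _ _ hs).2 hω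
        · filter_upwards [h2.2] with ω hω
          rw [hge _ _ _ hs, show u (ω, s) = u (ω, t) from congrFun (h3 s hs) ω]
          exact hω
    · rintro ⟨⟨h1, h2⟩, h3⟩
      refine ⟨fun s hs => ?_, ⟨h1 t le_rfl, ?_⟩, h2⟩
      · rw [(hG s hs).2.1]
        refine ⟨h1 s hs.le, ?_⟩
        filter_upwards [h3 s] with ω hω
        exact (hlt _ _ _ hs).1 hω
      · filter_upwards [h3 t] with ω hω
        exact (hge _ _ _ le_rfl).1 hω
  · rw [ae_tensor_iff hF0 hμ]
    intro s
    rcases lt_or_ge s t with hs | hs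
    · filter_upwards [(hG s hs).2.2] with ω hω
      simp only [hlt _ _ _ hs]
      exact hω
    · filter_upwards [hGtae] with ω hω
      simp only [hge _ _ _ hs]
      exact hω

/-- The risk measure which is composed of a risk measure for processes and of restricted risk
measures for vectors. -/
theorem isClosedConvexVectorRM_toOptional [IsProbabilityMeasure P]
    (hF0 : ∀ A : Set Ω, MeasurableSet[F 0] A ↔ P A = 0 ∨ P Aᶜ = 0)
    (hμ : IsReference P F μ) (hρ : IsClosedConvexProcessRM P F m t ρ)
    (hR : ∀ s < t, IsClosedConvexVectorRM (F s) (F s) P m (R s)) :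
    IsClosedConvexVectorRM (optSigma F) (optFilt F t) (tensor F P μ) m (toOptional t ρ R) := by
  have hsl : ∀ {X : Ω × Fin (T + 1) → Fin d → ℝ}, X ∈ LInf (optSigma F) (tensor F P μ) →
      ∀ s, slice s X ∈ LInf (F s) P := fun hX => (mem_LInf_optSigma hF0 hμ).1 hX
  refine isClosedConvexVectorRM_of ?_ ?_ ?_ ?_ (toOptional_randomSet hF0 hμ hρ hR) ?_ ?_
  · intro X hX
    have hρX := mem_UpperSets_iff.1 (hρ.upper _ (projFrom_mem_RInf (t := t) hF0 hμ hX))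
    have hRX := fun s hs => mem_UpperSets_iff.1 ((hR s hs).upper _ (hsl hX s))
    refine mem_UpperSets_iff.2 ⟨fun u hu => ?_, fun u hu e he => ?_⟩
    · obtain ⟨h1, h2, h3⟩ := mem_pasteSets_iff.1 hu
      refine (mem_Elig_optFilt hF0 hμ).2 ⟨fun s hs => ?_, h3⟩
      rcases hs.eq_or_lt with rfl | hs
      · exact hρX.1 h2
      · exact (hRX s hs).1 (h1 s hs)
    · obtain ⟨h1, h2, h3⟩ := mem_pasteSets_iff.1 hu
      obtain ⟨h4, h5⟩ := (mem_EligPos_optFilt hF0 hμ).1 he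
      refine mem_pasteSets_iff.2 ⟨fun s hs => (hRX s hs).2 _ (h1 s hs) _ (h4 s hs.le),
        hρX.2 _ h2 _ (h4 t le_rfl), fun s hs => ?_⟩
      exact congrArg₂ (· + ·) (h3 s hs) (h5 s hs)
  · intro X hX c hc
    obtain ⟨hc1, hc2⟩ := (mem_Elig_optFilt hF0 hμ).1 hc
    ext u
    rw [mem_image_sub_iff, toOptional, toOptional, mem_pasteSets_iff, mem_pasteSets_iff,
      projFrom_add hc2, hρ.cash _ (projFrom_mem_RInf hF0 hμ hX) _ (hc1 t le_rfl), mem_image_sub_iff]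
    refine and_congr (forall₂_congr fun s hs => ?_) (and_congr Iff.rfl (forall₂_congr fun s hs => ?_))
    · rw [show slice s (X + c) = slice s X + slice s c from rfl,
        (hR s hs).cash _ (hsl hX s) _ (hc1 s hs.le), mem_image_sub_iff]
      rfl
    · rw [show slice s (u + c) = slice s u + slice s c from rfl,
        show slice t (u + c) = slice t u + slice t c from rfl, hc2 s hs]
      exact (add_left_inj _).symm
  · intro X hX Y hY hXY u hu
    rw [ae_tensor_iff hF0 hμ] at hXY
    obtain ⟨h1, h2, h3⟩ := mem_pasteSets_iff.1 hu
    refine mem_pasteSets_iff.2 ⟨fun s hs => (hR s hs).mono _ (hsl hX s) _ (hsl hY s) (hXY s) (h1 s hs),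
      hρ.mono _ (projFrom_mem_RInf hF0 hμ hX) _ (projFrom_mem_RInf hF0 hμ hY) (fun s => ?_) h2, h3⟩
    filter_upwards [hXY s] with ω hω
    unfold projFrom
    split_ifs
    · exact hω
    · exact le_rfl
  · obtain ⟨v, hv⟩ := hρ.zero.1
    have hex : ∀ s, ∃ u, s < t → u ∈ R s 0 := fun s => by
      by_cases hs : s < t
      · obtain ⟨u, hu⟩ := (hR s hs).zero.1
        exact ⟨u, fun _ => hu⟩
      · exact ⟨0, fun h => absurd h hs⟩
    choose u hu using hex
    refine ⟨paste t u v, u, v, hu, ?_, rfl⟩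
    rwa [projFrom_zero]
  · intro X hX Y hY l hl hl1 u hu v hv
    obtain ⟨hlm, hlt⟩ := measurable_optFilt_iff.1 hl
    rw [ae_tensor_iff hF0 hμ] at hl1
    obtain ⟨h1, h2, h3⟩ := mem_pasteSets_iff.1 hu
    obtain ⟨h4, h5, h6⟩ := mem_pasteSets_iff.1 hv
    refine mem_pasteSets_iff.2 ⟨fun s hs => ?_, ?_, fun s hs => ?_⟩
    · exact (hR s hs).convex _ (hsl hX s) _ (hsl hY s) (fun ω => l (ω, s)) (hlm s hs.le) (hl1 s)
        _ (h1 s hs) _ (h4 s hs)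
    · have := hρ.convex _ (projFrom_mem_RInf hF0 hμ hX) _ (projFrom_mem_RInf hF0 hμ hY)
        (fun ω => l (ω, t)) (hlm t le_rfl) (hl1 t) _ h2 _ h5
      have he : projFrom t (fun x => l x • X x + (1 - l x) • Y x) =
          fun s ω => l (ω, t) • projFrom t X s ω + (1 - l (ω, t)) • projFrom t Y s ω := by
        ext s ω i
        by_cases hs : t ≤ s
        · simp [projFrom, hs, slice, hlt s hs]
        · simp [projFrom, hs]
      rw [he]
      exact this
    · ext ω i
      have e1 := congrFun (congrFun (h3 s hs) ω) i
      have e2 := congrFun (congrFun (h6 s hs) ω) i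
      simp only [slice] at e1 e2
      simp [slice, hlt s hs, e1, e2]
  · let _ := weakTop (optSigma F) (tensor F P μ) (LInf (d := d) (optSigma F) (tensor F P μ))
    let _ := weakTop (optFilt F t) (tensor F P μ) (Elig (d := d) (optFilt F t) (tensor F P μ) m)
    have hset : {p : ↥(LInf (d := d) (optSigma F) (tensor F P μ)) ×
        ↥(Elig (d := d) (optFilt F t) (tensor F P μ) m) | p.2.1 ∈ toOptional t ρ R p.1.1} =
        (⋂ s : {s // s < t}, {p | slice s.1 p.2.1 ∈ R s.1 (slice s.1 p.1.1)}) ∩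
          {p | slice t p.2.1 ∈ ρ (projFrom t p.1.1)} := by
      ext p
      simp only [mem_ofPred_eq, toOptional, mem_pasteSets_iff, mem_inter_iff, mem_iInter,
        Subtype.forall]
      exact ⟨fun h => ⟨h.1, h.2.1⟩, fun h => ⟨h.1, h.2, ((mem_Elig_optFilt hF0 hμ).1 p.2.2).2⟩⟩
    rw [hset]
    refine (isClosed_iInter fun s => ?_).inter ?_
    · let _ := weakTop (F s.1) P (LInf (d := d) (F s.1) P)
      let _ := weakTop (F s.1) P (Elig (d := d) (F s.1) P m)
      exact (hR s.1 s.2).closed.preimage (((continuous_slice_LInf hF0 hμ s.1).comp continuous_fst).prodMk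
        ((continuous_slice_Elig hF0 hμ s.2.le).comp continuous_snd))
    · let _ := weakTopProc (d := d) P F t
      let _ := weakTop (F t) P (Elig (d := d) (F t) P m)
      exact hρ.closed.preimage (((continuous_projFrom hF0 hμ).comp continuous_fst).prodMk
        ((continuous_slice_Elig hF0 hμ le_rfl).comp continuous_snd))

end ToOptional

end SetRisk

namespace SetRisk

section Localization

theorem IsClosedConvexVectorRM.paste_mem {S : Type*} {d m : ℕ} {mt mX mS : MeasurableSpace S}
    {P : Measure S} {R : (S → Fin d → ℝ) → Set (S → Fin d → ℝ)}
    (h : IsClosedConvexVectorRM mX mt P m R) {X Y u v : S → Fin d → ℝ} (hX : X ∈ LInf mX P)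
    (hY : Y ∈ LInf mX P) (hu : u ∈ R X) (hv : v ∈ R Y) {A : Set S} (hA : MeasurableSet[mt] A) :
    A.indicator u + Aᶜ.indicator v ∈ R (A.indicator X + Aᶜ.indicator Y) := by
  rw [indicator_add_compl_eq, indicator_add_compl_eq]
  exact h.convex X hX Y hY _ (measurable_const.indicator hA) (indicator_one_bounds A P) u hu v hv

variable {Ω : Type*} {m0 : MeasurableSpace Ω} {P : Measure Ω} {T d m : ℕ}
  {F : Filtration (Fin (T + 1)) m0} {t r : Fin (T + 1)} {μ : Fin (T + 1) → Ω → ℝ}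

/-- The random vector which equals `u` on the part of the optional space where the information
at time `t` is that of time `r ≤ t`, and `v` elsewhere. -/
def glue (t r : Fin (T + 1)) (v : Ω × Fin (T + 1) → Fin d → ℝ) (u : Ω → Fin d → ℝ) :
    Ω × Fin (T + 1) → Fin d → ℝ :=
  fun x => if min x.2 t = r then u x.1 else v x

theorem slice_glue (hr : r ≤ t) (v : Ω × Fin (T + 1) → Fin d → ℝ) (u : Ω → Fin d → ℝ) :
    slice r (glue t r v u) = u := by
  ext ω i
  simp [slice, glue, hr]

theorem measurableSet_optFilt_min :
    MeasurableSet[optFilt F t] {x : Ω × Fin (T + 1) | min x.2 t = r} := by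
  refine measurableSet_optFilt_iff.2 ⟨fun s hs => ?_, fun s hs ω => ?_⟩
  · by_cases h : s = r <;> simp [hs, h]
  · simp [hs]

theorem measurable_optFilt_prodMk (hr : r ≤ t) :
    Measurable[F r, optFilt F t] (fun ω : Ω => (ω, r)) := fun _ hA =>
  (measurableSet_optFilt_iff.1 hA).1 r hr

theorem slice_eq_slice_min {X : Ω × Fin (T + 1) → Fin d → ℝ}
    (h : ∀ s, t ≤ s → slice s X = slice t X) (s : Fin (T + 1)) : slice s X = slice (min s t) X := by
  rcases le_total s t with hs | hs
  · rw [min_eq_left hs]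
  · rw [min_eq_right hs, h s hs]

theorem indicator_min_eq_glue {v z : Ω × Fin (T + 1) → Fin d → ℝ}
    (hz : ∀ s, t ≤ s → slice s z = slice t z) :
    {x : Ω × Fin (T + 1) | min x.2 t = r}.indicator z +
      {x : Ω × Fin (T + 1) | min x.2 t = r}ᶜ.indicator v = glue t r v (slice r z) := by
  ext ⟨ω, s⟩ i
  by_cases h : min s t = r
  · have := congrFun (congrFun (slice_eq_slice_min hz s) ω) i
    rw [h] at this
    simpa [glue, h, slice] using this
  · simp [glue, h]

theorem forall_slice_glue {p : (s : Fin (T + 1)) → (Ω → Fin d → ℝ) → Prop} (hr : r ≤ t)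
    {v : Ω × Fin (T + 1) → Fin d → ℝ} {u : Ω → Fin d → ℝ}
    (hv : (∀ s ≤ t, p s (slice s v)) ∧ ∀ s, t ≤ s → slice s v = slice t v) :
    ((∀ s ≤ t, p s (slice s (glue t r v u))) ∧
      ∀ s, t ≤ s → slice s (glue t r v u) = slice t (glue t r v u)) ↔ p r u := by
  constructor
  · rintro ⟨h1, -⟩
    have := h1 r hr
    rwa [slice_glue hr] at this
  · intro h
    refine ⟨fun s hs => ?_, fun s hs => ?_⟩
    · by_cases hsr : s = r
      · subst hsr
        rwa [slice_glue hr]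
      · have : slice s (glue t r v u) = slice s v := by
          ext ω i
          simp [slice, glue, hs, hsr]
        rw [this]
        exact hv.1 s hs
    · ext ω i
      have := congrFun (congrFun (hv.2 s hs) ω) i
      simp only [slice] at this
      by_cases htr : t = r
      · subst htr; simp [slice, glue, hs]
      · simp [slice, glue, hs, this, htr]

theorem glue_mem_Elig (hF0 : ∀ A : Set Ω, MeasurableSet[F 0] A ↔ P A = 0 ∨ P Aᶜ = 0)
    (hμ : IsReference P F μ) (hr : r ≤ t) {v : Ω × Fin (T + 1) → Fin d → ℝ}
    (hv : v ∈ Elig (optFilt F t) (tensor F P μ) m) {u : Ω → Fin d → ℝ} :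
    glue t r v u ∈ Elig (optFilt F t) (tensor F P μ) m ↔ u ∈ Elig (F r) P m := by
  rw [mem_Elig_optFilt hF0 hμ]
  exact forall_slice_glue (p := fun s x => x ∈ Elig (F s) P m) hr ((mem_Elig_optFilt hF0 hμ).1 hv)

theorem glue_zero_mem_EligPos (hF0 : ∀ A : Set Ω, MeasurableSet[F 0] A ↔ P A = 0 ∨ P Aᶜ = 0)
    (hμ : IsReference P F μ) (hr : r ≤ t) {u : Ω → Fin d → ℝ} (hu : u ∈ EligPos (F r) P m) :
    glue t r 0 u ∈ EligPos (optFilt F t) (tensor F P μ) m := by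
  rw [mem_EligPos_optFilt hF0 hμ]
  refine (forall_slice_glue (p := fun s x => x ∈ EligPos (F s) P m) hr ⟨fun s _ => ?_, ?_⟩).2 hu
  · exact ⟨Elig_zero, Filter.Eventually.of_forall fun _ _ => le_rfl⟩
  · exact fun _ _ => rfl

theorem glue_mem_LInf (hF0 : ∀ A : Set Ω, MeasurableSet[F 0] A ↔ P A = 0 ∨ P Aᶜ = 0)
    (hμ : IsReference P F μ) (hr : r ≤ t) {v : Ω × Fin (T + 1) → Fin d → ℝ}
    (hv : v ∈ LInf (optFilt F t) (tensor F P μ)) {u : Ω → Fin d → ℝ} :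
    glue t r v u ∈ LInf (optFilt F t) (tensor F P μ) ↔ u ∈ LInf (F r) P := by
  rw [mem_LInf_optFilt hF0 hμ]
  exact forall_slice_glue (p := fun s x => x ∈ LInf (F s) P) hr ((mem_LInf_optFilt hF0 hμ).1 hv)

variable {R : (Ω × Fin (T + 1) → Fin d → ℝ) → Set (Ω × Fin (T + 1) → Fin d → ℝ)}
  {X Y v : Ω × Fin (T + 1) → Fin d → ℝ} {u : Ω → Fin d → ℝ}

theorem IsClosedConvexVectorRM.mem_slice_image_iff
    (hF0 : ∀ A : Set Ω, MeasurableSet[F 0] A ↔ P A = 0 ∨ P Aᶜ = 0) (hμ : IsReference P F μ)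
    (hR : IsClosedConvexVectorRM (optSigma F) (optFilt F t) (tensor F P μ) m R) (hr : r ≤ t)
    (hX : X ∈ LInf (optSigma F) (tensor F P μ)) (hX0 : ∀ x, min x.2 t ≠ r → X x = 0)
    (hv : v ∈ R 0) :
    u ∈ slice r '' R X ↔ glue t r v u ∈ R X := by
  constructor
  · rintro ⟨z, hz, rfl⟩
    have h := hR.paste_mem (A := {x | min x.2 t = r}) hX LInf_zero hz hv measurableSet_optFilt_min
    rw [indicator_min_eq_glue ((mem_Elig_optFilt hF0 hμ).1 (hR.subset_Elig hX hz)).2] at h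
    convert h using 1
    congr 1
    ext x i
    by_cases hx : min x.2 t = r
    · simp [hx]
    · simp [hx, hX0 x hx]
  · exact fun h => ⟨_, h, slice_glue hr v u⟩

theorem IsClosedConvexVectorRM.slice_image_upper
    (hF0 : ∀ A : Set Ω, MeasurableSet[F 0] A ↔ P A = 0 ∨ P Aᶜ = 0) (hμ : IsReference P F μ)
    (hR : IsClosedConvexVectorRM (optSigma F) (optFilt F t) (tensor F P μ) m R) (hr : r ≤ t)
    (hX : X ∈ LInf (optSigma F) (tensor F P μ)) :
    slice r '' R X ∈ UpperSets (F r) P m := by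
  obtain ⟨h1, h2⟩ := mem_UpperSets_iff.1 (hR.upper X hX)
  refine mem_UpperSets_iff.2 ⟨?_, ?_⟩
  · rintro _ ⟨z, hz, rfl⟩
    exact ((mem_Elig_optFilt hF0 hμ).1 (h1 hz)).1 r hr
  · rintro _ ⟨z, hz, rfl⟩ e he
    refine ⟨_, h2 z hz _ (glue_zero_mem_EligPos hF0 hμ hr he), ?_⟩
    change slice r z + slice r (glue t r 0 e) = _
    rw [slice_glue hr]

theorem IsClosedConvexVectorRM.slice_image_cash
    (hF0 : ∀ A : Set Ω, MeasurableSet[F 0] A ↔ P A = 0 ∨ P Aᶜ = 0) (hμ : IsReference P F μ)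
    (hR : IsClosedConvexVectorRM (optSigma F) (optFilt F t) (tensor F P μ) m R) (hr : r ≤ t)
    (hX : X ∈ LInf (optSigma F) (tensor F P μ)) {c : Ω → Fin d → ℝ} (hc : c ∈ Elig (F r) P m) :
    slice r '' R (X + glue t r 0 c) = (fun u => u - c) '' (slice r '' R X) := by
  rw [hR.cash X hX _ ((glue_mem_Elig hF0 hμ hr Elig_zero).2 hc), image_image, image_image]
  refine image_congr fun z _ => ?_
  change slice r z - slice r (glue t r 0 c) = _
  rw [slice_glue hr]

theorem IsClosedConvexVectorRM.slice_image_randomSet [IsProbabilityMeasure P]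
    (hF0 : ∀ A : Set Ω, MeasurableSet[F 0] A ↔ P A = 0 ∨ P Aᶜ = 0) (hμ : IsReference P F μ)
    (hR : IsClosedConvexVectorRM (optSigma F) (optFilt F t) (tensor F P μ) m R) (hr : r ≤ t) :
    ∃ G : Set (Ω × (Fin d → ℝ)), MeasurableSet[(F r).prod MeasurableSpace.pi] G ∧
      slice r '' R 0 = {u | u ∈ LInf (F r) P ∧ ∀ᵐ ω ∂P, (ω, u ω) ∈ G} ∧
      ∀ᵐ ω ∂P, IsClosed {x | (ω, x) ∈ G} ∧ {x | (ω, x) ∈ G} ⊆ eligible m d ∧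
        {x | (ω, x) ∈ G} ≠ eligible m d := by
  obtain ⟨⟨v, hv⟩, -, -, G, hGm, hG0, hGae⟩ := hR.zero
  have hv0 := hv
  rw [hG0] at hv0
  have hv1 := (ae_tensor_iff hF0 hμ).1 hv0.2
  have hmin : ∀ ω s y, ((ω, s), y) ∈ G ↔ ((ω, min s t), y) ∈ G := by
    intro ω s y
    rcases le_total s t with hs | hs
    · rw [min_eq_left hs]
    · rw [min_eq_right hs]
      exact (measurableSet_optFilt_iff.1 (measurableSet_section hGm y)).2 s hs ω
  refine ⟨{p | ((p.1, r), p.2) ∈ G},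
    measurableSet_prod_preimage (measurable_optFilt_prodMk hr) hGm, ?_,
    (ae_tensor_iff hF0 hμ).1 hGae r⟩
  ext u
  rw [hR.mem_slice_image_iff hF0 hμ hr LInf_zero (fun _ _ => rfl) hv, hG0, mem_ofPred_eq,
    mem_ofPred_eq, glue_mem_LInf hF0 hμ hr hv0.1, ae_tensor_iff hF0 hμ]
  refine and_congr_right fun _ => ⟨fun h => ?_, fun h s => ?_⟩
  · filter_upwards [h r] with ω hω
    simpa [glue, hr] using hω
  · filter_upwards [h, hv1 s] with ω h1 h2
    by_cases hs : min s t = r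
    · rw [hmin, hs]
      simpa [glue, hs] using h1
    · simpa [glue, hs] using h2

theorem IsClosedConvexVectorRM.slice_image_convex
    (hF0 : ∀ A : Set Ω, MeasurableSet[F 0] A ↔ P A = 0 ∨ P Aᶜ = 0) (hμ : IsReference P F μ)
    (hR : IsClosedConvexVectorRM (optSigma F) (optFilt F t) (tensor F P μ) m R) (hr : r ≤ t)
    (hX : X ∈ LInf (optSigma F) (tensor F P μ)) (hX0 : ∀ x, min x.2 t ≠ r → X x = 0)
    (hY : Y ∈ LInf (optSigma F) (tensor F P μ)) (hY0 : ∀ x, min x.2 t ≠ r → Y x = 0)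
    {l : Ω → ℝ} (hl : Measurable[F r] l) (hl1 : ∀ᵐ ω ∂P, 0 ≤ l ω ∧ l ω ≤ 1)
    (hu : u ∈ slice r '' R X) {w : Ω → Fin d → ℝ} (hw : w ∈ slice r '' R Y) :
    (fun ω => l ω • u ω + (1 - l ω) • w ω) ∈
      slice r '' R (fun x => l x.1 • X x + (1 - l x.1) • Y x) := by
  obtain ⟨z, hz, rfl⟩ := hu
  obtain ⟨y, hy, rfl⟩ := hw
  set k : Ω × Fin (T + 1) → ℝ := fun x => if min x.2 t = r then l x.1 else 0 with hk
  have hkm : Measurable[optFilt F t] k := by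
    refine measurable_optFilt_iff.2 ⟨fun s hs => ?_, fun s hs ω => ?_⟩
    · by_cases h : s = r
      · subst h; simpa [hk, hs] using hl
      · simp [hk, hs, h]
    · simp [hk, hs]
  have h := hR.convex X hX Y hY k hkm ((ae_tensor_iff hF0 hμ).2 fun s => by
    filter_upwards [hl1] with ω hω
    by_cases h : min s t = r <;> simp [hk, h, hω]) z hz y hy
  refine ⟨fun x => k x • z x + (1 - k x) • y x, ?_, ?_⟩
  · convert h using 1
    congr 1
    ext x i
    by_cases hx : min x.2 t = r
    · simp [hk, hx]
    · simp [hX0 x hx, hY0 x hx]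
  · ext ω i
    simp [slice, hk, hr]

theorem glue_self_eq_paste (v : Ω × Fin (T + 1) → Fin d → ℝ) (u : Ω → Fin d → ℝ) :
    glue t t v u = paste t (fun s => slice s v) u := by
  ext x i
  by_cases h : t ≤ x.2
  · simp [glue, paste, h, not_lt.2 h]
  · simp [glue, paste, h, not_le.1 h, slice]

theorem glue_eq_paste_update (hr : r < t) {v : Ω × Fin (T + 1) → Fin d → ℝ}
    (hv : ∀ s, t ≤ s → slice s v = slice t v) (u : Ω → Fin d → ℝ) :
    glue t r v u = paste t (Function.update (fun s => slice s v) r u) (slice t v) := by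
  ext ⟨ω, s⟩ i
  by_cases h : s < t
  · by_cases hs : s = r
    · subst hs; simp [glue, paste, h, h.le]
    · simp [glue, paste, h, h.le, hs, slice]
  · have := congrFun (congrFun (hv s (not_lt.1 h)) ω) i
    simpa [glue, paste, h, not_lt.1 h, hr.ne', slice] using this

theorem continuous_glue (hF0 : ∀ A : Set Ω, MeasurableSet[F 0] A ↔ P A = 0 ∨ P Aᶜ = 0)
    (hμ : IsReference P F μ) (hr : r ≤ t) {v : Ω × Fin (T + 1) → Fin d → ℝ}
    (hv : v ∈ Elig (optFilt F t) (tensor F P μ) m) :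
    @Continuous _ _ (weakTop (F r) P (Elig (d := d) (F r) P m))
      (weakTop (optFilt F t) (tensor F P μ) (Elig (d := d) (optFilt F t) (tensor F P μ) m))
      (fun u => ⟨glue t r v u.1, (glue_mem_Elig hF0 hμ hr hv).2 u.2⟩) := by
  obtain ⟨hv1, hv2⟩ := (mem_Elig_optFilt hF0 hμ).1 hv
  rcases hr.eq_or_lt with rfl | hr'
  · simp only [glue_self_eq_paste]
    exact continuous_paste hF0 hμ fun s hs => hv1 s hs.le
  · simp only [glue_eq_paste_update hr' hv2]
    exact continuous_paste_update hF0 hμ hr' fun x hx => by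
      rw [← glue_eq_paste_update hr' hv2]
      exact (glue_mem_Elig hF0 hμ hr hv).2 hx

theorem single_eq_zero (hr : r < t) (Z : Ω → Fin d → ℝ) (x : Ω × Fin (T + 1))
    (hx : min x.2 t ≠ r) : single r Z x = 0 := by
  have : x.2 ≠ r := by
    rintro rfl
    exact hx (min_eq_left hr.le)
  simp [single, this]

theorem procFrom_eq_zero (X : Fin (T + 1) → Ω → Fin d → ℝ) (x : Ω × Fin (T + 1))
    (hx : min x.2 t ≠ t) : procFrom t X x = 0 := by
  have : ¬ t ≤ x.2 := fun h => hx (min_eq_right h)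
  simp [procFrom, this]

theorem single_eq_glue (hr : r < t) (Z : Ω → Fin d → ℝ) : single r Z = glue t r 0 Z := by
  ext x i
  have : x.2 = r ↔ min x.2 t = r := by
    constructor
    · rintro rfl
      exact min_eq_left hr.le
    · intro h
      rcases le_total x.2 t with hx | hx
      · rwa [min_eq_left hx] at h
      · rw [min_eq_right hx] at h
        exact absurd h hr.ne'
  by_cases hx : x.2 = r
  · simp [single, glue, hx, hr.le]
  · simp [single, glue, hx, mt this.2 hx]

theorem single_add (Y Z : Ω → Fin d → ℝ) : single r (Y + Z) = single r Y + single r Z := by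
  ext x i
  by_cases h : x.2 = r <;> simp [single, h]

/-- The restrictions of a closed conditionally convex risk measure on the optional space. -/
theorem IsClosedConvexVectorRM.toRestricted [IsProbabilityMeasure P]
    (hF0 : ∀ A : Set Ω, MeasurableSet[F 0] A ↔ P A = 0 ∨ P Aᶜ = 0) (hμ : IsReference P F μ)
    (hR : IsClosedConvexVectorRM (optSigma F) (optFilt F t) (tensor F P μ) m R) (hr : r < t) :
    IsClosedConvexVectorRM (F r) (F r) P m (toRestricted r R) := by
  obtain ⟨v, hv⟩ := hR.zero.1
  have h0 : single r (0 : Ω → Fin d → ℝ) = 0 := by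
    ext x i
    simp [single]
  refine isClosedConvexVectorRM_of
    (fun X hX => hR.slice_image_upper hF0 hμ hr.le (single_mem_LInf hF0 hμ hX))
    (fun X hX c hc => ?_) (fun X hX Y hY hXY => image_mono (hR.mono _ (single_mem_LInf hF0 hμ hX) _
      (single_mem_LInf hF0 hμ hY) ((ae_tensor_iff hF0 hμ).2 fun s => ?_))) ?_ ?_
    (fun X hX Y hY l hl hl1 u hu w hw => ?_) ?_
  · change slice r '' R (single r (X + c)) = _
    rw [single_add, single_eq_glue hr c]
    exact hR.slice_image_cash hF0 hμ hr.le (single_mem_LInf hF0 hμ hX) hc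
  · filter_upwards [hXY] with ω hω
    unfold single
    split_ifs
    · exact hω
    · exact le_rfl
  · rw [SetRisk.toRestricted, h0]
    exact Set.Nonempty.image _ ⟨v, hv⟩
  · simp only [SetRisk.toRestricted, h0]
    exact hR.slice_image_randomSet hF0 hμ hr.le
  · have := hR.slice_image_convex hF0 hμ hr.le (single_mem_LInf hF0 hμ hX) (single_eq_zero hr X)
      (single_mem_LInf hF0 hμ hY) (single_eq_zero hr Y) hl hl1 hu hw
    convert this using 1
    rw [SetRisk.toRestricted]
    congr 2
    ext x i
    by_cases hx : x.2 = r <;> simp [single, hx]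
  · let _ := weakTop (F r) P (LInf (d := d) (F r) P)
    let _ := weakTop (F r) P (Elig (d := d) (F r) P m)
    let _ := weakTop (optSigma F) (tensor F P μ) (LInf (d := d) (optSigma F) (tensor F P μ))
    let _ := weakTop (optFilt F t) (tensor F P μ) (Elig (d := d) (optFilt F t) (tensor F P μ) m)
    convert! hR.closed.preimage (((continuous_single hF0 hμ r).comp continuous_fst).prodMk
      ((continuous_glue hF0 hμ hr.le (hR.subset_Elig LInf_zero hv)).comp continuous_snd)) using 1
    ext p
    exact hR.mem_slice_image_iff hF0 hμ hr.le (single_mem_LInf hF0 hμ p.1.2)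
      (single_eq_zero hr _) hv

/-- The restriction to processes from time `t` on of a closed conditionally convex risk measure on
the optional space. -/
theorem IsClosedConvexVectorRM.toProcess [IsProbabilityMeasure P]
    (hF0 : ∀ A : Set Ω, MeasurableSet[F 0] A ↔ P A = 0 ∨ P Aᶜ = 0) (hμ : IsReference P F μ)
    (hR : IsClosedConvexVectorRM (optSigma F) (optFilt F t) (tensor F P μ) m R) :
    IsClosedConvexProcessRM P F m t (toProcess t R) := by
  obtain ⟨v, hv⟩ := hR.zero.1
  have h0 : procFrom t (0 : Fin (T + 1) → Ω → Fin d → ℝ) = 0 := by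
    ext x i
    simp [procFrom]
  refine isClosedConvexProcessRM_of
    (fun X hX => hR.slice_image_upper hF0 hμ le_rfl (procFrom_mem_LInf hF0 hμ hX))
    (fun X hX c hc => ?_) (fun X hX Y hY hXY => image_mono (hR.mono _ (procFrom_mem_LInf hF0 hμ hX) _
      (procFrom_mem_LInf hF0 hμ hY) ((ae_tensor_iff hF0 hμ).2 fun s => ?_))) ?_ ?_
    (fun X hX Y hY l hl hl1 u hu w hw => ?_) ?_
  · have : procFrom t (X + constFrom t c) = procFrom t X + glue t t 0 c := by
      ext x i
      by_cases hx : t ≤ x.2 <;> simp [procFrom, constFrom, glue, hx]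
    change slice t '' R (procFrom t (X + constFrom t c)) = _
    rw [this]
    exact hR.slice_image_cash hF0 hμ le_rfl (procFrom_mem_LInf hF0 hμ hX) hc
  · filter_upwards [hXY s] with ω hω
    unfold procFrom
    split_ifs
    · exact hω
    · exact le_rfl
  · rw [SetRisk.toProcess, h0]
    exact Set.Nonempty.image _ ⟨v, hv⟩
  · simp only [SetRisk.toProcess, h0]
    exact hR.slice_image_randomSet hF0 hμ le_rfl
  · have := hR.slice_image_convex hF0 hμ le_rfl (procFrom_mem_LInf hF0 hμ hX) (procFrom_eq_zero X)
      (procFrom_mem_LInf hF0 hμ hY) (procFrom_eq_zero Y) hl hl1 hu hw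
    convert this using 1
    rw [SetRisk.toProcess]
    congr 2
    ext x i
    by_cases hx : t ≤ x.2 <;> simp [procFrom, hx]
  · let _ := weakTopProc (d := d) P F t
    let _ := weakTop (F t) P (Elig (d := d) (F t) P m)
    let _ := weakTop (optSigma F) (tensor F P μ) (LInf (d := d) (optSigma F) (tensor F P μ))
    let _ := weakTop (optFilt F t) (tensor F P μ) (Elig (d := d) (optFilt F t) (tensor F P μ) m)
    convert! hR.closed.preimage (((continuous_procFrom hF0 hμ).comp continuous_fst).prodMk
      ((continuous_glue hF0 hμ le_rfl (hR.subset_Elig LInf_zero hv)).comp continuous_snd)) using 1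
    ext p
    exact hR.mem_slice_image_iff hF0 hμ le_rfl (procFrom_mem_LInf hF0 hμ p.1.2)
      (procFrom_eq_zero _) hv

end Localization

end SetRisk

namespace SetRisk

section HalfSpaces

variable {Ω : Type*} {m0 : MeasurableSpace Ω} {P : Measure Ω} {T d m : ℕ}
  {F : Filtration (Fin (T + 1)) m0} {t : Fin (T + 1)} {μ : Fin (T + 1) → Ω → ℝ}

theorem mem_halfProc_iff [IsFiniteMeasure P]
    {p : (Fin (T + 1) → Fin d → Measure Ω) × (Fin (T + 1) → Ω → Fin d → ℝ)}
    (hp : p ∈ dualProcCone P F m t) {X : Fin (T + 1) → Ω → Fin d → ℝ} (hX : ∀ s, X s ∈ LInf (F s) P)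
    {u : Ω → Fin d → ℝ} :
    u ∈ halfProc P F m t p X ↔ u ∈ Elig (F t) P m ∧
      0 ≤ᵐ[P] condExp (F t) P (fun ω => ∑ s ∈ Finset.Ici t,
        wts (F t) (F s) P (p.1 s) (p.2 s) ω ⬝ᵥ (X s ω + u ω)) := by
  refine and_congr_right fun hu => ?_
  have h1 : ∀ s ∈ Finset.Ici t, Integrable (fun ω =>
      wts (F t) (F s) P (p.1 s) (p.2 s) ω ⬝ᵥ (X s ω + u ω)) P := fun s hs =>
    integrable_dot (F.le s) (LOne_mono (F.le s) (hp s (Finset.mem_Ici.1 hs)).2.2.1)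
      (LInf_add (hX s) (LInf_mono (F.mono (Finset.mem_Ici.1 hs)) hu.1))
  have h2 : condExp (F t) P (fun ω => ∑ s ∈ Finset.Ici t,
        wts (F t) (F s) P (p.1 s) (p.2 s) ω ⬝ᵥ (X s ω + u ω)) =ᵐ[P]
      ∑ s ∈ Finset.Ici t, condExp (F t) P (fun ω =>
        wts (F t) (F s) P (p.1 s) (p.2 s) ω ⬝ᵥ (X s ω + u ω)) := by
    have := condExp_finsetSum h1 (F t)
    convert this using 2
    ext ω
    rw [Finset.sum_apply]
  have h3 : ∀ᵐ ω ∂P, ∀ s, t ≤ s → condExp (F t) P (fun ω =>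
        wts (F t) (F s) P (p.1 s) (p.2 s) ω ⬝ᵥ (X s ω + u ω)) ω =
      p.2 s ω ⬝ᵥ u ω - p.2 s ω ⬝ᵥ condQVec (F t) P (p.1 s) (-(X s)) ω := by
    rw [ae_all_iff]
    intro s
    by_cases hs : t ≤ s
    · obtain ⟨hQ, hw, hwts⟩ := hp s hs
      have e1 := dot_condQVec (F.mono hs) (F.le s) hQ hw.1.1 hwts.1 (LInf_neg (hX s))
      have hZ := LOne_mono (F.le s) hwts.1
      have e2 := condExp_dot_add_right (F.le t) hZ (LInf_mono (F.le s) (hX s)) hu.1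
      have e3 := condVec_wts (F.mono hs) (F.le s) hQ hw.1.1 hwts.1
      have e4 : condExp (F t) P (fun ω => wts (F t) (F s) P (p.1 s) (p.2 s) ω ⬝ᵥ (-X s) ω) =ᵐ[P]
          -condExp (F t) P (fun ω => wts (F t) (F s) P (p.1 s) (p.2 s) ω ⬝ᵥ X s ω) := by
        refine Filter.EventuallyEq.trans ?_ (condExp_neg _ (F t))
        refine condExp_congr_ae (Filter.Eventually.of_forall fun ω => ?_)
        simp
      filter_upwards [e1, e2, e3, e4] with ω a1 a2 a3 a4 _
      rw [a1, a4]
      change condExp (F t) P (fun ω => wts (F t) (F s) P (p.1 s) (p.2 s) ω ⬝ᵥ (X s + u) ω) ω = _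
      rw [a2, a3]
      simp only [Pi.neg_apply]
      ring
    · exact Filter.Eventually.of_forall fun ω h => absurd h hs
  refine ⟨fun h => ?_, fun h => ?_⟩
  · filter_upwards [h, h2, h3] with ω a1 a2 a3
    rw [a2, Finset.sum_apply, Finset.sum_congr rfl fun s hs => a3 s (Finset.mem_Ici.1 hs),
      Finset.sum_sub_distrib]
    simpa using a1
  · filter_upwards [h, h2, h3] with ω a1 a2 a3
    rw [a2, Finset.sum_apply, Finset.sum_congr rfl fun s hs => a3 s (Finset.mem_Ici.1 hs),
      Finset.sum_sub_distrib] at a1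
    simpa using a1

theorem condExp_mul_nonneg_iff [IsFiniteMeasure P] {g f : Ω → ℝ} {mt : MeasurableSpace Ω}
    (hg : Measurable[mt] g) (hg0 : ∀ᵐ ω ∂P, 0 < g ω) (hf : Integrable f P)
    (hgf : Integrable (fun ω => g ω * f ω) P) :
    0 ≤ᵐ[P] condExp mt P (fun ω => g ω * f ω) ↔ 0 ≤ᵐ[P] condExp mt P f := by
  have h := condExp_mul_of_stronglyMeasurable_left (m := mt) hg.stronglyMeasurable hgf hf
  have h' : condExp mt P (fun ω => g ω * f ω) =ᵐ[P] g * condExp mt P f := h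
  constructor
  · intro h1
    filter_upwards [h1, h', hg0] with ω a1 a2 a3
    rw [a2] at a1
    exact nonneg_of_mul_nonneg_right a1 a3
  · intro h1
    filter_upwards [h1, h', hg0] with ω a1 a2 a3
    rw [a2]
    exact mul_nonneg a3.le a1

theorem dens_slice_eq_one [IsProbabilityMeasure P]
    (hF0 : ∀ A : Set Ω, MeasurableSet[F 0] A ↔ P A = 0 ∨ P Aᶜ = 0) (hμ : IsReference P F μ)
    {Q : @Measure (Ω × Fin (T + 1)) (optSigma F)} (hQ : Q ∈ ProbACAt (optFilt F t) (tensor F P μ))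
    {s : Fin (T + 1)} (hs : s < t) : ∀ᵐ ω ∂P, dens (tensor F P μ) Q (ω, s) = 1 := by
  have := isProbabilityMeasure_tensor hμ
  have := hQ.1.1
  have h1 := (ae_tensor_iff hF0 hμ).1 (condExp_dens optFilt_le hQ) s
  have h2 := condExp_tensor (t := t) hF0 hμ (measurable_dens (P := tensor F P μ) (Q := Q))
    ((integrable_tensor_iff hμ measurable_dens).1 integrable_dens) s
  filter_upwards [h1, h2] with ω a1 a2
  rwa [a2, if_pos hs] at a1

theorem wts_optional_slice [IsProbabilityMeasure P]
    (hF0 : ∀ A : Set Ω, MeasurableSet[F 0] A ↔ P A = 0 ∨ P Aᶜ = 0) (hμ : IsReference P F μ)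
    {Q : Fin d → @Measure (Ω × Fin (T + 1)) (optSigma F)}
    (hQ : ∀ i, Q i ∈ ProbACAt (optFilt F t) (tensor F P μ)) (w : Ω × Fin (T + 1) → Fin d → ℝ)
    (s : Fin (T + 1)) : ∀ᵐ ω ∂P, ∀ i, wts (optFilt F t) (optSigma F) (tensor F P μ) Q w (ω, s) i =
      w (ω, s) i * dens (tensor F P μ) (Q i) (ω, s) := by
  have := isProbabilityMeasure_tensor hμ
  rw [ae_all_iff]
  intro i
  filter_upwards [(ae_tensor_iff hF0 hμ).1 (xi_self optFilt_le (hQ i)) s] with ω h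
  rw [wts, h]

theorem wts_optional_slice_of_lt [IsProbabilityMeasure P]
    (hF0 : ∀ A : Set Ω, MeasurableSet[F 0] A ↔ P A = 0 ∨ P Aᶜ = 0) (hμ : IsReference P F μ)
    {Q : Fin d → @Measure (Ω × Fin (T + 1)) (optSigma F)}
    (hQ : ∀ i, Q i ∈ ProbACAt (optFilt F t) (tensor F P μ)) (w : Ω × Fin (T + 1) → Fin d → ℝ)
    {s : Fin (T + 1)} (hs : s < t) :
    ∀ᵐ ω ∂P, wts (optFilt F t) (optSigma F) (tensor F P μ) Q w (ω, s) = w (ω, s) := by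
  filter_upwards [wts_optional_slice hF0 hμ hQ w s,
    ae_all_iff.2 fun i => dens_slice_eq_one hF0 hμ (hQ i) hs] with ω h1 h2
  ext i
  rw [h1, h2, mul_one]

/-- Half spaces on the optional space are composed of half spaces for the restricted claims and
of half spaces for processes, for corresponding dual variables. -/
theorem halfSp_optional_eq [IsProbabilityMeasure P]
    (hF0 : ∀ A : Set Ω, MeasurableSet[F 0] A ↔ P A = 0 ∨ P Aᶜ = 0) (hμ : IsReference P F μ)
    {Q : Fin d → @Measure (Ω × Fin (T + 1)) (optSigma F)} {w : Ω × Fin (T + 1) → Fin d → ℝ}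
    (hQ : ∀ i, Q i ∈ ProbACAt (optFilt F t) (tensor F P μ)) (hw : Measurable[optFilt F t] w)
    (hwts : wts (optFilt F t) (optSigma F) (tensor F P μ) Q w ∈ LOne (optSigma F) (tensor F P μ))
    {p : (Fin (T + 1) → Fin d → Measure Ω) × (Fin (T + 1) → Ω → Fin d → ℝ)}
    (hp : p ∈ dualProcCone P F m t)
    (hpw : ∀ s, t ≤ s → ∀ᵐ ω ∂P, ∀ i,
      μ s ω * wts (optFilt F t) (optSigma F) (tensor F P μ) Q w (ω, s) i =
        remMass μ t ω * wts (F t) (F s) P (p.1 s) (p.2 s) ω i)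
    {Y : Ω × Fin (T + 1) → Fin d → ℝ} (hY : Y ∈ LInf (optSigma F) (tensor F P μ)) :
    halfSp (optFilt F t) (tensor F P μ) m w (condQVec (optFilt F t) (tensor F P μ) Q (-Y)) =
      pasteSets t (fun s => halfSp (F s) P m (slice s w) (-slice s Y))
        (halfProc P F m t p (projFrom t Y)) := by
  have := isProbabilityMeasure_tensor hμ
  ext u
  have hYs := (mem_LInf_optSigma hF0 hμ).1 hY
  rw [mem_halfSp_condQVec_iff optFilt_le hQ hw hwts hY, mem_pasteSets_iff,
    mem_halfProc_iff hp (projFrom_mem_RInf hF0 hμ hY).1]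
  simp only [mem_halfSp_neg_iff (hYs _)]
  have key : u ∈ Elig (optFilt F t) (tensor F P μ) m →
      (0 ≤ᵐ[tensor F P μ] condExp (optFilt F t) (tensor F P μ)
        (fun x => wts (optFilt F t) (optSigma F) (tensor F P μ) Q w x ⬝ᵥ (Y + u) x) ↔
      (∀ s < t, ∀ᵐ ω ∂P, 0 ≤ slice s w ω ⬝ᵥ (slice s Y + slice s u) ω) ∧
        0 ≤ᵐ[P] condExp (F t) P (fun ω => ∑ s ∈ Finset.Ici t,
          wts (F t) (F s) P (p.1 s) (p.2 s) ω ⬝ᵥ (projFrom t Y s ω + slice t u ω))) := by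
    intro hu
    have huL := LInf_mono optFilt_le hu.1
    obtain ⟨hu1, hu2⟩ := (mem_Elig_optFilt hF0 hμ).1 hu
    have hYu := LInf_add hY huL
    rw [condExp_tensor_nonneg_iff hF0 hμ (dotProduct_measurable hwts.1 hYu.1)
      (integrable_dot_slice hF0 hμ hwts hYu)]
    refine and_congr (forall₂_congr fun s hs => ?_) ?_
    · have h := wts_optional_slice_of_lt hF0 hμ hQ w hs
      constructor
      · intro h1
        filter_upwards [h, h1] with ω a1 a2
        rw [a1] at a2
        exact a2
      · intro h1
        filter_upwards [h, h1] with ω a1 a2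
        rw [a1]
        exact a2
    · have hint : ∀ s ∈ Finset.Ici t, Integrable (fun ω =>
          wts (F t) (F s) P (p.1 s) (p.2 s) ω ⬝ᵥ (projFrom t Y s ω + slice t u ω)) P := fun s hs =>
        integrable_dot (F.le s) (LOne_mono (F.le s) (hp s (Finset.mem_Ici.1 hs)).2.2.1)
          (LInf_add ((projFrom_mem_RInf hF0 hμ hY).1 s)
            (LInf_mono (F.mono (Finset.mem_Ici.1 hs)) (hu1 t le_rfl).1))
      have hsum := integrable_finsetSum _ hint
      rw [← condExp_mul_nonneg_iff hμ.measurable_remMass (hμ.remMass_pos t) hsum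
        (hμ.integrable_remMass_mul hsum)]
      have hae : (fun ω => ∑ r ∈ Finset.Ici t, μ r ω *
          (wts (optFilt F t) (optSigma F) (tensor F P μ) Q w (ω, r) ⬝ᵥ (Y + u) (ω, r))) =ᵐ[P]
          fun ω => remMass μ t ω * ∑ s ∈ Finset.Ici t,
            wts (F t) (F s) P (p.1 s) (p.2 s) ω ⬝ᵥ (projFrom t Y s ω + slice t u ω) := by
        have h1 : ∀ᵐ ω ∂P, ∀ s, t ≤ s → ∀ i,
            μ s ω * wts (optFilt F t) (optSigma F) (tensor F P μ) Q w (ω, s) i =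
            remMass μ t ω * wts (F t) (F s) P (p.1 s) (p.2 s) ω i := by
          rw [ae_all_iff]
          intro s
          by_cases hs : t ≤ s
          · filter_upwards [hpw s hs] with ω h _ using h
          · exact Filter.Eventually.of_forall fun ω h => absurd h hs
        filter_upwards [h1] with ω h
        rw [Finset.mul_sum]
        refine Finset.sum_congr rfl fun s hs => ?_
        have hs := Finset.mem_Ici.1 hs
        rw [← mul_dot, ← mul_dot]
        have e1 : (Y + u) (ω, s) = projFrom t Y s ω + slice t u ω := by
          rw [projFrom, if_pos hs, ← hu2 s hs]
          rfl
        rw [e1]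
        congr 1
        ext i
        exact h s hs i
      constructor
      · intro h
        filter_upwards [h, condExp_congr_ae (m := F t) hae] with ω a1 a2
        rwa [← a2]
      · intro h
        filter_upwards [h, condExp_congr_ae (m := F t) hae] with ω a1 a2
        rwa [a2]
  constructor
  · rintro ⟨h1, h2⟩
    obtain ⟨h3, h4⟩ := (mem_Elig_optFilt hF0 hμ).1 h1
    obtain ⟨h5, h6⟩ := (key h1).1 h2
    exact ⟨fun s hs => ⟨h3 s hs.le, h5 s hs⟩, ⟨h3 t le_rfl, h6⟩, h4⟩
  · rintro ⟨h1, h2, h3⟩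
    have hu : u ∈ Elig (optFilt F t) (tensor F P μ) m := by
      refine (mem_Elig_optFilt hF0 hμ).2 ⟨fun s hs => ?_, h3⟩
      rcases hs.eq_or_lt with rfl | hs
      · exact h2.1
      · exact (h1 s hs).1
    exact ⟨hu, (key hu).2 ⟨fun s hs => (h1 s hs).2, h2.2⟩⟩

end HalfSpaces

end SetRisk

namespace SetRisk

section Penalties

variable {Ω : Type*} {m0 : MeasurableSpace Ω} {P : Measure Ω} {T d m : ℕ}
  {F : Filtration (Fin (T + 1)) m0} {t r : Fin (T + 1)} {μ : Fin (T + 1) → Ω → ℝ}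

theorem mem_accVec_toOptional (hF0 : ∀ A : Set Ω, MeasurableSet[F 0] A ↔ P A = 0 ∨ P Aᶜ = 0)
    (hμ : IsReference P F μ) {ρ : (Fin (T + 1) → Ω → Fin d → ℝ) → Set (Ω → Fin d → ℝ)}
    {R : Fin (T + 1) → (Ω → Fin d → ℝ) → Set (Ω → Fin d → ℝ)} {Y : Ω × Fin (T + 1) → Fin d → ℝ} :
    Y ∈ accVec (optSigma F) (tensor F P μ) (toOptional t ρ R) ↔
      Y ∈ LInf (optSigma F) (tensor F P μ) ∧ (∀ s < t, slice s Y ∈ accVec (F s) P (R s)) ∧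
        projFrom t Y ∈ accProc P F t ρ := by
  refine and_congr_right fun hY => ?_
  rw [toOptional, mem_pasteSets_iff]
  constructor
  · rintro ⟨h1, h2, -⟩
    exact ⟨fun s hs => ⟨(mem_LInf_optSigma hF0 hμ).1 hY s, h1 s hs⟩, projFrom_mem_RInf hF0 hμ hY, h2⟩
  · rintro ⟨h1, h2⟩
    exact ⟨fun s hs => (h1 s hs).2, h2.2, fun _ _ => rfl⟩

theorem IsClosedConvexProcessRM.accProc_nonempty {ρ : (Fin (T + 1) → Ω → Fin d → ℝ) → Set (Ω → Fin d → ℝ)}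
    (hρ : IsClosedConvexProcessRM P F m t ρ) : (accProc P F t ρ).Nonempty := by
  obtain ⟨c, hc⟩ := hρ.zero.1
  have hcE := (hρ.upper 0 RInf_zero).1 hc
  refine ⟨0 + constFrom t c, ⟨fun s => ?_, fun s hs => ?_⟩, ?_⟩
  · rw [zero_add, constFrom]
    split_ifs with h
    · exact LInf_mono (F.mono h) hcE.1
    · exact LInf_zero
  · rw [zero_add, constFrom, if_neg (not_le.2 hs)]
  · rw [hρ.cash 0 RInf_zero c hcE]
    exact ⟨c, hc, sub_self c⟩

theorem projFrom_procFrom {X : Fin (T + 1) → Ω → Fin d → ℝ} (hX : X ∈ RInf P F t) :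
    projFrom t (procFrom t X) = X := by
  ext s ω i
  by_cases h : t ≤ s
  · simp [projFrom, procFrom, slice, h]
  · simp [projFrom, h, hX.2 s (not_le.1 h)]

/-- The penalty function of a composed risk measure is composed of the penalty functions. -/
theorem penVec_toOptional_eq (hF0 : ∀ A : Set Ω, MeasurableSet[F 0] A ↔ P A = 0 ∨ P Aᶜ = 0)
    (hμ : IsReference P F μ) {ρ : (Fin (T + 1) → Ω → Fin d → ℝ) → Set (Ω → Fin d → ℝ)}
    {R : Fin (T + 1) → (Ω → Fin d → ℝ) → Set (Ω → Fin d → ℝ)}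
    (hρ : IsClosedConvexProcessRM P F m t ρ)
    (hR : ∀ s < t, IsClosedConvexVectorRM (F s) (F s) P m (R s))
    {Q : Fin d → @Measure (Ω × Fin (T + 1)) (optSigma F)} {w : Ω × Fin (T + 1) → Fin d → ℝ}
    {p : (Fin (T + 1) → Fin d → Measure Ω) × (Fin (T + 1) → Ω → Fin d → ℝ)}
    (hhalf : ∀ Y ∈ LInf (optSigma F) (tensor F P μ),
      halfSp (optFilt F t) (tensor F P μ) m w (condQVec (optFilt F t) (tensor F P μ) Q (-Y)) =
      pasteSets t (fun s => halfSp (F s) P m (slice s w) (-slice s Y))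
        (halfProc P F m t p (projFrom t Y))) :
    penVec (optFilt F t) (tensor F P μ) m (toOptional t ρ R) (Q, w) =
      pasteSets t (fun s => penRes (F s) P m (R s) (slice s w)) (penProc P F m t ρ p) := by
  obtain ⟨X0, hX0⟩ := hρ.accProc_nonempty
  have hZ0 : ∀ s, ∃ Z, s < t → Z ∈ accVec (F s) P (R s) := fun s => by
    by_cases hs : s < t
    · obtain ⟨Z, -, -, hZ⟩ := (hR s hs).exists_accVec_Elig le_rfl
      exact ⟨Z, fun _ => hZ⟩
    · exact ⟨0, fun h => absurd h hs⟩
  choose Z0 hZ0 using hZ0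
  set y : (Fin (T + 1) → Ω → Fin d → ℝ) → (Fin (T + 1) → Ω → Fin d → ℝ) →
    Ω × Fin (T + 1) → Fin d → ℝ := fun Z X x => if x.2 < t then Z x.2 x.1 else X x.2 x.1 with hy
  have hys : ∀ Z X s, slice s (y Z X) = if s < t then Z s else X s := by
    intro Z X s
    ext ω i
    by_cases h : s < t <;> simp [hy, slice, h]
  have hyp : ∀ Z X, X ∈ RInf P F t → projFrom t (y Z X) = X := by
    intro Z X hX
    ext s ω i
    by_cases h : t ≤ s
    · simp [projFrom, h, hys, not_lt.2 h]
    · simp [projFrom, h, hX.2 s (not_le.1 h)]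
  have hyA : ∀ Z X, (∀ s < t, Z s ∈ accVec (F s) P (R s)) → X ∈ accProc P F t ρ →
      y Z X ∈ accVec (optSigma F) (tensor F P μ) (toOptional t ρ R) := by
    intro Z X hZ hX
    refine (mem_accVec_toOptional hF0 hμ).2 ⟨(mem_LInf_optSigma hF0 hμ).2 fun s => ?_,
      fun s hs => ?_, ?_⟩
    · rw [hys]
      split_ifs with h
      · exact (hZ s h).1
      · exact hX.1.1 s
    · rw [hys, if_pos hs]
      exact hZ s hs
    · rwa [hyp _ _ hX.1]
  ext u
  rw [mem_pasteSets_iff]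
  simp only [penVec, penRes, penProc, mem_iInter₂]
  constructor
  · intro h
    have h' : ∀ (Z X : Fin (T + 1) → Ω → Fin d → ℝ), (∀ s < t, Z s ∈ accVec (F s) P (R s)) → X ∈ accProc P F t ρ → _ :=
      fun Z X hZ hX => mem_pasteSets_iff.1 ((hhalf _ (hyA Z X hZ hX).1).subset (h _ (hyA Z X hZ hX)))
    refine ⟨fun s hs Z hZ => ?_, fun X hX => ?_, (h' Z0 X0 hZ0 hX0).2.2⟩
    · have := (h' (Function.update Z0 s Z) X0 (fun r hr => by
        by_cases hrs : r = s
        · subst hrs; simpa using hZ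
        · simpa [hrs] using hZ0 r hr) hX0).1 s hs
      simpa [hys, hs] using this
    · have := (h' Z0 X hZ0 hX).2.1
      rwa [hyp _ _ hX.1] at this
  · rintro ⟨h1, h2, h3⟩ Y hY
    obtain ⟨hYL, hY1, hY2⟩ := (mem_accVec_toOptional hF0 hμ).1 hY
    refine (hhalf Y hYL).symm.subset (mem_pasteSets_iff.2 ⟨fun s hs => h1 s hs _ (hY1 s hs),
      h2 _ hY2, h3⟩)

variable {R : (Ω × Fin (T + 1) → Fin d → ℝ) → Set (Ω × Fin (T + 1) → Fin d → ℝ)}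

theorem IsClosedConvexVectorRM.glue_zero_mem_accVec
    (hF0 : ∀ A : Set Ω, MeasurableSet[F 0] A ↔ P A = 0 ∨ P Aᶜ = 0) (hμ : IsReference P F μ)
    (hR : IsClosedConvexVectorRM (optSigma F) (optFilt F t) (tensor F P μ) m R) (hr : r ≤ t)
    {X : Ω × Fin (T + 1) → Fin d → ℝ} (hX : X ∈ LInf (optSigma F) (tensor F P μ))
    (hX0 : ∀ x, min x.2 t ≠ r → X x = 0) (h : 0 ∈ slice r '' R X) :
    ∃ v, X + glue t r v 0 ∈ accVec (optSigma F) (tensor F P μ) R := by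
  obtain ⟨v, hv⟩ := hR.zero.1
  have hvE := hR.subset_Elig LInf_zero hv
  exact ⟨v, (hR.mem_iff_add_mem_accVec optFilt_le hX
    ((glue_mem_Elig hF0 hμ hr hvE).2 Elig_zero)).1 ((hR.mem_slice_image_iff hF0 hμ hr hX hX0 hv).1 h)⟩

theorem IsClosedConvexVectorRM.zero_mem_slice_image
    (hR : IsClosedConvexVectorRM (optSigma F) (optFilt F t) (tensor F P μ) m R) (hr : r ≤ t)
    {X Y : Ω × Fin (T + 1) → Fin d → ℝ} (hY : Y ∈ accVec (optSigma F) (tensor F P μ) R)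
    (hXY : X = {x | min x.2 t = r}.indicator Y) : 0 ∈ slice r '' R X := by
  obtain ⟨v, hv⟩ := hR.zero.1
  have h := hR.paste_mem (A := {x | min x.2 t = r}) hY.1 LInf_zero hY.2 hv measurableSet_optFilt_min
  rw [indicator_zero', add_zero, ← hXY, indicator_zero', zero_add] at h
  refine ⟨_, h, ?_⟩
  ext ω i
  simp [slice, hr]

theorem accProc_toProcess
    (hF0 : ∀ A : Set Ω, MeasurableSet[F 0] A ↔ P A = 0 ∨ P Aᶜ = 0) (hμ : IsReference P F μ)
    (hR : IsClosedConvexVectorRM (optSigma F) (optFilt F t) (tensor F P μ) m R) :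
    accProc P F t (toProcess t R) = projFrom t '' accVec (optSigma F) (tensor F P μ) R := by
  ext X
  constructor
  · rintro ⟨hX, h⟩
    obtain ⟨v, hv⟩ := hR.glue_zero_mem_accVec hF0 hμ le_rfl (procFrom_mem_LInf hF0 hμ hX)
      (procFrom_eq_zero X) h
    refine ⟨_, hv, ?_⟩
    rw [← projFrom_procFrom hX]
    ext s ω i
    by_cases hs : t ≤ s <;> simp [projFrom, slice, glue, procFrom, hs]
  · rintro ⟨Y, hY, rfl⟩
    refine ⟨projFrom_mem_RInf hF0 hμ hY.1, hR.zero_mem_slice_image le_rfl hY ?_⟩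
    ext x i
    by_cases hs : t ≤ x.2 <;> simp [projFrom, slice, procFrom, hs]

theorem accVec_toRestricted
    (hF0 : ∀ A : Set Ω, MeasurableSet[F 0] A ↔ P A = 0 ∨ P Aᶜ = 0) (hμ : IsReference P F μ)
    (hR : IsClosedConvexVectorRM (optSigma F) (optFilt F t) (tensor F P μ) m R) (hr : r < t) :
    accVec (F r) P (toRestricted r R) = slice r '' accVec (optSigma F) (tensor F P μ) R := by
  ext X
  constructor
  · rintro ⟨hX, h⟩
    obtain ⟨v, hv⟩ := hR.glue_zero_mem_accVec hF0 hμ hr.le (single_mem_LInf hF0 hμ hX)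
      (single_eq_zero hr X) h
    refine ⟨_, hv, ?_⟩
    ext ω i
    simp [slice, glue, single, hr.le]
  · rintro ⟨Y, hY, rfl⟩
    refine ⟨(mem_LInf_optSigma hF0 hμ).1 hY.1 r, hR.zero_mem_slice_image hr.le hY ?_⟩
    rw [single_eq_glue hr]
    ext ⟨ω, s⟩ i
    by_cases hs : min s t = r
    · have : s = r := by
        rcases le_total s t with h | h
        · rwa [min_eq_left h] at hs
        · rw [min_eq_right h] at hs
          exact absurd hs hr.ne'
      subst this
      simp [glue, slice, hr.le]
    · simp [glue, hs]

theorem halfSp_zero {mt : MeasurableSpace Ω} {c : Ω → Fin d → ℝ} (hc : c ∈ LInf mt P) :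
    halfSp mt P m 0 c = Elig mt P m := by
  ext u
  rw [mem_halfSp_iff hc]
  simp

theorem penProc_toProcess_eq
    (hF0 : ∀ A : Set Ω, MeasurableSet[F 0] A ↔ P A = 0 ∨ P Aᶜ = 0) (hμ : IsReference P F μ)
    (hR : IsClosedConvexVectorRM (optSigma F) (optFilt F t) (tensor F P μ) m R)
    {Q : Fin d → @Measure (Ω × Fin (T + 1)) (optSigma F)} {w : Ω × Fin (T + 1) → Fin d → ℝ}
    {p : (Fin (T + 1) → Fin d → Measure Ω) × (Fin (T + 1) → Ω → Fin d → ℝ)}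
    (hw : ∀ s < t, slice s w = 0)
    (hhalf : ∀ Y ∈ LInf (optSigma F) (tensor F P μ),
      halfSp (optFilt F t) (tensor F P μ) m w (condQVec (optFilt F t) (tensor F P μ) Q (-Y)) =
      pasteSets t (fun s => halfSp (F s) P m (slice s w) (-slice s Y))
        (halfProc P F m t p (projFrom t Y))) :
    penProc P F m t (toProcess t R) p =
      slice t '' penVec (optFilt F t) (tensor F P μ) m R (Q, w) := by
  rw [penProc, accProc_toProcess hF0 hμ hR, penVec, biInter_image]
  ext u
  simp only [mem_iInter₂, mem_image]
  constructor
  · intro h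
    refine ⟨paste t 0 u, fun Y hY => ?_, by rw [slice_paste, if_neg (lt_irrefl t)]⟩
    rw [hhalf Y hY.1]
    refine ⟨0, u, fun s hs => ?_, h Y hY, rfl⟩
    beta_reduce
    rw [hw s hs, halfSp_zero (LInf_neg ((mem_LInf_optSigma hF0 hμ).1 hY.1 s))]
    exact Elig_zero
  · rintro ⟨z, hz, rfl⟩ Y hY
    have := hz Y hY
    rw [hhalf Y hY.1] at this
    exact (mem_pasteSets_iff.1 this).2.1

theorem penRes_toRestricted_eq
    (hF0 : ∀ A : Set Ω, MeasurableSet[F 0] A ↔ P A = 0 ∨ P Aᶜ = 0) (hμ : IsReference P F μ)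
    (hR : IsClosedConvexVectorRM (optSigma F) (optFilt F t) (tensor F P μ) m R) (hr : r < t)
    {Q : Fin d → @Measure (Ω × Fin (T + 1)) (optSigma F)} {w : Ω → Fin d → ℝ}
    {p : (Fin (T + 1) → Fin d → Measure Ω) × (Fin (T + 1) → Ω → Fin d → ℝ)} (hp : p.2 = 0)
    (hhalf : ∀ Y ∈ LInf (optSigma F) (tensor F P μ),
      halfSp (optFilt F t) (tensor F P μ) m (single r w)
        (condQVec (optFilt F t) (tensor F P μ) Q (-Y)) =
      pasteSets t (fun s => halfSp (F s) P m (slice s (single r w)) (-slice s Y))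
        (halfProc P F m t p (projFrom t Y))) :
    penRes (F r) P m (toRestricted r R) w =
      slice r '' penVec (optFilt F t) (tensor F P μ) m R (Q, single r w) := by
  rw [penRes, accVec_toRestricted hF0 hμ hR hr, penVec, biInter_image]
  ext u
  simp only [mem_iInter₂, mem_image]
  constructor
  · intro h
    refine ⟨glue t r 0 u, fun Y hY => ?_, slice_glue hr.le 0 u⟩
    rw [hhalf Y hY.1, glue_eq_paste_update hr (fun _ _ => rfl)]
    refine ⟨_, _, fun s hs => ?_, ⟨Elig_zero, ?_⟩, rfl⟩
    · beta_reduce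
      rw [slice_single]
      by_cases hsr : s = r
      · subst hsr
        simpa using h Y hY
      · rw [if_neg hsr, halfSp_zero (LInf_neg ((mem_LInf_optSigma hF0 hμ).1 hY.1 s)),
          Function.update_of_ne hsr]
        exact Elig_zero
    · simp [hp]
  · rintro ⟨z, hz, rfl⟩ Y hY
    have := hz Y hY
    rw [hhalf Y hY.1] at this
    have := (mem_pasteSets_iff.1 this).1 r hr
    rwa [slice_single, if_pos rfl] at this

end Penalties

end SetRisk

namespace SetRisk

section DualVariables

theorem self_mem_ProbACAt {S : Type*} {mt mS : MeasurableSpace S} {P : Measure S}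
    [IsProbabilityMeasure P] : P ∈ ProbACAt mt P :=
  ⟨⟨inferInstance, Measure.AbsolutelyContinuous.rfl⟩, fun _ _ => rfl⟩

theorem dens_self {S : Type*} {mS : MeasurableSpace S} {P : Measure S} [SigmaFinite P] :
    dens P P =ᵐ[P] fun _ => 1 := by
  filter_upwards [Measure.rnDeriv_self P] with ω h
  simp [dens, h]

theorem LOnePos_congr {S : Type*} {d : ℕ} {mt mS : MeasurableSpace S} {P : Measure S}
    {X Y : S → Fin d → ℝ} (hX : X ∈ LOnePos mt P) (hY : Measurable[mt] Y) (h : Y =ᵐ[P] X) :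
    Y ∈ LOnePos mt P := by
  refine ⟨⟨hY, hX.1.2.congr h.symm⟩, ?_⟩
  filter_upwards [h, hX.2] with ω h1 h2
  rwa [h1]

theorem LOnePos_zero {S : Type*} {d : ℕ} {mt mS : MeasurableSpace S} {P : Measure S} :
    (0 : S → Fin d → ℝ) ∈ LOnePos mt P :=
  ⟨LOne_zero, Filter.Eventually.of_forall fun _ _ => le_rfl⟩

variable {Ω : Type*} {m0 : MeasurableSpace Ω} {P : Measure Ω} {T d m : ℕ}
  {F : Filtration (Fin (T + 1)) m0} {t r : Fin (T + 1)} {μ : Fin (T + 1) → Ω → ℝ}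

theorem mem_LOnePos_optSigma (hF0 : ∀ A : Set Ω, MeasurableSet[F 0] A ↔ P A = 0 ∨ P Aᶜ = 0)
    (hμ : IsReference P F μ) {X : Ω × Fin (T + 1) → Fin d → ℝ} :
    X ∈ LOnePos (optSigma F) (tensor F P μ) ↔ ∀ s, slice s X ∈ LOnePos (F s) P := by
  rw [LOnePos, mem_ofPred_eq, mem_LOne_optSigma hμ, ae_tensor_iff hF0 hμ, ← forall_and]
  rfl

theorem single_mem_dualVec [IsProbabilityMeasure P]
    (hF0 : ∀ A : Set Ω, MeasurableSet[F 0] A ↔ P A = 0 ∨ P Aᶜ = 0) (hμ : IsReference P F μ)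
    (hr : r < t) {w : Ω → Fin d → ℝ} (hw : w ∈ dualRes (F r) P m) :
    ((fun _ => tensor F P μ), single r w) ∈ dualVec (optFilt F t) (tensor F P μ) m := by
  have := isProbabilityMeasure_tensor hμ
  have hwL := single_mem_LOne_optFilt hμ hr hw.1.1
  have hpos : single r w ∈ LOnePos (optSigma F) (tensor F P μ) := by
    refine (mem_LOnePos_optSigma hF0 hμ).2 fun s => ?_
    rw [slice_single]
    split_ifs with h
    · exact h ▸ hw.1
    · exact LOnePos_zero
  refine ⟨fun _ => self_mem_ProbACAt, ⟨mem_EligPosDual_of_nonneg hwL hpos.2, fun h => hw.2 ?_⟩, ?_⟩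
  · rw [mem_EligPerp_iff optFilt_le hwL hpos.2, ae_tensor_iff hF0 hμ] at h
    rw [mem_EligPerp_iff (F.le r) hw.1.1 hw.1.2]
    filter_upwards [h r] with ω hω
    simpa [single] using hω
  · refine LOnePos_congr hpos (measurable_wts optFilt_le hwL.1) ?_
    refine (ae_tensor_iff hF0 hμ).2 fun s => ?_
    filter_upwards [wts_optional_slice hF0 hμ (fun _ => self_mem_ProbACAt) (single r w) s,
      (ae_tensor_iff hF0 hμ).1 (dens_self (P := tensor F P μ)) s] with ω h1 h2
    ext i
    rw [h1, h2, mul_one]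

theorem zero_mem_dualProcCone [IsProbabilityMeasure P] :
    ((fun _ _ => P), 0) ∈ (dualProcCone P F m t :
      Set ((Fin (T + 1) → Fin d → Measure Ω) × (Fin (T + 1) → Ω → Fin d → ℝ))) := by
  refine fun s _ => ⟨fun _ => self_mem_ProbACAt, mem_EligPosDual_of_nonneg LOne_zero
    (Filter.Eventually.of_forall fun _ _ => le_rfl), ?_⟩
  convert LOnePos_zero using 1
  ext ω i
  simp [wts]

theorem penRes_toRestricted [IsProbabilityMeasure P]
    (hF0 : ∀ A : Set Ω, MeasurableSet[F 0] A ↔ P A = 0 ∨ P Aᶜ = 0) (hμ : IsReference P F μ)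
    {R : (Ω × Fin (T + 1) → Fin d → ℝ) → Set (Ω × Fin (T + 1) → Fin d → ℝ)}
    (hR : IsClosedConvexVectorRM (optSigma F) (optFilt F t) (tensor F P μ) m R) (hr : r < t)
    {w : Ω → Fin d → ℝ} (hw : w ∈ dualRes (F r) P m) :
    penRes (F r) P m (toRestricted r R) w = slice r '' penVec (optFilt F t) (tensor F P μ) m R
      ((fun _ => tensor F P μ), single r w) := by
  obtain ⟨h1, h2, h3⟩ := single_mem_dualVec (m := m) hF0 hμ hr hw
  refine penRes_toRestricted_eq hF0 hμ hR hr (p := ((fun _ _ => P), 0)) rfl fun Y hY =>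
    halfSp_optional_eq hF0 hμ h1 h2.1.1.1 h3.1 zero_mem_dualProcCone (fun s hs => ?_) hY
  refine Filter.Eventually.of_forall fun ω i => ?_
  simp [wts, single, (hr.trans_le hs).ne']

section MapWbar

variable {p : (Fin (T + 1) → Fin d → Measure Ω) × (Fin (T + 1) → Ω → Fin d → ℝ)}

theorem dualProcCone_nonneg [IsFiniteMeasure P] (hp : p ∈ dualProcCone P F m t) :
    ∀ᵐ ω ∂P, ∀ s, t ≤ s → ∀ i, 0 ≤ p.2 s ω i := by
  rw [ae_all_iff]
  intro s
  by_cases hs : t ≤ s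
  · obtain ⟨h1, h2, h3⟩ := hp s hs
    filter_upwards [nonneg_of_wts_nonneg (F.mono hs) (F.le s) h1 h2.1.1 h3] with ω h _ using h
  · exact Filter.Eventually.of_forall fun ω h => absurd h hs

theorem sumPos_eq {w : Fin (T + 1) → Ω → Fin d → ℝ} {ω : Ω} (h : ∀ s, t ≤ s → ∀ i, 0 ≤ w s ω i)
    (i : Fin d) : sumPos t w ω i = ∑ s ∈ Finset.Ici t, w s ω i := by
  refine Finset.sum_congr rfl fun s hs => ?_
  split_ifs with h1
  · rfl
  · exact le_antisymm (h s (Finset.mem_Ici.1 hs) i) (not_lt.1 h1)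

theorem sum_mem_LOne (hp : p ∈ dualProcCone P F m t) :
    ∑ s ∈ Finset.Ici t, p.2 s ∈ LOne (F t) P := by
  refine ⟨by
    rw [Finset.sum_fn]
    exact Finset.measurable_fun_sum _ fun s hs => (hp s (Finset.mem_Ici.1 hs)).2.1.1.1, ?_⟩
  exact integrable_finsetSum' _ fun s hs => (hp s (Finset.mem_Ici.1 hs)).2.1.1.2

theorem sumPos_ae_eq [IsFiniteMeasure P] (hp : p ∈ dualProcCone P F m t) :
    sumPos t p.2 =ᵐ[P] ∑ s ∈ Finset.Ici t, p.2 s := by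
  filter_upwards [dualProcCone_nonneg hp] with ω h
  ext i
  rw [sumPos_eq h, Finset.sum_apply, Finset.sum_apply]

theorem measurable_sumPos (hp : p ∈ dualProcCone P F m t) : Measurable[F t] (sumPos t p.2) := by
  refine measurable_of_apply fun i => Finset.measurable_fun_sum _ fun s hs => ?_
  have := measurable_apply (hp s (Finset.mem_Ici.1 hs)).2.1.1.1 i
  exact Measurable.ite (measurableSet_lt_fun measurable_const this) this measurable_const

theorem sumPos_mem_LOnePos [IsFiniteMeasure P] (hp : p ∈ dualProcCone P F m t) :
    sumPos t p.2 ∈ LOnePos (F t) P := by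
  refine LOnePos_congr ⟨sum_mem_LOne hp, ?_⟩ (measurable_sumPos hp) (sumPos_ae_eq hp)
  filter_upwards [dualProcCone_nonneg hp] with ω h i
  rw [Finset.sum_apply, Finset.sum_apply]
  exact Finset.sum_nonneg fun s hs => h s (Finset.mem_Ici.1 hs) i

open Classical in
/-- The proportion of the weight which is assigned to time `s`. -/
noncomputable def weightRatio (t : Fin (T + 1)) (w : Fin (T + 1) → Ω → Fin d → ℝ) (i : Fin d)
    (s : Fin (T + 1)) (ω : Ω) : ℝ :=
  if 0 < sumPos t w ω i then w s ω i / sumPos t w ω i else 1 / ((T : ℝ) - ((t : ℕ) : ℝ) + 1)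

theorem horizon_pos (t : Fin (T + 1)) : (0 : ℝ) < (T : ℝ) - ((t : ℕ) : ℝ) + 1 := by
  have : ((t : ℕ) : ℝ) ≤ T := by exact_mod_cast Nat.lt_succ_iff.1 t.2
  linarith

theorem card_Ici (t : Fin (T + 1)) : ((Finset.Ici t).card : ℝ) = (T : ℝ) - ((t : ℕ) : ℝ) + 1 := by
  rw [Fin.card_Ici, Nat.cast_sub t.2.le]
  push_cast
  ring

theorem weightRatio_nonneg {w : Fin (T + 1) → Ω → Fin d → ℝ} {ω : Ω}
    (h : ∀ s, t ≤ s → ∀ i, 0 ≤ w s ω i) (i : Fin d) {s : Fin (T + 1)} (hs : t ≤ s) :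
    0 ≤ weightRatio t w i s ω := by
  unfold weightRatio
  split_ifs with h1
  · exact div_nonneg (h s hs i) h1.le
  · exact div_nonneg zero_le_one (horizon_pos t).le

theorem sum_weightRatio {w : Fin (T + 1) → Ω → Fin d → ℝ} {ω : Ω}
    (h : ∀ s, t ≤ s → ∀ i, 0 ≤ w s ω i) (i : Fin d) :
    ∑ s ∈ Finset.Ici t, weightRatio t w i s ω = 1 := by
  unfold weightRatio
  split_ifs with h1
  · rw [← Finset.sum_div, ← sumPos_eq h, div_self h1.ne']
  · rw [Finset.sum_const, nsmul_eq_mul, card_Ici, mul_one_div_cancel (horizon_pos t).ne']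

theorem sumPos_mul_weightRatio {w : Fin (T + 1) → Ω → Fin d → ℝ} {ω : Ω}
    (h : ∀ s, t ≤ s → ∀ i, 0 ≤ w s ω i) (i : Fin d) {s : Fin (T + 1)} (hs : t ≤ s) :
    sumPos t w ω i * weightRatio t w i s ω = w s ω i := by
  unfold weightRatio
  split_ifs with h1
  · rw [mul_div_cancel₀ _ h1.ne']
  · have h2 : sumPos t w ω i = 0 := by
      refine le_antisymm (not_lt.1 h1) ?_
      rw [sumPos_eq h]
      exact Finset.sum_nonneg fun s hs => h s (Finset.mem_Ici.1 hs) i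
    rw [h2, zero_mul]
    rw [sumPos_eq h, Finset.sum_eq_zero_iff_of_nonneg fun s hs => h s (Finset.mem_Ici.1 hs) i] at h2
    exact (h2 s (Finset.mem_Ici.2 hs)).symm

theorem measurable_weightRatio (hp : p ∈ dualProcCone P F m t) (i : Fin d) {s : Fin (T + 1)}
    (hs : t ≤ s) : Measurable[F t] (weightRatio t p.2 i s) := by
  have h1 := measurable_apply (measurable_sumPos hp) i
  exact Measurable.ite (measurableSet_lt_fun measurable_const h1)
    ((measurable_apply (hp s hs).2.1.1.1 i).div h1) measurable_const

/-- The density of the `i`-th measure of `mapWbar`. -/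
noncomputable def wbarDens (P : Measure Ω) (F : Filtration (Fin (T + 1)) m0)
    (μ : Fin (T + 1) → Ω → ℝ) (t : Fin (T + 1))
    (p : (Fin (T + 1) → Fin d → Measure Ω) × (Fin (T + 1) → Ω → Fin d → ℝ)) (i : Fin d)
    (x : Ω × Fin (T + 1)) : ℝ :=
  if x.2 < t then 1 else remMass μ t x.1 / μ x.2 x.1 * weightRatio t p.2 i x.2 x.1 *
    xi (F t) (F x.2) P (p.1 x.2 i) x.1

theorem measurable_wbarDens (hμ : IsReference P F μ) (hp : p ∈ dualProcCone P F m t) (i : Fin d) :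
    Measurable[optSigma F] (wbarDens P F μ t p i) := by
  refine measurable_optSigma_iff.2 fun s => ?_
  by_cases hs : s < t
  · simp only [wbarDens, hs, if_true]
    exact measurable_const
  · simp only [wbarDens, hs, if_false]
    have h := F.mono (not_lt.1 hs)
    exact (((hμ.measurable_remMass.mono h le_rfl).div (hμ.1 s)).mul
      ((measurable_weightRatio hp i (not_lt.1 hs)).mono h le_rfl)).mul (measurable_xi h _)

theorem wbarDens_nonneg [IsFiniteMeasure P]
    (hF0 : ∀ A : Set Ω, MeasurableSet[F 0] A ↔ P A = 0 ∨ P Aᶜ = 0) (hμ : IsReference P F μ)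
    (hp : p ∈ dualProcCone P F m t) (i : Fin d) :
    0 ≤ᵐ[tensor F P μ] wbarDens P F μ t p i := by
  refine (ae_tensor_iff hF0 hμ).2 fun s => ?_
  filter_upwards [dualProcCone_nonneg hp, hμ.pos, hμ.remMass_pos t,
    xi_nonneg (mt := F t) (ms := F s) (P := P) (p.1 s i)] with ω h1 h2 h3 h4
  simp only [wbarDens, Pi.zero_apply]
  split_ifs with hs
  · exact zero_le_one
  · exact mul_nonneg (mul_nonneg (div_nonneg h3.le (h2 s).le)
      (weightRatio_nonneg h1 i (not_lt.1 hs))) h4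

theorem integrable_weightRatio_mul_xi [IsFiniteMeasure P] (hp : p ∈ dualProcCone P F m t)
    (i : Fin d) {s : Fin (T + 1)} (hs : t ≤ s) :
    Integrable (fun ω => weightRatio t p.2 i s ω * xi (F t) (F s) P (p.1 s i) ω) P := by
  simp only [mul_comm (weightRatio t p.2 i s _)]
  refine integrable_mul_of_bounded (C := 1) (integrable_xi (F.le t) ((hp s hs).1 i))
    ((measurable_weightRatio hp i hs).mono (F.le t) le_rfl) ?_
  filter_upwards [dualProcCone_nonneg hp] with ω h
  rw [abs_of_nonneg (weightRatio_nonneg h i hs), ← sum_weightRatio h i]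
  exact Finset.single_le_sum (fun r hr => weightRatio_nonneg h i (Finset.mem_Ici.1 hr))
    (Finset.mem_Ici.2 hs)

theorem integrable_wbarDens_slice [IsFiniteMeasure P] (hμ : IsReference P F μ)
    (hp : p ∈ dualProcCone P F m t) (i : Fin d) (s : Fin (T + 1)) :
    Integrable (fun ω => wbarDens P F μ t p i (ω, s)) P := by
  by_cases hs : s < t
  · simp only [wbarDens, hs, if_true]
    exact integrable_const _
  · simp only [wbarDens, hs, if_false]
    convert hμ.integrable_div (hμ.integrable_remMass_mul (t := t)
      (integrable_weightRatio_mul_xi hp i (not_lt.1 hs))) s using 2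
    ring

theorem condExp_wbarDens [IsProbabilityMeasure P]
    (hF0 : ∀ A : Set Ω, MeasurableSet[F 0] A ↔ P A = 0 ∨ P Aᶜ = 0) (hμ : IsReference P F μ)
    (hp : p ∈ dualProcCone P F m t) (i : Fin d) :
    condExp (optFilt F t) (tensor F P μ) (wbarDens P F μ t p i) =ᵐ[tensor F P μ] fun _ => 1 := by
  refine (ae_tensor_iff hF0 hμ).2 fun s => ?_
  have h1 := condExp_tensor (t := t) hF0 hμ (measurable_wbarDens hμ hp i)
    (integrable_wbarDens_slice hμ hp i) s
  by_cases hs : s < t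
  · filter_upwards [h1] with ω a1
    rw [a1, if_pos hs]
    simp [wbarDens, hs]
  have hint : ∀ r ∈ Finset.Ici t, Integrable (fun ω =>
      weightRatio t p.2 i r ω * xi (F t) (F r) P (p.1 r i) ω) P := fun r hr =>
    integrable_weightRatio_mul_xi hp i (Finset.mem_Ici.1 hr)
  have h2 : (fun ω => ∑ r ∈ Finset.Ici t, μ r ω * wbarDens P F μ t p i (ω, r)) =ᵐ[P]
      fun ω => remMass μ t ω * (∑ r ∈ Finset.Ici t, fun ω =>
        weightRatio t p.2 i r ω * xi (F t) (F r) P (p.1 r i) ω) ω := by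
    filter_upwards [hμ.pos] with ω h
    rw [Finset.sum_apply, Finset.mul_sum]
    refine Finset.sum_congr rfl fun r hr => ?_
    have := (h r).ne'
    rw [wbarDens, if_neg (not_lt.2 (Finset.mem_Ici.1 hr))]
    field_simp
  have h3 := condExp_mul_of_stronglyMeasurable_left (m := F t)
    (hμ.measurable_remMass (t := t)).stronglyMeasurable
    (hμ.integrable_remMass_mul (t := t) (integrable_finsetSum' _ hint)) (integrable_finsetSum' _ hint)
  have h4 := condExp_finsetSum hint (F t)
  have h5 : ∀ᵐ ω ∂P, ∀ r, t ≤ r → condExp (F t) P (fun ω =>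
      weightRatio t p.2 i r ω * xi (F t) (F r) P (p.1 r i) ω) ω = weightRatio t p.2 i r ω := by
    rw [ae_all_iff]
    intro r
    by_cases hr : t ≤ r
    · have e1 := condExp_mul_of_stronglyMeasurable_left (m := F t)
        (measurable_weightRatio hp i hr).stronglyMeasurable
        (integrable_weightRatio_mul_xi hp i hr) (integrable_xi (F.le t) ((hp r hr).1 i))
      filter_upwards [e1, condExp_xi (F.mono hr) (F.le r) ((hp r hr).1 i)] with ω a1 a2 _
      refine a1.trans ?_
      rw [Pi.mul_apply, a2, mul_one]
    · exact Filter.Eventually.of_forall fun ω h => absurd h hr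
  filter_upwards [h1, condExp_congr_ae (m := F t) h2, h3, h4, h5, dualProcCone_nonneg hp,
    hμ.remMass_pos t] with ω a1 a2 a3 a4 a5 a6 a7
  rw [a1, if_neg hs, a2]
  refine (congrArg (· / remMass μ t ω) a3).trans ?_
  change remMass μ t ω * _ / remMass μ t ω = 1
  rw [mul_div_cancel_left₀ _ a7.ne', a4, Finset.sum_apply,
    Finset.sum_congr rfl fun r hr => a5 r (Finset.mem_Ici.1 hr), sum_weightRatio a6]

theorem mapWbar_fst_mem [IsProbabilityMeasure P]
    (hF0 : ∀ A : Set Ω, MeasurableSet[F 0] A ↔ P A = 0 ∨ P Aᶜ = 0) (hμ : IsReference P F μ)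
    (hp : p ∈ dualProcCone P F m t) (i : Fin d) :
    (mapWbar P F μ t p).1 i ∈ ProbACAt (optFilt F t) (tensor F P μ) := by
  have := isProbabilityMeasure_tensor hμ
  exact withDensity_mem_ProbACAt optFilt_le
    ((integrable_tensor_iff hμ (measurable_wbarDens hμ hp i)).2 (integrable_wbarDens_slice hμ hp i))
    (wbarDens_nonneg hF0 hμ hp i) (condExp_wbarDens hF0 hμ hp i)

theorem dens_mapWbar [IsProbabilityMeasure P]
    (hF0 : ∀ A : Set Ω, MeasurableSet[F 0] A ↔ P A = 0 ∨ P Aᶜ = 0) (hμ : IsReference P F μ)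
    (hp : p ∈ dualProcCone P F m t) (i : Fin d) :
    dens (tensor F P μ) ((mapWbar P F μ t p).1 i) =ᵐ[tensor F P μ] wbarDens P F μ t p i := by
  have := isProbabilityMeasure_tensor hμ
  exact dens_withDensity
    ((integrable_tensor_iff hμ (measurable_wbarDens hμ hp i)).2 (integrable_wbarDens_slice hμ hp i))
    (wbarDens_nonneg hF0 hμ hp i)

theorem mul_wts_mapWbar [IsProbabilityMeasure P]
    (hF0 : ∀ A : Set Ω, MeasurableSet[F 0] A ↔ P A = 0 ∨ P Aᶜ = 0) (hμ : IsReference P F μ)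
    (hp : p ∈ dualProcCone P F m t) {s : Fin (T + 1)} (hs : t ≤ s) :
    ∀ᵐ ω ∂P, ∀ i, μ s ω * wts (optFilt F t) (optSigma F) (tensor F P μ)
      (mapWbar P F μ t p).1 (mapWbar P F μ t p).2 (ω, s) i =
        remMass μ t ω * wts (F t) (F s) P (p.1 s) (p.2 s) ω i := by
  rw [ae_all_iff]
  intro i
  filter_upwards [wts_optional_slice hF0 hμ (mapWbar_fst_mem hF0 hμ hp) (mapWbar P F μ t p).2 s,
    (ae_tensor_iff hF0 hμ).1 (dens_mapWbar hF0 hμ hp i) s, hμ.pos, dualProcCone_nonneg hp]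
    with ω h1 h2 h3 h4
  have := (h3 s).ne'
  rw [h1, h2, wts, ← sumPos_mul_weightRatio h4 i hs, wbarDens, if_neg (not_lt.2 hs),
    show (mapWbar P F μ t p).2 (ω, s) i = sumPos t p.2 ω i by
      simp [mapWbar, paste, not_lt.2 hs]]
  field_simp

theorem mapWbar_mem_dualVec [IsProbabilityMeasure P]
    (hF0 : ∀ A : Set Ω, MeasurableSet[F 0] A ↔ P A = 0 ∨ P Aᶜ = 0) (hμ : IsReference P F μ)
    (hp : p ∈ dualProc P F m t) :
    mapWbar P F μ t p ∈ dualVec (optFilt F t) (tensor F P μ) m := by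
  have := isProbabilityMeasure_tensor hμ
  have hs := sumPos_mem_LOnePos hp.1
  have hQ := mapWbar_fst_mem hF0 hμ hp.1
  have hwL : (mapWbar P F μ t p).2 ∈ LOne (optFilt F t) (tensor F P μ) :=
    paste_mem_LOne_optFilt hμ (fun s _ => LOne_zero) hs.1
  have hw0 : ∀ᵐ x ∂(tensor F P μ), ∀ i, 0 ≤ (mapWbar P F μ t p).2 x i := by
    refine (ae_tensor_iff hF0 hμ).2 fun s => ?_
    filter_upwards [hs.2] with ω h i
    by_cases hst : s < t
    · simp [mapWbar, paste, hst]
    · simpa [mapWbar, paste, hst] using h i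
  refine ⟨hQ, ⟨mem_EligPosDual_of_nonneg hwL hw0, fun h => hp.2 ?_⟩, ?_⟩
  · rw [mem_EligPerp_iff optFilt_le hwL hw0, ae_tensor_iff hF0 hμ] at h
    have hsum := LOnePos_congr hs (sum_mem_LOne hp.1).1 (sumPos_ae_eq hp.1).symm
    rw [mem_EligPerp_iff (F.le t) hsum.1 hsum.2]
    filter_upwards [h t, sumPos_ae_eq hp.1] with ω h1 h2
    rw [← h2]
    simpa [mapWbar, paste] using h1
  · refine (mem_LOnePos_optSigma hF0 hμ).2 fun s => ?_
    have hm := measurable_optSigma_slice.1 (measurable_wts (Q := (mapWbar P F μ t p).1)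
      (P := tensor F P μ) optFilt_le hwL.1) s
    by_cases hst : s < t
    · refine LOnePos_congr LOnePos_zero hm ?_
      filter_upwards [wts_optional_slice_of_lt hF0 hμ hQ (mapWbar P F μ t p).2 hst] with ω h
      refine h.trans ?_
      simp [mapWbar, paste, hst]
    · obtain ⟨-, -, h3⟩ := hp.1 s (not_lt.1 hst)
      have hL : (fun ω i => remMass μ t ω * wts (F t) (F s) P (p.1 s) (p.2 s) ω i / μ s ω) ∈
          LOnePos (F s) P := by
        refine ⟨hμ.div_mem_LOne (mem_LOne_iff.2 ⟨measurable_of_apply fun i =>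
          ((hμ.measurable_remMass).mono (F.mono (not_lt.1 hst)) le_rfl).mul (measurable_apply h3.1.1 i),
          fun i => hμ.integrable_remMass_mul ((mem_LOne_iff.1 h3.1).2 i)⟩), ?_⟩
        filter_upwards [h3.2, hμ.pos, hμ.remMass_pos t] with ω a1 a2 a3 i
        exact div_nonneg (mul_nonneg a3.le (a1 i)) (a2 s).le
      refine LOnePos_congr hL hm ?_
      filter_upwards [mul_wts_mapWbar hF0 hμ hp.1 (not_lt.1 hst), hμ.pos] with ω a1 a2
      ext i
      rw [← a1 i, mul_div_cancel_left₀ _ (a2 s).ne']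
      rfl

theorem penProc_toProcess [IsProbabilityMeasure P]
    (hF0 : ∀ A : Set Ω, MeasurableSet[F 0] A ↔ P A = 0 ∨ P Aᶜ = 0) (hμ : IsReference P F μ)
    {R : (Ω × Fin (T + 1) → Fin d → ℝ) → Set (Ω × Fin (T + 1) → Fin d → ℝ)}
    (hR : IsClosedConvexVectorRM (optSigma F) (optFilt F t) (tensor F P μ) m R)
    (hp : p ∈ dualProc P F m t) :
    penProc P F m t (toProcess t R) p =
      slice t '' penVec (optFilt F t) (tensor F P μ) m R (mapWbar P F μ t p) := by
  obtain ⟨h1, h2, h3⟩ := mapWbar_mem_dualVec hF0 hμ hp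
  refine penProc_toProcess_eq hF0 hμ hR (fun s hs => ?_) fun Y hY =>
    halfSp_optional_eq hF0 hμ h1 h2.1.1.1 h3.1 hp.1 (fun s hs => mul_wts_mapWbar hF0 hμ hp.1 hs) hY
  rw [slice_paste, if_pos hs]
  rfl

end MapWbar

end DualVariables

end SetRisk

namespace SetRisk

section MapW

theorem dens_withDensity_of_measurable {S : Type*} {mS : MeasurableSpace S} {P : Measure S}
    [IsFiniteMeasure P] {q : S → ℝ} (hq : Measurable q) (hq0 : 0 ≤ᵐ[P] q) :
    dens P (P.withDensity fun ω => ENNReal.ofReal (q ω)) =ᵐ[P] q := by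
  filter_upwards [Measure.rnDeriv_withDensity₀ P hq.ennreal_ofReal.aemeasurable, hq0] with ω h1 h2
  rw [dens, h1, ENNReal.toReal_ofReal h2]

theorem lintegral_withDensity_ofReal {S : Type*} {mS : MeasurableSpace S} {P : Measure S}
    {q : S → ℝ} (hq : Measurable q) {f : S → ℝ≥0∞} (hf : Measurable f) :
    ∫⁻ ω, f ω ∂(P.withDensity fun ω => ENNReal.ofReal (q ω)) =
      ∫⁻ ω, ENNReal.ofReal (q ω) * f ω ∂P :=
  lintegral_withDensity_eq_lintegral_mul _ hq.ennreal_ofReal hf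

theorem measurable_ofReal_mul {S : Type*} {mS : MeasurableSpace S} {q : S → ℝ} (hq : Measurable q)
    {f : S → ℝ≥0∞} (hf : Measurable f) : Measurable fun ω => ENNReal.ofReal (q ω) * f ω :=
  hq.ennreal_ofReal.mul hf

theorem mem_ProbACAt_of_condExp_dens {S : Type*} {mt mS : MeasurableSpace S} {P Q : Measure S}
    [IsProbabilityMeasure P] (hm : mt ≤ mS) (hQ : Q ∈ ProbAC P)
    (h : condExp mt P (dens P Q) =ᵐ[P] fun _ => 1) : Q ∈ ProbACAt mt P := by
  have := hQ.1
  have h1 := withDensity_mem_ProbACAt hm integrable_dens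
    (Filter.Eventually.of_forall (dens_nonneg (P := P) Q)) h
  rwa [withDensity_dens hQ.2] at h1

variable {Ω : Type*} {m0 : MeasurableSpace Ω} {P : Measure Ω} {T d m : ℕ}
  {F : Filtration (Fin (T + 1)) m0} {t s : Fin (T + 1)} {μ : Fin (T + 1) → Ω → ℝ}

theorem optFilt_mono (h : s ≤ t) : optFilt F s ≤ optFilt F t := by
  intro B hB
  obtain ⟨h1, h2⟩ := measurableSet_optFilt_iff.1 hB
  refine measurableSet_optFilt_iff.2 ⟨fun r hr => ?_, fun r hr ω => ?_⟩
  · rcases le_total r s with hrs | hrs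
    · exact h1 r hrs
    · have : {ω | (ω, r) ∈ B} = {ω | (ω, s) ∈ B} := by
        ext ω; exact h2 r hrs ω
      rw [this]
      exact F.mono hrs _ (h1 s le_rfl)
  · rw [h2 r (h.trans hr), h2 t h]

theorem OptRandomMeas.le_one {ψ : Fin (T + 1) → Ω → ℝ} (hψ : ψ ∈ OptRandomMeas P F) :
    ∀ᵐ ω ∂P, ∀ s, |ψ s ω| ≤ 1 := by
  filter_upwards [hψ.2] with ω h s
  rw [abs_of_nonneg (h.1 s), ← h.2]
  exact Finset.single_le_sum (fun r _ => h.1 r) (Finset.mem_univ s)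

variable {Q : Measure Ω} {ψ : Fin (T + 1) → Ω → ℝ}

/-- The density with respect to the reference measure of the measure `Q ⊗ ψ`. -/
theorem tensor_eq_withDensity [IsProbabilityMeasure P]
    (hμ : IsReference P F μ) (hQ : Q ∈ ProbAC P) (hψ : ψ ∈ OptRandomMeas P F) :
    tensor F Q ψ = (tensor F P μ).withDensity fun x =>
      ENNReal.ofReal (ψ x.2 x.1 * condExp (F x.2) P (dens P Q) x.1 / μ x.2 x.1) := by
  have := hQ.1
  have hψm : ∀ s, Measurable (ψ s) := fun s => (hψ.1 s).mono (F.le s) le_rfl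
  have hD : Measurable[optSigma F] (fun x : Ω × Fin (T + 1) =>
      ψ x.2 x.1 * condExp (F x.2) P (dens P Q) x.1 / μ x.2 x.1) :=
    measurable_optSigma_iff.2 fun s =>
      ((hψ.1 s).mul stronglyMeasurable_condExp.measurable).div (hμ.1 s)
  refine @Measure.ext _ (optSigma F) _ _ fun B hB => ?_
  rw [measure_eq_lintegral_indicator hB, measure_eq_lintegral_indicator hB,
    lintegral_tensor hψm (measurable_indicator_one hB),
    lintegral_withDensity_ofReal hD (measurable_indicator_one hB),
    lintegral_tensor hμ.measurable (measurable_ofReal_mul hD (measurable_indicator_one hB))]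
  refine Finset.sum_congr rfl fun s _ => ?_
  have hBs : Measurable[F s] fun ω => B.indicator (1 : Ω × Fin (T + 1) → ℝ≥0∞) (ω, s) :=
    measurable_optSigma_iff.1 (measurable_indicator_one hB) s
  have hk : Measurable[F s] fun ω => ENNReal.ofReal (ψ s ω) * B.indicator 1 (ω, s) :=
    (hψ.1 s).ennreal_ofReal.mul hBs
  conv_lhs => rw [← withDensity_dens hQ.2]
  rw [lintegral_withDensity_ofReal measurable_dens (hk.mono (F.le s) le_rfl)]
  refine (lintegral_mul_ofReal_condExp (F.le s) hk integrable_dens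
    (Filter.Eventually.of_forall (dens_nonneg Q))).trans ?_
  refine lintegral_congr_ae ?_
  filter_upwards [hμ.pos, hψ.2, condExp_nonneg (m := F s)
    (Filter.Eventually.of_forall (dens_nonneg (P := P) Q))] with ω h1 h2 h3
  have hp := (h1 s).ne'
  rw [← mul_assoc, ← mul_assoc, ← ENNReal.ofReal_mul h3, ← ENNReal.ofReal_mul (h1 s).le]
  congr 2
  field_simp

theorem dens_tensor [IsProbabilityMeasure P]
    (hF0 : ∀ A : Set Ω, MeasurableSet[F 0] A ↔ P A = 0 ∨ P Aᶜ = 0)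
    (hμ : IsReference P F μ) (hQ : Q ∈ ProbAC P) (hψ : ψ ∈ OptRandomMeas P F) (s : Fin (T + 1)) :
    ∀ᵐ ω ∂P, μ s ω * dens (tensor F P μ) (tensor F Q ψ) (ω, s) =
      ψ s ω * condExp (F s) P (dens P Q) ω := by
  have := isProbabilityMeasure_tensor hμ
  have hD : Measurable[optSigma F] (fun x : Ω × Fin (T + 1) =>
      ψ x.2 x.1 * condExp (F x.2) P (dens P Q) x.1 / μ x.2 x.1) :=
    measurable_optSigma_iff.2 fun s =>
      ((hψ.1 s).mul stronglyMeasurable_condExp.measurable).div (hμ.1 s)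
  have hD0 : 0 ≤ᵐ[tensor F P μ] (fun x : Ω × Fin (T + 1) =>
      ψ x.2 x.1 * condExp (F x.2) P (dens P Q) x.1 / μ x.2 x.1) := by
    refine (ae_tensor_iff hF0 hμ).2 fun s => ?_
    filter_upwards [hμ.pos, hψ.2, condExp_nonneg (m := F s)
      (Filter.Eventually.of_forall (dens_nonneg (P := P) Q))] with ω h1 h2 h3
    exact div_nonneg (mul_nonneg (h2.1 s) h3) (h1 s).le
  have h := dens_withDensity_of_measurable hD hD0
  rw [← tensor_eq_withDensity hμ hQ hψ] at h
  filter_upwards [(ae_tensor_iff hF0 hμ).1 h s, hμ.pos] with ω h1 h2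
  rw [h1, mul_div_cancel₀ _ (h2 s).ne']

theorem mul_condExp_dens [IsProbabilityMeasure P] (hQ : Q ∈ ProbAC P)
    (hψ : ψ ∈ OptRandomMeas P F) (s : Fin (T + 1)) :
    Integrable (fun ω => ψ s ω * dens P Q ω) P ∧
    condExp (F s) P (fun ω => ψ s ω * dens P Q ω) =ᵐ[P]
      fun ω => ψ s ω * condExp (F s) P (dens P Q) ω := by
  have := hQ.1
  have h1 : Integrable (fun ω => ψ s ω * dens P Q ω) P := by
    simp only [mul_comm (ψ s _)]
    exact integrable_mul_of_bounded integrable_dens ((hψ.1 s).mono (F.le s) le_rfl)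
      ((OptRandomMeas.le_one hψ).mono fun ω h => h s)
  exact ⟨h1, condExp_mul_of_stronglyMeasurable_left (hψ.1 s).stronglyMeasurable h1 integrable_dens⟩

theorem condExp_sum_mul_dens [IsProbabilityMeasure P] (hQ : Q ∈ ProbAC P)
    (hψ : ψ ∈ OptRandomMeas P F) (s : Fin (T + 1)) :
    condExp (F s) P (fun ω => ∑ r ∈ Finset.Ici s, ψ r ω * condExp (F r) P (dens P Q) ω) =ᵐ[P]
      fun ω => (1 - ∑ r ∈ Finset.Iio s, ψ r ω) * condExp (F s) P (dens P Q) ω := by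
  have := hQ.1
  have e0 : (fun ω => ∑ r ∈ Finset.Ici s, ψ r ω * condExp (F r) P (dens P Q) ω) =ᵐ[P]
      ∑ r ∈ Finset.Ici s, condExp (F r) P (fun ω => ψ r ω * dens P Q ω) := by
    filter_upwards [ae_all_iff.2 fun r => (mul_condExp_dens hQ hψ r).2] with ω h
    rw [Finset.sum_apply]
    exact Finset.sum_congr rfl fun r _ => (h r).symm
  have e1 := condExp_finsetSum (s := Finset.Ici s)
    (f := fun r => condExp (F r) P (fun ω => ψ r ω * dens P Q ω))
    (fun r _ => integrable_condExp) (F s)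
  have e2 : ∀ᵐ ω ∂P, ∀ r, s ≤ r → condExp (F s) P (condExp (F r) P (fun ω => ψ r ω * dens P Q ω)) ω =
      condExp (F s) P (fun ω => ψ r ω * dens P Q ω) ω := by
    rw [ae_all_iff]
    intro r
    by_cases hr : s ≤ r
    · filter_upwards [condExp_condExp_of_le (f := fun ω => ψ r ω * dens P Q ω) (μ := P)
        (F.mono hr) (F.le r)] with ω h _ using h
    · exact Filter.Eventually.of_forall fun ω h => absurd h hr
  have e3 := condExp_finsetSum (s := Finset.Ici s) (f := fun r ω => ψ r ω * dens P Q ω)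
    (fun r _ => (mul_condExp_dens hQ hψ r).1) (F s)
  have e4 : ∑ r ∈ Finset.Ici s, (fun ω => ψ r ω * dens P Q ω) =ᵐ[P]
      fun ω => (1 - ∑ r ∈ Finset.Iio s, ψ r ω) * dens P Q ω := by
    filter_upwards [hψ.2] with ω h
    rw [Finset.sum_apply, ← Finset.sum_mul, ← h.2, ← sum_Iio_add_sum_Ici (fun r => ψ r ω) s]
    ring
  have hint : Integrable (fun ω => (1 - ∑ r ∈ Finset.Iio s, ψ r ω) * dens P Q ω) P :=
    (integrable_finsetSum' (Finset.Ici s) fun r _ => (mul_condExp_dens hQ hψ r).1).congr e4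
  have e5 := condExp_mul_of_stronglyMeasurable_left (m := F s)
    (measurable_const.sub (measurable_sum_Iio hψ.1 s) :
      Measurable[F s] fun ω => 1 - ∑ r ∈ Finset.Iio s, ψ r ω).stronglyMeasurable hint
    integrable_dens
  filter_upwards [condExp_congr_ae (m := F s) e0, e1, e2, e3, condExp_congr_ae (m := F s) e4, e5]
    with ω a0 a1 a2 a3 a4 a5
  rw [a0, a1, Finset.sum_apply, Finset.sum_congr rfl fun r hr => a2 r (Finset.mem_Ici.1 hr),
    ← Finset.sum_apply, ← a3, a4]
  exact a5

theorem condExp_sum_tensor [IsProbabilityMeasure P]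
    (hF0 : ∀ A : Set Ω, MeasurableSet[F 0] A ↔ P A = 0 ∨ P Aᶜ = 0)
    (hμ : IsReference P F μ) (hQ : Q ∈ ProbAC P) (hψ : ψ ∈ OptRandomMeas P F)
    (hQψ : tensor F Q ψ ∈ ProbACAt (optFilt F t) (tensor F P μ)) (hs : s ≤ t) :
    ∀ᵐ ω ∂P, (1 - ∑ r ∈ Finset.Iio s, ψ r ω) * condExp (F s) P (dens P Q) ω = remMass μ s ω := by
  have := isProbabilityMeasure_tensor hμ
  have := hQψ.1.1
  have h0 : tensor F Q ψ ∈ ProbACAt (optFilt F s) (tensor F P μ) :=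
    ⟨hQψ.1, fun A hA => hQψ.2 A (optFilt_mono hs A hA)⟩
  have h1 := (ae_tensor_iff hF0 hμ).1 (condExp_dens optFilt_le h0) s
  have h2 := condExp_tensor (t := s) hF0 hμ
    (measurable_dens (P := tensor F P μ) (Q := tensor F Q ψ))
    ((integrable_tensor_iff hμ measurable_dens).1 integrable_dens) s
  have h3 : (fun ω => ∑ r ∈ Finset.Ici s, μ r ω * dens (tensor F P μ) (tensor F Q ψ) (ω, r)) =ᵐ[P]
      fun ω => ∑ r ∈ Finset.Ici s, ψ r ω * condExp (F r) P (dens P Q) ω := by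
    filter_upwards [ae_all_iff.2 fun r => dens_tensor hF0 hμ hQ hψ r] with ω h
    exact Finset.sum_congr rfl fun r _ => h r
  filter_upwards [h1, h2, condExp_congr_ae (m := F s) h3, condExp_sum_mul_dens hQ hψ s,
    hμ.remMass_pos s] with ω a1 a2 a3 a4 a5
  rw [a1, if_neg (lt_irrefl s), a3, a4, eq_comm, div_eq_one_iff_eq a5.ne'] at a2
  exact a2

theorem condExp_dens_of_tensor [IsProbabilityMeasure P]
    (hF0 : ∀ A : Set Ω, MeasurableSet[F 0] A ↔ P A = 0 ∨ P Aᶜ = 0)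
    (hμ : IsReference P F μ) (hQ : Q ∈ ProbAC P) (hψ : ψ ∈ OptRandomMeas P F)
    (hQψ : tensor F Q ψ ∈ ProbACAt (optFilt F t) (tensor F P μ)) :
    condExp (F t) P (dens P Q) =ᵐ[P] fun _ => 1 := by
  have h1 : ∀ᵐ ω ∂P, ∀ s ≤ t,
      (1 - ∑ r ∈ Finset.Iio s, ψ r ω) * condExp (F s) P (dens P Q) ω = remMass μ s ω := by
    rw [ae_all_iff]
    intro s
    by_cases hs : s ≤ t
    · filter_upwards [condExp_sum_tensor hF0 hμ hQ hψ hQψ hs] with ω h _ using h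
    · exact Filter.Eventually.of_forall fun ω h => absurd h hs
  have h2 : ∀ᵐ ω ∂P, ∀ s < t, ψ s ω * condExp (F s) P (dens P Q) ω = μ s ω := by
    rw [ae_all_iff]
    intro s
    by_cases hs : s < t
    · filter_upwards [dens_tensor hF0 hμ hQ hψ s, dens_slice_eq_one hF0 hμ hQψ hs] with ω h3 h4 _
      rw [← h3, h4, mul_one]
    · exact Filter.Eventually.of_forall fun ω h => absurd h hs
  filter_upwards [h1, h2, ae_all_iff.2 fun s => hμ.remMass_pos s] with ω a1 a2 a3
  have key : ∀ n : ℕ, ∀ s : Fin (T + 1), (s : ℕ) = n → s ≤ t →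
      condExp (F s) P (dens P Q) ω = 1 := by
    intro n
    induction n using Nat.strong_induction_on with
    | _ n ih =>
      intro s hsn hst
      have hsum : ∑ r ∈ Finset.Iio s, ψ r ω = ∑ r ∈ Finset.Iio s, μ r ω := by
        refine Finset.sum_congr rfl fun r hr => ?_
        have hr := Finset.mem_Iio.1 hr
        have := ih r (hsn ▸ hr) r rfl (hr.le.trans hst)
        have h4 := a2 r (hr.trans_le hst)
        rwa [this, mul_one] at h4
      have h5 := a1 s hst
      rw [hsum] at h5
      exact (mul_eq_left₀ (a3 s).ne').1 h5
  exact key _ t rfl le_rfl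

end MapW

end SetRisk

namespace SetRisk

section MapW

variable {Ω : Type*} {m0 : MeasurableSpace Ω} {P : Measure Ω} {T d m : ℕ}
  {F : Filtration (Fin (T + 1)) m0} {t s : Fin (T + 1)} {μ : Fin (T + 1) → Ω → ℝ}

section Component

variable {Q : Measure Ω} {ψ : Fin (T + 1) → Ω → ℝ}

theorem integrable_mul_xi [IsFiniteMeasure P] (hQ : Q ∈ ProbACAt (F t) P)
    (hψ : ψ ∈ OptRandomMeas P F) (s : Fin (T + 1)) :
    Integrable (fun ω => ψ s ω * xi (F t) (F s) P Q ω) P := by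
  simp only [mul_comm (ψ s _)]
  exact integrable_mul_of_bounded (integrable_xi (F.le t) hQ) ((hψ.1 s).mono (F.le s) le_rfl)
    ((OptRandomMeas.le_one hψ).mono fun ω h => h s)

theorem mul_xi_nonneg (hψ : ψ ∈ OptRandomMeas P F) (s : Fin (T + 1)) :
    0 ≤ᵐ[P] fun ω => ψ s ω * xi (F t) (F s) P Q ω := by
  filter_upwards [hψ.2, xi_nonneg (mt := F t) (ms := F s) (P := P) Q] with ω h1 h2
  exact mul_nonneg (h1.1 s) h2

theorem condQ_optRandomMeas [IsFiniteMeasure P] (hQ : Q ∈ ProbACAt (F t) P)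
    (hψ : ψ ∈ OptRandomMeas P F) (hs : t ≤ s) :
    condQ (F t) P Q (ψ s) =ᵐ[P] condExp (F t) P (fun ω => ψ s ω * xi (F t) (F s) P Q ω) := by
  simp only [mul_comm (ψ s _)]
  exact condQ_ae_eq (F.mono hs) (F.le s) hQ (hψ.1 s)
    ((OptRandomMeas.le_one hψ).mono fun ω h => h s)

theorem condQ_optRandomMeas_bounds [IsFiniteMeasure P] (hQ : Q ∈ ProbACAt (F t) P)
    (hψ : ψ ∈ OptRandomMeas P F) (hs : t ≤ s) :
    ∀ᵐ ω ∂P, 0 ≤ condQ (F t) P Q (ψ s) ω ∧ condQ (F t) P Q (ψ s) ω ≤ 1 := by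
  have h1 := condExp_mono (m := F t) (integrable_mul_xi hQ hψ s)
    (integrable_xi (ms := F s) (F.le t) hQ) (by
      filter_upwards [OptRandomMeas.le_one hψ, xi_nonneg (mt := F t) (ms := F s) (P := P) Q]
        with ω h1 h2
      exact mul_le_of_le_one_left h2 ((le_abs_self _).trans (h1 s)))
  filter_upwards [condQ_optRandomMeas hQ hψ hs, h1, condExp_xi (F.mono hs) (F.le s) hQ,
    condExp_nonneg (m := F t) (mul_xi_nonneg (t := t) (Q := Q) hψ s)] with ω a1 a2 a3 a4
  rw [a1]
  exact ⟨a4, a2.trans a3.le⟩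

theorem condExp_reference_pos [IsProbabilityMeasure P] (hμ : IsReference P F μ) (t s : Fin (T + 1)) :
    ∀ᵐ ω ∂P, 0 < condExp (F t) P (μ s) ω := by
  have hint : Integrable (μ s) P := by
    simpa using hμ.integrable_mul (integrable_const (1 : ℝ)) s
  obtain ⟨-, -, ε, hε, h⟩ := hμ
  have h1 := condExp_mono (m := F t) (integrable_const ε) hint (h.mono fun ω h => (h s).le)
  filter_upwards [h1] with ω h1
  rw [condExp_const (F.le t)] at h1
  exact hε.trans_le h1

/-- A density of the measures of `mapW`. -/
noncomputable def mapWDens (P : Measure Ω) (F : Filtration (Fin (T + 1)) m0)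
    (μ : Fin (T + 1) → Ω → ℝ) (t : Fin (T + 1)) (Q : Measure Ω) (ψ : Fin (T + 1) → Ω → ℝ)
    (s : Fin (T + 1)) : Ω → ℝ :=
  normalize (F t) P (fun ω => ψ s ω * xi (F t) (F s) P Q ω) (normalize (F t) P (μ s) fun _ => 1)

open Classical in
theorem mapWDens_ae_eq [IsProbabilityMeasure P] (hμ : IsReference P F μ)
    (hQ : Q ∈ ProbACAt (F t) P) (hψ : ψ ∈ OptRandomMeas P F) (hs : t ≤ s) :
    ∀ᵐ ω ∂P, (if 0 < condQ (F t) P Q (ψ s) ω then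
        ψ s ω / condQ (F t) P Q (ψ s) ω * xi (F t) (F s) P Q ω
      else μ s ω / condExp (F t) P (μ s) ω) = mapWDens P F μ t Q ψ s ω := by
  filter_upwards [condQ_optRandomMeas hQ hψ hs, condExp_reference_pos hμ t s] with ω h1 h2
  rw [h1, mapWDens, normalize, normalize, if_pos h2]
  split_ifs with h
  · ring
  · rfl

theorem mapWDens_spec [IsProbabilityMeasure P] (hμ : IsReference P F μ)
    (hQ : Q ∈ ProbACAt (F t) P) (hψ : ψ ∈ OptRandomMeas P F) (hs : t ≤ s) :
    Measurable[F s] (mapWDens P F μ t Q ψ s) ∧ Integrable (mapWDens P F μ t Q ψ s) P ∧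
      0 ≤ᵐ[P] mapWDens P F μ t Q ψ s ∧
      condExp (F t) P (mapWDens P F μ t Q ψ s) =ᵐ[P] fun _ => 1 := by
  have hint : Integrable (μ s) P := by
    simpa using hμ.integrable_mul (integrable_const (1 : ℝ)) s
  have hpos : 0 ≤ᵐ[P] μ s := hμ.pos.mono fun ω h => (h s).le
  have h1 := condExp_normalize (F.le t) hint hpos (integrable_const 1) (condExp_one (F.le t))
  have h2 := condExp_normalize (F.le t) (integrable_mul_xi hQ hψ s) (mul_xi_nonneg hψ s) h1.1 h1.2
  exact ⟨measurable_normalize (F.mono hs) ((hψ.1 s).mul (measurable_xi (F.mono hs) Q))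
    (measurable_normalize (F.mono hs) (hμ.1 s) measurable_const), h2.1,
    normalize_nonneg (mul_xi_nonneg hψ s) (normalize_nonneg hpos
      (Filter.Eventually.of_forall fun _ => zero_le_one)), h2.2⟩

theorem condQ_mul_mapWDens [IsProbabilityMeasure P] (hQ : Q ∈ ProbACAt (F t) P)
    (hψ : ψ ∈ OptRandomMeas P F) (hs : t ≤ s) :
    ∀ᵐ ω ∂P, condQ (F t) P Q (ψ s) ω * mapWDens P F μ t Q ψ s ω =
      ψ s ω * xi (F t) (F s) P Q ω := by
  filter_upwards [condQ_optRandomMeas hQ hψ hs, condQ_optRandomMeas_bounds hQ hψ hs,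
    ae_eq_zero_of_condExp_eq_zero (F.le t) (integrable_mul_xi hQ hψ s) (mul_xi_nonneg hψ s)]
    with ω h1 h2 h3
  rw [h1] at h2
  rw [h1, mapWDens, normalize]
  split_ifs with h
  · rw [mul_div_cancel₀ _ h.ne']
  · rw [h3 (not_lt.1 h), le_antisymm (not_lt.1 h) h2.1, zero_mul]

theorem sum_condQ_optRandomMeas [IsProbabilityMeasure P]
    (hF0 : ∀ A : Set Ω, MeasurableSet[F 0] A ↔ P A = 0 ∨ P Aᶜ = 0)
    (hμ : IsReference P F μ) (hQ : Q ∈ ProbACAt (F t) P) (hψ : ψ ∈ OptRandomMeas P F)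
    (hQψ : tensor F Q ψ ∈ ProbACAt (optFilt F t) (tensor F P μ)) :
    ∀ᵐ ω ∂P, ∑ s ∈ Finset.Ici t, condQ (F t) P Q (ψ s) ω = remMass μ t ω := by
  have h1 := condExp_finsetSum (s := Finset.Ici t)
    (fun s _ => integrable_mul_xi hQ hψ s) (F t)
  have h2 : ∑ s ∈ Finset.Ici t, (fun ω => ψ s ω * xi (F t) (F s) P Q ω) =ᵐ[P]
      fun ω => ∑ r ∈ Finset.Ici t, ψ r ω * condExp (F r) P (dens P Q) ω := by
    filter_upwards [ae_all_iff.2 fun s => xi_ae_eq (ms := F s) (F.le t) hQ] with ω h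
    rw [Finset.sum_apply]
    exact Finset.sum_congr rfl fun s _ => by rw [h]
  have h3 : ∀ᵐ ω ∂P, ∀ s, t ≤ s → condQ (F t) P Q (ψ s) ω =
      condExp (F t) P (fun ω => ψ s ω * xi (F t) (F s) P Q ω) ω := by
    rw [ae_all_iff]
    intro s
    by_cases hs : t ≤ s
    · filter_upwards [condQ_optRandomMeas hQ hψ hs] with ω h _ using h
    · exact Filter.Eventually.of_forall fun ω h => absurd h hs
  filter_upwards [h1, condExp_congr_ae (m := F t) h2, h3, condExp_sum_mul_dens hQ.1 hψ t,
    condExp_sum_tensor hF0 hμ hQ.1 hψ hQψ le_rfl] with ω a1 a2 a3 a4 a5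
  rw [Finset.sum_congr rfl fun s hs => a3 s (Finset.mem_Ici.1 hs), ← Finset.sum_apply, ← a1, a2, a4,
    a5]

end Component

variable {Q : Fin d → Measure Ω} {ψ : Fin d → Fin (T + 1) → Ω → ℝ}
  {Qbar : Fin d → @Measure (Ω × Fin (T + 1)) (optSigma F)} {wbar : Ω × Fin (T + 1) → Fin d → ℝ}

theorem mapW_fst_eq [IsProbabilityMeasure P] (hμ : IsReference P F μ)
    (hQ : ∀ i, Q i ∈ ProbACAt (F t) P) (hψ : ∀ i, ψ i ∈ OptRandomMeas P F) (hs : t ≤ s)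
    (i : Fin d) : (mapW P F μ t Q ψ wbar).1 s i =
      P.withDensity fun ω => ENNReal.ofReal (mapWDens P F μ t (Q i) (ψ i) s ω) := by
  refine withDensity_congr_ae ?_
  filter_upwards [mapWDens_ae_eq hμ (hQ i) (hψ i) hs] with ω h
  rw [h]

theorem mul_wts_mapW [IsProbabilityMeasure P]
    (hF0 : ∀ A : Set Ω, MeasurableSet[F 0] A ↔ P A = 0 ∨ P Aᶜ = 0) (hμ : IsReference P F μ)
    (hw : (Qbar, wbar) ∈ dualVec (optFilt F t) (tensor F P μ) m)
    (hQ : ∀ i, Q i ∈ ProbACAt (F t) P) (hψ : ∀ i, ψ i ∈ OptRandomMeas P F)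
    (hQψ : ∀ i, Qbar i = tensor F (Q i) (ψ i)) (hs : t ≤ s) :
    ∀ᵐ ω ∂P, ∀ i, μ s ω * wts (optFilt F t) (optSigma F) (tensor F P μ) Qbar wbar (ω, s) i =
        remMass μ t ω * wts (F t) (F s) P ((mapW P F μ t Q ψ wbar).1 s)
          ((mapW P F μ t Q ψ wbar).2 s) ω i := by
  rw [ae_all_iff]
  intro i
  have hd := dens_tensor hF0 hμ (hQ i).1 (hψ i) s
  rw [← hQψ i] at hd
  obtain ⟨g1, g2, g3, g4⟩ := mapWDens_spec hμ (hQ i) (hψ i) hs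
  have hx := xi_withDensity (F.mono hs) (F.le s) g1 g2 g3 g4
  rw [← mapW_fst_eq (wbar := wbar) hμ hQ hψ hs i] at hx
  have hc : wbar ∈ LOne (optFilt F t) (tensor F P μ) := hw.2.1.1.1
  filter_upwards [wts_optional_slice hF0 hμ hw.1 wbar s, hd, hx, hμ.remMass_pos t,
    condQ_mul_mapWDens (μ := μ) (hQ i) (hψ i) hs, xi_ae_eq (ms := F s) (F.le t) (hQ i)]
    with ω a1 a2 a3 a4 a5 a6
  have e1 : wbar (ω, s) i = wbar (ω, t) i :=
    congrFun (congrFun (((mem_LOne_optFilt hμ).1 hc).2 s hs) ω) i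
  have e2 : (mapW P F μ t Q ψ wbar).2 s ω i =
      condQ (F t) P (Q i) (ψ i s) ω / remMass μ t ω * wbar (ω, t) i := rfl
  have hne := a4.ne'
  rw [a1, e1, wts, a3, e2]
  calc μ s ω * (wbar (ω, t) i * dens (tensor F P μ) (Qbar i) (ω, s))
      = wbar (ω, t) i * (μ s ω * dens (tensor F P μ) (Qbar i) (ω, s)) := by ring
    _ = wbar (ω, t) i *
        (condQ (F t) P (Q i) (ψ i s) ω * mapWDens P F μ t (Q i) (ψ i) s ω) := by
      rw [a2, a5, a6]
    _ = _ := by field_simp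

theorem dualVec_optional_nonneg [IsProbabilityMeasure P] (hμ : IsReference P F μ)
    (hw : (Qbar, wbar) ∈ dualVec (optFilt F t) (tensor F P μ) m) :
    ∀ᵐ x ∂(tensor F P μ), ∀ i, 0 ≤ wbar x i := by
  have := isProbabilityMeasure_tensor hμ
  exact nonneg_of_wts_nonneg optFilt_le le_rfl hw.1 hw.2.1.1.1.1 hw.2.2

theorem mapW_mem_dualProcCone [IsProbabilityMeasure P]
    (hF0 : ∀ A : Set Ω, MeasurableSet[F 0] A ↔ P A = 0 ∨ P Aᶜ = 0) (hμ : IsReference P F μ)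
    (hw : (Qbar, wbar) ∈ dualVec (optFilt F t) (tensor F P μ) m)
    (hQ : ∀ i, Q i ∈ ProbACAt (F t) P) (hψ : ∀ i, ψ i ∈ OptRandomMeas P F)
    (hQψ : ∀ i, Qbar i = tensor F (Q i) (ψ i)) :
    mapW P F μ t Q ψ wbar ∈ dualProcCone P F m t := by
  intro s hs
  have hwt := ((mem_LOne_optFilt hμ).1 hw.2.1.1.1).1 t le_rfl
  have hw0 := (ae_tensor_iff hF0 hμ).1 (dualVec_optional_nonneg hμ hw) t
  have hwL : (mapW P F μ t Q ψ wbar).2 s ∈ LOne (F t) P := by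
    have h1 : (fun ω i => condQ (F t) P (Q i) (ψ i s) ω * slice t wbar ω i) ∈ LOne (F t) P := by
      refine mem_LOne_iff.2 ⟨measurable_of_apply fun i => Measurable.mul
        stronglyMeasurable_condExp.measurable (measurable_apply hwt.1 i), fun i => ?_⟩
      simp only [mul_comm (condQ _ _ _ _ _)]
      refine integrable_mul_of_bounded (C := 1) ((mem_LOne_iff.1 hwt).2 i)
        (stronglyMeasurable_condExp.measurable.mono (F.le t) le_rfl) ?_
      filter_upwards [condQ_optRandomMeas_bounds (hQ i) (hψ i) hs] with ω h
      rw [abs_of_nonneg h.1]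
      exact h.2
    convert hμ.div_remMass_mem_LOne h1 using 1
    ext ω i
    exact (mul_div_right_comm _ _ _).symm
  refine ⟨fun i => ?_, mem_EligPosDual_of_nonneg hwL ?_, ?_⟩
  · obtain ⟨g1, g2, g3, g4⟩ := mapWDens_spec hμ (hQ i) (hψ i) hs
    rw [mapW_fst_eq hμ hQ hψ hs i]
    exact withDensity_mem_ProbACAt (F.le t) g2 g3 g4
  · filter_upwards [hw0, hμ.remMass_pos t,
      ae_all_iff.2 fun i => condQ_optRandomMeas_bounds (hQ i) (hψ i) hs] with ω a1 a2 a3 i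
    exact mul_nonneg (div_nonneg (a3 i).1 a2.le) (a1 i)
  · have hbar := (mem_LOnePos_optSigma hF0 hμ).1 hw.2.2 s
    have hL := hμ.mul_mem_LOne hbar.1
    have hL2 : (fun ω i => μ s ω * slice s (wts (optFilt F t) (optSigma F) (tensor F P μ)
        Qbar wbar) ω i / remMass μ t ω) ∈ LOnePos (F s) P := by
      refine ⟨mem_LOne_iff.2 ⟨measurable_of_apply fun i => (measurable_apply hL.1 i).div
        (hμ.measurable_remMass.mono (F.mono hs) le_rfl), fun i =>
        hμ.integrable_div_remMass ((mem_LOne_iff.1 hL).2 i)⟩, ?_⟩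
      filter_upwards [hbar.2, hμ.pos, hμ.remMass_pos t] with ω a1 a2 a3 i
      exact div_nonneg (mul_nonneg (a2 s).le (a1 i)) a3.le
    refine LOnePos_congr hL2 (measurable_wts (F.mono hs) hwL.1) ?_
    filter_upwards [mul_wts_mapW hF0 hμ hw hQ hψ hQψ hs, hμ.remMass_pos t] with ω a1 a2
    ext i
    rw [slice, a1 i, mul_div_cancel_left₀ _ a2.ne']

theorem mapW_mem_dualProc [IsProbabilityMeasure P]
    (hF0 : ∀ A : Set Ω, MeasurableSet[F 0] A ↔ P A = 0 ∨ P Aᶜ = 0) (hμ : IsReference P F μ)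
    (hw : (Qbar, wbar) ∈ dualVec (optFilt F t) (tensor F P μ) m)
    (hQ : ∀ i, Q i ∈ ProbACAt (F t) P) (hψ : ∀ i, ψ i ∈ OptRandomMeas P F)
    (hQψ : ∀ i, Qbar i = tensor F (Q i) (ψ i)) (hwt : slice t wbar ∉ EligPerp (F t) P m) :
    mapW P F μ t Q ψ wbar ∈ dualProc P F m t := by
  have hp := mapW_mem_dualProcCone hF0 hμ hw hQ hψ hQψ
  have hwL := ((mem_LOne_optFilt hμ).1 hw.2.1.1.1).1 t le_rfl
  have hw0 := (ae_tensor_iff hF0 hμ).1 (dualVec_optional_nonneg hμ hw) t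
  have hae : ∑ s ∈ Finset.Ici t, (mapW P F μ t Q ψ wbar).2 s =ᵐ[P] slice t wbar := by
    filter_upwards [ae_all_iff.2 fun i => sum_condQ_optRandomMeas hF0 hμ (hQ i) (hψ i)
      (hQψ i ▸ hw.1 i), hμ.remMass_pos t] with ω a1 a2
    ext i
    rw [Finset.sum_apply, Finset.sum_apply]
    change ∑ s ∈ Finset.Ici t, condQ (F t) P (Q i) (ψ i s) ω / remMass μ t ω * wbar (ω, t) i = _
    rw [← Finset.sum_mul, ← Finset.sum_div, a1 i, div_self a2.ne', one_mul]
    rfl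
  refine ⟨hp, fun h => hwt ?_⟩
  have hpos := LOnePos_congr ⟨hwL, hw0⟩ (sum_mem_LOne hp).1 hae
  rw [mem_EligPerp_iff (F.le t) hpos.1 hpos.2] at h
  rw [mem_EligPerp_iff (F.le t) hwL hw0]
  filter_upwards [h, hae] with ω h1 h2
  rwa [← h2]

theorem penVec_toOptional [IsProbabilityMeasure P]
    (hF0 : ∀ A : Set Ω, MeasurableSet[F 0] A ↔ P A = 0 ∨ P Aᶜ = 0) (hμ : IsReference P F μ)
    {ρ : (Fin (T + 1) → Ω → Fin d → ℝ) → Set (Ω → Fin d → ℝ)}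
    {R : Fin (T + 1) → (Ω → Fin d → ℝ) → Set (Ω → Fin d → ℝ)}
    (hρ : IsClosedConvexProcessRM P F m t ρ)
    (hR : ∀ s < t, IsClosedConvexVectorRM (F s) (F s) P m (R s))
    (hw : (Qbar, wbar) ∈ dualVec (optFilt F t) (tensor F P μ) m)
    (hQ : ∀ i, Q i ∈ ProbACAt (F t) P) (hψ : ∀ i, ψ i ∈ OptRandomMeas P F)
    (hQψ : ∀ i, Qbar i = tensor F (Q i) (ψ i)) :
    penVec (optFilt F t) (tensor F P μ) m (toOptional t ρ R) (Qbar, wbar) =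
      pasteSets t (fun s => penRes (F s) P m (R s) (slice s wbar))
        (penProc P F m t ρ (mapW P F μ t Q ψ wbar)) :=
  penVec_toOptional_eq hF0 hμ hρ hR fun _ hY =>
    halfSp_optional_eq hF0 hμ hw.1 hw.2.1.1.1.1 hw.2.2.1
      (mapW_mem_dualProcCone hF0 hμ hw hQ hψ hQψ) (fun _ hs => mul_wts_mapW hF0 hμ hw hQ hψ hQψ hs) hY

end MapW

end SetRisk

namespace SetRisk

section Decomposition

variable {Ω : Type*} {m0 : MeasurableSpace Ω} {P : Measure Ω}

theorem sum_prod_one_sub_mul (k : ℕ → ℝ) (n : ℕ) :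
    ∑ j ∈ Finset.range n, (∏ r ∈ Finset.range j, (1 - k r)) * k j =
      1 - ∏ r ∈ Finset.range n, (1 - k r) := by
  induction n with
  | zero => simp
  | succ n ih =>
    rw [Finset.sum_range_succ, ih, Finset.prod_range_succ]
    ring

theorem condExp_mul_normalize {mt : MeasurableSpace Ω} (hm : mt ≤ m0) [IsFiniteMeasure P]
    {f r : Ω → ℝ} (hf : Integrable f P) (hf0 : 0 ≤ᵐ[P] f) :
    ∀ᵐ ω ∂P, condExp mt P f ω * normalize mt P f r ω = f ω := by
  filter_upwards [ae_eq_zero_of_condExp_eq_zero hm hf hf0, condExp_nonneg (m := mt) hf0] with ω h1 h2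
  rw [normalize]
  split_ifs with h
  · rw [mul_div_cancel₀ _ h.ne']
  · rw [h1 (not_lt.1 h), le_antisymm (not_lt.1 h) h2, zero_mul]

/-- The multiplicative decomposition of an adapted nonnegative process into a martingale and a
process with sum one. -/
theorem exists_multiplicative_decomposition [IsProbabilityMeasure P] (G : Filtration ℕ m0) (T : ℕ)
    {a : ℕ → Ω → ℝ} (ham : ∀ n, Measurable[G n] (a n)) (ha0 : ∀ n, 0 ≤ᵐ[P] a n)
    (hai : ∀ n, Integrable (a n) P) :
    ∃ N ψ : ℕ → Ω → ℝ, Martingale N G P ∧ (∀ n, 0 ≤ᵐ[P] N n) ∧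
      ∫ ω, N 0 ω ∂P = ∫ ω, ∑ n ∈ Finset.range (T + 1), a n ω ∂P ∧
      (∀ n, Measurable[G n] (ψ n)) ∧
      ∀ᵐ ω ∂P, (∀ n ≤ T, 0 ≤ ψ n ω) ∧ ∑ n ∈ Finset.range (T + 1), ψ n ω = 1 ∧
        ∀ n ≤ T, ψ n ω * N n ω = a n ω := by
  classical
  set A : ℕ → Ω → ℝ := fun n => ∑ r ∈ Finset.Ico n (T + 1), a r with hA
  set U : ℕ → Ω → ℝ := fun n => condExp (G n) P (A n) with hU
  have hAi : ∀ n, Integrable (A n) P := fun n => integrable_finsetSum' _ fun r _ => hai r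
  have hA0 : ∀ n, 0 ≤ᵐ[P] A n := fun n => by
    filter_upwards [ae_all_iff.2 ha0] with ω h
    simp only [hA, Finset.sum_apply]
    exact Finset.sum_nonneg fun r _ => h r
  have hUm : ∀ n, Measurable[G n] (U n) := fun n => stronglyMeasurable_condExp.measurable
  have hUi : ∀ n, Integrable (U n) P := fun n => integrable_condExp
  have hU0 : ∀ n, 0 ≤ᵐ[P] U n := fun n => condExp_nonneg (hA0 n)
  set V : ℕ → Ω → ℝ := fun n => condExp (G n) P (U (n + 1)) with hV
  have hV0 : ∀ n, 0 ≤ᵐ[P] V n := fun n => condExp_nonneg (hU0 (n + 1))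
  have hUV : ∀ n ≤ T, ∀ᵐ ω ∂P, U n ω = a n ω + V n ω := by
    intro n hn
    have h1 : A n = a n + A (n + 1) := by
      simp only [hA]
      exact Finset.sum_eq_sum_Ico_succ_bot (Nat.lt_succ_of_le hn) a
    have h2 := condExp_add (hai n) (hAi (n + 1)) (G n)
    have h3 : condExp (G n) P (a n) = a n :=
      condExp_of_stronglyMeasurable (G.le n) (ham n).stronglyMeasurable (hai n)
    have h4 := condExp_condExp_of_le (f := A (n + 1)) (μ := P) (G.mono n.le_succ) (G.le (n + 1))
    filter_upwards [h2, h4] with ω a1 a2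
    simp only [hU, hV, h1] at a1 a2 ⊢
    rw [a1, Pi.add_apply, h3, ← a2]
  have hVT : V T = 0 := by
    have h1 : A (T + 1) = 0 := by simp [hA]
    simp only [hV, hU, h1, condExp_zero]
  set k : ℕ → Ω → ℝ := fun n ω => if U n ω = 0 then 1 else a n ω / U n ω with hk
  have hkm : ∀ n, Measurable[G n] (k n) := fun n =>
    Measurable.ite (hUm n (measurableSet_singleton 0)) measurable_const ((ham n).div (hUm n))
  set ν : ℕ → Ω → ℝ := fun n => normalize (G n) P (U (n + 1)) fun _ => 1 with hν
  have hνm : ∀ n, Measurable[G (n + 1)] (ν n) := fun n =>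
    measurable_normalize (G.mono n.le_succ) (hUm (n + 1)) measurable_const
  have hν0 : ∀ n, 0 ≤ᵐ[P] ν n := fun n =>
    normalize_nonneg (hU0 (n + 1)) (Filter.Eventually.of_forall fun _ => zero_le_one)
  have hν1 : ∀ n, Integrable (ν n) P ∧ condExp (G n) P (ν n) =ᵐ[P] fun _ => 1 := fun n =>
    condExp_normalize (G.le n) (hUi (n + 1)) (hU0 (n + 1)) (integrable_const 1)
      (condExp_one (G.le n))
  set N : ℕ → Ω → ℝ := fun n ω => U 0 ω * ∏ r ∈ Finset.range n, ν r ω with hN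
  have hNs : ∀ n, N (n + 1) = fun ω => N n ω * ν n ω := fun n => by
    ext ω
    simp only [hN, Finset.prod_range_succ, mul_assoc]
  have hNm : ∀ n, Measurable[G n] (N n) := by
    intro n
    refine ((hUm 0).mono (G.mono n.zero_le) le_rfl).mul (Finset.measurable_fun_prod _ fun r hr => ?_)
    exact (hνm r).mono (G.mono (Finset.mem_range.1 hr)) le_rfl
  have hN0 : ∀ n, 0 ≤ᵐ[P] N n := fun n => by
    filter_upwards [hU0 0, ae_all_iff.2 hν0] with ω h1 h2
    exact mul_nonneg h1 (Finset.prod_nonneg fun r _ => h2 r)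
  have hstep : ∀ n, Integrable (N n) P → Integrable (N (n + 1)) P ∧
      condExp (G n) P (N (n + 1)) =ᵐ[P] N n := by
    intro n hn
    have h1 : (fun ω => N n ω * condExp (G n) P (ν n) ω) =ᵐ[P] N n := by
      filter_upwards [(hν1 n).2] with ω h
      rw [h, mul_one]
    have h2 := condExp_mul_of_nonneg (G.le n) (hNm n) (hN0 n) (hν1 n).1 (hν0 n) (hn.congr h1.symm)
    rw [hNs]
    exact ⟨h2.1, h2.2.trans h1⟩
  have hNi : ∀ n, Integrable (N n) P := by
    intro n
    induction n with
    | zero => simpa [hN] using hUi 0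
    | succ n ih => exact (hstep n ih).1
  refine ⟨N, fun n ω => (∏ r ∈ Finset.range n, (1 - k r ω)) * k n ω,
    martingale_nat (fun n => (hNm n).stronglyMeasurable) hNi fun n => (hstep n (hNi n)).2.symm,
    hN0, ?_, fun n => ?_, ?_⟩
  · simp only [hN, Finset.range_zero, Finset.prod_empty, mul_one, hU]
    rw [integral_condExp (G.le 0)]
    simp [hA]
  · refine Measurable.mul (Finset.measurable_fun_prod _ fun r hr => ?_) (hkm n)
    exact measurable_const.sub ((hkm r).mono (G.mono (Finset.mem_range.1 hr).le) le_rfl)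
  · have hUV' : ∀ᵐ ω ∂P, ∀ n ≤ T, U n ω = a n ω + V n ω := by
      rw [ae_all_iff]
      intro n
      by_cases hn : n ≤ T
      · filter_upwards [hUV n hn] with ω h _ using h
      · exact Filter.Eventually.of_forall fun ω h => absurd h hn
    filter_upwards [hUV', ae_all_iff.2 ha0, ae_all_iff.2 hV0,
      ae_all_iff.2 fun n => condExp_mul_normalize (r := fun _ => 1) (G.le n) (hUi (n + 1))
        (hU0 (n + 1))] with ω h1 h2 h3 h4
    have h2' : ∀ n, 0 ≤ a n ω := h2
    have h3' : ∀ n, 0 ≤ V n ω := h3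
    have h4' : ∀ n, V n ω * ν n ω = U (n + 1) ω := h4
    have hUk : ∀ n ≤ T, U n ω * k n ω = a n ω := by
      intro n hn
      simp only [hk]
      split_ifs with h
      · have := h1 n hn
        linarith [h2' n, h3' n]
      · rw [mul_div_cancel₀ _ h]
    have hk01 : ∀ n ≤ T, 0 ≤ k n ω ∧ k n ω ≤ 1 := by
      intro n hn
      simp only [hk]
      split_ifs with h
      · exact ⟨zero_le_one, le_rfl⟩
      · have h5 := h1 n hn
        have h6 : 0 < U n ω := lt_of_le_of_ne (by linarith [h2' n, h3' n]) (Ne.symm h)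
        exact ⟨div_nonneg (h2' n) h6.le, (div_le_one h6).2 (by linarith [h3' n])⟩
    have hkT : k T ω = 1 := by
      have h5 := h1 T le_rfl
      rw [hVT, Pi.zero_apply, add_zero] at h5
      simp only [hk]
      split_ifs with h
      · rfl
      · rw [← h5, div_self h]
    have hGN : ∀ n ≤ T, (∏ r ∈ Finset.range n, (1 - k r ω)) * N n ω = U n ω := by
      intro n
      induction n with
      | zero => simp [hN]
      | succ n ih =>
        intro hn
        have h5 := ih (by omega)
        have h6 := hUk n (by omega)
        have h7 := h1 n (by omega)
        rw [Finset.prod_range_succ, hNs, ← h4' n]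
        have h8 : V n ω = U n ω * (1 - k n ω) := by linarith
        rw [h8, ← h5]
        ring
    refine ⟨fun n hn => mul_nonneg (Finset.prod_nonneg fun r hr => ?_) (hk01 n hn).1, ?_,
      fun n hn => ?_⟩
    · have := Finset.mem_range.1 hr
      linarith [(hk01 r (by omega)).2]
    · rw [sum_prod_one_sub_mul fun n => k n ω, Finset.prod_range_succ, hkT]
      ring
    · rw [mul_right_comm, hGN n hn, hUk n hn]

/-- The extension to natural times of a filtration with finitely many times. -/
def natFiltration {T : ℕ} (F : Filtration (Fin (T + 1)) m0) : Filtration ℕ m0 where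
  seq n := F ⟨min n T, by omega⟩
  mono' i j h := F.mono (Fin.mk_le_mk.2 (min_le_min_right T h))
  le' _ := F.le _

theorem natFiltration_val {T : ℕ} (F : Filtration (Fin (T + 1)) m0) (s : Fin (T + 1)) :
    natFiltration F (s : ℕ) = F s := by
  change F _ = F s
  congr 1
  ext
  exact min_eq_left (Nat.lt_succ_iff.1 s.2)

/-- Every absolutely continuous probability measure on the optional space is of the form
`Q ⊗ ψ`. -/
theorem exists_tensor_eq [IsProbabilityMeasure P] {T : ℕ} {F : Filtration (Fin (T + 1)) m0}
    {μ : Fin (T + 1) → Ω → ℝ}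
    (hF0 : ∀ A : Set Ω, MeasurableSet[F 0] A ↔ P A = 0 ∨ P Aᶜ = 0) (hμ : IsReference P F μ)
    {Qbar : @Measure (Ω × Fin (T + 1)) (optSigma F)} (hQ : Qbar ∈ ProbAC (tensor F P μ)) :
    ∃ Q ∈ ProbAC P, ∃ ψ ∈ OptRandomMeas P F, Qbar = tensor F Q ψ := by
  have := isProbabilityMeasure_tensor hμ
  have := hQ.1
  set D : Ω × Fin (T + 1) → ℝ := dens (tensor F P μ) Qbar with hD
  have hDm : Measurable[optSigma F] D := measurable_dens
  have hDi := (integrable_tensor_iff hμ hDm).1 integrable_dens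
  set e : ℕ → Fin (T + 1) := fun n => ⟨min n T, by omega⟩ with he
  have hes : ∀ s : Fin (T + 1), e (s : ℕ) = s := fun s => by
    ext
    exact min_eq_left (Nat.lt_succ_iff.1 s.2)
  have hsum : ∀ f : Fin (T + 1) → ℝ, ∑ n ∈ Finset.range (T + 1), f (e n) = ∑ s, f s := by
    intro f
    rw [Finset.sum_range fun n => f (e n)]
    exact Finset.sum_congr rfl fun s _ => by rw [hes]
  obtain ⟨N, ψ, hN, hN0, hN1, hψm, hψ⟩ := exists_multiplicative_decomposition (P := P)
    (natFiltration F) T (a := fun n ω => μ (e n) ω * D (ω, e n))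
    (fun n => (hμ.1 (e n)).mul (measurable_optSigma_iff.1 hDm (e n)))
    (fun n => by
      filter_upwards [hμ.pos] with ω h
      exact mul_nonneg (h _).le (dens_nonneg _ _))
    (fun n => hμ.integrable_mul (hDi (e n)) (e n))
  have hint1 : ∫ ω, N T ω ∂P = 1 := by
    have h1 : ∫ ω, N T ω ∂P = ∫ ω, N 0 ω ∂P := by
      rw [← integral_condExp ((natFiltration F).le 0) (f := N T)]
      exact integral_congr_ae (hN.condExp_ae_eq (Nat.zero_le T))
    have h2 : ∫ ω, ∑ n ∈ Finset.range (T + 1), μ (e n) ω * D (ω, e n) ∂P =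
        ∫ x, D x ∂(tensor F P μ) := by
      rw [integral_tensor hμ hDm hDi, ← integral_finsetSum _ fun s _ => hμ.integrable_mul (hDi s) s]
      refine integral_congr_ae (Filter.Eventually.of_forall fun ω => ?_)
      exact hsum fun s => μ s ω * D (ω, s)
    have h3 : ∫ x, D x ∂(tensor F P μ) = 1 := by
      rw [hD]
      refine (Measure.integral_toReal_rnDeriv hQ.2).trans ?_
      simp
    rw [h1, hN1, h2, h3]
  have hNi := hN.integrable T
  have hNT := dens_withDensity hNi (hN0 T)
  set Q := P.withDensity fun ω => ENNReal.ofReal (N T ω) with hQdef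
  have hQ' : Q ∈ ProbAC P := by
    refine ⟨⟨?_⟩, withDensity_absolutelyContinuous _ _⟩
    rw [hQdef, withDensity_apply _ MeasurableSet.univ, Measure.restrict_univ,
      ← ofReal_integral_eq_lintegral_ofReal hNi (hN0 T), hint1, ENNReal.ofReal_one]
  have hψ' : (fun s : Fin (T + 1) => ψ s) ∈ OptRandomMeas P F := by
    refine ⟨fun s => natFiltration_val F s ▸ hψm s, ?_⟩
    filter_upwards [hψ] with ω h
    refine ⟨fun s => h.1 s (Nat.lt_succ_iff.1 s.2), ?_⟩
    rw [← h.2.1, Finset.sum_range fun n => ψ n ω]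
  refine ⟨Q, hQ', fun s => ψ s, hψ', ?_⟩
  rw [tensor_eq_withDensity hμ hQ' hψ', ← withDensity_dens hQ.2]
  refine withDensity_congr_ae ((ae_tensor_iff hF0 hμ).2 fun s => ?_)
  have h1 := hN.condExp_ae_eq (Nat.lt_succ_iff.1 s.2)
  rw [natFiltration_val F s] at h1
  filter_upwards [h1, condExp_congr_ae (m := F s) hNT, hψ, hμ.pos] with ω a1 a2 a3 a4
  have h5 := a3.2.2 s (Nat.lt_succ_iff.1 s.2)
  rw [hes] at h5
  rw [a2, a1, h5, mul_div_cancel_left₀ _ (a4 s).ne']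

end Decomposition

end SetRisk

namespace SetRisk

section ProcessDuality

variable {Ω : Type*} {m0 : MeasurableSpace Ω} {P : Measure Ω} {T d m : ℕ}
  {F : Filtration (Fin (T + 1)) m0} {t : Fin (T + 1)} {μ : Fin (T + 1) → Ω → ℝ}

theorem measure_section_ne_zero
    (hF0 : ∀ A : Set Ω, MeasurableSet[F 0] A ↔ P A = 0 ∨ P Aᶜ = 0) (hμ : IsReference P F μ)
    {B : Set (Ω × Fin (T + 1))} (hB : MeasurableSet[optFilt F t] B) (hB0 : tensor F P μ B ≠ 0)
    (h : ∀ s < t, ∀ᵐ ω ∂P, (ω, s) ∉ B) : P {ω | (ω, t) ∈ B} ≠ 0 := by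
  intro h0
  refine hB0 (measure_eq_zero_iff_ae_notMem.2 ((ae_tensor_iff hF0 hμ).2 fun s => ?_))
  rcases lt_or_ge s t with hs | hs
  · exact h s hs
  · filter_upwards [measure_eq_zero_iff_ae_notMem.1 h0] with ω hω
    exact mt ((measurableSet_optFilt_iff.1 hB).2 s hs ω).1 hω

/-- The dual variables for processes which are induced by a random vector on the optional space. -/
noncomputable def procDual (P : Measure Ω) (F : Filtration (Fin (T + 1)) m0)
    (μ : Fin (T + 1) → Ω → ℝ) (t : Fin (T + 1)) (Z : Ω × Fin (T + 1) → Fin d → ℝ) :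
    (Fin (T + 1) → Fin d → Measure Ω) × (Fin (T + 1) → Ω → Fin d → ℝ) :=
  (fun s => normMeas (F t) P fun ω i => μ s ω * slice s Z ω i,
    fun s => condVec (F t) P fun ω i => μ s ω * slice s Z ω i)

variable {Z : Ω × Fin (T + 1) → Fin d → ℝ}

theorem mul_slice_mem_LOnePos (hF0 : ∀ A : Set Ω, MeasurableSet[F 0] A ↔ P A = 0 ∨ P Aᶜ = 0)
    (hμ : IsReference P F μ) (hZ : Z ∈ LOnePos (optSigma F) (tensor F P μ)) (s : Fin (T + 1)) :
    (fun ω i => μ s ω * slice s Z ω i) ∈ LOnePos (F s) P := by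
  have h := (mem_LOnePos_optSigma hF0 hμ).1 hZ s
  refine ⟨hμ.mul_mem_LOne h.1, ?_⟩
  filter_upwards [h.2, hμ.pos] with ω h1 h2 i
  exact mul_nonneg (h2 s).le (h1 i)

theorem procDual_mem_dualProcCone [IsProbabilityMeasure P]
    (hF0 : ∀ A : Set Ω, MeasurableSet[F 0] A ↔ P A = 0 ∨ P Aᶜ = 0)
    (hμ : IsReference P F μ) (hZ : Z ∈ LOnePos (optSigma F) (tensor F P μ)) :
    procDual P F μ t Z ∈ dualProcCone P F m t := fun s hs =>
  have h := mul_slice_mem_LOnePos hF0 hμ hZ s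
  ⟨normMeas_mem (F.mono hs) (F.le s) h,
    mem_EligPosDual_of_nonneg (condVec_mem_LOne _) (condVec_nonneg h.2),
    wts_normMeas_mem (F.mono hs) (F.le s) h⟩

theorem sum_procDual [IsProbabilityMeasure P]
    (hF0 : ∀ A : Set Ω, MeasurableSet[F 0] A ↔ P A = 0 ∨ P Aᶜ = 0)
    (hμ : IsReference P F μ) (hZ : Z ∈ LOnePos (optSigma F) (tensor F P μ)) :
    ∀ᵐ ω ∂P, ∀ i, (∑ s ∈ Finset.Ici t, (procDual P F μ t Z).2 s) ω i =
      remMass μ t ω * condVec (optFilt F t) (tensor F P μ) Z (ω, t) i := by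
  rw [ae_all_iff]
  intro i
  have hZs := (mem_LOne_optSigma hμ).1 hZ.1
  have h1 := condExp_tensor (t := t) hF0 hμ (measurable_apply hZ.1.1 i)
    (fun s => (mem_LOne_iff.1 (hZs s)).2 i) t
  have h2 := condExp_finsetSum (s := Finset.Ici t) (f := fun s ω => μ s ω * Z (ω, s) i)
    (fun s _ => hμ.integrable_mul ((mem_LOne_iff.1 (hZs s)).2 i) s) (F t)
  have h3 : (fun ω => ∑ s ∈ Finset.Ici t, μ s ω * Z (ω, s) i) =
      ∑ s ∈ Finset.Ici t, fun ω => μ s ω * Z (ω, s) i := by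
    ext ω
    rw [Finset.sum_apply]
  filter_upwards [h1, h2, hμ.remMass_pos t] with ω a1 a2 a3
  rw [condVec, a1, if_neg (lt_irrefl t), h3, a2, mul_div_cancel₀ _ a3.ne', Finset.sum_apply,
    Finset.sum_apply, Finset.sum_apply]
  rfl

theorem procDual_mem_dualProc [IsProbabilityMeasure P]
    (hF0 : ∀ A : Set Ω, MeasurableSet[F 0] A ↔ P A = 0 ∨ P Aᶜ = 0)
    (hμ : IsReference P F μ) (hZ : Z ∈ LOnePos (optSigma F) (tensor F P μ)) {C : Set Ω}
    (hC : P C ≠ 0) (h : ∀ᵐ ω ∂P, ω ∈ C → ∃ i : Fin d, (i : ℕ) < m ∧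
      0 < condVec (optFilt F t) (tensor F P μ) Z (ω, t) i) :
    procDual P F μ t Z ∈ dualProc P F m t := by
  have hp := procDual_mem_dualProcCone (t := t) (m := m) hF0 hμ hZ
  refine ⟨hp, notMem_EligPerp (F.le t) (sum_mem_LOne hp) ?_ hC ?_⟩
  · filter_upwards [dualProcCone_nonneg hp] with ω h i
    rw [Finset.sum_apply, Finset.sum_apply]
    exact Finset.sum_nonneg fun s hs => h s (Finset.mem_Ici.1 hs) i
  · filter_upwards [h, sum_procDual (t := t) hF0 hμ hZ, hμ.remMass_pos t] with ω a1 a2 a3 hω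
    obtain ⟨i, hi, hi0⟩ := a1 hω
    refine ⟨i, hi, ?_⟩
    rw [a2]
    exact mul_pos a3 hi0

theorem mem_halfProc_procDual_iff [IsProbabilityMeasure P]
    (hF0 : ∀ A : Set Ω, MeasurableSet[F 0] A ↔ P A = 0 ∨ P Aᶜ = 0)
    (hμ : IsReference P F μ) (hZ : Z ∈ LOnePos (optSigma F) (tensor F P μ))
    {X u : Ω × Fin (T + 1) → Fin d → ℝ} (hX : X ∈ LInf (optSigma F) (tensor F P μ))
    (hu : u ∈ Elig (optFilt F t) (tensor F P μ) m) :
    slice t u ∈ halfProc P F m t (procDual P F μ t Z) (projFrom t X) ↔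
      ∀ᵐ ω ∂P, 0 ≤ condExp (optFilt F t) (tensor F P μ) (fun x => Z x ⬝ᵥ (X + u) x) (ω, t) := by
  have hp := procDual_mem_dualProcCone (t := t) (m := m) hF0 hμ hZ
  obtain ⟨hu1, hu2⟩ := (mem_Elig_optFilt hF0 hμ).1 hu
  have hXu := LInf_add hX (LInf_mono optFilt_le hu.1)
  rw [mem_halfProc_iff hp (projFrom_mem_RInf hF0 hμ hX).1, and_iff_right (hu1 t le_rfl)]
  have h1 := condExp_tensor (t := t) hF0 hμ (dotProduct_measurable hZ.1.1 hXu.1)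
    (integrable_dot_slice hF0 hμ hZ.1 hXu) t
  have h2 : ∀ᵐ ω ∂P, ∀ s, t ≤ s → wts (F t) (F s) P ((procDual P F μ t Z).1 s)
      ((procDual P F μ t Z).2 s) ω = fun i => μ s ω * Z (ω, s) i := by
    rw [ae_all_iff]
    intro s
    by_cases hs : t ≤ s
    · filter_upwards [wts_normMeas (F.mono hs) (F.le s) (mul_slice_mem_LOnePos hF0 hμ hZ s)]
        with ω h _ using h
    · exact Filter.Eventually.of_forall fun ω h => absurd h hs
  have h3 : (fun ω => ∑ s ∈ Finset.Ici t, wts (F t) (F s) P ((procDual P F μ t Z).1 s)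
      ((procDual P F μ t Z).2 s) ω ⬝ᵥ (projFrom t X s ω + slice t u ω)) =ᵐ[P]
      fun ω => ∑ s ∈ Finset.Ici t, μ s ω * (Z (ω, s) ⬝ᵥ (X + u) (ω, s)) := by
    filter_upwards [h2] with ω h
    refine Finset.sum_congr rfl fun s hs => ?_
    have hs := Finset.mem_Ici.1 hs
    rw [h s hs, mul_dot, projFrom, if_pos hs, ← hu2 s hs]
    rfl
  refine Filter.eventually_congr ?_
  filter_upwards [h1, condExp_congr_ae (m := F t) h3, hμ.remMass_pos t] with ω a1 a2 a3
  rw [a1, if_neg (lt_irrefl t), a2, Pi.zero_apply, div_nonneg_iff]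
  constructor
  · exact fun h => Or.inl ⟨h, a3.le⟩
  · rintro (h | h)
    · exact h.1
    · exact absurd h.2 (not_le.2 a3)

variable {R : (Ω × Fin (T + 1) → Fin d → ℝ) → Set (Ω × Fin (T + 1) → Fin d → ℝ)}

theorem constFrom_mem_RInf {c : Ω → Fin d → ℝ} (hc : c ∈ LInf (F t) P) :
    constFrom t c ∈ RInf P F t := by
  refine ⟨fun s => ?_, fun s hs => if_neg (not_le.2 hs)⟩
  unfold constFrom
  split_ifs with h
  · exact LInf_mono (F.mono h) hc
  · exact LInf_zero

theorem RInf_add {X Y : Fin (T + 1) → Ω → Fin d → ℝ} (hX : X ∈ RInf P F t) (hY : Y ∈ RInf P F t) :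
    X + Y ∈ RInf P F t :=
  ⟨fun s => LInf_add (hX.1 s) (hY.1 s), fun s hs => by
    rw [Pi.add_apply, hX.2 s hs, hY.2 s hs, add_zero]⟩

theorem IsProcessRM.add_constFrom_mem_accProc
    {ρ : (Fin (T + 1) → Ω → Fin d → ℝ) → Set (Ω → Fin d → ℝ)} (hρ : IsProcessRM P F m t ρ)
    {X : Fin (T + 1) → Ω → Fin d → ℝ} (hX : X ∈ RInf P F t) {u : Ω → Fin d → ℝ} (hu : u ∈ ρ X) :
    X + constFrom t u ∈ accProc P F t ρ := by
  have huE := (hρ.upper X hX).1 hu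
  refine ⟨RInf_add hX (constFrom_mem_RInf huE.1), ?_⟩
  rw [hρ.cash X hX u huE]
  exact ⟨u, hu, sub_self u⟩

/-- Dual representation of the risk measure for processes which is induced by a closed
conditionally convex risk measure on the optional space. -/
theorem IsClosedConvexVectorRM.hasDualProc [IsProbabilityMeasure P]
    (hF0 : ∀ A : Set Ω, MeasurableSet[F 0] A ↔ P A = 0 ∨ P Aᶜ = 0) (hμ : IsReference P F μ)
    (hR : IsClosedConvexVectorRM (optSigma F) (optFilt F t) (tensor F P μ) m R) :
    HasDualProc P F m t (SetRisk.toProcess t R) := by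
  have := isProbabilityMeasure_tensor hμ
  have hρ := hR.toProcess hF0 hμ
  intro X hX
  obtain ⟨v0, hv0E, hv0, hv0A⟩ := hR.exists_accVec_Elig optFilt_le
  refine Subset.antisymm (fun u hu => mem_iInter₂.2 fun p hp => ?_) fun u hu => ?_
  · have huE := (hρ.upper X hX).1 hu
    have hXu := hρ.add_constFrom_mem_accProc hX hu
    refine mem_minkSub_iff.2 ⟨huE, fun v hv => ?_⟩
    have hv1 := (mem_halfProc_iff hp.1 hXu.1.1).1 (mem_iInter₂.1 hv _ hXu)
    refine (mem_halfProc_iff hp.1 hX.1).2 ⟨Elig_add hv1.1 huE, ?_⟩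
    refine hv1.2.trans_eq (condExp_congr_ae (Filter.Eventually.of_forall fun ω =>
      Finset.sum_congr rfl fun s hs => ?_))
    rw [Pi.add_apply, Pi.add_apply, Pi.add_apply, constFrom, if_pos (Finset.mem_Ici.1 hs), add_assoc,
      add_comm (v ω)]
  · have hXL := procFrom_mem_LInf hF0 hμ hX
    have hE : u ∈ Elig (F t) P m := by
      obtain ⟨Z, hZ, -, -, -, -, hP⟩ := hR.exists_eligWeight_pos optFilt_le le_rfl
        (measurableSet_optFilt_ge (F := F) (t := t)) (fun h0 => by
          have := (ae_tensor_iff hF0 hμ).1 (measure_eq_zero_iff_ae_notMem.1 h0) t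
          obtain ⟨ω, hω⟩ := this.exists
          exact hω (le_refl t))
      have hC := measure_section_ne_zero hF0 hμ (measurableSet_optFilt_ge.inter
        (measurableSet_lt_fun measurable_const (measurable_eligWeight Z))) hP
        fun s hs => Filter.Eventually.of_forall fun ω h => absurd h.1 (not_le.2 hs)
      exact (mem_iInter₂.1 hu _ (procDual_mem_dualProc hF0 hμ hZ hC
        (Filter.Eventually.of_forall fun ω hω => exists_lt_of_eligWeight_pos hω.2))).1
    by_contra hu'
    have hgE := (glue_mem_Elig hF0 hμ le_rfl hv0E).2 hE
    obtain ⟨Z, hZ, v, hv, B, hBm, hB, h1, h2, h3⟩ := hR.exists_dual optFilt_le le_rfl hXL hgE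
      (mt (hR.mem_slice_image_iff hF0 hμ le_rfl hXL (procFrom_eq_zero X) hv0).2 hu')
    have hBs : ∀ s < t, ∀ᵐ ω ∂P, (ω, s) ∉ B := by
      intro s hs
      have hY := LInf_add hv0A.1 (LInf_mono optFilt_le hv.1)
      have hW := LInf_add (LInf_add hXL (LInf_mono optFilt_le hgE.1)) (LInf_mono optFilt_le hv.1)
      have e1 := condExp_tensor (t := t) hF0 hμ (dotProduct_measurable hZ.1.1 hY.1)
        (integrable_dot_slice hF0 hμ hZ.1 hY) s
      have e2 := condExp_tensor (t := t) hF0 hμ (dotProduct_measurable hZ.1.1 hW.1)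
        (integrable_dot_slice hF0 hμ hZ.1 hW) s
      filter_upwards [e1, e2, (ae_tensor_iff hF0 hμ).1 (h2 v0 hv0A) s,
        (ae_tensor_iff hF0 hμ).1 h3 s] with ω a1 a2 a3 a4 hω
      have a5 := a4 hω
      rw [a2, if_pos hs] at a5
      rw [a1, if_pos hs] at a3
      have e3 : (procFrom t X + glue t t v0 u + v) (ω, s) = (v0 + v) (ω, s) := by
        simp [procFrom, glue, not_le.2 hs]
      rw [e3] at a5
      exact absurd a3 (not_le.2 a5)
    have hC := measure_section_ne_zero hF0 hμ hBm hB hBs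
    have hp := procDual_mem_dualProc (m := m) hF0 hμ hZ hC ((ae_tensor_iff hF0 hμ).1 h1 t)
    have h4 := (mem_minkSub_iff.1 (mem_iInter₂.1 hu _ hp)).2 (slice t v) (by
      rw [penProc, accProc_toProcess hF0 hμ hR, biInter_image]
      refine mem_iInter₂.2 fun Y hY => ?_
      rw [mem_halfProc_procDual_iff hF0 hμ hZ hY.1 hv]
      exact (ae_tensor_iff hF0 hμ).1 (h2 Y hY) t)
    rw [← projFrom_procFrom hX, show slice t v + u = slice t (v + glue t t v0 u) by
      change _ = slice t v + slice t (glue t t v0 u)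
      rw [slice_glue le_rfl], mem_halfProc_procDual_iff hF0 hμ hZ hXL (Elig_add hv hgE)] at h4
    refine hC (measure_eq_zero_iff_ae_notMem.2 ?_)
    filter_upwards [h4, (ae_tensor_iff hF0 hμ).1 h3 t] with ω h5 h6 hω
    have h7 := h6 hω
    rw [add_assoc, add_comm (glue t t v0 u)] at h7
    exact absurd h5 (not_le.2 h7)

end ProcessDuality

end SetRisk

theorem mainTheorem3 {Ω : Type*} {m0 : MeasurableSpace Ω} (P : Measure Ω)
    [IsProbabilityMeasure P] {T : ℕ} (hT : 1 ≤ T) (F : Filtration (Fin (T + 1)) m0)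
    (hF0 : ∀ A : Set Ω, MeasurableSet[F 0] A ↔ P A = 0 ∨ P Aᶜ = 0)
    (hFT : F (Fin.last T) = m0) {d : ℕ} (m : ℕ) (hm1 : 1 ≤ m) (hmd : m ≤ d)
    (μ : Fin (T + 1) → Ω → ℝ) (hμ : IsReference P F μ) (t : Fin (T + 1)) :
    (∀ (ρ : (Fin (T + 1) → Ω → Fin d → ℝ) → Set (Ω → Fin d → ℝ))
      (R : Fin (T + 1) → (Ω → Fin d → ℝ) → Set (Ω → Fin d → ℝ)),
      IsClosedConvexProcessRM P F m t ρ →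
      (∀ s < t, IsClosedConvexVectorRM (F s) (F s) P m (R s)) →
      IsClosedConvexVectorRM (optSigma F) (optFilt F t) (tensor F P μ) m (toOptional t ρ R) ∧
      HasDualVec (optFilt F t) (tensor F P μ) m (toOptional t ρ R) ∧
      ∀ (Qbar : Fin d → @Measure (Ω × Fin (T + 1)) (optSigma F))
        (wbar : Ω × Fin (T + 1) → Fin d → ℝ),
        (Qbar, wbar) ∈ dualVec (optFilt F t) (tensor F P μ) m →
        (∃ (Q : Fin d → Measure Ω) (ψ : Fin d → Fin (T + 1) → Ω → ℝ),
          ∀ i, Q i ∈ ProbAC P ∧ ψ i ∈ OptRandomMeas P F ∧ Qbar i = tensor F (Q i) (ψ i)) ∧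
        ∀ (Q : Fin d → Measure Ω) (ψ : Fin d → Fin (T + 1) → Ω → ℝ),
          (∀ i, Q i ∈ ProbAC P ∧ ψ i ∈ OptRandomMeas P F ∧ Qbar i = tensor F (Q i) (ψ i)) →
          mapW P F μ t Q ψ wbar ∈ dualProcCone P F m t ∧
          (slice t wbar ∉ EligPerp (F t) P m → mapW P F μ t Q ψ wbar ∈ dualProc P F m t) ∧
          penVec (optFilt F t) (tensor F P μ) m (toOptional t ρ R) (Qbar, wbar) =
            pasteSets t (fun s => penRes (F s) P m (R s) (slice s wbar))
              (penProc P F m t ρ (mapW P F μ t Q ψ wbar))) ∧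
    (∀ Rbar : (Ω × Fin (T + 1) → Fin d → ℝ) → Set (Ω × Fin (T + 1) → Fin d → ℝ),
      IsClosedConvexVectorRM (optSigma F) (optFilt F t) (tensor F P μ) m Rbar →
      (IsClosedConvexProcessRM P F m t (toProcess t Rbar) ∧
        HasDualProc P F m t (toProcess t Rbar) ∧
        ∀ p ∈ (dualProc P F m t :
            Set ((Fin (T + 1) → Fin d → Measure Ω) × (Fin (T + 1) → Ω → Fin d → ℝ))),
          mapWbar P F μ t p ∈ dualVec (optFilt F t) (tensor F P μ) m ∧
          penProc P F m t (toProcess t Rbar) p =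
            slice t '' penVec (optFilt F t) (tensor F P μ) m Rbar (mapWbar P F μ t p)) ∧
      ∀ s < t, IsClosedConvexVectorRM (F s) (F s) P m (toRestricted s Rbar) ∧
        HasDualRes (F s) P m (toRestricted s Rbar) ∧
        ∀ w ∈ (dualRes (F s) P m : Set (Ω → Fin d → ℝ)),
          ((fun _ => tensor F P μ), single s w) ∈ dualVec (optFilt F t) (tensor F P μ) m ∧
          penRes (F s) P m (toRestricted s Rbar) w =
            slice s '' penVec (optFilt F t) (tensor F P μ) m Rbar
              ((fun _ => tensor F P μ), single s w)) := by
  have := isProbabilityMeasure_tensor hμ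
  refine ⟨fun ρ R hρ hR => ?_, fun Rbar hR => ⟨⟨hR.toProcess hF0 hμ, hR.hasDualProc hF0 hμ,
    fun p hp => ⟨mapWbar_mem_dualVec hF0 hμ hp, penProc_toProcess hF0 hμ hR hp⟩⟩, fun s hs =>
    ⟨hR.toRestricted hF0 hμ hs, (hR.toRestricted hF0 hμ hs).hasDualRes (F.le s), fun w hw =>
      ⟨single_mem_dualVec hF0 hμ hs hw, penRes_toRestricted hF0 hμ hR hs hw⟩⟩⟩⟩
  have hopt := isClosedConvexVectorRM_toOptional hF0 hμ hρ hR
  refine ⟨hopt, hopt.hasDualVec optFilt_le, fun Qbar wbar hw => ⟨?_, fun Q ψ hQψ => ?_⟩⟩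
  · have h := fun i => exists_tensor_eq hF0 hμ (hw.1 i).1
    choose Q hQ ψ hψ hQψ using h
    exact ⟨Q, ψ, fun i => ⟨hQ i, hψ i, hQψ i⟩⟩
  · have hQ : ∀ i, Q i ∈ ProbACAt (F t) P := fun i =>
      mem_ProbACAt_of_condExp_dens (F.le t) (hQψ i).1 (condExp_dens_of_tensor hF0 hμ (hQψ i).1
        (hQψ i).2.1 ((hQψ i).2.2 ▸ hw.1 i))
    have hψ := fun i => (hQψ i).2.1
    have hQb := fun i => (hQψ i).2.2
    exact ⟨mapW_mem_dualProcCone hF0 hμ hw hQ hψ hQb,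
      fun h => mapW_mem_dualProc hF0 hμ hw hQ hψ hQb h,
      penVec_toOptional hF0 hμ hρ hR hw hQ hψ hQb⟩
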